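/- **Setting.** Let $V$ be a two-sided Banach space over the quaternions $\mathbb H$ (with $\|qv\|=|q|\|v\|=\|vq\|$, real scalars acting equally on both sides), $e_0=1,e_1,e_2,e_3$ the quaternion units and $\mathbb S=\{J\in\mathbb H:\operatorname{Re}J=0,|J|=1\}$. Let $T$ be a right linear operator in $V$ whose domain is a two-sided linear subspace. It has components $T_i=\frac{e_i}{4}\big(e_iTe_i-\sum_{j\ne i}e_jTe_j\big)$ with $T=\sum_i e_iT_i$ and conjugate $\overline T=T_0-e_1T_1-e_2T_2-e_3T_3$, all with domain $\operatorname{dom}(T)$, and $|T|^2=\sum_k T_k^2$ with $\operatorname{dom}(|T|^2)=\bigcap_k\operatorname{dom}(T_k^2)$. Write $T\in\mathcal{KC}(V)$ if $T$ is closed and $T_iT_jv=T_jT_iv$ for all $i,j$ and $v\in\operatorname{dom}(|T|^2)$. For $\omega\in(0,\pi)$ let $S_\omega=\{s\in\mathbb H\setminus\{0\}:|\operatorname{Arg}s|<\omega\}$. Let $\alpha,\beta\in\mathbb R$. The operator $T$, together with a two-sided linear dense subspace $D\subseteq\operatorname{dom}(|T|^2)$, is *of type* $(\alpha,\beta,\omega)$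 if $T,\overline T\in\mathcal{KC}(V)$; $T_iv\in D$ for all $i$ whenever $v\in D$ and $|T|^2v\in\operatorname{dom}(T)$; the operator $Q_{c,s}(T)=s^2-2sT_0+|T|^2$ with domain $D$ is closed for every $s\in\mathbb H$; the $F$-spectrum $\sigma_F(T)=\{s: Q_{c,s}(T):D\to V\text{ is not bijective}\}$ is contained in $\overline{S_\omega}$; and for every $\varphi\in(\omega,\pi)$ there is $C_\varphi\ge0$ such that $S_L^{-1}(s,T):=(s-\overline T)Q_{c,s}^{-1}(T)$ satisfies $\|S_L^{-1}(s,T)\|\le C_\varphi|s|^{-\alpha}$ if $|s|\le1$ and $\le C_\varphi|s|^{-\beta}$ if $|s|\ge1$, for all $s\notin S_\varphi$, $s\neq0$. Put $P_2^L(s,T)=2S_L^{-1}(s,T)\big(S_L^{-1}(s,T)+S_L^{-1}(s,\overline T)\big)$ and $F_L(s,T)=-4S_L^{-1}(s,T)Q_{c,s}^{-1}(T)$. A function $f$ on $S_\theta$ is *left slice hyperholomorphic* if $f(x+Jy)=a(x,y)+Jb(x,y)$ for all $J\in\mathbb S$, with $C^1$ functions $a,b$ on $\{(x,y):x+\mathbb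 Sy\subseteq S_\theta\}$ that are even, resp. odd, in $y$ and satisfy $\partial_xa=\partial_yb$, $\partial_ya=-\partial_xb$; it is *intrinsic* if $a,b$ are real valued. Let $\mathcal F_L(S_\theta)$, resp. $\mathcal F(S_\theta)$, be the left slice hyperholomorphic, resp. intrinsic, functions with $|f(s)|\le C(|s|^k+|s|^{-k})$ on $S_\theta$ for some $k>0$, $C\ge0$. Let $\Psi_L^{a,b}(S_\theta)$, resp. $\Psi^{a,b}(S_\theta)$, be those with $|f(s)|\le C|s|^{a-1+\delta}$ for $|s|\le1$ and $|f(s)|\le C|s|^{b-1-\delta}$ for $|s|\ge1$, for some $\delta>0$, $C\ge0$. *Decaying functions.* Let $J\in\mathbb S$, $\varphi\in(\omega,\theta)$, and parametrize $\partial(S_\varphi\cap\mathbb C_J)$ by $\gamma(t)=-te^{J\varphi}$ $(t<0)$, $\gamma(t)=te^{-J\varphi}$ $(t>0)$, with $\int K(s)\,ds_J\,h(s):=\int_{\mathbb R}K(\gamma(t))\frac{\gamma'(t)}{J}h(\gamma(t))\,dt$. Put $$h(T)=\tfrac1{2\pi}\!\int S_L^{-1}(s,T)ds_Jh(s),\quad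 \mathcal Dh(T)=\tfrac{-1}{\pi}\!\int Q_{c,s}^{-1}(T)ds_Jh(s),\quad \overline{\mathcal D}h(T)=\tfrac1{2\pi}\!\int P_2^L(s,T)ds_Jh(s),\quad \Delta h(T)=\tfrac1{2\pi}\!\int F_L(s,T)ds_Jh(s),$$ for $h\in\Psi_L^{3\alpha,3\beta}(S_\theta)$ such that the integrals for $h(T),h(\overline T),\mathcal Dh(T),\overline{\mathcal D}h(T),\Delta h(T)$ converge absolutely for all $J\in\mathbb S$, $\varphi\in(\omega,\theta)$. *Growing functions.* A *regularizer* of $f\in\mathcal F_L(S_\theta)$ is an $e\in\Psi^{3\alpha,3\beta}(S_\theta)$ with $ef\in\Psi_L^{3\alpha,3\beta}(S_\theta)$ such that the integrals above converge absolutely for $h=e$ and $h=ef$, and $e(T),e(\overline T)$ are injective. Then $$f(T)=e(T)^{-1}(ef)(T),\qquad \mathcal Df(T)=\big(e(T)e(\overline T)\big)^{-1}\big(e(T)\mathcal D(ef)(T)-\mathcal De(T)(ef)(T)\big),$$ $$\overline{\mathcal D}f(T)=\big(e(T)^2e(\overline T)\big)^{-1}\big(e(T)e(\overline T)\overline{\mathcal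 D}(ef)(T)-e(\overline T)\overline{\mathcal D}e(T)(ef)(T)+e(T)\mathcal De(T)(ef)(\overline T)-e(\overline T)\mathcal De(T)(ef)(T)\big),$$ $$\Delta f(T)=\big(e(T)^2e(\overline T)\big)^{-1}\big(e(T)e(\overline T)\Delta(ef)(T)-e(\overline T)\Delta e(T)(ef)(T)+e(T)\mathcal De(T)\mathcal D(ef)(T)-(\mathcal De(T))^2(ef)(T)\big),$$ and $f(\overline T)=e(\overline T)^{-1}(ef)(\overline T)$. Sums and products of unbounded operators have their natural domains, and $A\supseteq B$ means that $A$ extends $B$. **Theorem.** Let $\alpha\ge\frac13$, $\beta\in(0,\frac13]$, $\omega\in(0,\pi)$, let $T$ (with $D$) be of type $(\alpha,\beta,\omega)$ with $T$ and $\overline T$ injective, let $\theta\in(\omega,\pi)$, $g\in\mathcal F(S_\theta)$, $f\in\mathcal F_L(S_\theta)$. Then $g$, $f$ and $gf$ have regularizers, and for any choice of regularizers and integration paths $(J,\varphi)$ for $g$, for $f$ and for $gf$, i) $(gf)(T)\supseteq g(T)f(T)$, ii) $\mathcal D(gf)(T)\supseteq\mathcal Dg(T)f(T)+g(\overline T)\mathcal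 Df(T)$ and $\mathcal D(gf)(T)\supseteq\mathcal Dg(T)f(\overline T)+g(T)\mathcal Df(T)$, iii) $\overline{\mathcal D}(gf)(T)\supseteq\overline{\mathcal D}g(T)f(T)+g(T)\overline{\mathcal D}f(T)+\mathcal Dg(T)\big(f(T)-f(\overline T)\big)$, iv) $\Delta(gf)(T)\supseteq\Delta g(T)f(T)+g(T)\Delta f(T)-\mathcal Dg(T)\mathcal Df(T)$. -/

import Mathlib

open MeasureTheory Set
open scoped Quaternion

namespace QuatHInfty

/-! ### Quaternions, sectors and slice hyperholomorphic functions -/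

/-- The quaternion units `e₀ = 1, e₁, e₂, e₃`. -/
noncomputable def quatUnit (i : Fin 4) : ℍ[ℝ] := ![⟨1, 0, 0, 0⟩, ⟨0, 1, 0, 0⟩, ⟨0, 0, 1, 0⟩, ⟨0, 0, 0, 1⟩] i

/-- The sphere of imaginary units. -/
def imagSphere : Set ℍ[ℝ] := {J | J.re = 0 ∧ ‖J‖ = 1}

/-- The point `x + J y` of the plane `ℂ_J`. -/
noncomputable def slicePt (J : ℍ[ℝ]) (x y : ℝ) : ℍ[ℝ] := (x : ℍ[ℝ]) + (y : ℍ[ℝ]) * J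

/-- The modulus of the argument of a quaternion `s`, that is, the argument in `[0, π]` of the complex
number `Re s + i |Im s|`. -/
noncomputable def absArg (s : ℍ[ℝ]) : ℝ := Complex.arg ⟨s.re, ‖s.im‖⟩

/-- The open sector `S_θ`. -/
def sector (θ : ℝ) : Set ℍ[ℝ] := {s | s ≠ 0 ∧ absArg s < θ}

/-- For `U ⊆ ℍ` the set of all `(x, y) ∈ ℝ²` with `x + 𝕊 y ⊆ U`. -/
def reducedSet (U : Set ℍ[ℝ]) : Set (ℝ × ℝ) :=
  {p | ∀ J ∈ imagSphere, slicePt J p.1 p.2 ∈ U}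

/-- `f = a + J b` on `U`, where the continuously differentiable functions `a`, `b` are even and odd in
`y`, and satisfy the Cauchy-Riemann equations. Only the values of `f` on `U` matter. -/
structure SliceDecomposition (U : Set ℍ[ℝ]) (f : ℍ[ℝ] → ℍ[ℝ]) (a b : ℝ × ℝ → ℍ[ℝ]) : Prop where
  contDiff_a : ContDiffOn ℝ 1 a (reducedSet U)
  contDiff_b : ContDiffOn ℝ 1 b (reducedSet U)
  repr : ∀ p ∈ reducedSet U, ∀ J ∈ imagSphere, f (slicePt J p.1 p.2) = a p + J * b p
  even_a : ∀ p ∈ reducedSet U, a (p.1, -p.2) = a p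
  odd_b : ∀ p ∈ reducedSet U, b (p.1, -p.2) = -b p
  cauchyRiemann_x : ∀ p ∈ reducedSet U, fderiv ℝ a p (1, 0) = fderiv ℝ b p (0, 1)
  cauchyRiemann_y : ∀ p ∈ reducedSet U, fderiv ℝ a p (0, 1) = -fderiv ℝ b p (1, 0)

/-- Left slice hyperholomorphic functions on `U`. -/
def LeftSlice (U : Set ℍ[ℝ]) (f : ℍ[ℝ] → ℍ[ℝ]) : Prop :=
  ∃ a b : ℝ × ℝ → ℍ[ℝ], SliceDecomposition U f a b

/-- Intrinsic functions on `U`: the components `a`, `b` are real valued. -/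
def Intrinsic (U : Set ℍ[ℝ]) (f : ℍ[ℝ] → ℍ[ℝ]) : Prop :=
  ∃ a b : ℝ × ℝ → ℍ[ℝ], SliceDecomposition U f a b ∧
    ∀ p ∈ reducedSet U, (a p).im = 0 ∧ (b p).im = 0

/-- `|f(s)| ≤ C |s|^(a-1+δ)` for `|s| ≤ 1` and `|f(s)| ≤ C |s|^(b-1-δ)` for `|s| ≥ 1` on `S_θ`, for some
`δ > 0` and `C ≥ 0`. -/
def Decays (a b θ : ℝ) (f : ℍ[ℝ] → ℍ[ℝ]) : Prop :=
  ∃ δ > 0, ∃ C ≥ 0, ∀ s ∈ sector θ,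
    (‖s‖ ≤ 1 → ‖f s‖ ≤ C * ‖s‖ ^ (a - 1 + δ)) ∧ (1 ≤ ‖s‖ → ‖f s‖ ≤ C * ‖s‖ ^ (b - 1 - δ))

/-- The class `Ψ_L^{a,b}(S_θ)`. -/
def PsiL (a b θ : ℝ) (f : ℍ[ℝ] → ℍ[ℝ]) : Prop := LeftSlice (sector θ) f ∧ Decays a b θ f

/-- The class `Ψ^{a,b}(S_θ)`. -/
def Psi (a b θ : ℝ) (f : ℍ[ℝ] → ℍ[ℝ]) : Prop := Intrinsic (sector θ) f ∧ Decays a b θ f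

/-- Polynomial growth at `0` and at `∞` on `S_θ`. -/
def PolyGrowth (θ : ℝ) (f : ℍ[ℝ] → ℍ[ℝ]) : Prop :=
  ∃ k : ℝ, 0 < k ∧ ∃ C ≥ 0, ∀ s ∈ sector θ, ‖f s‖ ≤ C * (‖s‖ ^ k + 1 / ‖s‖ ^ k)

/-- The class `𝓕_L(S_θ)`. -/
def GrowthL (θ : ℝ) (f : ℍ[ℝ] → ℍ[ℝ]) : Prop := LeftSlice (sector θ) f ∧ PolyGrowth θ f

/-- The class `𝓕(S_θ)`. -/
def Growth (θ : ℝ) (f : ℍ[ℝ] → ℍ[ℝ]) : Prop := Intrinsic (sector θ) f ∧ PolyGrowth θ f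

/-! ### Operators

A two-sided quaternionic Banach space is a real Banach space with commuting left and right
multiplications by quaternions (right multiplication by `q` is the action of `MulOpposite.op q`), both
extending the real scalar multiplication and with `‖q v‖ = |q| ‖v‖ = ‖v q‖`. -/

section Operators

variable {V : Type*} [NormedAddCommGroup V] [NormedSpace ℝ V]
  [Module ℍ[ℝ] V] [Module ℍ[ℝ]ᵐᵒᵖ V] [SMulCommClass ℍ[ℝ]ᵐᵒᵖ ℍ[ℝ] V]
  [IsScalarTower ℝ ℍ[ℝ] V] [IsScalarTower ℝ ℍ[ℝ]ᵐᵒᵖ V]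
  [NormSMulClass ℍ[ℝ] V] [NormSMulClass ℍ[ℝ]ᵐᵒᵖ V]

variable (V) in
/-- Right linear operators `T : V → V` with a two-sided linear domain. -/
structure RightOp extends V →ₗ.[ℍ[ℝ]ᵐᵒᵖ] V where
  smul_mem : ∀ (q : ℍ[ℝ]) {v : V}, v ∈ domain → q • v ∈ domain

namespace RightOp

/-- The right linear map `v ↦ q T (q v)` on the domain of `T`. -/
noncomputable def sandwich (T : RightOp V) (q : ℍ[ℝ]) : T.domain →ₗ[ℍ[ℝ]ᵐᵒᵖ] V where
  toFun v := q • T.toFun ⟨q • (v : V), T.smul_mem q v.2⟩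
  map_add' v w := by
    rw [← smul_add, ← map_add]
    congr 2
    exact Subtype.ext (smul_add q (v : V) (w : V))
  map_smul' c v := by
    rw [RingHom.id_apply, smul_comm c q, ← T.toFun.map_smul]
    congr 2
    exact Subtype.ext (smul_comm c q (v : V)).symm

/-- The components `T_i = (e_i/4) (e_i T e_i - ∑_{j ≠ i} e_j T e_j)` of
`T = T_0 + e_1 T_1 + e_2 T_2 + e_3 T_3`, with the domain of `T`. -/
noncomputable def comp (T : RightOp V) (i : Fin 4) : RightOp V where
  domain := T.domain
  toFun := ((1 / 4 : ℝ) • quatUnit i : ℍ[ℝ]) •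
    (T.sandwich (quatUnit i) - ∑ j ∈ Finset.univ.erase i, T.sandwich (quatUnit j))
  smul_mem := T.smul_mem

/-- The conjugate `T_0 - e_1 T_1 - e_2 T_2 - e_3 T_3`, with the domain of `T`. -/
noncomputable def conj (T : RightOp V) : RightOp V where
  domain := T.domain
  toFun := ∑ i : Fin 4, (star (quatUnit i) : ℍ[ℝ]) • (T.comp i).toFun
  smul_mem := T.smul_mem

open Classical in
/-- The value `T v` for `v` in the domain of `T` (and `0` for all other `v`, which never matters). -/
noncomputable def app (T : RightOp V) (v : V) : V :=
  if h : v ∈ T.domain then T.toFun ⟨v, h⟩ else 0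

/-- The domain of `|T|² = T_0² + T_1² + T_2² + T_3²`, the intersection of the domains of the `T_k²`. -/
def normSqDomain (T : RightOp V) : Set V :=
  {v | v ∈ T.domain ∧ ∀ k, (T.comp k).app v ∈ T.domain}

/-- The operator `|T|²` (on its domain). -/
noncomputable def normSq (T : RightOp V) (v : V) : V := ∑ k, (T.comp k).app ((T.comp k).app v)

/-- Closed operators with commuting components. -/
def IsKC (T : RightOp V) : Prop :=
  IsClosed (T.toLinearPMap.graph : Set (V × V)) ∧
    ∀ v ∈ T.normSqDomain, ∀ i j,
      (T.comp i).app ((T.comp j).app v) = (T.comp j).app ((T.comp i).app v)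

/-- `T` is injective (on its domain). -/
def IsInjective (T : RightOp V) : Prop := Function.Injective T.toFun

/-- The operator `Q_{c,s}(T) = s² - 2 s T_0 + |T|²`, to be used on a subspace `D` of `dom(|T|²)`. -/
noncomputable def Q (T : RightOp V) (s : ℍ[ℝ]) (v : V) : V :=
  (s ^ 2) • v - (2 * s) • (T.comp 0).app v + T.normSq v

/-- Admissible domains `D` for the operators `Q_{c,s}(T)`. -/
structure IsAdmissible (T : RightOp V) (D : Submodule ℝ V) : Prop where
  isKC : T.IsKC
  isKC_conj : T.conj.IsKC
  smul_mem : ∀ (q : ℍ[ℝ]), ∀ v ∈ D, q • v ∈ D ∧ MulOpposite.op q • v ∈ D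
  dense : Dense (D : Set V)
  le_domain : ∀ v ∈ D, v ∈ T.normSqDomain
  comp_mem : ∀ i, ∀ v ∈ D, T.normSq v ∈ T.domain → (T.comp i).app v ∈ D
  closed_Q : ∀ s : ℍ[ℝ], IsClosed {p : V × V | p.1 ∈ D ∧ p.2 = T.Q s p.1}

/-- The `F`-resolvent set: `Q_{c,s}(T) : D → V` is bijective. -/
def resolventSet (T : RightOp V) (D : Submodule ℝ V) : Set ℍ[ℝ] :=
  {s | BijOn (T.Q s) D univ}

/-- The `F`-spectrum. -/
def spectrumF (T : RightOp V) (D : Submodule ℝ V) : Set ℍ[ℝ] := (T.resolventSet D)ᶜ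

/-- The inverse `Q_{c,s}(T)⁻¹ : V → D`, for `s` in the `F`-resolvent set. -/
noncomputable def Qinv (T : RightOp V) (D : Submodule ℝ V) (s : ℍ[ℝ]) : V → V :=
  Function.invFunOn (T.Q s) D

/-- The left `S`-resolvent `(s - T̄) Q_{c,s}(T)⁻¹`. -/
noncomputable def SL (T : RightOp V) (D : Submodule ℝ V) (s : ℍ[ℝ]) (v : V) : V :=
  s • T.Qinv D s v - T.conj.app (T.Qinv D s v)

/-- Operators of type `(α, β, ω)`. -/
structure IsOfType (T : RightOp V) (D : Submodule ℝ V) (α β ω : ℝ) : Prop where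
  admissible : T.IsAdmissible D
  spectrum_subset : T.spectrumF D ⊆ closure (sector ω)
  resolvent_bound : ∀ φ ∈ Ioo ω Real.pi, ∃ C ≥ 0, ∀ s : ℍ[ℝ], s ∉ sector φ → s ≠ 0 → ∀ v : V,
    (‖s‖ ≤ 1 → ‖T.SL D s v‖ ≤ C * ‖s‖ ^ (-α) * ‖v‖) ∧
    (1 ≤ ‖s‖ → ‖T.SL D s v‖ ≤ C * ‖s‖ ^ (-β) * ‖v‖)

end RightOp

/-! ### The functional calculi for decaying functions

Bounded operators are elements of the real Banach space `V →L[ℝ] V`. -/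

open Classical in
/-- A map `V → V` that is a bounded linear operator, as an element of `V →L[ℝ] V` (and `0` for other
maps). It is applied to resolvents, which are bounded by the closed graph theorem. -/
noncomputable def asBounded (F : V → V) : V →L[ℝ] V :=
  if h : ∃ B : V →L[ℝ] V, ∀ v, B v = F v then h.choose else 0

/-- Left multiplication by a quaternion as a bounded operator. -/
noncomputable def leftMul (q : ℍ[ℝ]) : V →L[ℝ] V :=
  LinearMap.mkContinuous
    { toFun := fun v => q • v
      map_add' := smul_add q
      map_smul' := fun r v => smul_comm q r v } ‖q‖ (fun v => (norm_smul q v).le)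

/-- Left `S`-resolvent kernel. -/
noncomputable def kerS (T : RightOp V) (D : Submodule ℝ V) (s : ℍ[ℝ]) : V →L[ℝ] V :=
  asBounded (T.SL D s)

/-- The kernel `Q_{c,s}(T)⁻¹`. -/
noncomputable def kerQ (T : RightOp V) (D : Submodule ℝ V) (s : ℍ[ℝ]) : V →L[ℝ] V :=
  asBounded (T.Qinv D s)

/-- The kernel `P_2^L(s,T) = 2 S_L⁻¹(s,T) (S_L⁻¹(s,T) + S_L⁻¹(s,T̄))`. -/
noncomputable def kerP (T : RightOp V) (D : Submodule ℝ V) (s : ℍ[ℝ]) : V →L[ℝ] V :=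
  (2 : ℝ) • (kerS T D s ∘L (kerS T D s + kerS T.conj D s))

/-- The kernel `F_L(s,T) = -4 S_L⁻¹(s,T) Q_{c,s}(T)⁻¹`. -/
noncomputable def kerF (T : RightOp V) (D : Submodule ℝ V) (s : ℍ[ℝ]) : V →L[ℝ] V :=
  (-4 : ℝ) • (kerS T D s ∘L kerQ T D s)

/-- `e^{Jφ} = cos φ + J sin φ`. -/
noncomputable def expJ (J : ℍ[ℝ]) (φ : ℝ) : ℍ[ℝ] := slicePt J (Real.cos φ) (Real.sin φ)

/-- The path `-t e^{Jφ}` (`t < 0`), `t e^{-Jφ}` (`t > 0`) along the boundary of `S_φ ∩ ℂ_J`. -/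
noncomputable def sectorPath (J : ℍ[ℝ]) (φ t : ℝ) : ℍ[ℝ] :=
  if t < 0 then (-t) • expJ J φ else t • expJ J (-φ)

/-- The derivative of the path (for `t ≠ 0`). -/
noncomputable def sectorPathDeriv (J : ℍ[ℝ]) (φ t : ℝ) : ℍ[ℝ] :=
  if t < 0 then -expJ J φ else expJ J (-φ)

/-- The integrand `K(γ(t)) (γ'(t)/J) f(γ(t))` of `∫ K(s) ds_J f(s)`. -/
noncomputable def integrand (K : ℍ[ℝ] → V →L[ℝ] V) (f : ℍ[ℝ] → ℍ[ℝ]) (J : ℍ[ℝ]) (φ t : ℝ) :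
    V →L[ℝ] V :=
  K (sectorPath J φ t) ∘L leftMul (sectorPathDeriv J φ t * J⁻¹ * f (sectorPath J φ t))

/-- The integral `∫ K(s) ds_J f(s)` over the boundary of `S_φ ∩ ℂ_J`. -/
noncomputable def contourInt (K : ℍ[ℝ] → V →L[ℝ] V) (f : ℍ[ℝ] → ℍ[ℝ]) (J : ℍ[ℝ]) (φ : ℝ) :
    V →L[ℝ] V := ∫ t : ℝ, integrand K f J φ t

/-- An integration path: an imaginary unit `J` and an angle `φ ∈ (ω, θ)`. -/
structure Contour (ω θ : ℝ) where
  J : ℍ[ℝ]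
  J_mem : J ∈ imagSphere
  φ : ℝ
  φ_mem : φ ∈ Ioo ω θ

variable {ω θ : ℝ}

/-- `f(T)` for decaying `f` (`S`-functional calculus). -/
noncomputable def decS (T : RightOp V) (D : Submodule ℝ V) (c : Contour ω θ)
    (f : ℍ[ℝ] → ℍ[ℝ]) : V →L[ℝ] V := (1 / (2 * Real.pi)) • contourInt (kerS T D) f c.J c.φ

/-- `𝓓f(T)` for decaying `f` (`Q`-functional calculus). -/
noncomputable def decQ (T : RightOp V) (D : Submodule ℝ V) (c : Contour ω θ)
    (f : ℍ[ℝ] → ℍ[ℝ]) : V →L[ℝ] V := (-1 / Real.pi) • contourInt (kerQ T D) f c.J c.φ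

/-- `𝓓̄f(T)` for decaying `f` (`P_2`-functional calculus). -/
noncomputable def decP (T : RightOp V) (D : Submodule ℝ V) (c : Contour ω θ)
    (f : ℍ[ℝ] → ℍ[ℝ]) : V →L[ℝ] V := (1 / (2 * Real.pi)) • contourInt (kerP T D) f c.J c.φ

/-- `Δf(T)` for decaying `f` (`F`-functional calculus). -/
noncomputable def decF (T : RightOp V) (D : Submodule ℝ V) (c : Contour ω θ)
    (f : ℍ[ℝ] → ℍ[ℝ]) : V →L[ℝ] V := (1 / (2 * Real.pi)) • contourInt (kerF T D) f c.J c.φ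

/-- The integrals that define `f(T)`, `f(T̄)`, `𝓓f(T)`, `𝓓̄f(T)`, `Δf(T)` converge absolutely. -/
def Converges (T : RightOp V) (D : Submodule ℝ V) (ω θ : ℝ) (f : ℍ[ℝ] → ℍ[ℝ]) : Prop :=
  ∀ c : Contour ω θ, ∀ K ∈ ({kerS T D, kerS T.conj D, kerQ T D, kerP T D, kerF T D} :
    Set (ℍ[ℝ] → V →L[ℝ] V)), Integrable (integrand K f c.J c.φ)

/-! ### The `H^∞`-functional calculi -/

/-- The product `A B` of two unbounded operators, on `{v ∈ dom B | B v ∈ dom A}`. -/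
noncomputable def mulP (A B : V →ₗ.[ℝ] V) : V →ₗ.[ℝ] V :=
  A.comp (B.domRestrict ((A.domain.comap B.toFun).map B.domain.subtype)) (by
    rintro ⟨v, hv⟩
    obtain ⟨hv₁, hv₂⟩ := Submodule.mem_inf.1 hv
    obtain ⟨w, hw, rfl⟩ := (Submodule.mem_map).1 hv₁
    have := LinearPMap.domRestrict_apply (f := B) (x := ⟨_, hv⟩) (y := w) rfl
    exact this ▸ hw)

/-- The unbounded operator `A⁻¹ B`, for bounded operators `A`, `B` with `A` injective. -/
noncomputable def invMul (A B : V →L[ℝ] V) : V →ₗ.[ℝ] V :=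
  mulP ((A : V →ₗ[ℝ] V).toPMap ⊤).inverse ((B : V →ₗ[ℝ] V).toPMap ⊤)

/-- `r` is a regularizer of `f`: `r ∈ Ψ^{3α,3β}(S_θ)` and `r f ∈ Ψ_L^{3α,3β}(S_θ)`, the integrals that
define the calculi of `r` and `r f` converge absolutely, and `r(T)`, `r(T̄)` are injective. -/
structure IsRegularizer (T : RightOp V) (D : Submodule ℝ V) (α β : ℝ) (c : Contour ω θ)
    (r f : ℍ[ℝ] → ℍ[ℝ]) : Prop where
  psi : Psi (3 * α) (3 * β) θ r
  psi_mul : PsiL (3 * α) (3 * β) θ (fun s => r s * f s)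
  converges : Converges T D ω θ r
  converges_mul : Converges T D ω θ (fun s => r s * f s)
  injective : Function.Injective (decS T D c r)
  injective_conj : Function.Injective (decS T.conj D c r)

/-- `f(T) = r(T)⁻¹ (rf)(T)`. -/
noncomputable def hInfS (T : RightOp V) (D : Submodule ℝ V) (c : Contour ω θ)
    (r f : ℍ[ℝ] → ℍ[ℝ]) : V →ₗ.[ℝ] V :=
  invMul (decS T D c r) (decS T D c (fun s => r s * f s))

/-- `𝓓f(T) = (r(T) r(T̄))⁻¹ (r(T) 𝓓(rf)(T) - 𝓓r(T) (rf)(T))`. -/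
noncomputable def hInfQ (T : RightOp V) (D : Submodule ℝ V) (c : Contour ω θ)
    (r f : ℍ[ℝ] → ℍ[ℝ]) : V →ₗ.[ℝ] V :=
  let rf : ℍ[ℝ] → ℍ[ℝ] := fun s => r s * f s
  invMul (decS T D c r ∘L decS T.conj D c r)
    (decS T D c r ∘L decQ T D c rf - decQ T D c r ∘L decS T D c rf)

/-- `𝓓̄f(T) = (r(T)² r(T̄))⁻¹ (r(T) r(T̄) 𝓓̄(rf)(T) - r(T̄) 𝓓̄r(T) (rf)(T)
  + r(T) 𝓓r(T) (rf)(T̄) - r(T̄) 𝓓r(T) (rf)(T))`. -/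
noncomputable def hInfP (T : RightOp V) (D : Submodule ℝ V) (c : Contour ω θ)
    (r f : ℍ[ℝ] → ℍ[ℝ]) : V →ₗ.[ℝ] V :=
  let rf : ℍ[ℝ] → ℍ[ℝ] := fun s => r s * f s
  invMul (decS T D c r ∘L decS T D c r ∘L decS T.conj D c r)
    (decS T D c r ∘L decS T.conj D c r ∘L decP T D c rf
      - decS T.conj D c r ∘L decP T D c r ∘L decS T D c rf
      + decS T D c r ∘L decQ T D c r ∘L decS T.conj D c rf
      - decS T.conj D c r ∘L decQ T D c r ∘L decS T D c rf)

/-- `Δf(T) = (r(T)² r(T̄))⁻¹ (r(T) r(T̄) Δ(rf)(T) - r(T̄) Δr(T) (rf)(T)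
  + r(T) 𝓓r(T) 𝓓(rf)(T) - 𝓓r(T)² (rf)(T))`. -/
noncomputable def hInfF (T : RightOp V) (D : Submodule ℝ V) (c : Contour ω θ)
    (r f : ℍ[ℝ] → ℍ[ℝ]) : V →ₗ.[ℝ] V :=
  let rf : ℍ[ℝ] → ℍ[ℝ] := fun s => r s * f s
  invMul (decS T D c r ∘L decS T D c r ∘L decS T.conj D c r)
    (decS T D c r ∘L decS T.conj D c r ∘L decF T D c rf
      - decS T.conj D c r ∘L decF T D c r ∘L decS T D c rf
      + decS T D c r ∘L decQ T D c r ∘L decQ T D c rf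
      - decQ T D c r ∘L decQ T D c r ∘L decS T D c rf)

end Operators

end QuatHInfty

open QuatHInfty

set_option linter.unusedSectionVars false

/-! Everything is reduced to holomorphic functional calculus for two commuting resolvents on a
complex Banach space. Right multiplication by the plane spanned by $1,e_1$ makes $V$ a complex space
`CV V` on which $T$, $\overline T$, the components $T_i$ and all left multiplications are complex
linear. Since the components commute, $z^2-2zT_0+|T|^2$, with $z$ acting from the right, factors on
$D$ as $(z-T)(z-\overline T)$. Hence $R(z)=(z-\overline T)Q(z)^{-1}$ and $R_b(z)=(z-T)Q(z)^{-1}$ are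
the ordinary resolvents of $T$ and $\overline T$; they commute and $RR_b=Q^{-1}$.

Left multiplication by $J\in\mathbb S$ splits the space into the parts where $Jv=ve_1$ and
$Jv=-ve_1$, with projections $P_J$ and $P_{-J}$. On them $s=x+Jy$ acts as $z$ and $\bar z$, so each
quaternionic kernel at $s$ has the form $K(z)P_J+K(\bar z)P_{-J}$ (`Represents`). A slice function
$a+Jb$ becomes the holomorphic operator function $\hat f=L_a+iL_b$ (`hat`), and `contourInt_eq`
turns the path integral into $-i\int K(z)\hat f(z)\,dz$, in which $J$ no longer occurs. The four
calculi are then given by the kernels $R$, $-2RR_b$, $2(R^2+RR_b)$ and $-4R^2R_b$.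

For decaying functions the product rules come from divided differences. If
$K(z)-K(w)=(w-z)\sum_jF_j(z)G_j(w)$, the product of two integrals at different angles becomes, by
Fubini, a double integral with kernel $(w-z)^{-1}$. Cauchy's formula evaluates one part and Cauchy's
theorem annihilates the other (`leibniz_rayInt`, `cal_leibniz`). The resolvent identity supplies
these differences for all kernels (`cal_S_mul` to `cal_F_mul`).

For growing functions one works with graphs: $(v,w)$ lies in the graph of $f(T)$ iff
$e(T)w=(ef)(T)v$, and similarly for the other calculi. An additional regularizing factor only
multiplies this equation by an injective operator (`graph_smul_iff`), so $g$ and $f$ may share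
$\rho=r_1r_2r_3$, while $gf$ is regularized by $\rho^2$. Intrinsic functions give operators in a
commutative ring, the bicommutant of the resolvents. The values of $f$ need not commute with
anything and enter only as vectors, after application to $v$. The inclusions thus become linear
identities over a commutative ring (`graphS_mul` to `graphF_mul`).

Regularizers exist because $z^m(1+z)^{-2m-1}$ has the calculus value $(-R(-1))^{m+1}(1+R(-1))^m$
(`rayInt_ratFun_resolvent`). This is injective, since $1+R(-1)=-TR(-1)$ and $T$ is injective; the
same holds for $\overline T$. -/

namespace QuatHInfty

/-! ### Contour shifts in horizontal strips. -/

section ComplexAnalysis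
open Filter Topology Complex

variable {E : Type*} [NormedAddCommGroup E] [NormedSpace ℂ E]

/-- The integral of a holomorphic function over a horizontal line does not depend on the line, when the
function tends to zero at both ends of the strip. -/
theorem integral_line_eq_of_tendsto_zero {H : ℂ → E} {a b : ℝ} (hab : a ≤ b)
    (hd : ∀ ζ : ℂ, ζ.im ∈ Icc a b → DifferentiableAt ℂ H ζ)
    (hz : ∀ ε > 0, ∃ T₀ : ℝ, ∀ ζ : ℂ, ζ.im ∈ Icc a b → T₀ ≤ |ζ.re| → ‖H ζ‖ ≤ ε)
    (ha : Integrable fun x : ℝ => H (x + a * I)) (hb : Integrable fun x : ℝ => H (x + b * I)) :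
    ∫ x : ℝ, H (x + a * I) = ∫ x : ℝ, H (x + b * I) := by
  have h1 : Tendsto (fun T : ℝ => (∫ x in (-T)..T, H (x + a * I)) - ∫ x in (-T)..T, H (x + b * I))
      atTop (𝓝 ((∫ x : ℝ, H (x + a * I)) - ∫ x : ℝ, H (x + b * I))) :=
    (intervalIntegral_tendsto_integral ha tendsto_neg_atTop_atBot tendsto_id).sub
      (intervalIntegral_tendsto_integral hb tendsto_neg_atTop_atBot tendsto_id)
  have h2 : Tendsto (fun T : ℝ => (∫ x in (-T)..T, H (x + a * I)) - ∫ x in (-T)..T, H (x + b * I))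
      atTop (𝓝 0) := by
    rw [NormedAddGroup.tendsto_nhds_zero]
    intro ε hε
    obtain ⟨T₀, hT₀⟩ := hz (ε / (2 * (b - a) + 1)) (by
      have : 0 ≤ b - a := by linarith
      positivity)
    filter_upwards [eventually_ge_atTop T₀, eventually_ge_atTop 0] with T hT hT0
    have key := integral_boundary_rect_eq_zero_of_differentiableOn H (((-T : ℝ) : ℂ) + a * I)
      ((T : ℂ) + b * I) (by
        intro ζ hζ
        refine (hd ζ ?_).differentiableWithinAt
        have := hζ.2
        simp only [mem_preimage, add_im, ofReal_im, mul_im, ofReal_re, I_im, I_re, mul_one, mul_zero,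
          zero_add, add_zero] at this
        rwa [uIcc_of_le hab] at this)
    simp only [add_re, ofReal_re, mul_re, I_re, mul_zero, ofReal_im, I_im, mul_one, sub_self,
      add_zero, add_im, mul_im, zero_add] at key
    have hv : ∀ S : ℝ, T₀ ≤ |S| → ‖∫ y in a..b, H (S + y * I)‖ ≤
        ε / (2 * (b - a) + 1) * |b - a| := by
      intro S hS
      refine intervalIntegral.norm_integral_le_of_norm_le_const fun y hy => ?_
      rw [uIoc_of_le hab] at hy
      exact hT₀ _ (by simpa using ⟨hy.1.le, hy.2⟩) (by simpa using hS)
    have e : (∫ x in (-T)..T, H (x + a * I)) - ∫ x in (-T)..T, H (x + b * I) =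
        I • (∫ y in a..b, H ((-T : ℝ) + y * I)) - I • ∫ y in a..b, H ((T : ℝ) + y * I) := by
      rw [← sub_eq_zero, ← key]
      abel
    rw [e]
    have hba : 0 ≤ b - a := by linarith
    calc _ ≤ ‖∫ y in a..b, H ((-T : ℝ) + y * I)‖ + ‖∫ y in a..b, H ((T : ℝ) + y * I)‖ := by
          refine (norm_sub_le _ _).trans ?_
          simp [norm_smul]
      _ ≤ ε / (2 * (b - a) + 1) * |b - a| + ε / (2 * (b - a) + 1) * |b - a| :=
          add_le_add (hv _ (by rw [abs_neg, abs_of_nonneg hT0]; exact hT))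
            (hv _ (by rw [abs_of_nonneg hT0]; exact hT))
      _ = ε * ((2 * (b - a)) / (2 * (b - a) + 1)) := by rw [abs_of_nonneg hba]; ring
      _ < ε * 1 := by
          refine mul_lt_mul_of_pos_left ?_ hε
          rw [div_lt_one (by positivity)]
          linarith
      _ = ε := mul_one _
  exact sub_eq_zero.1 (tendsto_nhds_unique h1 h2)

/-- With $r=|w|$ and $c=\cos\varphi$, the difference $1+2rc+r^2-\frac{1+c}2(1+r)^2$ is the
nonnegative number $\frac{1-c}2(1-r)^2$. -/
theorem one_add_norm_le {w : ℂ} {φ : ℝ} (hw : ‖w‖ * Real.cos φ ≤ w.re) :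
    (1 + Real.cos φ) / 2 * (1 + ‖w‖) ^ 2 ≤ ‖1 + w‖ ^ 2 := by
  have h1 : ‖1 + w‖ ^ 2 = 1 + 2 * w.re + ‖w‖ ^ 2 := by
    rw [← normSq_eq_norm_sq, ← normSq_eq_norm_sq, normSq_apply, normSq_apply]
    simp
    ring
  rw [h1]
  have := mul_nonneg (sub_nonneg.2 (Real.cos_le_one φ)) (sq_nonneg (1 - ‖w‖))
  nlinarith

theorem exists_one_add_norm_le {φ : ℝ} (h0 : 0 ≤ φ) (hφ : φ < Real.pi) :
    ∃ κ > 0, ∀ w : ℂ, ‖w‖ * Real.cos φ ≤ w.re → κ * (1 + ‖w‖) ≤ ‖1 + w‖ := by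
  have hc : 0 < (1 + Real.cos φ) / 2 := by
    have : Real.cos Real.pi < Real.cos φ := Real.cos_lt_cos_of_nonneg_of_le_pi h0 le_rfl hφ
    rw [Real.cos_pi] at this
    linarith
  refine ⟨Real.sqrt ((1 + Real.cos φ) / 2), Real.sqrt_pos.2 hc, fun w hw => ?_⟩
  refine (sq_le_sq₀ (by positivity) (norm_nonneg _)).1 ?_
  rw [mul_pow, Real.sq_sqrt hc.le]
  exact one_add_norm_le hw

theorem norm_exp_mul_cos_le {ζ : ℂ} {φ : ℝ} (hφ : φ ≤ Real.pi) (h : |ζ.im| ≤ φ) :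
    ‖exp ζ‖ * Real.cos φ ≤ (exp ζ).re := by
  rw [norm_exp, exp_re]
  refine mul_le_mul_of_nonneg_left ?_ (Real.exp_pos _).le
  rw [← Real.cos_abs ζ.im]
  exact Real.cos_le_cos_of_nonneg_of_le_pi (abs_nonneg _) hφ h

/-- The integral over horizontal lines of a holomorphic function on a strip does not depend on the line,
when the function decays exponentially to the left, grows at most exponentially to the right, and is
integrable over the two lines. -/
theorem integral_line_eq_of_growth {H : ℂ → E} {a b φ : ℝ} (hab : a ≤ b) (hφ : φ < Real.pi)
    (ha' : -φ ≤ a) (hb' : b ≤ φ)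
    (hd : ∀ ζ : ℂ, ζ.im ∈ Icc a b → DifferentiableAt ℂ H ζ)
    {C δ : ℝ} {N : ℕ} (hδ : 0 < δ)
    (hl : ∀ ζ : ℂ, ζ.im ∈ Icc a b → ζ.re ≤ 0 → ‖H ζ‖ ≤ C * Real.exp (δ * ζ.re))
    (hr : ∀ ζ : ℂ, ζ.im ∈ Icc a b → 0 ≤ ζ.re → ‖H ζ‖ ≤ C * Real.exp (N * ζ.re))
    (ha : Integrable fun x : ℝ => H (x + a * I)) (hb : Integrable fun x : ℝ => H (x + b * I)) :
    ∫ x : ℝ, H (x + a * I) = ∫ x : ℝ, H (x + b * I) := by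
  have hφ0 : 0 ≤ φ := by linarith
  obtain ⟨κ, hκ, hκw⟩ := exists_one_add_norm_le hφ0 hφ
  have hC : 0 ≤ C := by
    have := (norm_nonneg _).trans (hl (a * I) (by simp [hab]) (by simp))
    simpa using this
  -- The growth to the right is removed by the factor $(1+\varepsilon e^\zeta)^{-m}$, one power
  -- above the growth rate, so that $e^{-\operatorname{Re}\zeta}$ remains. Since
  -- $|\operatorname{Im}\zeta|\le\varphi<\pi$, the denominator stays away from zero uniformly in
  -- $\varepsilon$, and dominated convergence gives the limit $\varepsilon\to0$.
  set m : ℕ := N + 1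
  set ε : ℕ → ℝ := fun n => 1 / ((n : ℝ) + 1)
  have hε : ∀ n, 0 < ε n := fun n => by positivity
  have hcos : ∀ n (ζ : ℂ), ζ.im ∈ Icc a b → κ * (1 + ε n * Real.exp ζ.re) ≤ ‖1 + ε n * exp ζ‖ := by
    intro n ζ hζ
    have h1 := norm_exp_mul_cos_le hφ.le (abs_le.2 ⟨ha'.trans hζ.1, hζ.2.trans hb'⟩)
    have h2 := hκw (ε n * exp ζ) (by
      rw [norm_mul, re_ofReal_mul, norm_real, Real.norm_of_nonneg (hε n).le, mul_assoc]
      exact mul_le_mul_of_nonneg_left h1 (hε n).le)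
    rwa [norm_mul, norm_real, Real.norm_of_nonneg (hε n).le, norm_exp] at h2
  have hpos : ∀ n (ζ : ℂ), ζ.im ∈ Icc a b → 0 < ‖1 + ε n * exp ζ‖ := fun n ζ hζ =>
    lt_of_lt_of_le (mul_pos hκ (by have := hε n; positivity)) (hcos n ζ hζ)
  set F : ℕ → ℂ → E := fun n ζ => ((1 + ε n * exp ζ) ^ m)⁻¹ • H ζ
  have hF1 : ∀ n ζ, ζ.im ∈ Icc a b → ‖F n ζ‖ ≤ (κ ^ m)⁻¹ * ‖H ζ‖ := by
    intro n ζ hζ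
    rw [norm_smul, norm_inv, norm_pow]
    refine mul_le_mul_of_nonneg_right ?_ (norm_nonneg _)
    refine inv_anti₀ (by positivity) (pow_le_pow_left₀ hκ.le ?_ _)
    refine le_trans ?_ (hcos n ζ hζ)
    have := hε n
    have := Real.exp_pos ζ.re
    nlinarith [mul_pos hκ (mul_pos (hε n) this)]
  have hF2 : ∀ n ζ, ζ.im ∈ Icc a b → 0 ≤ ζ.re →
      ‖F n ζ‖ ≤ ((κ * ε n) ^ m)⁻¹ * C * Real.exp (-ζ.re) := by
    intro n ζ hζ hre
    rw [norm_smul, norm_inv, norm_pow]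
    have h3 : (κ * ε n) ^ m * Real.exp (m * ζ.re) ≤ ‖1 + ε n * exp ζ‖ ^ m := by
      rw [Real.exp_nat_mul, ← mul_pow]
      refine pow_le_pow_left₀ (by have := hε n; positivity) (le_trans ?_ (hcos n ζ hζ)) _
      rw [mul_assoc]
      refine mul_le_mul_of_nonneg_left ?_ hκ.le
      linarith
    calc _ ≤ ((κ * ε n) ^ m * Real.exp (m * ζ.re))⁻¹ * (C * Real.exp (N * ζ.re)) := by
          refine mul_le_mul (inv_anti₀ (by have := hε n; positivity) h3) (hr ζ hζ hre) (norm_nonneg _)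
            (by have := hε n; positivity)
      _ = _ := by
          rw [mul_inv, ← Real.exp_neg, mul_assoc, mul_assoc, mul_left_comm (Real.exp _), ← Real.exp_add]
          congr 3
          simp only [m]
          push_cast
          ring
  have hcont : ∀ n (y : ℝ), Continuous fun x : ℝ => ((1 + ε n * exp (x + y * I)) ^ m) := by
    intro n y; fun_prop
  have hint : ∀ n (y : ℝ), y ∈ Icc a b → Integrable (fun x : ℝ => H (x + y * I)) →
      Integrable fun x : ℝ => F n (x + y * I) := by
    intro n y hy hi
    have hne : ∀ x : ℝ, ((1 + ε n * exp (x + y * I)) ^ m) ≠ 0 := fun x =>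
      pow_ne_zero _ (norm_pos_iff.1 (hpos n _ (by simpa using hy)))
    refine Integrable.mono' (hi.norm.const_mul (κ ^ m)⁻¹)
      (((hcont n y).inv₀ hne).aestronglyMeasurable.smul hi.1) (ae_of_all _ fun x => ?_)
    exact hF1 n _ (by simpa using hy)
  have hlim : ∀ y : ℝ, y ∈ Icc a b → Integrable (fun x : ℝ => H (x + y * I)) →
      Tendsto (fun n => ∫ x : ℝ, F n (x + y * I)) atTop (𝓝 (∫ x : ℝ, H (x + y * I))) := by
    intro y hy hi
    refine tendsto_integral_of_dominated_convergence (fun x => (κ ^ m)⁻¹ * ‖H (x + y * I)‖)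
      (fun n => (hint n y hy hi).1) (hi.norm.const_mul _)
      (fun n => ae_of_all _ fun x => hF1 n _ (by simpa using hy)) (ae_of_all _ fun x => ?_)
    have h0 : Tendsto (fun n => ((ε n : ℝ) : ℂ)) atTop (𝓝 0) := by
      rw [← ofReal_zero]
      exact (continuous_ofReal.tendsto _).comp tendsto_one_div_add_atTop_nhds_zero_nat
    have h4 : Tendsto (fun n => ((1 + (ε n : ℂ) * exp (x + y * I)) ^ m)⁻¹) atTop
        (𝓝 (((1 + 0 * exp (x + y * I)) ^ m)⁻¹)) :=
      (((h0.mul_const _).const_add _).pow _).inv₀ (by simp)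
    have h5 := h4.smul_const (H (x + y * I))
    simpa using h5
  have hna : a ∈ Icc a b := ⟨le_rfl, hab⟩
  have hnb : b ∈ Icc a b := ⟨hab, le_rfl⟩
  refine tendsto_nhds_unique (hlim a hna ha) ?_
  have : (fun n => ∫ x : ℝ, F n (x + a * I)) = fun n => ∫ x : ℝ, F n (x + b * I) := by
    funext n
    refine integral_line_eq_of_tendsto_zero hab ?_ ?_ (hint n a hna ha) (hint n b hnb hb)
    · intro ζ hζ
      refine DifferentiableAt.smul (DifferentiableAt.inv (by fun_prop) ?_) (hd ζ hζ)
      exact pow_ne_zero _ (norm_pos_iff.1 (hpos n _ hζ))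
    · intro η hη
      have t1 : Tendsto (fun x : ℝ => ((κ ^ m)⁻¹ * C) * Real.exp (-(δ * x))
          + ((κ * ε n) ^ m)⁻¹ * C * Real.exp (-x)) atTop (𝓝 (((κ ^ m)⁻¹ * C) * 0
          + ((κ * ε n) ^ m)⁻¹ * C * 0)) := by
        refine Tendsto.add (Tendsto.const_mul _ ?_) (Tendsto.const_mul _ ?_)
        · exact Real.tendsto_exp_atBot.comp
            (tendsto_neg_atTop_atBot.comp (tendsto_id.const_mul_atTop hδ))
        · exact Real.tendsto_exp_atBot.comp tendsto_neg_atTop_atBot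
      rw [mul_zero, mul_zero, add_zero] at t1
      obtain ⟨T₀, hT₀⟩ := eventually_atTop.1 (t1.eventually (gt_mem_nhds hη))
      refine ⟨T₀, fun ζ hζ hT => le_trans ?_ (hT₀ _ hT).le⟩
      have := hε n
      rcases le_total ζ.re 0 with h | h
      · refine le_trans ((hF1 n ζ hζ).trans
          (mul_le_mul_of_nonneg_left (hl ζ hζ h) (by positivity))) ?_
        rw [abs_of_nonpos h, mul_neg, neg_neg, mul_assoc (κ ^ m)⁻¹]
        exact le_add_of_nonneg_right (by positivity)
      · refine (hF2 n ζ hζ h).trans ?_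
        rw [abs_of_nonneg h]
        exact le_add_of_nonneg_left (by positivity)
  rw [this]
  exact hlim b hnb hb

end ComplexAnalysis

end QuatHInfty

namespace QuatHInfty

/-! ### Cauchy's integral formula in a strip. -/

section CauchyKernel
open Filter Topology Complex

variable {E : Type*} [NormedAddCommGroup E] [NormedSpace ℂ E]

theorem integrable_inv_cosh : Integrable fun x : ℝ => (Real.cosh x)⁻¹ := by
  refine (integrable_inv_one_add_sq.const_mul 4).mono'
    (Real.continuous_cosh.inv₀ fun x => (Real.cosh_pos x).ne').aestronglyMeasurable
    (ae_of_all _ fun x => ?_)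
  rw [Real.norm_of_nonneg (inv_nonneg.2 (Real.cosh_pos x).le), ← Real.cosh_abs, Real.cosh_eq]
  have h1 := Real.quadratic_le_exp_of_nonneg (abs_nonneg x)
  have h2 := Real.exp_pos (-|x|)
  rw [← div_eq_mul_inv, inv_eq_one_div, div_le_div_iff₀ (by positivity) (by positivity)]
  rw [sq_abs] at h1
  nlinarith [abs_nonneg x]

/-- An antiderivative is $\arctan(\sinh x)$. -/
theorem integral_inv_cosh : ∫ x : ℝ, (Real.cosh x)⁻¹ = Real.pi := by
  have hs : Tendsto Real.sinh atTop atTop := by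
    simpa using Real.sinhOrderIso.tendsto_atTop
  have hs' : Tendsto Real.sinh atBot atBot := by
    simpa using Real.sinhOrderIso.tendsto_atBot
  rw [integral_of_hasDerivAt_of_tendsto (f := fun x => Real.arctan (Real.sinh x))
    (m := -(Real.pi / 2)) (n := Real.pi / 2) (fun x => ?_) integrable_inv_cosh
    ((Real.tendsto_arctan_atBot.mono_right nhdsWithin_le_nhds).comp hs')
    ((Real.tendsto_arctan_atTop.mono_right nhdsWithin_le_nhds).comp hs)]
  · ring
  · refine (Real.hasDerivAt_sinh x).arctan.congr_deriv ?_
    have h := Real.cosh_sq x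
    have hp := (Real.cosh_pos x).ne'
    rw [show 1 + Real.sinh x ^ 2 = Real.cosh x ^ 2 by linarith]
    field_simp

theorem normSq_sinh (ζ : ℂ) : ‖sinh ζ‖ ^ 2 = Real.sinh ζ.re ^ 2 + Real.sin ζ.im ^ 2 := by
  have e : sinh ζ = sinh (ζ.re + ζ.im * I) := by rw [re_add_im]
  rw [← normSq_eq_norm_sq, normSq_apply, e, sinh_add, sinh_mul_I, cosh_mul_I]
  simp only [← ofReal_sinh, ← ofReal_cosh, ← ofReal_sin, ← ofReal_cos]
  simp only [add_re, add_im, mul_re, mul_im, ofReal_re, ofReal_im, I_re, I_im, mul_zero, mul_one,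
    zero_mul, sub_zero, add_zero, zero_add, sub_self]
  nlinarith [Real.cosh_sq ζ.re, Real.sin_sq_add_cos_sq ζ.im]

theorem sinh_half_ne_zero {ξ : ℂ} (h : |ξ.im| < 2 * Real.pi) (h0 : ξ ≠ 0) : sinh (ξ / 2) ≠ 0 := by
  intro hs
  have h1 := normSq_sinh (ξ / 2)
  rw [hs] at h1
  simp only [norm_zero, div_ofNat_re, div_ofNat_im] at h1
  have h2 : Real.sinh (ξ.re / 2) = 0 := by
    nlinarith [sq_nonneg (Real.sinh (ξ.re / 2)), sq_nonneg (Real.sin (ξ.im / 2))]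
  have h3 : Real.sin (ξ.im / 2) = 0 := by
    nlinarith [sq_nonneg (Real.sinh (ξ.re / 2)), sq_nonneg (Real.sin (ξ.im / 2))]
  rw [Real.sinh_eq_zero] at h2
  rw [abs_lt] at h
  rw [Real.sin_eq_zero_iff_of_lt_of_lt (by linarith) (by linarith)] at h3
  exact h0 (Complex.ext (by simpa using h2) (by simpa using h3))

/-- This bound compares $1/\sinh$ on a horizontal line that misses its poles with the integrable
function $1/\cosh$. -/
theorem sin_mul_cosh_le (ζ : ℂ) : |Real.sin ζ.im| * Real.cosh ζ.re ≤ ‖sinh ζ‖ := by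
  refine (sq_le_sq₀ (mul_nonneg (abs_nonneg _) (Real.cosh_pos _).le) (norm_nonneg _)).1 ?_
  rw [normSq_sinh, mul_pow, sq_abs]
  have h1 := Real.cosh_sq ζ.re
  have h2 := Real.sin_sq_add_cos_sq ζ.im
  nlinarith [mul_nonneg (sq_nonneg (Real.sinh ζ.re)) (sq_nonneg (Real.cos ζ.im))]

theorem exp_half_le_norm_sinh {ξ : ℂ} (h : 1 ≤ |ξ.re|) :
    Real.exp (|ξ.re| / 2) / 2 ≤ ‖2 * sinh (ξ / 2)‖ := by
  have h1 : Real.sinh (|ξ.re| / 2) ≤ ‖sinh (ξ / 2)‖ := by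
    refine (sq_le_sq₀ (Real.sinh_nonneg_iff.2 (by positivity)) (norm_nonneg _)).1 ?_
    rw [normSq_sinh, div_ofNat_re]
    have : Real.sinh (|ξ.re| / 2) ^ 2 = Real.sinh (ξ.re / 2) ^ 2 := by
      rcases abs_cases ξ.re with h | h <;> rw [h.1]
      rw [neg_div, Real.sinh_neg, neg_sq]
    rw [this]
    exact le_add_of_nonneg_right (sq_nonneg _)
  rw [norm_mul, norm_ofNat]
  refine le_trans ?_ (mul_le_mul_of_nonneg_left h1 zero_le_two)
  rw [Real.sinh_eq]
  have h2 : 2 ≤ Real.exp |ξ.re| := by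
    have := Real.add_one_le_exp |ξ.re|
    linarith
  have h3 : Real.exp |ξ.re| = Real.exp (|ξ.re| / 2) * Real.exp (|ξ.re| / 2) := by
    rw [← Real.exp_add]; ring_nf
  have h4 : Real.exp (-(|ξ.re| / 2)) * Real.exp (|ξ.re| / 2) = 1 := by
    rw [← Real.exp_add]; simp
  have h5 := Real.exp_pos (|ξ.re| / 2)
  have h6 := Real.exp_pos (-(|ξ.re| / 2))
  nlinarith

theorem integrable_inv_sinh_line {y : ℝ} (hy : Real.sin (y / 2) ≠ 0) :
    Integrable fun x : ℝ => (2 * sinh ((x + y * I) / 2))⁻¹ := by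
  have h0 : ∀ x : ℝ, |Real.sin (y / 2)| * Real.cosh (x / 2) ≤ ‖sinh (((x : ℂ) + y * I) / 2)‖ := by
    intro x
    have := sin_mul_cosh_le (((x : ℂ) + y * I) / 2)
    simpa using this
  have hp : ∀ x : ℝ, 0 < |Real.sin (y / 2)| * Real.cosh (x / 2) := fun x =>
    mul_pos (abs_pos.2 hy) (Real.cosh_pos _)
  have h1 := ((integrable_inv_cosh.comp_div (two_ne_zero)).const_mul |Real.sin (y / 2)|⁻¹)
  refine h1.mono' (Continuous.inv₀ (by fun_prop) fun x => ?_).aestronglyMeasurable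
    (ae_of_all _ fun x => ?_)
  · exact mul_ne_zero two_ne_zero (norm_pos_iff.1 ((hp x).trans_le (h0 x)))
  · rw [norm_inv, norm_mul, norm_ofNat, ← mul_inv]
    refine inv_anti₀ (hp x) ((h0 x).trans ?_)
    linarith [norm_nonneg (sinh (((x : ℂ) + y * I) / 2))]

/-- There is no pole with imaginary part strictly between $0$ and $2\pi$, so the line may be moved
to height $\pi$, where $2\sinh((x+\pi i)/2)=2i\cosh(x/2)$. -/
theorem integral_inv_sinh_line {y : ℝ} (hy0 : 0 < y) (hy : y < 2 * Real.pi) :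
    ∫ x : ℝ, (2 * sinh ((x + y * I) / 2))⁻¹ = -(Real.pi * I) := by
  have hsin : ∀ z ∈ Ioo 0 (2 * Real.pi), Real.sin (z / 2) ≠ 0 := fun z hz =>
    (Real.sin_pos_of_pos_of_lt_pi (by linarith [hz.1]) (by linarith [hz.2])).ne'
  have hpi := Real.pi_pos
  have shift : ∀ a b : ℝ, 0 < a → a ≤ b → b < 2 * Real.pi →
      ∫ x : ℝ, (2 * sinh ((x + a * I) / 2))⁻¹ = ∫ x : ℝ, (2 * sinh ((x + b * I) / 2))⁻¹ := by
    intro a b ha hab hb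
    refine integral_line_eq_of_tendsto_zero (H := fun ζ => (2 * sinh (ζ / 2))⁻¹) hab ?_ ?_
      (integrable_inv_sinh_line (hsin a ⟨ha, by linarith⟩))
      (integrable_inv_sinh_line (hsin b ⟨by linarith, hb⟩))
    · intro ζ hζ
      refine DifferentiableAt.inv ?_ (mul_ne_zero two_ne_zero (sinh_half_ne_zero ?_ ?_))
      · exact ((differentiableAt_id.div_const 2).csinh).const_mul 2
      · rw [abs_lt]; constructor <;> linarith [hζ.1, hζ.2]
      · rintro rfl
        simp at hζ
        linarith [hζ.1]
    · intro ε hε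
      have t1 : Tendsto (fun x : ℝ => 2 * Real.exp (-(x / 2))) atTop (𝓝 (2 * 0)) := by
        refine Tendsto.const_mul _ (Real.tendsto_exp_atBot.comp (tendsto_neg_atTop_atBot.comp ?_))
        exact tendsto_id.atTop_div_const two_pos
      rw [mul_zero] at t1
      obtain ⟨T₀, hT₀⟩ := eventually_atTop.1 (t1.eventually (gt_mem_nhds hε))
      refine ⟨max T₀ 1, fun ζ _ hT => le_trans ?_ (hT₀ _ ((le_max_left _ _).trans hT)).le⟩
      rw [norm_inv, Real.exp_neg, ← inv_inv (2 : ℝ), ← mul_inv]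
      refine inv_anti₀ (by positivity) ?_
      have := exp_half_le_norm_sinh ((le_max_right _ _).trans hT)
      linarith
  have h1 : ∫ x : ℝ, (2 * sinh ((x + y * I) / 2))⁻¹ =
      ∫ x : ℝ, (2 * sinh ((x + Real.pi * I) / 2))⁻¹ := by
    rcases le_total y Real.pi with h | h
    · exact shift _ _ hy0 h (by linarith)
    · exact (shift _ _ hpi h hy).symm
  rw [h1]
  have h2 : ∀ x : ℝ, (2 * sinh ((x + Real.pi * I) / 2))⁻¹ =
      (2 * I)⁻¹ * (((Real.cosh (x / 2))⁻¹ : ℝ) : ℂ) := by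
    intro x
    rw [add_div, show (Real.pi : ℂ) * I / 2 = (Real.pi / 2) * I by ring, sinh_add, sinh_mul_I,
      cosh_mul_I, sin_pi_div_two, cos_pi_div_two]
    push_cast
    rw [mul_zero, zero_add, one_mul, ← mul_inv]
    ring
  simp_rw [h2]
  rw [integral_const_mul, integral_complex_ofReal, Measure.integral_comp_div (fun x => (Real.cosh x)⁻¹) 2,
    integral_inv_cosh, mul_inv, inv_I]
  simp
  ring

theorem integral_inv_sinh_line_neg {y : ℝ} (hy0 : y < 0) (hy : -(2 * Real.pi) < y) :
    ∫ x : ℝ, (2 * sinh ((x + y * I) / 2))⁻¹ = Real.pi * I := by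
  rw [← integral_neg_eq_self]
  have : ∀ x : ℝ, (2 * sinh ((((-x : ℝ) : ℂ) + y * I) / 2))⁻¹ =
      -(2 * sinh ((x + (-y : ℝ) * I) / 2))⁻¹ := by
    intro x
    rw [show (((-x : ℝ) : ℂ) + y * I) / 2 = -((x + (-y : ℝ) * I) / 2) by push_cast; ring, sinh_neg,
      mul_neg, inv_neg]
  simp_rw [this]
  rw [integral_neg, integral_inv_sinh_line (by linarith) (by linarith), neg_neg]

/-- Taking $e^{(\zeta+\zeta_0)/2}$ out of numerator and denominator puts the Cauchy kernel
$dz/(z-z_0)$, in logarithmic coordinates, into a form that depends on $\zeta-\zeta_0$ only. -/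
theorem exp_div_exp_sub (ζ ζ₀ : ℂ) :
    exp ζ / (exp ζ - exp ζ₀) = exp ((ζ - ζ₀) / 2) * (2 * sinh ((ζ - ζ₀) / 2))⁻¹ := by
  have e1 : exp ζ = exp ((ζ + ζ₀) / 2) * exp ((ζ - ζ₀) / 2) := by rw [← exp_add]; ring_nf
  have e2 : exp ζ₀ = exp ((ζ + ζ₀) / 2) * exp (-((ζ - ζ₀) / 2)) := by rw [← exp_add]; ring_nf
  rw [two_sinh]
  nth_rewrite 1 [e1]
  rw [e1, e2, ← mul_sub, mul_div_mul_left _ _ (exp_ne_zero _), div_eq_mul_inv]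

/-- The kernel decays at rate $1$ to the left and is bounded to the right, where the function decays
at rate $\delta$. For $\delta\le1$ both combine to two-sided decay at rate $\delta$. -/
theorem exponent_bound {δ : ℝ} (hδ : 0 < δ) (hδ1 : δ ≤ 1) (x y : ℝ) :
    (x - y) / 2 + -(|x - y| / 2) + -(δ * max x 0) ≤ δ * |y| + -(δ * |x|) := by
  have h1 : (x - y) / 2 + -(|x - y| / 2) ≤ δ * ((x - y) / 2 + -(|x - y| / 2)) := by
    have := le_abs_self (x - y)
    nlinarith
  have h2 : (x - y) / 2 + -(|x - y| / 2) + |x| ≤ |y| + max x 0 := by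
    rcases le_total 0 x with h | h
    · rw [max_eq_left h, abs_of_nonneg h]
      have := le_abs_self (x - y)
      have := abs_nonneg y
      linarith
    · rw [max_eq_right h, abs_of_nonpos h]
      have := neg_abs_le (x - y)
      have := neg_abs_le y
      have := neg_le_abs (x - y)
      have := le_abs_self (x - y)
      linarith
  nlinarith

/-- Cauchy's integral formula for a strip, in logarithmic coordinates. -/
theorem cauchy_formula_strip [CompleteSpace E] {H : ℂ → E} {φ φ' : ℝ} (hφ : φ < φ')
    (hφ' : φ' ≤ Real.pi) {ζ₀ : ℂ} (hζ₀ : |ζ₀.im| < φ)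
    (hd : ∀ ζ : ℂ, |ζ.im| < φ' → DifferentiableAt ℂ H ζ) {C δ : ℝ} (hδ : 0 < δ)
    (hδ1 : δ ≤ 1) (hb : ∀ ζ : ℂ, |ζ.im| ≤ φ → ‖H ζ‖ ≤ C * Real.exp (-(δ * max ζ.re 0)))
    (hi : Integrable fun x : ℝ => (exp (x + (-φ : ℝ) * I) / (exp (x + (-φ : ℝ) * I) - exp ζ₀)) •
      H (x + (-φ : ℝ) * I))
    (hi' : Integrable fun x : ℝ => (exp (x + φ * I) / (exp (x + φ * I) - exp ζ₀)) •
      H (x + φ * I)) :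
    (∫ x : ℝ, (exp (x + (-φ : ℝ) * I) / (exp (x + (-φ : ℝ) * I) - exp ζ₀)) • H (x + (-φ : ℝ) * I)) -
      ∫ x : ℝ, (exp (x + φ * I) / (exp (x + φ * I) - exp ζ₀)) • H (x + φ * I) =
      (2 * Real.pi * I) • H ζ₀ := by
  have hφ0 : 0 < φ := (abs_nonneg _).trans_lt hζ₀
  have hpi := Real.pi_pos
  have hζ₀' := abs_lt.1 hζ₀
  set N : ℂ → E := fun ζ => exp ((ζ - ζ₀) / 2) • H ζ with hN
  set sh : ℂ → ℂ := fun ζ => 2 * sinh ((ζ - ζ₀) / 2) with hsh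
  -- The quotient of two divided slopes is the holomorphic extension across $\zeta_0$ of the Cauchy
  -- integrand minus the model singularity $(2\sinh((\zeta-\zeta_0)/2))^{-1}H(\zeta_0)$.
  set D : ℂ → E := fun ζ => (dslope sh ζ₀ ζ)⁻¹ • dslope N ζ₀ ζ with hD
  have hopen : IsOpen {ζ : ℂ | |ζ.im| < φ'} := isOpen_lt (by fun_prop) continuous_const
  have hmem : {ζ : ℂ | |ζ.im| < φ'} ∈ 𝓝 ζ₀ := hopen.mem_nhds (hζ₀.trans hφ)
  have hN0 : N ζ₀ = H ζ₀ := by simp [hN]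
  have hsh0 : sh ζ₀ = 0 := by simp [hsh]
  have hshd : ∀ ζ, HasDerivAt sh (cosh ((ζ - ζ₀) / 2)) ζ := by
    intro ζ
    have := ((((hasDerivAt_id ζ).sub_const ζ₀).div_const 2).csinh).const_mul 2
    refine this.congr_deriv ?_
    simp only [id]
    ring
  have hshne : ∀ ζ : ℂ, |ζ.im| < φ' → ζ ≠ ζ₀ → sh ζ ≠ 0 := by
    intro ζ hζ hne
    refine mul_ne_zero two_ne_zero (sinh_half_ne_zero ?_ (sub_ne_zero.2 hne))
    rw [abs_lt] at hζ ⊢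
    rw [sub_im]
    constructor <;> linarith [hζ.1, hζ.2, hζ₀'.1, hζ₀'.2]
  have hDeq : ∀ ζ : ℂ, ζ ≠ ζ₀ → D ζ = (exp ζ / (exp ζ - exp ζ₀)) • H ζ - (sh ζ)⁻¹ • H ζ₀ := by
    intro ζ hne
    have h1 : ζ - ζ₀ ≠ 0 := sub_ne_zero.2 hne
    simp only [hD]
    rw [dslope_of_ne _ hne, dslope_of_ne _ hne, slope_def_module, slope_def_module, hsh0, hN0,
      sub_zero, smul_smul, exp_div_exp_sub, smul_eq_mul, mul_inv, inv_inv, mul_right_comm,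
      mul_inv_cancel₀ h1, one_mul, smul_sub, smul_smul, mul_comm]
  have hDd : ∀ ζ : ℂ, |ζ.im| < φ' → DifferentiableAt ℂ D ζ := by
    have hNd : DifferentiableOn ℂ (dslope N ζ₀) {ζ : ℂ | |ζ.im| < φ'} := by
      rw [differentiableOn_dslope hmem]
      intro ζ hζ
      exact (DifferentiableAt.smul (by fun_prop) (hd ζ hζ)).differentiableWithinAt
    have hsd : DifferentiableOn ℂ (dslope sh ζ₀) {ζ : ℂ | |ζ.im| < φ'} := by
      rw [differentiableOn_dslope hmem]
      intro ζ _
      exact (hshd ζ).differentiableAt.differentiableWithinAt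
    intro ζ hζ
    refine DifferentiableAt.smul (DifferentiableAt.inv (hsd.differentiableAt (hopen.mem_nhds hζ)) ?_)
      (hNd.differentiableAt (hopen.mem_nhds hζ))
    rcases eq_or_ne ζ ζ₀ with rfl | hne
    · rw [dslope_same, (hshd ζ).deriv]
      simp
    · rw [dslope_of_ne _ hne, slope_def_module, hsh0, sub_zero]
      exact smul_ne_zero (inv_ne_zero (sub_ne_zero.2 hne)) (hshne ζ hζ hne)
  have hline : ∀ y : ℝ, ∀ x : ℝ, sh (x + y * I) =
      2 * sinh ((((x - ζ₀.re : ℝ) : ℂ) + ((y - ζ₀.im : ℝ) : ℂ) * I) / 2) := by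
    intro y x
    simp only [hsh]
    congr 3
    nth_rewrite 1 [← re_add_im ζ₀]
    push_cast
    ring
  have hshI : ∀ y : ℝ, Real.sin ((y - ζ₀.im) / 2) ≠ 0 →
      Integrable fun x : ℝ => (sh (x + y * I))⁻¹ := by
    intro y hy
    simp_rw [hline]
    exact (integrable_inv_sinh_line hy).comp_sub_right ζ₀.re
  have hs1 : Real.sin ((φ - ζ₀.im) / 2) ≠ 0 :=
    (Real.sin_pos_of_pos_of_lt_pi (by linarith) (by linarith)).ne'
  have hs2 : Real.sin ((-φ - ζ₀.im) / 2) ≠ 0 :=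
    (Real.sin_neg_of_neg_of_neg_pi_lt (by linarith) (by linarith)).ne
  have hI1 : ∫ x : ℝ, (sh (x + φ * I))⁻¹ = -(Real.pi * I) := by
    simp_rw [hline]
    rw [integral_sub_right_eq_self
      (fun x : ℝ => (2 * sinh (((x : ℂ) + ((φ - ζ₀.im : ℝ) : ℂ) * I) / 2))⁻¹) ζ₀.re]
    exact integral_inv_sinh_line (by linarith) (by linarith)
  have hI2 : ∫ x : ℝ, (sh (x + (-φ : ℝ) * I))⁻¹ = Real.pi * I := by
    simp_rw [hline]
    rw [integral_sub_right_eq_self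
      (fun x : ℝ => (2 * sinh (((x : ℂ) + ((-φ - ζ₀.im : ℝ) : ℂ) * I) / 2))⁻¹) ζ₀.re]
    exact integral_inv_sinh_line_neg (by linarith) (by linarith)
  have hne : ∀ y : ℝ, φ = |y| → ∀ x : ℝ, (x : ℂ) + y * I ≠ ζ₀ := by
    rintro y hy x rfl
    simp at hζ₀
    linarith
  have hne1 := hne φ (abs_of_pos hφ0).symm
  have hne2 := hne (-φ) (by rw [abs_neg, abs_of_pos hφ0])
  -- Having no pole, `D` has the same integral over both lines. Only the model singularity
  -- contributes, with $\pi i$ below and $-\pi i$ above $\zeta_0$, whence the factor $2\pi i$.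
  have key : ∫ x : ℝ, D (x + (-φ : ℝ) * I) = ∫ x : ℝ, D (x + φ * I) := by
    refine integral_line_eq_of_tendsto_zero (by linarith) ?_ ?_ ?_ ?_
    · intro ζ hζ
      exact hDd ζ ((abs_le.2 hζ).trans_lt hφ)
    · intro ε hε
      have hC : 0 ≤ C := by
        have := (norm_nonneg _).trans (hb 0 (by simpa using hφ0.le))
        simpa using this
      have t0 : Tendsto (fun x : ℝ => |x - ζ₀.re|) (cocompact ℝ) atTop :=
        tendsto_norm_cocompact_atTop.comp (Homeomorph.subRight ζ₀.re).isClosedEmbedding.tendsto_cocompact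
      have t1 : Tendsto (fun x : ℝ => 2 * (C * Real.exp (δ * |ζ₀.re|) * Real.exp (-(δ * |x|))) +
          2 * Real.exp (-(|x - ζ₀.re| / 2)) * ‖H ζ₀‖) (cocompact ℝ)
          (𝓝 (2 * (C * Real.exp (δ * |ζ₀.re|) * 0) + 2 * 0 * ‖H ζ₀‖)) := by
        refine Tendsto.add (Tendsto.const_mul _ (Tendsto.const_mul _ ?_))
          (Tendsto.mul_const _ (Tendsto.const_mul _ ?_))
        · exact Real.tendsto_exp_atBot.comp (tendsto_neg_atTop_atBot.comp
            (tendsto_norm_cocompact_atTop.const_mul_atTop hδ))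
        · exact Real.tendsto_exp_atBot.comp (tendsto_neg_atTop_atBot.comp
            (t0.atTop_div_const two_pos))
      have t2 := (t1.eventually (gt_mem_nhds (show _ < ε by simpa using hε))).and
        (t0.eventually (eventually_ge_atTop 1))
      rw [← Metric.cobounded_eq_cocompact, ← comap_norm_atTop, eventually_comap] at t2
      obtain ⟨T₀, hT₀⟩ := eventually_atTop.1 t2
      refine ⟨T₀, fun ζ hζ hT => ?_⟩
      obtain ⟨h1, h2⟩ := hT₀ _ hT ζ.re rfl
      refine le_trans ?_ h1.le
      have h3 : ζ ≠ ζ₀ := by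
        rintro rfl
        simp at h2
        linarith
      rw [hDeq ζ h3, exp_div_exp_sub]
      have h4 := exp_half_le_norm_sinh (ξ := ζ - ζ₀) (by simpa using h2)
      rw [sub_re] at h4
      have h5 : ‖(sh ζ)⁻¹‖ ≤ 2 * Real.exp (-(|ζ.re - ζ₀.re| / 2)) := by
        rw [norm_inv, Real.exp_neg, ← inv_inv (2 : ℝ), ← mul_inv]
        refine inv_anti₀ (by positivity) ?_
        simp only [hsh]
        linarith
      refine (norm_sub_le _ _).trans (add_le_add ?_ ?_)
      · rw [norm_smul, norm_mul]
        refine (mul_le_mul (mul_le_mul_of_nonneg_left h5 (norm_nonneg _)) (hb ζ (abs_le.2 hζ))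
          (norm_nonneg _) (by positivity)).trans ?_
        have eL : ‖exp ((ζ - ζ₀) / 2)‖ * (2 * Real.exp (-(|ζ.re - ζ₀.re| / 2))) *
            (C * Real.exp (-(δ * max ζ.re 0))) = 2 * C * Real.exp ((ζ.re - ζ₀.re) / 2 +
              -(|ζ.re - ζ₀.re| / 2) + -(δ * max ζ.re 0)) := by
          rw [norm_exp, div_ofNat_re, sub_re, Real.exp_add, Real.exp_add]
          ring
        have eR : 2 * (C * Real.exp (δ * |ζ₀.re|) * Real.exp (-(δ * |ζ.re|))) =
            2 * C * Real.exp (δ * |ζ₀.re| + -(δ * |ζ.re|)) := by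
          rw [Real.exp_add]
          ring
        rw [eL, eR]
        refine mul_le_mul_of_nonneg_left (Real.exp_le_exp.2 ?_) (by positivity)
        exact exponent_bound hδ hδ1 _ _
      · rw [norm_smul]
        exact mul_le_mul_of_nonneg_right h5 (norm_nonneg _)
    · simp_rw [fun x => hDeq _ (hne2 x)]
      exact hi.sub ((hshI _ hs2).smul_const _)
    · simp_rw [fun x => hDeq _ (hne1 x)]
      exact hi'.sub ((hshI _ hs1).smul_const _)
  simp_rw [fun x => hDeq _ (hne1 x), fun x => hDeq _ (hne2 x)] at key
  rw [integral_sub hi ((hshI _ hs2).smul_const _), integral_sub hi' ((hshI _ hs1).smul_const _),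
    integral_smul_const, integral_smul_const, hI1, hI2] at key
  linear_combination (norm := module) (1 : ℂ) • key

end CauchyKernel

end QuatHInfty

namespace QuatHInfty

/-! ### Integrals over the boundary of a complex sector. -/

section Rays
open Filter Topology Complex

variable {E : Type*} [NormedAddCommGroup E] [NormedSpace ℂ E]

/-- The boundary of the complex sector of half-angle `φ`. -/
noncomputable def zpath (φ t : ℝ) : ℂ :=
  if t < 0 then ((-t : ℝ) : ℂ) * exp (φ * I) else (t : ℂ) * exp ((-φ : ℝ) * I)

/-- The derivative of `zpath φ` (for `t ≠ 0`). -/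
noncomputable def zder (φ t : ℝ) : ℂ := if t < 0 then -exp (φ * I) else exp ((-φ : ℝ) * I)

/-- The integral over the boundary of a complex sector. -/
noncomputable def rayInt (φ : ℝ) (u : ℂ → E) : E := ∫ t : ℝ, zder φ t • u (zpath φ t)

/-- Power bounds near `0` and near `∞`. -/
def PowBound (s : Set ℂ) (C p q : ℝ) (u : ℂ → E) : Prop :=
  ∀ z ∈ s, (‖z‖ ≤ 1 → ‖u z‖ ≤ C * ‖z‖ ^ p) ∧ (1 ≤ ‖z‖ → ‖u z‖ ≤ C * ‖z‖ ^ q)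

theorem PowBound.mono {E : Type*} [NormedAddCommGroup E] [NormedSpace ℂ E] {s s' : Set ℂ}
    {C p q p' q' : ℝ} {u : ℂ → E} (h : PowBound s C p q u) (hs' : s' ⊆ s)
    (hs : ∀ z ∈ s', z ≠ 0) (hp : p' ≤ p) (hq : q ≤ q') : PowBound s' C p' q' u := by
  intro z hz
  have h0 := norm_pos_iff.2 (hs z hz)
  obtain ⟨h1, h2⟩ := h z (hs' hz)
  refine ⟨fun h3 => (h1 h3).trans ?_, fun h3 => (h2 h3).trans ?_⟩
  · have hC : 0 ≤ C := nonneg_of_mul_nonneg_left ((norm_nonneg _).trans (h1 h3)) (by positivity)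
    exact mul_le_mul_of_nonneg_left (Real.rpow_le_rpow_of_exponent_ge h0 h3 hp) hC
  · have hC : 0 ≤ C := nonneg_of_mul_nonneg_left ((norm_nonneg _).trans (h2 h3)) (by positivity)
    exact mul_le_mul_of_nonneg_left (Real.rpow_le_rpow_of_exponent_le h3 hq) hC

theorem norm_zpath (φ t : ℝ) : ‖zpath φ t‖ = |t| := by
  unfold zpath
  split_ifs with h
  · rw [norm_mul, norm_exp_ofReal_mul_I, norm_real, mul_one, norm_neg, Real.norm_eq_abs]
  · rw [norm_mul, norm_exp_ofReal_mul_I, norm_real, mul_one, Real.norm_eq_abs]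

theorem norm_zder (φ t : ℝ) : ‖zder φ t‖ = 1 := by
  unfold zder
  split_ifs <;> simp only [norm_neg, norm_exp_ofReal_mul_I]

theorem zpath_ne_zero {φ t : ℝ} (ht : t ≠ 0) : zpath φ t ≠ 0 := by
  rw [← norm_pos_iff, norm_zpath]
  exact abs_pos.2 ht

theorem abs_arg_exp {ζ : ℂ} (h : |ζ.im| < Real.pi) : |arg (exp ζ)| = |ζ.im| := by
  rw [abs_lt] at h
  rw [← log_im, log_exp h.1 h.2.le]

theorem abs_arg_zpath {φ t : ℝ} (h0 : 0 ≤ φ) (h : φ < Real.pi) (ht : t ≠ 0) :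
    |arg (zpath φ t)| = φ := by
  have key : ∀ (r y : ℝ), 0 < r → |y| = φ → |arg ((r : ℂ) * exp (y * I))| = φ := by
    intro r y hr hy
    rw [arg_real_mul _ hr, abs_arg_exp] <;> simp [hy, h]
  unfold zpath
  split_ifs with h1
  · exact key _ _ (by linarith) (abs_of_nonneg h0)
  · exact key _ _ (lt_of_le_of_ne (not_lt.1 h1) ht.symm) (by rw [abs_neg, abs_of_nonneg h0])

theorem zpath_neg_exp (φ x : ℝ) : zpath φ (-Real.exp x) = exp (x + φ * I) := by
  unfold zpath
  rw [if_pos (by simpa using Real.exp_pos x), neg_neg, exp_add, ofReal_exp]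

theorem zpath_exp (φ x : ℝ) : zpath φ (Real.exp x) = exp (x + (-φ : ℝ) * I) := by
  unfold zpath
  rw [if_neg (not_lt.2 (Real.exp_pos x).le), exp_add, ofReal_exp]

theorem image_neg_exp_univ : (fun x : ℝ => -Real.exp x) '' univ = Iio 0 := by
  ext t
  simp only [image_univ, mem_range, mem_Iio]
  exact ⟨by rintro ⟨x, rfl⟩; simpa using Real.exp_pos x,
    fun h => ⟨Real.log (-t), by rw [Real.exp_log (by linarith), neg_neg]⟩⟩

theorem image_exp_univ : Real.exp '' univ = Ioi 0 := by
  rw [image_univ, Real.range_exp]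

theorem hasDerivWithinAt_neg_exp (x : ℝ) :
    HasDerivWithinAt (fun x : ℝ => -Real.exp x) (-Real.exp x) univ x :=
  (Real.hasDerivAt_exp x).neg.hasDerivWithinAt

theorem injOn_neg_exp : InjOn (fun x : ℝ => -Real.exp x) univ := fun _ _ _ _ h =>
  Real.exp_injective (neg_injective h)

theorem integrable_line_iff (u : ℂ → E) (y : ℝ) :
    Integrable (fun x : ℝ => Real.exp x • u (exp (x + y * I))) ↔
      Integrable fun x : ℝ => exp (x + y * I) • u (exp (x + y * I)) := by
  have e : (fun x : ℝ => exp (x + y * I) • u (exp (x + y * I))) = fun x : ℝ =>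
      exp (y * I) • Real.exp x • u (exp (x + y * I)) := by
    funext x
    rw [← coe_smul (Real.exp x), smul_smul, ofReal_exp, ← exp_add,
      add_comm ((y : ℂ) * I) x]
  rw [e]
  exact (integrable_smul_iff (exp_ne_zero _) _).symm

/-- The substitutions $t=-e^x$ and $t=e^x$ map the two rays to the lines at heights $\varphi$ and
$-\varphi$; all theorems on sectors are deduced from strips in this way. -/
theorem integrable_ray_iff (φ : ℝ) (u : ℂ → E) :
    Integrable (fun t : ℝ => u (zpath φ t)) ↔
      Integrable (fun x : ℝ => exp (x + φ * I) • u (exp (x + φ * I))) ∧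
      Integrable (fun x : ℝ => exp (x + (-φ : ℝ) * I) • u (exp (x + (-φ : ℝ) * I))) := by
  rw [← integrableOn_univ, ← Iio_union_Ici (a := (0 : ℝ)), integrableOn_union,
    integrableOn_Ici_iff_integrableOn_Ioi, ← image_neg_exp_univ, ← image_exp_univ,
    integrableOn_image_iff_integrableOn_abs_deriv_smul MeasurableSet.univ
      (fun x _ => hasDerivWithinAt_neg_exp x) injOn_neg_exp,
    integrableOn_image_iff_integrableOn_abs_deriv_smul MeasurableSet.univ
      (fun x _ => (Real.hasDerivAt_exp x).hasDerivWithinAt) Real.exp_injective.injOn]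
  simp only [zpath_neg_exp, zpath_exp, abs_neg, Real.abs_exp, integrableOn_univ]
  rw [integrable_line_iff, integrable_line_iff]

theorem integrable_zder_smul {φ : ℝ} {v : ℝ → E} (h : Integrable v) :
    Integrable fun t => zder φ t • v t := by
  refine h.norm.mono' (AEStronglyMeasurable.smul ?_ h.1) (ae_of_all _ fun t => ?_)
  · unfold zder
    exact (Measurable.ite measurableSet_Iio measurable_const measurable_const).aestronglyMeasurable
  · rw [norm_smul, norm_zder, one_mul]

theorem rayInt_eq_lines {φ : ℝ} {u : ℂ → E} (h : Integrable fun t : ℝ => u (zpath φ t)) :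
    rayInt φ u = (∫ x : ℝ, exp (x + (-φ : ℝ) * I) • u (exp (x + (-φ : ℝ) * I))) -
      ∫ x : ℝ, exp (x + φ * I) • u (exp (x + φ * I)) := by
  have h' := integrable_zder_smul (φ := φ) h
  unfold rayInt
  rw [← setIntegral_univ, ← Iio_union_Ici (a := (0 : ℝ)),
    setIntegral_union (Iio_disjoint_Ici le_rfl)
      measurableSet_Ici h'.integrableOn h'.integrableOn,
    integral_Ici_eq_integral_Ioi, ← image_neg_exp_univ, ← image_exp_univ,
    integral_image_eq_integral_abs_deriv_smul MeasurableSet.univ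
      (fun x _ => hasDerivWithinAt_neg_exp x) injOn_neg_exp,
    integral_image_eq_integral_abs_deriv_smul MeasurableSet.univ
      (fun x _ => (Real.hasDerivAt_exp x).hasDerivWithinAt) Real.exp_injective.injOn]
  simp only [zpath_neg_exp, zpath_exp, abs_neg, Real.abs_exp, setIntegral_univ]
  rw [add_comm, sub_eq_add_neg, ← integral_neg]
  congr 2
  · funext x
    rw [← coe_smul (Real.exp x), smul_smul, ofReal_exp, zder,
      if_neg (not_lt.2 (Real.exp_pos x).le), ← exp_add]
  · funext x
    rw [← coe_smul (Real.exp x), smul_smul, ofReal_exp, zder,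
      if_pos (by simpa using Real.exp_pos x), mul_neg, ← exp_add, neg_smul]

theorem continuousAt_zpath {φ t : ℝ} (ht : t ≠ 0) : ContinuousAt (zpath φ) t := by
  rcases lt_or_gt_of_ne ht with h | h
  · have : zpath φ =ᶠ[𝓝 t] fun t => ((-t : ℝ) : ℂ) * exp (φ * I) := by
      filter_upwards [Iio_mem_nhds h] with s hs
      exact if_pos hs
    exact (ContinuousAt.congr (by fun_prop) this.symm)
  · have : zpath φ =ᶠ[𝓝 t] fun t => (t : ℂ) * exp ((-φ : ℝ) * I) := by
      filter_upwards [Ioi_mem_nhds h] with s hs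
      exact if_neg (not_lt.2 (le_of_lt hs))
    exact (ContinuousAt.congr (by fun_prop) this.symm)

theorem ae_ne_zero : ∀ᵐ t : ℝ, t ≠ 0 := by
  simp [ae_iff, measure_singleton]

theorem aestronglyMeasurable_of_continuousAt {F : Type*} [TopologicalSpace F]
    [TopologicalSpace.PseudoMetrizableSpace F] {v : ℝ → F} (h : ∀ t ≠ 0, ContinuousAt v t) :
    AEStronglyMeasurable v := by
  have h1 : ContinuousOn v {0}ᶜ := fun t ht => (h t ht).continuousWithinAt
  have h2 := h1.aestronglyMeasurable (μ := volume) (measurableSet_singleton (0 : ℝ)).compl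
  rwa [Measure.restrict_eq_self_of_ae_mem (by simpa using ae_ne_zero)] at h2

theorem integrable_powBound {p q : ℝ} (hp : -1 < p) (hq : q < -1) :
    Integrable fun t : ℝ => if |t| ≤ 1 then |t| ^ p else |t| ^ q := by
  have h1 : IntegrableOn (fun t : ℝ => if |t| ≤ 1 then |t| ^ p else |t| ^ q) (Ioi 0) := by
    rw [← Ioc_union_Ioi_eq_Ioi zero_le_one, integrableOn_union]
    constructor
    · have := (intervalIntegral.intervalIntegrable_rpow' (a := 0) (b := 1) hp)
      rw [intervalIntegrable_iff_integrableOn_Ioc_of_le zero_le_one] at this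
      refine this.congr_fun (fun t ht => ?_) measurableSet_Ioc
      simp only
      rw [abs_of_pos ht.1, if_pos ht.2]
    · refine (integrableOn_Ioi_rpow_of_lt hq zero_lt_one).congr_fun (fun t ht => ?_) measurableSet_Ioi
      simp only
      rw [abs_of_pos (zero_lt_one.trans ht), if_neg (not_le.2 ht)]
  rw [← integrableOn_univ, ← Iic_union_Ioi (a := (0 : ℝ)), integrableOn_union]
  refine ⟨?_, h1⟩
  rw [integrableOn_Iic_iff_integrableOn_Iio]
  have h2 := (h1.integrable_indicator measurableSet_Ioi).comp_neg
  refine (integrable_indicator_iff measurableSet_Iio).1 (h2.congr (ae_of_all _ fun t => ?_))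
  simp only [indicator, mem_Ioi, mem_Iio, abs_neg, Left.neg_pos_iff]

theorem integrable_ray_of_bound {F : Type*} [NormedAddCommGroup F] {C p q : ℝ} (hp : -1 < p)
    (hq : q < -1) {v : ℝ → F}
    (hv : AEStronglyMeasurable v)
    (h : ∀ t ≠ 0, (|t| ≤ 1 → ‖v t‖ ≤ C * |t| ^ p) ∧ (1 ≤ |t| → ‖v t‖ ≤ C * |t| ^ q)) :
    Integrable v := by
  refine ((integrable_powBound hp hq).const_mul C).mono' hv ?_
  filter_upwards [ae_ne_zero] with t ht
  split_ifs with h1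
  · exact (h t ht).1 h1
  · exact (h t ht).2 (not_le.1 h1).le

/-- The left side is the distance from $w$ to the line through $0$ and $z$ when both points lie in
the same closed half plane. Reflecting $z$ into the half plane of $w$ does not increase $|w-z|$,
which accounts for the absolute values of the arguments. -/
theorem norm_mul_sin_le_norm_sub (w z : ℂ) : ‖w‖ * |Real.sin (|arg w| - |arg z|)| ≤ ‖w - z‖ := by
  refine (sq_le_sq₀ (by positivity) (norm_nonneg _)).1 ?_
  rw [mul_pow, sq_abs]
  have h1 : ‖w - z‖ ^ 2 = ‖w‖ ^ 2 + ‖z‖ ^ 2 - 2 * (w.re * z.re + w.im * z.im) := by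
    rw [← normSq_eq_norm_sq, ← normSq_eq_norm_sq, ← normSq_eq_norm_sq, normSq_apply, normSq_apply,
      normSq_apply, sub_re, sub_im]
    ring
  have h2 : w.re * z.re + w.im * z.im ≤ ‖w‖ * ‖z‖ * Real.cos (|arg w| - |arg z|) := by
    rw [← norm_mul_cos_arg w, ← norm_mul_cos_arg z, ← norm_mul_sin_arg w, ← norm_mul_sin_arg z,
      Real.cos_sub, Real.cos_abs, Real.cos_abs]
    have h3 : Real.sin (arg w) * Real.sin (arg z) ≤ Real.sin |arg w| * Real.sin |arg z| := by
      have hs : ∀ x : ℝ, |x| ≤ Real.pi → Real.sin |x| = |Real.sin x| := by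
        intro x hx
        have := Real.sin_nonneg_of_nonneg_of_le_pi (abs_nonneg x) hx
        rcases abs_cases x with h | h
        · rw [h.1] at this ⊢; rw [abs_of_nonneg this]
        · rw [h.1, Real.sin_neg] at this ⊢; rw [abs_of_nonpos (by linarith)]
      rw [hs _ (abs_arg_le_pi _), hs _ (abs_arg_le_pi _), ← abs_mul]
      exact le_abs_self _
    have h4 := mul_nonneg (norm_nonneg w) (norm_nonneg z)
    nlinarith [mul_le_mul_of_nonneg_left h3 h4]
  have h5 := Real.sin_sq_add_cos_sq (|arg w| - |arg z|)
  have h6 := sq_nonneg (‖z‖ - ‖w‖ * Real.cos (|arg w| - |arg z|))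
  rw [h1]
  nlinarith

theorem rpow_norm_exp (ζ : ℂ) (p : ℝ) : ‖exp ζ‖ ^ p = Real.exp (p * ζ.re) := by
  rw [norm_exp, ← Real.exp_mul, mul_comm]

/-- Power bounds become exponential bounds, with $1$ added to the exponent by $dz=e^\zeta d\zeta$.
The rate on the right is rounded up to a natural number because the strip lemma divides by an
integer power. -/
theorem line_bounds {s : Set ℂ} {C p q : ℝ} {u : ℂ → E} (hb : PowBound s C p q u) {ζ : ℂ}
    (hζ : exp ζ ∈ s) :
    (ζ.re ≤ 0 → ‖exp ζ • u (exp ζ)‖ ≤ C * Real.exp ((1 + p) * ζ.re)) ∧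
    (0 ≤ ζ.re → ‖exp ζ • u (exp ζ)‖ ≤ C * Real.exp (⌈1 + q⌉₊ * ζ.re)) := by
  obtain ⟨h1, h2⟩ := hb _ hζ
  rw [rpow_norm_exp] at h1 h2
  rw [norm_smul, norm_exp]
  rw [norm_exp, Real.exp_le_one_iff] at h1
  rw [norm_exp, Real.one_le_exp_iff] at h2
  have e : ∀ r : ℝ, Real.exp ζ.re * (C * Real.exp (r * ζ.re)) = C * Real.exp ((1 + r) * ζ.re) := by
    intro r
    rw [mul_left_comm, ← Real.exp_add]
    ring_nf
  refine ⟨fun h => ?_, fun h => ?_⟩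
  · rw [← e]
    exact mul_le_mul_of_nonneg_left (h1 h) (Real.exp_pos _).le
  · refine (mul_le_mul_of_nonneg_left (h2 h) (Real.exp_pos _).le).trans ?_
    rw [e]
    have hC : 0 ≤ C := by
      have := (norm_nonneg _).trans (h2 h)
      exact nonneg_of_mul_nonneg_left this (Real.exp_pos _)
    refine mul_le_mul_of_nonneg_left (Real.exp_le_exp.2 ?_) hC
    exact mul_le_mul_of_nonneg_right (Nat.le_ceil _) h

theorem line_eq_of_powBound {φ a b C p q : ℝ} {s : Set ℂ} {u : ℂ → E} (hab : a ≤ b)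
    (hφ : φ < Real.pi) (ha : -φ ≤ a) (hb : b ≤ φ) (hs : ∀ ζ : ℂ, ζ.im ∈ Icc a b → exp ζ ∈ s)
    (hd : ∀ z ∈ s, DifferentiableAt ℂ u z) (hp : -1 < p) (hu : PowBound s C p q u)
    (hi : Integrable fun x : ℝ => exp (x + a * I) • u (exp (x + a * I)))
    (hi' : Integrable fun x : ℝ => exp (x + b * I) • u (exp (x + b * I))) :
    ∫ x : ℝ, exp (x + a * I) • u (exp (x + a * I)) =
      ∫ x : ℝ, exp (x + b * I) • u (exp (x + b * I)) := by
  refine integral_line_eq_of_growth (H := fun ζ => exp ζ • u (exp ζ)) (δ := 1 + p) (C := C)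
    (N := ⌈1 + q⌉₊) hab hφ ha hb (fun ζ hζ => ?_) (by linarith)
    (fun ζ hζ => (line_bounds hu (hs ζ hζ)).1) (fun ζ hζ => (line_bounds hu (hs ζ hζ)).2) hi hi'
  exact differentiableAt_exp.smul ((hd _ (hs ζ hζ)).comp ζ differentiableAt_exp)

/-- Cauchy's theorem for a sector. -/
theorem rayInt_eq_zero {φ C p q : ℝ} {u : ℂ → E} (h0 : 0 ≤ φ) (hφ : φ < Real.pi)
    (hd : ∀ z : ℂ, z ≠ 0 → |arg z| ≤ φ → DifferentiableAt ℂ u z) (hp : -1 < p)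
    (hu : PowBound {z : ℂ | z ≠ 0 ∧ |arg z| ≤ φ} C p q u)
    (hi : Integrable fun t : ℝ => u (zpath φ t)) : rayInt φ u = 0 := by
  rw [rayInt_eq_lines hi, sub_eq_zero]
  obtain ⟨h1, h2⟩ := (integrable_ray_iff φ u).1 hi
  refine line_eq_of_powBound (φ := φ) (by linarith) hφ le_rfl le_rfl (fun ζ hζ => ?_)
    (fun z hz => hd z hz.1 hz.2) hp hu h2 h1
  have := abs_le.2 hζ
  exact ⟨exp_ne_zero _, by rwa [abs_arg_exp (this.trans_lt hφ)]⟩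

/-- The integral over the boundary of a sector does not depend on its angle. -/
theorem rayInt_eq_rayInt {φ₁ φ₂ C p q : ℝ} {u : ℂ → E} (h0 : 0 ≤ φ₁) (h12 : φ₁ ≤ φ₂)
    (hφ : φ₂ < Real.pi)
    (hd : ∀ z : ℂ, z ≠ 0 → |arg z| ∈ Icc φ₁ φ₂ → DifferentiableAt ℂ u z) (hp : -1 < p)
    (hu : PowBound {z : ℂ | z ≠ 0 ∧ |arg z| ∈ Icc φ₁ φ₂} C p q u)
    (hi₁ : Integrable fun t : ℝ => u (zpath φ₁ t)) (hi₂ : Integrable fun t : ℝ => u (zpath φ₂ t)) :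
    rayInt φ₁ u = rayInt φ₂ u := by
  rw [rayInt_eq_lines hi₁, rayInt_eq_lines hi₂]
  obtain ⟨h1, h2⟩ := (integrable_ray_iff φ₁ u).1 hi₁
  obtain ⟨h3, h4⟩ := (integrable_ray_iff φ₂ u).1 hi₂
  congr 1
  · refine (line_eq_of_powBound (φ := φ₂) (by linarith) hφ (by linarith) (by linarith)
      (fun ζ hζ => ?_) (fun z hz => hd z hz.1 hz.2) hp hu h4 h2).symm
    have h5 : |ζ.im| = -ζ.im := abs_of_nonpos (by linarith [hζ.2])
    refine ⟨exp_ne_zero _, ?_⟩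
    rw [abs_arg_exp (by rw [h5]; linarith [hζ.1]), h5]
    exact ⟨by linarith [hζ.2], by linarith [hζ.1]⟩
  · refine line_eq_of_powBound (φ := φ₂) (by linarith) hφ (by linarith) (by linarith)
      (fun ζ hζ => ?_) (fun z hz => hd z hz.1 hz.2) hp hu h1 h3
    have h5 : |ζ.im| = ζ.im := abs_of_nonneg (by linarith [hζ.1])
    refine ⟨exp_ne_zero _, ?_⟩
    rw [abs_arg_exp (by rw [h5]; linarith [hζ.2]), h5]
    exact hζ

/-- Cauchy's integral formula for a sector. -/
theorem rayInt_cauchy [CompleteSpace E] {φ θ C δ : ℝ} {u : ℂ → E} (hφ : φ < θ) (hθ : θ ≤ Real.pi)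
    (hd : ∀ z : ℂ, z ≠ 0 → |arg z| < θ → DifferentiableAt ℂ u z) (hδ : 0 < δ)
    (hu : PowBound {z : ℂ | z ≠ 0 ∧ |arg z| ≤ φ} C 0 (-δ) u) {z₀ : ℂ} (hz₀ : z₀ ≠ 0)
    (hz₀' : |arg z₀| < φ) (hi : Integrable fun t : ℝ => (zpath φ t - z₀)⁻¹ • u (zpath φ t)) :
    rayInt φ (fun w => (w - z₀)⁻¹ • u w) = (2 * Real.pi * I) • u z₀ := by
  obtain ⟨h1, h2⟩ := (integrable_ray_iff φ fun w => (w - z₀)⁻¹ • u w).1 hi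
  rw [rayInt_eq_lines hi]
  have e : exp (log z₀) = z₀ := exp_log hz₀
  -- The strip formula requires a decay rate of at most $1$.
  replace hu := hu.mono (p' := 0) (q' := -min δ 1) subset_rfl (fun z hz => hz.1) le_rfl
    (neg_le_neg (min_le_left _ _))
  simp only [smul_smul] at h1 h2 ⊢
  have key := cauchy_formula_strip (H := fun ζ => u (exp ζ)) (ζ₀ := log z₀) (C := C) hφ hθ
    (by rwa [log_im]) (fun ζ hζ => ?_) (lt_min hδ one_pos) (min_le_right _ _) (fun ζ hζ => ?_) ?_ ?_
  · simpa only [e, div_eq_mul_inv] using key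
  · exact (hd _ (exp_ne_zero _) (by rwa [abs_arg_exp (hζ.trans_le hθ)])).comp ζ differentiableAt_exp
  · obtain ⟨h3, h4⟩ := hu (exp ζ) ⟨exp_ne_zero _, by rwa [abs_arg_exp (by linarith)]⟩
    rw [rpow_norm_exp] at h3 h4
    rw [norm_exp, Real.exp_le_one_iff] at h3
    rw [norm_exp, Real.one_le_exp_iff] at h4
    rcases le_total ζ.re 0 with h | h
    · rw [max_eq_right h, mul_zero, neg_zero]; simpa using h3 h
    · rw [max_eq_left h, ← neg_mul]; exact h4 h
  · simpa only [e, div_eq_mul_inv] using h2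
  · simpa only [e, div_eq_mul_inv] using h1

/-- The map $z\mapsto-z$ sends the boundary at angle $\varphi$ to the one at angle $\pi-\varphi$, so
a function holomorphic outside a sector can be treated as one inside a sector. -/
theorem neg_zpath (φ t : ℝ) (ht : t ≠ 0) : zpath φ (-t) = -zpath (Real.pi - φ) t := by
  have e1 : exp (((Real.pi - φ : ℝ) : ℂ) * I) = -exp ((-φ : ℝ) * I) := by
    rw [← neg_one_mul, ← exp_pi_mul_I, ← exp_add]; congr 1; push_cast; ring
  have e2 : exp (((-(Real.pi - φ) : ℝ) : ℂ) * I) = -exp (φ * I) := by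
    rw [← mul_one (exp (((-(Real.pi - φ) : ℝ) : ℂ) * I)), ← neg_neg (1 : ℂ), ← exp_pi_mul_I, mul_neg,
      ← exp_add]
    congr 2; push_cast; ring
  unfold zpath
  rcases lt_or_gt_of_ne ht with h | h
  · rw [if_neg (by linarith), if_pos h, e1]; ring
  · rw [if_pos (by linarith), if_neg (by linarith), e2]; push_cast; ring

theorem neg_zder (φ t : ℝ) (ht : t ≠ 0) : zder φ (-t) = zder (Real.pi - φ) t := by
  have e1 : exp (((Real.pi - φ : ℝ) : ℂ) * I) = -exp ((-φ : ℝ) * I) := by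
    rw [← neg_one_mul, ← exp_pi_mul_I, ← exp_add]; congr 1; push_cast; ring
  have e2 : exp (((-(Real.pi - φ) : ℝ) : ℂ) * I) = -exp (φ * I) := by
    rw [← mul_one (exp (((-(Real.pi - φ) : ℝ) : ℂ) * I)), ← neg_neg (1 : ℂ), ← exp_pi_mul_I, mul_neg,
      ← exp_add]
    congr 2; push_cast; ring
  unfold zder
  rcases lt_or_gt_of_ne ht with h | h
  · rw [if_neg (by linarith), if_pos h, e1, neg_neg]
  · rw [if_pos (by linarith), if_neg (by linarith), e2]

/-- The boundary of a sector, seen from the complementary sector. -/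
theorem rayInt_comp_neg (φ : ℝ) (u : ℂ → E) :
    rayInt φ u = rayInt (Real.pi - φ) fun z => u (-z) := by
  unfold rayInt
  rw [← integral_neg_eq_self]
  refine integral_congr_ae ?_
  filter_upwards [ae_ne_zero] with t ht
  rw [neg_zder φ t ht, neg_zpath φ t ht]

end Rays

end QuatHInfty

namespace QuatHInfty

/-! ### Holomorphy of resolvents and the product rule for contour integrals. -/

section Leibniz
open Filter Topology Complex

theorem re_eq_norm_mul_cos_abs_arg (z : ℂ) : z.re = ‖z‖ * Real.cos |arg z| := by
  rw [Real.cos_abs, norm_mul_cos_arg]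

theorem lt_abs_arg_iff {z : ℂ} (hz : z ≠ 0) {φ : ℝ} (h0 : 0 ≤ φ) (hφ : φ ≤ Real.pi) :
    φ < |arg z| ↔ z.re < ‖z‖ * Real.cos φ := by
  rw [re_eq_norm_mul_cos_abs_arg, mul_lt_mul_iff_right₀ (norm_pos_iff.2 hz),
    Real.strictAntiOn_cos.lt_iff_gt ⟨abs_nonneg _, abs_arg_le_pi z⟩ ⟨h0, hφ⟩]

theorem abs_arg_lt_iff {z : ℂ} (hz : z ≠ 0) {φ : ℝ} (h0 : 0 ≤ φ) (hφ : φ ≤ Real.pi) :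
    |arg z| < φ ↔ ‖z‖ * Real.cos φ < z.re := by
  rw [re_eq_norm_mul_cos_abs_arg, mul_lt_mul_iff_right₀ (norm_pos_iff.2 hz),
    Real.strictAntiOn_cos.lt_iff_gt ⟨h0, hφ⟩ ⟨abs_nonneg _, abs_arg_le_pi z⟩]

/-- The open complex sector of half-angle `θ`. -/
def csector (θ : ℝ) : Set ℂ := {z | z ≠ 0 ∧ |arg z| < θ}

/-- The complement of the closed complex sector of half-angle `ω`. -/
def cosector (ω : ℝ) : Set ℂ := {z | z ≠ 0 ∧ ω < |arg z|}

theorem isOpen_csector {θ : ℝ} (h0 : 0 ≤ θ) (hθ : θ ≤ Real.pi) : IsOpen (csector θ) := by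
  have : csector θ = {z : ℂ | z ≠ 0} ∩ {z | ‖z‖ * Real.cos θ < z.re} := by
    ext z
    exact and_congr_right fun hz => abs_arg_lt_iff hz h0 hθ
  rw [this]
  exact isOpen_ne.inter (isOpen_lt (by fun_prop) continuous_re)

theorem isOpen_cosector {ω : ℝ} (h0 : 0 ≤ ω) (hω : ω ≤ Real.pi) : IsOpen (cosector ω) := by
  have : cosector ω = {z : ℂ | z ≠ 0} ∩ {z | z.re < ‖z‖ * Real.cos ω} := by
    ext z
    exact and_congr_right fun hz => lt_abs_arg_iff hz h0 hω
  rw [this]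
  exact isOpen_ne.inter (isOpen_lt continuous_re (by fun_prop))

theorem zpath_mem_csector {φ θ t : ℝ} (h0 : 0 ≤ φ) (h : φ < θ) (hθ : θ ≤ Real.pi) (ht : t ≠ 0) :
    zpath φ t ∈ csector θ :=
  ⟨zpath_ne_zero ht, by rwa [abs_arg_zpath h0 (h.trans_le hθ) ht]⟩

theorem zpath_mem_cosector {φ ω t : ℝ} (h0 : 0 ≤ φ) (h : ω < φ) (hφ : φ < Real.pi) (ht : t ≠ 0) :
    zpath φ t ∈ cosector ω :=
  ⟨zpath_ne_zero ht, by rwa [abs_arg_zpath h0 hφ ht]⟩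

variable {A : Type*} [NormedRing A] [NormedAlgebra ℂ A]

/-- Pseudo-resolvents on open sets are holomorphic. -/
theorem differentiableAt_of_resolvent [CompleteSpace A] {R : ℂ → A} {s : Set ℂ} (hs : IsOpen s)
    (h : ∀ z ∈ s, ∀ w ∈ s, R z - R w = (w - z) • (R z * R w)) {z : ℂ} (hz : z ∈ s) :
    DifferentiableAt ℂ R z := by
  have hc : ContinuousAt (fun w : ℂ => (1 : A) + (w - z) • R z) z := by fun_prop
  have hu : ∀ᶠ w in 𝓝 z, IsUnit ((1 : A) + (w - z) • R z) :=
    hc.eventually (Units.isOpen.mem_nhds (by simp))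
  -- The identity at $(w,z)$ reads $R(w)\,(1+(w-z)R(z))=R(z)$, and the second factor is invertible
  -- for $w$ near $z$.
  have he : R =ᶠ[𝓝 z] fun w => R z * Ring.inverse ((1 : A) + (w - z) • R z) := by
    filter_upwards [hu, hs.mem_nhds hz] with w hw hws
    have h1 : R w * ((1 : A) + (w - z) • R z) = R z := by
      have := h w hws z hz
      rw [mul_add, mul_one, mul_smul_comm, ← neg_sub z w, neg_smul, ← this]
      abel
    change R w = R z * Ring.inverse ((1 : A) + (w - z) • R z)
    generalize hX : (1 : A) + (w - z) • R z = X at h1 hw ⊢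
    rw [← h1, mul_assoc, Ring.mul_inverse_cancel _ hw, mul_one]
  refine DifferentiableAt.congr_of_eventuallyEq ?_ he
  refine DifferentiableAt.const_mul ?_ _
  have h2 : DifferentiableAt ℂ (Ring.inverse : A → A) ((1 : A) + (z - z) • R z) := by
    have : (1 : A) + (z - z) • R z = ((1 : Aˣ) : A) := by simp
    rw [this]
    exact differentiableAt_inverse (1 : Aˣ).isUnit
  exact DifferentiableAt.comp z (f := fun w : ℂ => (1 : A) + (w - z) • R z) h2 (by fun_prop)

theorem measurable_zpath (φ : ℝ) : Measurable (zpath φ) := by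
  unfold zpath
  exact Measurable.ite measurableSet_Iio (by fun_prop) (by fun_prop)

theorem measurable_zder (φ : ℝ) : Measurable (zder φ) := by
  unfold zder
  exact Measurable.ite measurableSet_Iio measurable_const measurable_const

theorem aestronglyMeasurable_ray {E : Type*} [NormedAddCommGroup E] [NormedSpace ℂ E] {φ θ : ℝ}
    {u : ℂ → E} (h0 : 0 ≤ φ) (h : φ < θ) (hθ : θ ≤ Real.pi)
    (hd : ∀ z ∈ csector θ, DifferentiableAt ℂ u z) :
    AEStronglyMeasurable fun t => u (zpath φ t) :=
  aestronglyMeasurable_of_continuousAt fun _ ht =>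
    ContinuousAt.comp (hd _ (zpath_mem_csector h0 h hθ ht)).continuousAt (continuousAt_zpath ht)

theorem integrable_norm_div_ray {E : Type*} [NormedAddCommGroup E] [NormedSpace ℂ E]
    {φ θ C δ : ℝ} {u : ℂ → E} (h0 : 0 ≤ φ) (h : φ < θ) (hθ : θ ≤ Real.pi)
    (hd : ∀ z ∈ csector θ, DifferentiableAt ℂ u z) (hδ : 0 < δ)
    (hu : PowBound (csector θ) C δ (-δ) u) :
    Integrable fun t => ‖u (zpath φ t)‖ / |t| := by
  have hm := (aestronglyMeasurable_ray h0 h hθ hd).norm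
  refine integrable_ray_of_bound (p := δ - 1) (q := -δ - 1) (C := C) (by linarith) (by linarith)
    ?_ fun t ht => ?_
  · exact (hm.aemeasurable.div (by fun_prop)).aestronglyMeasurable
  · obtain ⟨h1, h2⟩ := hu _ (zpath_mem_csector h0 h hθ ht)
    rw [norm_zpath] at h1 h2
    have ht' : 0 < |t| := abs_pos.2 ht
    rw [norm_div, norm_norm, Real.norm_of_nonneg ht'.le]
    refine ⟨fun h3 => ?_, fun h3 => ?_⟩
    · rw [Real.rpow_sub_one ht'.ne', ← mul_div_assoc]
      exact div_le_div_of_nonneg_right (h1 h3) ht'.le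
    · rw [Real.rpow_sub_one ht'.ne', ← mul_div_assoc]
      exact div_le_div_of_nonneg_right (h2 h3) ht'.le

/-- Rays at different angles separate linearly from the origin, so the Cauchy kernel costs one power
of $|t|$, uniformly in $z$ on the other ray. -/
theorem norm_inv_sub_le {φ c : ℝ} {z : ℂ} (h0 : 0 ≤ φ) (hφ : φ < Real.pi) (hc0 : 0 < c)
    (hc : c = |Real.sin (φ - |arg z|)|) {t : ℝ} (ht : t ≠ 0) :
    ‖(zpath φ t - z)⁻¹‖ ≤ c⁻¹ / |t| := by
  have h1 := norm_mul_sin_le_norm_sub (zpath φ t) z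
  rw [abs_arg_zpath h0 hφ ht, norm_zpath, ← hc] at h1
  rw [norm_inv, div_eq_mul_inv, ← mul_inv, mul_comm c]
  exact inv_anti₀ (mul_pos (abs_pos.2 ht) hc0) h1

theorem integrable_inv_sub_smul {E : Type*} [NormedAddCommGroup E] [NormedSpace ℂ E]
    {φ θ C δ : ℝ} {u : ℂ → E} (h0 : 0 ≤ φ) (h : φ < θ) (hθ : θ ≤ Real.pi)
    (hd : ∀ z ∈ csector θ, DifferentiableAt ℂ u z) (hδ : 0 < δ)
    (hu : PowBound (csector θ) C δ (-δ) u) {z : ℂ} (hz : Real.sin (φ - |arg z|) ≠ 0) :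
    Integrable fun t => (zpath φ t - z)⁻¹ • u (zpath φ t) := by
  refine ((integrable_norm_div_ray h0 h hθ hd hδ hu).const_mul (|Real.sin (φ - |arg z|)|)⁻¹).mono'
    (AEStronglyMeasurable.smul
      ((measurable_zpath φ).sub_const z).inv.aestronglyMeasurable
      (aestronglyMeasurable_ray h0 h hθ hd)) ?_
  filter_upwards [ae_ne_zero] with t ht
  rw [norm_smul, mul_div_left_comm, mul_comm]
  exact mul_le_mul_of_nonneg_left (norm_inv_sub_le h0 (h.trans_le hθ) (abs_pos.2 hz) rfl ht)
    (norm_nonneg _)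

/-- The product rule for contour integrals: a divided difference identity for the kernels gives a
Leibniz rule for the integrals. -/
theorem leibniz_rayInt [CompleteSpace A] {ι : Type*} (S : Finset ι) {F G : ι → ℂ → A} {K : ℂ → A}
    {e : ℂ → ℂ} {h : ℂ → A} {ω φ₁ φ₂ θ C C' δ δ' : ℝ} (h0 : 0 ≤ ω) (h1 : ω < φ₁) (h12 : φ₁ < φ₂)
    (h2 : φ₂ < θ) (hθ : θ ≤ Real.pi)
    (hid : ∀ z ∈ cosector ω, ∀ w ∈ cosector ω, w ≠ z →
      ∑ j ∈ S, F j z * G j w = (w - z)⁻¹ • (K z - K w))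
    (hed : ∀ z ∈ csector θ, DifferentiableAt ℂ e z) (hhd : ∀ z ∈ csector θ, DifferentiableAt ℂ h z)
    (hδ : 0 < δ) (heb : PowBound (csector θ) C δ (-δ) e)
    (hδ' : 0 < δ') (hhb : PowBound (csector θ) C' δ' (-δ') h)
    (hF : ∀ j ∈ S, Integrable fun t => e (zpath φ₁ t) • F j (zpath φ₁ t))
    (hG : ∀ j ∈ S, Integrable fun t => G j (zpath φ₂ t) * h (zpath φ₂ t))
    (hKe : Integrable fun t => e (zpath φ₁ t) • K (zpath φ₁ t))
    (hKh : Integrable fun t => K (zpath φ₂ t) * h (zpath φ₂ t)) :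
    ∑ j ∈ S, rayInt φ₁ (fun z => e z • F j z) * rayInt φ₂ (fun z => G j z * h z) =
      (2 * Real.pi * I : ℂ) • rayInt φ₁ fun z => e z • (K z * h z) := by
  have p1 : 0 ≤ φ₁ := h0.trans h1.le
  have p2 : 0 ≤ φ₂ := p1.trans h12.le
  have q1 : φ₁ < θ := h12.trans h2
  have r2 : φ₂ < Real.pi := h2.trans_le hθ
  have r1 : φ₁ < Real.pi := h12.trans r2
  have hsin : 0 < Real.sin (φ₂ - φ₁) :=
    Real.sin_pos_of_pos_of_lt_pi (by linarith) (by linarith)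
  set c := |Real.sin (φ₂ - φ₁)| with hc
  have hc0 : 0 < c := abs_pos.2 hsin.ne'
  set a : ι → ℝ → A := fun j t => zder φ₁ t • e (zpath φ₁ t) • F j (zpath φ₁ t)
  set b : ι → ℝ → A := fun j t => zder φ₂ t • (G j (zpath φ₂ t) * h (zpath φ₂ t))
  have ha : ∀ j ∈ S, Integrable (a j) := fun j hj => integrable_zder_smul (hF j hj)
  have hb : ∀ j ∈ S, Integrable (b j) := fun j hj => integrable_zder_smul (hG j hj)
  have e1 : ∑ j ∈ S, rayInt φ₁ (fun z => e z • F j z) * rayInt φ₂ (fun z => G j z * h z) =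
      ∫ t, ∫ s, ∑ j ∈ S, a j t * b j s := by
    have : ∀ j ∈ S, rayInt φ₁ (fun z => e z • F j z) * rayInt φ₂ (fun z => G j z * h z) =
        ∫ t, a j t * ∫ s, b j s := fun j hj => (integral_mul_const_of_integrable (ha j hj)).symm
    rw [Finset.sum_congr rfl this, ← integral_finsetSum _ fun j hj => (ha j hj).mul_const _]
    congr 1
    funext t
    rw [integral_finsetSum _ fun j hj => (hb j hj).const_mul _]
    exact Finset.sum_congr rfl fun j hj => (integral_const_mul_of_integrable (hb j hj)).symm
  -- The difference $K(z)-K(w)$ splits the double integral into `P`, with $K$ at the inner contour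
  -- variable $z$, and `P'`, with $K$ at the outer variable $w$. Each part is absolutely integrable
  -- on its own.
  set k : ℝ → ℝ → ℂ := fun t s => zder φ₁ t * zder φ₂ s * (zpath φ₂ s - zpath φ₁ t)⁻¹
  set P : ℝ → ℝ → A := fun t s =>
    k t s • ((e (zpath φ₁ t) • K (zpath φ₁ t)) * h (zpath φ₂ s))
  set P' : ℝ → ℝ → A := fun t s =>
    k t s • e (zpath φ₁ t) • (K (zpath φ₂ s) * h (zpath φ₂ s))
  have hkm : Measurable fun x : ℝ × ℝ => k x.1 x.2 :=
    (((measurable_zder φ₁).comp measurable_fst).mul ((measurable_zder φ₂).comp measurable_snd)).mul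
      ((((measurable_zpath φ₂).comp measurable_snd).sub
        ((measurable_zpath φ₁).comp measurable_fst)).inv)
  -- Either variable can absorb the kernel: `P` charges it to $h$ and `P'` to $e$, the factor that
  -- does not carry $K$ and decays at both ends.
  have hksymm : ∀ t s : ℝ, t ≠ 0 → s ≠ 0 → ‖k t s‖ ≤ c⁻¹ / |s| ∧ ‖k t s‖ ≤ c⁻¹ / |t| := by
    intro t s ht hs
    have hn : ‖k t s‖ = ‖(zpath φ₂ s - zpath φ₁ t)⁻¹‖ := by
      simp only [k]
      rw [norm_mul, norm_mul, norm_zder, norm_zder, one_mul, one_mul]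
    rw [hn]
    constructor
    · exact norm_inv_sub_le p2 r2 hc0 (by rw [abs_arg_zpath p1 r1 ht]) hs
    · rw [← norm_neg, ← inv_neg, neg_sub]
      refine norm_inv_sub_le p1 r1 hc0 ?_ ht
      rw [abs_arg_zpath p2 r2 hs, hc, ← neg_sub, Real.sin_neg, abs_neg]
  have hae : ∀ᵐ x : ℝ × ℝ ∂(volume.prod volume), x.1 ≠ 0 ∧ x.2 ≠ 0 :=
    (Measure.quasiMeasurePreserving_fst.ae ae_ne_zero).and
      (Measure.quasiMeasurePreserving_snd.ae ae_ne_zero)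
  have hem := aestronglyMeasurable_ray p1 q1 hθ hed
  have hhm := aestronglyMeasurable_ray p2 h2 hθ hhd
  have hP : Integrable (Function.uncurry P) (volume.prod volume) := by
    refine Integrable.mono' ((hKe.norm.mul_prod
      (integrable_norm_div_ray p2 h2 hθ hhd hδ' hhb)).const_mul c⁻¹)
      (hkm.aestronglyMeasurable.smul (hKe.1.comp_fst.mul hhm.comp_snd)) ?_
    filter_upwards [hae] with x hx
    simp only [Function.uncurry, P]
    rw [norm_smul]
    refine (mul_le_mul (hksymm _ _ hx.1 hx.2).1 (norm_mul_le _ _) (norm_nonneg _)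
      (by positivity)).trans (le_of_eq ?_)
    ring
  have hP' : Integrable (Function.uncurry P') (volume.prod volume) := by
    refine Integrable.mono' (((integrable_norm_div_ray p1 q1 hθ hed hδ heb).mul_prod
      hKh.norm).const_mul c⁻¹)
      (hkm.aestronglyMeasurable.smul (hem.comp_fst.smul hKh.1.comp_snd)) ?_
    filter_upwards [hae] with x hx
    simp only [Function.uncurry, P']
    rw [norm_smul, norm_smul]
    refine (mul_le_mul_of_nonneg_right (hksymm _ _ hx.1 hx.2).2
      (by positivity)).trans (le_of_eq ?_)
    ring
  have e2 : ∫ t, ∫ s, ∑ j ∈ S, a j t * b j s = ∫ t, ∫ s, (P t s - P' t s) := by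
    refine integral_congr_ae ?_
    filter_upwards [ae_ne_zero] with t ht
    refine integral_congr_ae ?_
    filter_upwards [ae_ne_zero] with s hs
    have hne : zpath φ₂ s ≠ zpath φ₁ t := by
      intro h3
      have := abs_arg_zpath p1 r1 ht
      rw [← h3, abs_arg_zpath p2 r2 hs] at this
      linarith
    have h3 := hid _ (zpath_mem_cosector p1 h1 r1 ht) _ (zpath_mem_cosector p2 (h1.trans h12) r2 hs) hne
    have h4 : ∑ j ∈ S, a j t * b j s = (zder φ₁ t * zder φ₂ s * e (zpath φ₁ t)) •
        ((∑ j ∈ S, F j (zpath φ₁ t) * G j (zpath φ₂ s)) * h (zpath φ₂ s)) := by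
      rw [Finset.sum_mul, Finset.smul_sum]
      refine Finset.sum_congr rfl fun j _ => ?_
      simp only [a, b, smul_mul_assoc, mul_smul_comm, smul_smul, mul_assoc]
      congr 1
      ring
    rw [h4, h3]
    simp only [P, P', k, smul_mul_assoc, sub_mul, smul_sub, smul_smul]
    congr 2 <;> ring
  -- The point $z$ on the ray of angle $\varphi_1<\varphi_2$ lies inside the outer sector, so
  -- Cauchy's formula in $w$ gives $2\pi i\,h(z)$.
  have e3 : ∫ t, ∫ s, P t s = (2 * Real.pi * I : ℂ) • rayInt φ₁ fun z => e z • (K z * h z) := by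
    unfold rayInt
    rw [← integral_smul]
    refine integral_congr_ae ?_
    filter_upwards [ae_ne_zero] with t ht
    have ht2 : |arg (zpath φ₁ t)| = φ₁ := abs_arg_zpath p1 r1 ht
    have hI := integrable_inv_sub_smul p2 h2 hθ hhd hδ' hhb (z := zpath φ₁ t)
      (by rw [ht2]; exact hsin.ne')
    have h3 := rayInt_cauchy h2 hθ (fun z hz hz' => hhd z ⟨hz, hz'⟩) hδ'
      (hhb.mono (fun z hz => ⟨hz.1, hz.2.trans_lt h2⟩) (fun z hz => hz.1) hδ'.le le_rfl) (zpath_ne_zero ht) (by rw [ht2]; exact h12) hI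
    have h4 : ∀ s, P t s = (zder φ₁ t • e (zpath φ₁ t) • K (zpath φ₁ t)) *
        (zder φ₂ s • (zpath φ₂ s - zpath φ₁ t)⁻¹ • h (zpath φ₂ s)) := by
      intro s
      simp only [P, k, smul_mul_assoc, mul_smul_comm, smul_smul]
      congr 1
      ring
    simp_rw [h4]
    rw [integral_const_mul_of_integrable (integrable_zder_smul hI)]
    unfold rayInt at h3
    rw [h3]
    simp only [smul_mul_assoc, mul_smul_comm, smul_smul]
  -- After Fubini, $w$ lies outside the inner sector and $e(z)/(z-w)$ is holomorphic inside, so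
  -- Cauchy's theorem applies.
  have e4 : ∫ t, ∫ s, P' t s = 0 := by
    rw [integral_integral_swap hP']
    rw [← integral_zero ℝ A]
    refine integral_congr_ae ?_
    filter_upwards [ae_ne_zero] with s hs
    have hs2 : |arg (zpath φ₂ s)| = φ₂ := abs_arg_zpath p2 r2 hs
    have hI := integrable_inv_sub_smul p1 q1 hθ hed hδ heb (z := zpath φ₂ s)
      (by rw [hs2, ← neg_sub, Real.sin_neg]; exact neg_ne_zero.2 hsin.ne')
    have h3 : rayInt φ₁ (fun z => (z - zpath φ₂ s)⁻¹ • e z) = 0 := by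
      have hz2 : 0 < ‖zpath φ₂ s‖ := norm_pos_iff.2 (zpath_ne_zero hs)
      set m := min (Real.sin (φ₂ - φ₁)) (Real.sin φ₂)
      have hm : 0 < m := lt_min hsin (Real.sin_pos_of_pos_of_lt_pi (by linarith) r2)
      refine rayInt_eq_zero (C := (‖zpath φ₂ s‖ * m)⁻¹ * C) (p := δ) (q := -δ) p1 r1 ?_ (by linarith)
        ?_ hI
      · intro z hz hz1
        refine DifferentiableAt.smul ((differentiableAt_id.sub_const _).inv (sub_ne_zero.2 ?_))
          (hed z ⟨hz, hz1.trans_lt q1⟩)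
        rintro rfl
        linarith
      · intro z hz
        have h5 : ‖(z - zpath φ₂ s)⁻¹‖ ≤ (‖zpath φ₂ s‖ * m)⁻¹ := by
          have h6 := norm_mul_sin_le_norm_sub (zpath φ₂ s) z
          rw [hs2] at h6
          rw [norm_inv, ← norm_neg, neg_sub]
          refine inv_anti₀ (by positivity) (le_trans (mul_le_mul_of_nonneg_left ?_ hz2.le) h6)
          -- The angle $\varphi_2-|\arg z|$ lies between $\varphi_2-\varphi_1$ and $\varphi_2$, and
          -- the concave sine is at least the smaller of its values at the end points.
          refine le_trans (strictConcaveOn_sin_Icc.concaveOn.min_le_of_mem_Icc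
            ⟨by linarith, by linarith⟩ ⟨by linarith, r2.le⟩
            ⟨by linarith [hz.2], by linarith [abs_nonneg (arg z)]⟩) (le_abs_self _)
        obtain ⟨h7, h8⟩ := heb z ⟨hz.1, hz.2.trans_lt q1⟩
        rw [norm_smul, mul_assoc, mul_assoc]
        exact ⟨fun h9 => mul_le_mul h5 (h7 h9) (norm_nonneg _) (by positivity),
          fun h9 => mul_le_mul h5 (h8 h9) (norm_nonneg _) (by positivity)⟩
    have h4 : ∀ t, P' t s = (zder φ₁ t • (zpath φ₁ t - zpath φ₂ s)⁻¹ • e (zpath φ₁ t)) •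
        -(zder φ₂ s • (K (zpath φ₂ s) * h (zpath φ₂ s))) := by
      intro t
      simp only [P', k, smul_smul, ← neg_smul, smul_eq_mul]
      congr 1
      rw [← neg_sub (zpath φ₁ t), inv_neg]
      ring
    simp_rw [h4]
    unfold rayInt at h3
    rw [integral_smul_const, h3, zero_smul]
  have e5 : ∫ t, ∫ s, (P t s - P' t s) = (∫ t, ∫ s, P t s) - ∫ t, ∫ s, P' t s :=
    integral_integral_sub hP hP'
  rw [e1, e2, e5, e3, e4, sub_zero]

end Leibniz

end QuatHInfty

namespace QuatHInfty

/-! ### Functional calculi of a pair of commuting resolvents. -/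

section Calculus
open Filter Topology Complex

variable {A : Type*} [NormedRing A] [NormedAlgebra ℂ A]

theorem powBound_of_norm_le_mul {E F G : Type*} [NormedAddCommGroup E] [NormedSpace ℂ E]
    [NormedAddCommGroup F] [NormedSpace ℂ F] [NormedAddCommGroup G] [NormedSpace ℂ G] {s : Set ℂ}
    {C C' p q p' q' : ℝ} {u : ℂ → E} {v : ℂ → F} {w : ℂ → G} (h : PowBound s C p q u)
    (h' : PowBound s C' p' q' v) (hs : ∀ z ∈ s, z ≠ 0) (hw : ∀ z ∈ s, ‖w z‖ ≤ ‖u z‖ * ‖v z‖) :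
    PowBound s (C * C') (p + p') (q + q') w := by
  intro z hz
  have h0 := norm_pos_iff.2 (hs z hz)
  refine ⟨fun h3 => (hw z hz).trans ?_, fun h3 => (hw z hz).trans ?_⟩
  · have h1 := (h z hz).1 h3
    refine (mul_le_mul h1 ((h' z hz).1 h3) (norm_nonneg _) ((norm_nonneg _).trans h1)).trans ?_
    rw [Real.rpow_add h0]
    exact le_of_eq (by ring)
  · have h1 := (h z hz).2 h3
    refine (mul_le_mul h1 ((h' z hz).2 h3) (norm_nonneg _) ((norm_nonneg _).trans h1)).trans ?_
    rw [Real.rpow_add h0]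
    exact le_of_eq (by ring)

theorem PowBound.mul {s : Set ℂ} {C C' p q p' q' : ℝ} {u v : ℂ → A} (h : PowBound s C p q u)
    (h' : PowBound s C' p' q' v) (hs : ∀ z ∈ s, z ≠ 0) :
    PowBound s (C * C') (p + p') (q + q') fun z => u z * v z :=
  powBound_of_norm_le_mul h h' hs fun _ _ => norm_mul_le _ _

theorem PowBound.smul {E : Type*} [NormedAddCommGroup E] [NormedSpace ℂ E] {s : Set ℂ}
    {C C' p q p' q' : ℝ} {u : ℂ → ℂ} {v : ℂ → E} (h : PowBound s C p q u)
    (h' : PowBound s C' p' q' v) (hs : ∀ z ∈ s, z ≠ 0) :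
    PowBound s (C * C') (p + p') (q + q') fun z => u z • v z :=
  powBound_of_norm_le_mul h h' hs fun _ _ => (norm_smul _ _).le

/-- Two commuting families of resolvents with power bounds. -/
structure ResolventPair (ω α β : ℝ) (R Rb : ℂ → A) : Prop where
  res : ∀ z ∈ cosector ω, ∀ w ∈ cosector ω, R z - R w = (w - z) • (R z * R w)
  res' : ∀ z ∈ cosector ω, ∀ w ∈ cosector ω, Rb z - Rb w = (w - z) • (Rb z * Rb w)
  comm : ∀ z ∈ cosector ω, ∀ w ∈ cosector ω, R z * R w = R w * R z
  comm' : ∀ z ∈ cosector ω, ∀ w ∈ cosector ω, Rb z * Rb w = Rb w * Rb z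
  comm'' : ∀ z ∈ cosector ω, ∀ w ∈ cosector ω, R z * Rb w = Rb w * R z
  bound : ∀ φ ∈ Ioo ω Real.pi, ∃ C, PowBound {z : ℂ | z ≠ 0 ∧ φ ≤ |arg z|} C (-α) (-β) R
  bound' : ∀ φ ∈ Ioo ω Real.pi, ∃ C, PowBound {z : ℂ | z ≠ 0 ∧ φ ≤ |arg z|} C (-α) (-β) Rb

/-- The kernels of the functional calculi. -/
inductive Knl
  | S
  | Sb
  | Q
  | P
  | F

/-- The kernels of the functional calculi as operator valued functions. -/
def Knl.fn (R Rb : ℂ → A) : Knl → ℂ → A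
  | S => R
  | Sb => Rb
  | Q => fun z => R z * Rb z
  | P => fun z => R z * R z
  | F => fun z => R z * (R z * Rb z)

/-- The operator valued holomorphic functions to which the functional calculi apply. -/
structure Decaying (α β ω θ : ℝ) (R Rb h : ℂ → A) : Prop where
  diff : ∀ z ∈ csector θ, DifferentiableAt ℂ h z
  decay : ∃ δ > 0, ∃ C, PowBound (csector θ) C (3 * α - 1 + δ) (3 * β - 1 - δ) h
  conv : ∀ φ ∈ Ioo ω θ, ∀ k : Knl,
    Integrable fun t => k.fn R Rb (zpath φ t) * h (zpath φ t)

/-- The scalar holomorphic functions to which the functional calculi apply. -/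
structure ScalarDecaying (α β ω θ : ℝ) (R Rb : ℂ → A) (e : ℂ → ℂ) : Prop where
  diff : ∀ z ∈ csector θ, DifferentiableAt ℂ e z
  decay : ∃ δ > 0, ∃ C, PowBound (csector θ) C (3 * α - 1 + δ) (3 * β - 1 - δ) e
  conv : ∀ φ ∈ Ioo ω θ, ∀ k : Knl,
    Integrable fun t => e (zpath φ t) • k.fn R Rb (zpath φ t)

/-- The functional calculus with kernel `K`. -/
noncomputable def cal (φ : ℝ) (K h : ℂ → A) : A :=
  (2 * Real.pi * I : ℂ)⁻¹ • rayInt φ fun z => K z * h z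

/-- A scalar function as an operator valued function. -/
def toOp (A : Type*) [NormedRing A] [NormedAlgebra ℂ A] (e : ℂ → ℂ) (z : ℂ) : A := e z • 1

variable {α β ω θ : ℝ} {R Rb : ℂ → A} {e e' : ℂ → ℂ} {h : ℂ → A}

theorem mul_toOp (a : A) (z : ℂ) : a * toOp A e z = e z • a := by
  rw [toOp, mul_smul_comm, mul_one]

theorem ScalarDecaying.toOp (he : ScalarDecaying α β ω θ R Rb e) :
    Decaying α β ω θ R Rb (toOp A e) where
  diff z hz := (he.diff z hz).smul_const 1
  decay := by
    obtain ⟨δ, hδ, C, hC⟩ := he.decay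
    refine ⟨δ, hδ, C * ‖(1 : A)‖, fun z hz => ?_⟩
    obtain ⟨h1, h2⟩ := hC z hz
    unfold QuatHInfty.toOp
    refine ⟨fun h3 => ?_, fun h3 => ?_⟩ <;> rw [norm_smul, mul_right_comm]
    · exact mul_le_mul_of_nonneg_right (h1 h3) (norm_nonneg _)
    · exact mul_le_mul_of_nonneg_right (h2 h3) (norm_nonneg _)
  conv φ hφ k := by simpa only [mul_toOp] using he.conv φ hφ k

/-- Here $\alpha\ge\frac13$ and $\beta\le\frac13$ enter: they make $3\alpha-1\ge0\ge3\beta-1$, so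
the functions decay at both ends whatever the resolvents do. The Fubini argument needs this. -/
theorem exists_powBound_of_decay {E : Type*} [NormedAddCommGroup E] [NormedSpace ℂ E] {u : ℂ → E}
    (hα : 1 / 3 ≤ α) (hβ : β ≤ 1 / 3)
    (h : ∃ δ > 0, ∃ C, PowBound (csector θ) C (3 * α - 1 + δ) (3 * β - 1 - δ) u) :
    ∃ δ > 0, ∃ C, PowBound (csector θ) C δ (-δ) u := by
  obtain ⟨δ, hδ, C, hC⟩ := h
  exact ⟨δ, hδ, C, hC.mono subset_rfl (fun z hz => hz.1) (by linarith) (by linarith)⟩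

theorem ScalarDecaying.bounded (hα : 1 / 3 ≤ α) (hβ : β ≤ 1 / 3)
    (he : ScalarDecaying α β ω θ R Rb e) : ∃ C, ∀ z ∈ csector θ, ‖e z‖ ≤ C := by
  obtain ⟨δ, hδ, C, hC⟩ := exists_powBound_of_decay hα hβ he.decay
  refine ⟨C, fun z hz => ?_⟩
  have h0 := norm_pos_iff.2 hz.1
  obtain ⟨h1, h2⟩ := hC.mono (p' := 0) (q' := 0) subset_rfl (fun z hz => hz.1) hδ.le (by linarith) z hz
  rw [Real.rpow_zero, mul_one] at h1 h2
  exact (le_total ‖z‖ 1).elim h1 h2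

/-- Scalar decaying functions are bounded on the sector, so multiplication by them preserves both
the decay and the absolute convergence. -/
theorem Decaying.smul (hα : 1 / 3 ≤ α) (hβ : β ≤ 1 / 3) (hω : 0 ≤ ω) (hθ : θ ≤ Real.pi)
    (he : ScalarDecaying α β ω θ R Rb e) (hh : Decaying α β ω θ R Rb h) :
    Decaying α β ω θ R Rb fun z => e z • h z where
  diff z hz := (he.diff z hz).smul (hh.diff z hz)
  decay := by
    obtain ⟨D, hD⟩ := he.bounded hα hβ
    obtain ⟨δ, hδ, C, hC⟩ := hh.decay
    refine ⟨δ, hδ, D * C, ?_⟩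
    have : PowBound (csector θ) D 0 0 e := fun z hz => by simpa using ⟨fun _ => hD z hz, fun _ => hD z hz⟩
    simpa using this.smul hC fun z hz => hz.1
  conv φ hφ k := by
    obtain ⟨D, hD⟩ := he.bounded hα hβ
    have h0 := hω.trans hφ.1.le
    refine ((hh.conv φ hφ k).norm.const_mul D).mono' ?_ ?_
    · simp only [mul_smul_comm]
      exact (aestronglyMeasurable_ray h0 hφ.2 hθ he.diff).smul (hh.conv φ hφ k).1
    · filter_upwards [ae_ne_zero] with t ht
      rw [mul_smul_comm, norm_smul]
      exact mul_le_mul_of_nonneg_right (hD _ (zpath_mem_csector h0 hφ.2 hθ ht)) (norm_nonneg _)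

theorem ScalarDecaying.mul (hα : 1 / 3 ≤ α) (hβ : β ≤ 1 / 3) (hω : 0 ≤ ω) (hθ : θ ≤ Real.pi)
    (he : ScalarDecaying α β ω θ R Rb e) (he' : ScalarDecaying α β ω θ R Rb e') :
    ScalarDecaying α β ω θ R Rb fun z => e z * e' z where
  diff z hz := (he.diff z hz).mul (he'.diff z hz)
  decay := by
    obtain ⟨D, hD⟩ := he.bounded hα hβ
    obtain ⟨δ, hδ, C, hC⟩ := he'.decay
    refine ⟨δ, hδ, D * C, ?_⟩
    have : PowBound (csector θ) D 0 0 e := fun z hz => by simpa using ⟨fun _ => hD z hz, fun _ => hD z hz⟩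
    simpa using this.smul hC fun z hz => hz.1
  conv φ hφ k := by
    have h1 := (Decaying.smul hα hβ hω hθ he he'.toOp).conv φ hφ k
    simpa only [mul_smul_comm, mul_toOp, smul_smul] using h1

section Pair

variable (hR : ResolventPair ω α β R Rb)
include hR

theorem ResolventPair.diff (hω : 0 ≤ ω) (hω' : ω ≤ Real.pi) [CompleteSpace A] (k : Knl) :
    ∀ z ∈ cosector ω, DifferentiableAt ℂ (k.fn R Rb) z := by
  intro z hz
  have h1 := differentiableAt_of_resolvent (isOpen_cosector hω hω') hR.res hz
  have h2 := differentiableAt_of_resolvent (isOpen_cosector hω hω') hR.res' hz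
  cases k
  exacts [h1, h2, h1.mul h2, h1.mul h1, h1.mul (h1.mul h2)]

/-- Each kernel is a product of at most three resolvents, so it is no worse than $|z|^{-3\alpha}$ at
$0$; the exponent $3\alpha$ in the function classes compensates exactly this. -/
theorem ResolventPair.powBound (hα : 0 ≤ α) (k : Knl) {φ : ℝ} (hφ : φ ∈ Ioo ω Real.pi) :
    ∃ C p q, -(3 * α) ≤ p ∧ PowBound {z : ℂ | z ≠ 0 ∧ φ ≤ |arg z|} C p q (k.fn R Rb) := by
  obtain ⟨C, hC⟩ := hR.bound φ hφ
  obtain ⟨C', hC'⟩ := hR.bound' φ hφ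
  have hs : ∀ z ∈ {z : ℂ | z ≠ 0 ∧ φ ≤ |arg z|}, z ≠ 0 := fun z hz => hz.1
  cases k
  · exact ⟨_, _, _, by linarith, hC⟩
  · exact ⟨_, _, _, by linarith, hC'⟩
  · exact ⟨_, _, _, by linarith, hC.mul hC' hs⟩
  · exact ⟨_, _, _, by linarith, hC.mul hC hs⟩
  · exact ⟨_, _, _, by linarith, hC.mul (hC.mul hC' hs) hs⟩

/-- The functional calculi do not depend on the angle. -/
theorem cal_eq_cal [CompleteSpace A] (hα : 0 ≤ α) (hω : 0 ≤ ω) (hθ : θ < Real.pi)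
    (hh : Decaying α β ω θ R Rb h) (k : Knl) {φ φ' : ℝ} (hφ : φ ∈ Ioo ω θ) (hφ' : φ' ∈ Ioo ω θ) :
    cal φ (k.fn R Rb) h = cal φ' (k.fn R Rb) h := by
  wlog hle : φ ≤ φ' generalizing φ φ'
  · exact (this hφ' hφ (le_of_not_ge hle)).symm
  obtain ⟨C, p, q, hp, hb⟩ := hR.powBound hα k ⟨hφ.1, hφ.2.trans hθ⟩
  obtain ⟨δ, hδ, C', hb'⟩ := hh.decay
  unfold cal
  congr 1
  have hs : ∀ z ∈ {z : ℂ | z ≠ 0 ∧ |arg z| ∈ Icc φ φ'}, z ≠ 0 := fun z hz => hz.1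
  refine rayInt_eq_rayInt (C := C * C') (p := p + (3 * α - 1 + δ)) (q := q + (3 * β - 1 - δ))
    (hω.trans hφ.1.le) hle (hφ'.2.trans hθ) (fun z hz hz' => ?_)
    (by linarith) ?_ (hh.conv φ hφ k) (hh.conv φ' hφ' k)
  · exact (hR.diff hω (by linarith [hφ.1, hφ.2]) k z ⟨hz, hφ.1.trans_le hz'.1⟩).mul
      (hh.diff z ⟨hz, hz'.2.trans_lt hφ'.2⟩)
  · exact (hb.mono (fun z hz => ⟨hz.1, hz.2.1⟩) hs le_rfl le_rfl).mul
      (hb'.mono (fun z hz => ⟨hz.1, hz.2.2.trans_lt hφ'.2⟩) hs le_rfl le_rfl) hs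

/-- The contour argument needs two different angles. Since the calculi do not depend on the angle,
the integral of $h$ is first moved to a larger one. -/
theorem cal_leibniz [CompleteSpace A] (hα : 1 / 3 ≤ α) (hβ : β ≤ 1 / 3) (hω : 0 ≤ ω)
    (hθ : θ < Real.pi) (he : ScalarDecaying α β ω θ R Rb e) (hh : Decaying α β ω θ R Rb h)
    {φ : ℝ} (hφ : φ ∈ Ioo ω θ) {n : ℕ} {F G : Fin n → Knl} {K : Knl}
    (hid : ∀ z ∈ cosector ω, ∀ w ∈ cosector ω, w ≠ z →
      ∑ j, (F j).fn R Rb z * (G j).fn R Rb w = (w - z)⁻¹ • (K.fn R Rb z - K.fn R Rb w)) :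
    ∑ j, cal φ ((F j).fn R Rb) (toOp A e) * cal φ ((G j).fn R Rb) h =
      cal φ (K.fn R Rb) fun z => e z • h z := by
  have hα0 : 0 ≤ α := by linarith
  obtain ⟨φ₂, hφ₂, hφ₂'⟩ := exists_between hφ.2
  have m2 : φ₂ ∈ Ioo ω θ := ⟨hφ.1.trans hφ₂, hφ₂'⟩
  simp only [fun j => cal_eq_cal hR hα0 hω hθ hh (G j) hφ m2]
  obtain ⟨δ, hδ, C, hb⟩ := exists_powBound_of_decay hα hβ he.decay
  obtain ⟨δ', hδ', C', hb'⟩ := exists_powBound_of_decay hα hβ hh.decay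
  have key := leibniz_rayInt Finset.univ hω hφ.1 hφ₂ hφ₂' hθ.le hid he.diff hh.diff hδ hb hδ' hb'
    (fun j _ => he.conv φ hφ (F j)) (fun j _ => hh.conv φ₂ m2 (G j)) (he.conv φ hφ K)
    (hh.conv φ₂ m2 K)
  have hpi : (2 * Real.pi * I : ℂ) ≠ 0 := by simp [Real.pi_ne_zero]
  unfold cal
  simp only [smul_mul_assoc, mul_smul_comm, smul_smul, mul_toOp, ← Finset.smul_sum]
  rw [key, smul_smul, mul_assoc, inv_mul_cancel₀ hpi, mul_one]

theorem ResolventPair.mul_eq {z w : ℂ} (hz : z ∈ cosector ω) (hw : w ∈ cosector ω) (hne : w ≠ z) :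
    R z * R w = (w - z)⁻¹ • (R z - R w) := by
  rw [hR.res z hz w hw, smul_smul, inv_mul_cancel₀ (sub_ne_zero.2 hne), one_smul]

theorem ResolventPair.mul_eq' {z w : ℂ} (hz : z ∈ cosector ω) (hw : w ∈ cosector ω) (hne : w ≠ z) :
    Rb z * Rb w = (w - z)⁻¹ • (Rb z - Rb w) := by
  rw [hR.res' z hz w hw, smul_smul, inv_mul_cancel₀ (sub_ne_zero.2 hne), one_smul]

section Rules

variable [CompleteSpace A] (hα : 1 / 3 ≤ α) (hβ : β ≤ 1 / 3) (hω : 0 ≤ ω) (hθ : θ < Real.pi)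
  (he : ScalarDecaying α β ω θ R Rb e) (hh : Decaying α β ω θ R Rb h)
  {φ : ℝ} (hφ : φ ∈ Ioo ω θ)
include hα hβ hω hθ he hh hφ

theorem cal_S_mul : cal φ (Knl.S.fn R Rb) (fun z => e z • h z) =
    cal φ (Knl.S.fn R Rb) (toOp A e) * cal φ (Knl.S.fn R Rb) h := by
  rw [← cal_leibniz hR hα hβ hω hθ he hh hφ (F := ![Knl.S]) (G := ![Knl.S])]
  · simp
  · intro z hz w hw hne
    simpa [Knl.fn] using hR.mul_eq hz hw hne

theorem cal_Sb_mul : cal φ (Knl.Sb.fn R Rb) (fun z => e z • h z) =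
    cal φ (Knl.Sb.fn R Rb) (toOp A e) * cal φ (Knl.Sb.fn R Rb) h := by
  rw [← cal_leibniz hR hα hβ hω hθ he hh hφ (F := ![Knl.Sb]) (G := ![Knl.Sb])]
  · simp
  · intro z hz w hw hne
    simpa [Knl.fn] using hR.mul_eq' hz hw hne

/-- The difference telescopes as $(R(z)-R(w))R_b(z)+R(w)(R_b(z)-R_b(w))$. -/
theorem cal_Q_mul : cal φ (Knl.Q.fn R Rb) (fun z => e z • h z) =
    cal φ (Knl.Q.fn R Rb) (toOp A e) * cal φ (Knl.S.fn R Rb) h +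
    cal φ (Knl.Sb.fn R Rb) (toOp A e) * cal φ (Knl.Q.fn R Rb) h := by
  rw [← cal_leibniz hR hα hβ hω hθ he hh hφ (F := ![Knl.Q, Knl.Sb]) (G := ![Knl.S, Knl.Q])]
  · simp
  · intro z hz w hw hne
    have h1 := hR.mul_eq hz hw hne
    have h2 := hR.mul_eq' hz hw hne
    have h3 := hR.comm'' w hw z hz
    simp only [Knl.fn, Fin.sum_univ_two, Matrix.cons_val_zero, Matrix.cons_val_one]
    rw [mul_assoc, ← h3, ← mul_assoc, ← mul_assoc, ← h3, mul_assoc (R w), h1, h2, smul_mul_assoc,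
      mul_smul_comm, ← smul_add, sub_mul, mul_sub]
    abel_nf

/-- Telescoping in the other order, $R(z)(R_b(z)-R_b(w))+(R(z)-R(w))R_b(w)$, gives a second rule.
The equality of the two right sides is the relation `Jet.Rel` on which the algebra below relies. -/
theorem cal_Q_mul' : cal φ (Knl.Q.fn R Rb) (fun z => e z • h z) =
    cal φ (Knl.Q.fn R Rb) (toOp A e) * cal φ (Knl.Sb.fn R Rb) h +
    cal φ (Knl.S.fn R Rb) (toOp A e) * cal φ (Knl.Q.fn R Rb) h := by
  rw [← cal_leibniz hR hα hβ hω hθ he hh hφ (F := ![Knl.Q, Knl.S]) (G := ![Knl.Sb, Knl.Q])]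
  · simp
  · intro z hz w hw hne
    have h1 := hR.mul_eq hz hw hne
    have h2 := hR.mul_eq' hz hw hne
    simp only [Knl.fn, Fin.sum_univ_two, Matrix.cons_val_zero, Matrix.cons_val_one]
    rw [mul_assoc, ← mul_assoc (R z) (R w), h1, h2, smul_mul_assoc,
      mul_smul_comm, ← smul_add, sub_mul, mul_sub]
    abel_nf

theorem cal_P_mul : cal φ (Knl.P.fn R Rb) (fun z => e z • h z) =
    cal φ (Knl.P.fn R Rb) (toOp A e) * cal φ (Knl.S.fn R Rb) h +
    cal φ (Knl.S.fn R Rb) (toOp A e) * cal φ (Knl.P.fn R Rb) h := by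
  rw [← cal_leibniz hR hα hβ hω hθ he hh hφ (F := ![Knl.P, Knl.S]) (G := ![Knl.S, Knl.P])]
  · simp
  · intro z hz w hw hne
    have h1 := hR.mul_eq hz hw hne
    simp only [Knl.fn, Fin.sum_univ_two, Matrix.cons_val_zero, Matrix.cons_val_one]
    rw [mul_assoc, ← mul_assoc (R z) (R w), h1, smul_mul_assoc,
      mul_smul_comm, ← smul_add, sub_mul, mul_sub]
    abel_nf

/-- The difference telescopes as
$R(z)(R(z)-R(w))R_b(z)+(R(z)-R(w))R(w)R_b(w)+R(z)R(w)(R_b(z)-R_b(w))$. The last summand is the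
product of two `Q` kernels and produces the term $-\mathcal Dg\,\mathcal Df$ in the rule for
$\Delta$. -/
theorem cal_F_mul : cal φ (Knl.F.fn R Rb) (fun z => e z • h z) =
    cal φ (Knl.F.fn R Rb) (toOp A e) * cal φ (Knl.S.fn R Rb) h +
    cal φ (Knl.S.fn R Rb) (toOp A e) * cal φ (Knl.F.fn R Rb) h +
    cal φ (Knl.Q.fn R Rb) (toOp A e) * cal φ (Knl.Q.fn R Rb) h := by
  rw [← cal_leibniz hR hα hβ hω hθ he hh hφ (F := ![Knl.F, Knl.S, Knl.Q])
    (G := ![Knl.S, Knl.F, Knl.Q])]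
  · simp [Fin.sum_univ_three]
  · intro z hz w hw hne
    have h1 := hR.mul_eq hz hw hne
    have h2 := hR.mul_eq' hz hw hne
    have h3 := hR.comm'' w hw z hz
    simp only [Knl.fn, Fin.sum_univ_three, Matrix.cons_val_zero, Matrix.cons_val_one,
      Matrix.cons_val_two, Matrix.tail_cons, Matrix.head_cons]
    have e1 : R z * (R z * Rb z) * R w = (w - z)⁻¹ • (R z * (R z - R w) * Rb z) := by
      rw [mul_assoc, mul_assoc, ← h3, ← mul_assoc (R z) (R w), h1, smul_mul_assoc, mul_smul_comm,
        mul_assoc]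
    have e2 : R z * (R w * (R w * Rb w)) = (w - z)⁻¹ • ((R z - R w) * (R w * Rb w)) := by
      rw [← mul_assoc, h1, smul_mul_assoc]
    have e3 : R z * Rb z * (R w * Rb w) = (w - z)⁻¹ • (R z * R w * (Rb z - Rb w)) := by
      rw [mul_assoc, ← mul_assoc (Rb z), ← h3, mul_assoc, h2, mul_smul_comm, mul_smul_comm, mul_assoc]
    rw [e1, e2, e3, ← smul_add, ← smul_add]
    congr 1
    simp only [mul_sub, sub_mul, mul_assoc]
    abel

end Rules

end Pair

end Calculus

end QuatHInfty

namespace QuatHInfty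

/-! ### The calculus of the rational functions that serve as regularizers. -/

section RationalCalculus
open Filter Topology Complex

theorem exists_norm_inv_one_add_le {φ : ℝ} (h0 : 0 ≤ φ) (hφ : φ < Real.pi) :
    ∃ κ > 0, ∀ z : ℂ, z ≠ 0 → |arg z| ≤ φ →
      1 + z ≠ 0 ∧ ‖(1 + z)⁻¹‖ ≤ κ ∧ ‖(1 + z)⁻¹‖ ≤ κ * ‖z‖⁻¹ ∧ ‖z * (1 + z)⁻¹‖ ≤ κ := by
  obtain ⟨κ, hκ, h⟩ := exists_one_add_norm_le h0 hφ
  refine ⟨κ⁻¹, inv_pos.2 hκ, fun z hz hz' => ?_⟩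
  have hn := norm_pos_iff.2 hz
  have h1 : κ * (1 + ‖z‖) ≤ ‖1 + z‖ := by
    refine h z ?_
    rw [re_eq_norm_mul_cos_abs_arg]
    exact mul_le_mul_of_nonneg_left (Real.cos_le_cos_of_nonneg_of_le_pi (abs_nonneg _) hφ.le hz') hn.le
  have h2 : 0 < ‖1 + z‖ := lt_of_lt_of_le (by positivity) h1
  refine ⟨norm_pos_iff.1 h2, ?_, ?_, ?_⟩
  · rw [norm_inv]
    exact inv_anti₀ hκ (by nlinarith)
  · rw [norm_inv, ← mul_inv]
    exact inv_anti₀ (by positivity) (by nlinarith)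
  · rw [norm_mul, norm_inv, ← div_eq_mul_inv, div_le_iff₀ h2]
    rw [← mul_le_mul_iff_right₀ hκ, ← mul_assoc, mul_inv_cancel₀ hκ.ne', one_mul]
    nlinarith

/-- The rational functions `z^m / (1 + z)^(m + l)`. -/
noncomputable def ratFun (m l : ℕ) (z : ℂ) : ℂ := ((1 + z)⁻¹) ^ l * (z * (1 + z)⁻¹) ^ m

theorem exists_norm_ratFun_le {φ : ℝ} (h0 : 0 ≤ φ) (hφ : φ < Real.pi) (m l : ℕ) :
    ∃ C > 0, ∀ z : ℂ, z ≠ 0 → |arg z| ≤ φ →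
      (‖z‖ ≤ 1 → ‖ratFun m l z‖ ≤ C * ‖z‖ ^ m) ∧ (1 ≤ ‖z‖ → ‖ratFun m l z‖ ≤ C * (‖z‖⁻¹) ^ l) := by
  obtain ⟨κ, hκ, h⟩ := exists_norm_inv_one_add_le h0 hφ
  refine ⟨κ ^ l * κ ^ m, by positivity, fun z hz hz' => ?_⟩
  obtain ⟨_, h1, h2, h3⟩ := h z hz hz'
  unfold ratFun
  rw [norm_mul, norm_pow, norm_pow]
  refine ⟨fun _ => ?_, fun _ => ?_⟩
  · rw [mul_assoc]
    refine mul_le_mul (pow_le_pow_left₀ (norm_nonneg _) h1 l) ?_ (by positivity) (by positivity)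
    rw [← mul_pow, norm_mul, mul_comm ‖z‖]
    exact pow_le_pow_left₀ (by positivity) (mul_le_mul_of_nonneg_right h1 (norm_nonneg _)) m
  · rw [mul_right_comm, ← mul_pow]
    exact mul_le_mul (pow_le_pow_left₀ (norm_nonneg _) h2 l)
      (pow_le_pow_left₀ (norm_nonneg _) h3 m) (by positivity) (by positivity)

theorem differentiableAt_ratFun (m l : ℕ) {z : ℂ} (hz : 1 + z ≠ 0) :
    DifferentiableAt ℂ (ratFun m l) z := by
  have h : DifferentiableAt ℂ (fun z : ℂ => (1 + z)⁻¹) z :=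
    DifferentiableAt.inv (by fun_prop) hz
  exact (h.pow l).mul ((differentiableAt_id.mul h).pow m)

theorem powBound_ratFun {φ : ℝ} (h0 : 0 ≤ φ) (hφ : φ < Real.pi) (m l : ℕ) :
    ∃ C, PowBound {z : ℂ | z ≠ 0 ∧ |arg z| ≤ φ} C m (-l) (ratFun m l) := by
  obtain ⟨C, _, h⟩ := exists_norm_ratFun_le h0 hφ m l
  refine ⟨C, fun z hz => ?_⟩
  rw [Real.rpow_natCast, Real.rpow_neg (norm_nonneg _), Real.rpow_natCast, ← inv_pow]
  exact h z hz.1 hz.2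

theorem integrable_ray_of_powBound {E : Type*} [NormedAddCommGroup E] [NormedSpace ℂ E]
    {φ C p q : ℝ} {u : ℂ → E} (h0 : 0 ≤ φ) (hφ : φ < Real.pi) {s : Set ℂ}
    (hs : ∀ z : ℂ, z ≠ 0 → |arg z| = φ → z ∈ s)
    (hd : ∀ z : ℂ, z ≠ 0 → |arg z| = φ → ContinuousAt u z)
    (hu : PowBound s C p q u) (hp : -1 < p) (hq : q < -1) :
    Integrable fun t => u (zpath φ t) := by
  refine integrable_ray_of_bound (C := C) hp hq (aestronglyMeasurable_of_continuousAt fun t ht =>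
    ContinuousAt.comp (hd _ (zpath_ne_zero ht) (abs_arg_zpath h0 hφ ht)) (continuousAt_zpath ht))
    fun t ht => ?_
  have := hu _ (hs _ (zpath_ne_zero ht) (abs_arg_zpath h0 hφ ht))
  rwa [norm_zpath] at this

/-- The only pole, $-1$, lies outside the sector, and the decay at infinity is at least quadratic.
This removes the terms with a constant operator in the recursions below. -/
theorem rayInt_ratFun {φ : ℝ} (h0 : 0 ≤ φ) (hφ : φ < Real.pi) (m l : ℕ) :
    Integrable (fun t => ratFun m (l + 2) (zpath φ t)) ∧ rayInt φ (ratFun m (l + 2)) = 0 := by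
  obtain ⟨C, hC⟩ := powBound_ratFun h0 hφ m (l + 2)
  have hd : ∀ z : ℂ, z ≠ 0 → |arg z| ≤ φ → DifferentiableAt ℂ (ratFun m (l + 2)) z := by
    intro z hz hz'
    obtain ⟨κ, hκ, h⟩ := exists_norm_inv_one_add_le h0 hφ
    exact differentiableAt_ratFun _ _ (h z hz hz').1
  have hp : (-1 : ℝ) < m := by
    have : (0 : ℝ) ≤ m := Nat.cast_nonneg m
    linarith
  have hq : -((l + 2 : ℕ) : ℝ) < -1 := by
    have : (0 : ℝ) ≤ l := Nat.cast_nonneg l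
    push_cast
    linarith
  have hi := integrable_ray_of_powBound h0 hφ (s := {z : ℂ | z ≠ 0 ∧ |arg z| ≤ φ})
    (fun z hz hz' => ⟨hz, hz'.le⟩) (fun z hz hz' => (hd z hz hz'.le).continuousAt) hC hp hq
  exact ⟨hi, rayInt_eq_zero h0 hφ hd hp hC hi⟩

variable {A : Type*} [NormedRing A] [NormedAlgebra ℂ A] [CompleteSpace A]

theorem neg_one_mem_cosector {ω : ℝ} (hω : ω < Real.pi) : (-1 : ℂ) ∈ cosector ω :=
  ⟨by norm_num, by rw [arg_neg_one, abs_of_pos Real.pi_pos]; exact hω⟩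

section

variable {ω α β : ℝ} {R : ℂ → A} (hω : 0 ≤ ω) (hω' : ω < Real.pi)
  (hres : ∀ z ∈ cosector ω, ∀ w ∈ cosector ω, R z - R w = (w - z) • (R z * R w))
include hω' hres

/-- For the resolvent of an operator $T$, $-R(-1)=(1+T)^{-1}$, and this is the partial fraction
decomposition of $(z-T)^{-1}(1+T)^{-1}$. -/
theorem resolvent_mul_neg_one {z : ℂ} (hz : z ∈ cosector ω) (h1 : 1 + z ≠ 0) :
    R z * -R (-1) = (1 + z)⁻¹ • (R z - R (-1)) := by
  have h2 : (1 + z)⁻¹ * (-1 - z) = -1 := by field_simp; ring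
  rw [hres z hz _ (neg_one_mem_cosector hω'), smul_smul, h2, neg_one_smul, mul_neg]

/-- In the same reading $1+R(-1)=T(1+T)^{-1}$: this operator factor is exchanged for the scalar
$z/(1+z)$, up to a constant operator. -/
theorem resolvent_mul_one_sub {z : ℂ} (hz : z ∈ cosector ω) (h1 : 1 + z ≠ 0) :
    R z * (1 + R (-1)) = (z * (1 + z)⁻¹) • R z + (1 + z)⁻¹ • R (-1) := by
  have h2 := resolvent_mul_neg_one hω' hres hz h1
  rw [mul_neg, neg_eq_iff_eq_neg] at h2
  rw [mul_add, mul_one, h2]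
  have h3 : z * (1 + z)⁻¹ = 1 - (1 + z)⁻¹ := by field_simp; ring
  rw [h3]
  module

/-- By `resolvent_mul_one_sub` every factor $1+R(-1)$ gains one power of $z$ at the origin, up to a
bounded remainder. The restriction $|z|\le\frac12$ keeps $1+z$ away from $0$. -/
theorem resolvent_bounded_near_zero {φ : ℝ} {C : ℝ} (hφ : ω < φ)
    (hC : PowBound {z : ℂ | z ≠ 0 ∧ φ ≤ |arg z|} C (-α) (-β) R) (m : ℕ) :
    ∃ D ≥ 0, ∀ z : ℂ, z ≠ 0 → φ ≤ |arg z| → ‖z‖ ≤ 1 / 2 →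
      ‖R z * (1 + R (-1)) ^ m‖ ≤ D * (‖z‖ ^ (m - α) + 1) := by
  induction m with
  | zero =>
    refine ⟨|C|, abs_nonneg _, fun z hz hz' hz1 => ?_⟩
    rw [pow_zero, mul_one, Nat.cast_zero, zero_sub]
    refine ((hC z ⟨hz, hz'⟩).1 (by linarith)).trans ?_
    refine mul_le_mul (le_abs_self _) (by linarith) (by positivity) (abs_nonneg _)
  | succ m ih =>
    obtain ⟨D, hD, h⟩ := ih
    refine ⟨2 * D + 2 * ‖R (-1) * (1 + R (-1)) ^ m‖, by positivity, fun z hz hz' hz1 => ?_⟩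
    have hn := norm_pos_iff.2 hz
    have h2 : 1 / 2 ≤ ‖1 + z‖ := by
      have := norm_sub_norm_le (1 : ℂ) (-z)
      rw [sub_neg_eq_add, norm_neg, norm_one] at this
      linarith
    have h3 : 1 + z ≠ 0 := norm_pos_iff.1 (by linarith)
    have h4 : ‖(1 + z)⁻¹‖ ≤ 2 := by
      rw [norm_inv]
      exact inv_le_of_inv_le₀ two_pos (by linarith)
    have e : R z * (1 + R (-1)) ^ (m + 1) = (z * (1 + z)⁻¹) • (R z * (1 + R (-1)) ^ m) +
        (1 + z)⁻¹ • (R (-1) * (1 + R (-1)) ^ m) := by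
      rw [pow_succ', ← mul_assoc, resolvent_mul_one_sub hω' hres ⟨hz, hφ.trans_le hz'⟩ h3, add_mul,
        smul_mul_assoc, smul_mul_assoc]
    have e2 : ‖z‖ ^ (((m + 1 : ℕ) : ℝ) - α) = ‖z‖ ^ ((m : ℝ) - α) * ‖z‖ := by
      rw [← Real.rpow_add_one hn.ne']
      push_cast
      ring_nf
    rw [e, e2]
    refine (norm_add_le _ _).trans ?_
    rw [norm_smul, norm_smul, norm_mul]
    have h5 := h z hz hz' hz1
    have h6 : 0 ≤ ‖z‖ ^ ((m : ℝ) - α) := by positivity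
    calc ‖z‖ * ‖(1 + z)⁻¹‖ * ‖R z * (1 + R (-1)) ^ m‖ + ‖(1 + z)⁻¹‖ * ‖R (-1) * (1 + R (-1)) ^ m‖
        ≤ ‖z‖ * 2 * (D * (‖z‖ ^ ((m : ℝ) - α) + 1)) + 2 * ‖R (-1) * (1 + R (-1)) ^ m‖ := by gcongr
      _ ≤ _ := by
          have h7 : 0 ≤ D * (1 - ‖z‖) := mul_nonneg hD (by linarith)
          have h8 : 0 ≤ ‖R (-1) * (1 + R (-1)) ^ m‖ * (‖z‖ ^ ((m : ℝ) - α) * ‖z‖) := by positivity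
          nlinarith

/-- The singularity $|z|^{-\alpha}$ can be compensated jointly by $n$ scalar factors $z$ and $m$
operator factors $1+R(-1)$. -/
theorem powBound_resolvent_mul (hα : 0 ≤ α) {φ : ℝ} {C : ℝ} (hφ : ω < φ)
    (hC : PowBound {z : ℂ | z ≠ 0 ∧ φ ≤ |arg z|} C (-α) (-β) R) {n m : ℕ} (hm : α ≤ n + m) :
    ∃ D, ∀ z : ℂ, z ≠ 0 → φ ≤ |arg z| →
      (‖z‖ ≤ 1 → ‖R z * (1 + R (-1)) ^ m‖ * ‖z‖ ^ n ≤ D) ∧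
      (1 ≤ ‖z‖ → ‖R z * (1 + R (-1)) ^ m‖ ≤ D * ‖z‖ ^ (-β)) := by
  obtain ⟨D, hD, h⟩ := resolvent_bounded_near_zero hω' hres hφ hC m
  set M := ‖(1 + R (-1)) ^ m‖
  refine ⟨2 * D + |C| * 2 ^ α * M + |C| * M, fun z hz hz' => ⟨fun h1 => ?_, fun h1 => ?_⟩⟩
  · have hn := norm_pos_iff.2 hz
    have hM : 0 ≤ |C| * M := by positivity
    have hM' : 0 ≤ |C| * 2 ^ α * M := by positivity
    rcases le_total ‖z‖ (1 / 2) with h2 | h2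
    · refine (mul_le_mul_of_nonneg_right (h z hz hz' h2) (by positivity)).trans ?_
      have e1 : ‖z‖ ^ ((m : ℝ) - α) * ‖z‖ ^ n ≤ 1 := by
        rw [← Real.rpow_natCast, ← Real.rpow_add hn]
        exact Real.rpow_le_one hn.le h1 (by linarith)
      have e2 : ‖z‖ ^ n ≤ 1 := pow_le_one₀ hn.le h1
      rw [mul_assoc, add_mul, one_mul]
      nlinarith
    · have e1 : ‖R z‖ ≤ |C| * 2 ^ α := by
        refine ((hC z ⟨hz, hz'⟩).1 h1).trans ?_
        refine mul_le_mul (le_abs_self _) ?_ (by positivity) (abs_nonneg _)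
        rw [Real.rpow_neg hn.le, ← Real.inv_rpow hn.le]
        refine Real.rpow_le_rpow (by positivity) ?_ hα
        exact inv_le_of_inv_le₀ two_pos (by linarith)
      have e2 : ‖z‖ ^ n ≤ 1 := pow_le_one₀ hn.le h1
      refine (mul_le_of_le_one_right (norm_nonneg _) e2).trans ((norm_mul_le _ _).trans ?_)
      have := mul_le_mul_of_nonneg_right e1 (norm_nonneg ((1 + R (-1)) ^ m))
      linarith
  · refine (norm_mul_le _ _).trans ?_
    have h2 := (hC z ⟨hz, hz'⟩).2 h1
    have h3 : 0 ≤ ‖z‖ ^ (-β) := by positivity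
    calc ‖R z‖ * M ≤ (|C| * ‖z‖ ^ (-β)) * M := by
          refine mul_le_mul_of_nonneg_right (h2.trans ?_) (norm_nonneg _)
          exact mul_le_mul_of_nonneg_right (le_abs_self _) h3
      _ = (|C| * M) * ‖z‖ ^ (-β) := by ring
      _ ≤ _ := by
          refine mul_le_mul_of_nonneg_right ?_ h3
          have hM' : 0 ≤ |C| * 2 ^ α * M := by positivity
          linarith

include hω in
-- Near $0$ the integrand is bounded. At infinity a single factor $(1+z)^{-1}$ suffices, because the
-- resolvent adds the decay $|z|^{-\beta}$ with $\beta>0$.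
theorem integrable_ratFun_resolvent (hα : 0 ≤ α) (hβ : 0 < β) {φ : ℝ} {C : ℝ} (hφ : ω < φ)
    (hφ' : φ < Real.pi) (hC : PowBound {z : ℂ | z ≠ 0 ∧ φ ≤ |arg z|} C (-α) (-β) R) {n m l : ℕ}
    (hm : α ≤ n + m) :
    Integrable fun t => ratFun n (l + 1) (zpath φ t) • (R (zpath φ t) * (1 + R (-1)) ^ m) := by
  obtain ⟨D, hD⟩ := powBound_resolvent_mul hω' hres hα hφ hC hm
  have h0 : 0 ≤ φ := hω.trans hφ.le
  obtain ⟨C', hC', hr⟩ := exists_norm_ratFun_le h0 hφ' n (l + 1)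
  refine integrable_ray_of_powBound (u := fun z => ratFun n (l + 1) z • (R z * (1 + R (-1)) ^ m))
    (C := C' * D) (p := 0) (q := -1 - β) h0 hφ'
    (s := {z | z ≠ 0 ∧ |arg z| = φ}) (fun z hz hz' => ⟨hz, hz'⟩) (fun z hz hz' => ?_) ?_ (by norm_num)
    (by linarith)
  · obtain ⟨κ, hκ, h⟩ := exists_norm_inv_one_add_le h0 hφ'
    refine ((differentiableAt_ratFun _ _ (h z hz hz'.le).1).smul
      ((differentiableAt_of_resolvent (isOpen_cosector hω hω'.le) hres
        ⟨hz, by rwa [hz']⟩).mul_const _)).continuousAt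
  · intro z hz
    have hn := norm_pos_iff.2 hz.1
    obtain ⟨h1, h2⟩ := hr z hz.1 hz.2.le
    obtain ⟨h3, h4⟩ := hD z hz.1 hz.2.ge
    rw [norm_smul, Real.rpow_zero]
    refine ⟨fun h5 => ?_, fun h5 => ?_⟩
    · refine (mul_le_mul_of_nonneg_right (h1 h5) (norm_nonneg _)).trans ?_
      rw [mul_assoc, mul_one, mul_comm (‖z‖ ^ n)]
      exact mul_le_mul_of_nonneg_left (h3 h5) hC'.le
    · have h6 : (‖z‖⁻¹) ^ (l + 1) ≤ ‖z‖⁻¹ :=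
        pow_le_of_le_one (by positivity) (inv_le_one_of_one_le₀ h5) (by simp)
      refine (mul_le_mul ((h2 h5).trans (mul_le_mul_of_nonneg_left h6 hC'.le)) (h4 h5)
        (norm_nonneg _) (by positivity)).trans (le_of_eq ?_)
      rw [sub_eq_add_neg, Real.rpow_add hn, Real.rpow_neg_one]
      ring

include hω in
/-- The calculus of `z^m / (1 + z)^(m + l + 1)`. -/
theorem rayInt_ratFun_resolvent (hα : 0 ≤ α) (hβ : 0 < β) {φ : ℝ} (hφ : ω < φ)
    (hφ' : φ < Real.pi)
    (hb : ∀ φ ∈ Ioo ω Real.pi, ∃ C, PowBound {z : ℂ | z ≠ 0 ∧ φ ≤ |arg z|} C (-α) (-β) R) {m : ℕ}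
    (hm : α ≤ m) (l : ℕ) :
    rayInt φ (fun z => ratFun m (l + 1) z • R z) =
      (2 * Real.pi * I : ℂ) • ((-R (-1)) ^ (l + 1) * (1 + R (-1)) ^ m) := by
  have h0 : 0 ≤ φ := hω.trans hφ.le
  obtain ⟨C, hC⟩ := hb φ ⟨hφ, hφ'⟩
  have hmz : ∀ t : ℝ, t ≠ 0 → zpath φ t ∈ cosector ω := fun t ht => zpath_mem_cosector h0 hφ hφ' ht
  have hne : ∀ t : ℝ, t ≠ 0 → 1 + zpath φ t ≠ 0 := by
    intro t ht
    obtain ⟨κ, hκ, h⟩ := exists_norm_inv_one_add_le h0 hφ'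
    exact (h _ (zpath_ne_zero ht) (abs_arg_zpath h0 hφ' ht).le).1
  induction l with
  | zero =>
    -- The scalar factors $z/(1+z)$ are traded one by one for operator factors $1+R(-1)$. The
    -- remainder in each step is a constant operator times the integral of `ratFun n 2`, which is
    -- zero.
    have step : ∀ n : ℕ, n ≤ m → rayInt φ (fun z => ratFun n 1 z • (R z * (1 + R (-1)) ^ (m - n))) =
        rayInt φ fun z => ratFun 0 1 z • (R z * (1 + R (-1)) ^ m) := by
      intro n
      induction n with
      | zero => intro _; rfl
      | succ n ih =>
        intro hn
        rw [← ih (by omega)]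
        have hexp : m - n = (m - (n + 1)) + 1 := by omega
        set X := (1 + R (-1)) ^ (m - (n + 1)) with hX
        have i1 := integrable_ratFun_resolvent hω hω' hres hα hβ hφ hφ' hC (l := 0) (n := n + 1)
          (m := m - (n + 1)) (by rw [Nat.cast_sub hn]; linarith)
        obtain ⟨i2, i3⟩ := rayInt_ratFun h0 hφ' n 0
        have e : rayInt φ (fun z => ratFun n 1 z • (R z * (1 + R (-1)) ^ (m - n))) =
            rayInt φ (fun z => ratFun (n + 1) 1 z • (R z * X)) +
            rayInt φ (ratFun n 2) • (R (-1) * X) := by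
          unfold rayInt
          rw [← integral_smul_const, ← integral_add (integrable_zder_smul i1)
            ((integrable_zder_smul i2).smul_const _)]
          refine integral_congr_ae ?_
          filter_upwards [ae_ne_zero] with t ht
          have h1 := hne t ht
          rw [hexp, pow_succ', ← mul_assoc, resolvent_mul_one_sub hω' hres (hmz t ht) h1, add_mul,
            smul_mul_assoc, smul_mul_assoc, smul_eq_mul]
          unfold ratFun
          module
        rw [e, i3, zero_smul, add_zero]
    have h1 := step m le_rfl
    rw [Nat.sub_self] at h1
    simp only [pow_zero, mul_one] at h1
    -- What remains, $(1+z)^{-1}R(z)(1+R(-1))^m$, is holomorphic outside the spectral sector except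
    -- at $-1$. After $z\mapsto-z$ the pole is the point $1$ inside the complementary sector, and
    -- Cauchy's formula evaluates the integral.
    rw [zero_add, h1, pow_one, rayInt_comp_neg]
    have hpi : Real.pi - φ < Real.pi - ω := by linarith
    have i0 := integrable_ratFun_resolvent hω hω' hres hα hβ hφ hφ' hC (n := 0) (m := m) (l := 0)
      (by simpa using hm)
    have harg : ∀ z : ℂ, z ≠ 0 → |arg (-z)| = Real.pi - |arg z| := by
      intro z hz
      have h2 : Real.cos |arg (-z)| = Real.cos (Real.pi - |arg z|) := by
        have h3 := re_eq_norm_mul_cos_abs_arg (-z)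
        have h4 := re_eq_norm_mul_cos_abs_arg z
        rw [norm_neg, neg_re, h4] at h3
        rw [Real.cos_pi_sub]
        have := norm_pos_iff.2 hz
        nlinarith
      exact Real.injOn_cos ⟨abs_nonneg _, abs_arg_le_pi _⟩
        ⟨by linarith [abs_arg_le_pi z], by linarith [abs_nonneg (arg z)]⟩ h2
    have i1 : Integrable fun t => (zpath (Real.pi - φ) t - 1)⁻¹ •
        (-(R (-zpath (Real.pi - φ) t) * (1 + R (-1)) ^ m)) := by
      refine i0.comp_neg.congr ?_
      filter_upwards [ae_ne_zero] with t ht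
      rw [neg_zpath φ t ht]
      unfold ratFun
      rw [pow_zero, mul_one, zero_add, pow_one, smul_neg, ← neg_smul, ← inv_neg, neg_sub,
        ← sub_eq_add_neg]
    obtain ⟨D, hD⟩ := powBound_resolvent_mul hω' hres hα hφ hC (n := 0) (m := m)
      (by simpa using hm)
    have key := rayInt_cauchy (u := fun z => -(R (-z) * (1 + R (-1)) ^ m)) (z₀ := 1) (δ := β) (C := D)
      hpi (by linarith) (fun z hz hz' => ?_) hβ ?_ one_ne_zero (by simpa using hφ') i1
    · have e2 : (fun z : ℂ => ratFun 0 1 (-z) • (R (-z) * (1 + R (-1)) ^ m)) =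
          fun z => (z - 1)⁻¹ • -(R (-z) * (1 + R (-1)) ^ m) := by
        funext z
        unfold ratFun
        rw [pow_zero, mul_one, pow_one, smul_neg, ← neg_smul, ← inv_neg, neg_sub, ← sub_eq_add_neg]
      rw [e2, key, neg_mul]
    · have h2 : -z ∈ cosector ω := ⟨neg_ne_zero.2 hz, by rw [harg z hz]; linarith⟩
      exact ((DifferentiableAt.comp z (differentiableAt_of_resolvent (isOpen_cosector hω hω'.le)
        hres h2) differentiableAt_id.neg).mul_const _).neg
    · intro z hz
      obtain ⟨h2, h3⟩ := hD (-z) (neg_ne_zero.2 hz.1) (by rw [harg z hz.1]; linarith [hz.2])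
      rw [norm_neg] at h2 h3
      rw [norm_neg, Real.rpow_zero, mul_one]
      simpa using And.intro h2 h3
  | succ l ih =>
    have i1 := integrable_ratFun_resolvent hω hω' hres hα hβ hφ hφ' hC (l := l) (n := m) (m := 0)
      (by simpa using hm)
    have i1' := integrable_ratFun_resolvent hω hω' hres hα hβ hφ hφ' hC (l := l + 1) (n := m) (m := 0)
      (by simpa using hm)
    obtain ⟨i2, i3⟩ := rayInt_ratFun h0 hφ' m l
    simp only [pow_zero, mul_one] at i1 i1'
    -- A further factor $(1+z)^{-1}$ corresponds to a factor $-R(-1)$; the correction is again a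
    -- vanishing scalar integral.
    have e : rayInt φ (fun z => ratFun m (l + 1) z • R z) * -R (-1) =
        rayInt φ (fun z => ratFun m (l + 1 + 1) z • R z) - rayInt φ (ratFun m (l + 2)) • R (-1) := by
      unfold rayInt
      rw [← integral_smul_const, ← integral_mul_const_of_integrable (integrable_zder_smul i1),
        ← integral_sub (integrable_zder_smul i1') ((integrable_zder_smul i2).smul_const _)]
      refine integral_congr_ae ?_
      filter_upwards [ae_ne_zero] with t ht
      have h1 := hne t ht
      rw [smul_mul_assoc, smul_mul_assoc, resolvent_mul_neg_one hω' hres (hmz t ht) h1,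
        smul_eq_mul]
      unfold ratFun
      module
    rw [i3, zero_smul, sub_zero] at e
    rw [← e, ih, smul_mul_assoc]
    have hc : Commute ((1 + R (-1)) ^ m) (-R (-1)) :=
      (((Commute.one_left _).add_left (Commute.refl (R (-1)))).neg_right).pow_left m
    rw [mul_assoc ((-R (-1)) ^ (l + 1)), hc.eq, ← mul_assoc ((-R (-1)) ^ (l + 1)), ← pow_succ]

end

end RationalCalculus

end QuatHInfty

namespace QuatHInfty

/-! ### The algebra of the product rules over a commutative ring. -/

section Jets

/-- The values of the functional calculi with the kernels `S`, `Sb`, `Q`, `P`, `F`. -/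
@[ext] structure Jet (M : Type*) where
  s : M
  sb : M
  q : M
  p : M
  f : M

namespace Jet

section Graphs

variable {Γ W : Type*} [Ring Γ] [AddCommGroup W] [Module Γ W]

/-- Evaluation of a jet of operators at a vector. -/
def ev (G : Jet Γ) (w : W) : Jet W := ⟨G.s • w, G.sb • w, G.q • w, G.p • w, G.f • w⟩

/-- The Leibniz rules. -/
def act (e : Jet Γ) (F : Jet W) : Jet W where
  s := e.s • F.s
  sb := e.sb • F.sb
  q := e.q • F.s + e.sb • F.q
  p := e.p • F.s + e.s • F.p
  f := e.f • F.s + e.s • F.f + e.q • F.q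

/-- Equality of the two Leibniz rules for `Q`. -/
def Rel (e : Jet Γ) (F : Jet W) : Prop := e.q • F.sb + e.s • F.q = e.q • F.s + e.sb • F.q

/-- The graph of the `S`-calculus. -/
def GraphS (X : Jet Γ) (F : Jet W) (w : W) : Prop := X.s • w = F.s

/-- The graph of the `S`-calculus of the conjugate operator. -/
def GraphSb (X : Jet Γ) (F : Jet W) (w : W) : Prop := X.sb • w = F.sb

/-- The graph of the `Q`-calculus. -/
def GraphQ (X : Jet Γ) (F : Jet W) (w : W) : Prop :=
  (X.s * X.sb) • w = X.s • (-2 : Γ) • F.q - ((-2 : Γ) * X.q) • F.s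

/-- The graph of the `P`-calculus. -/
def GraphP (X : Jet Γ) (F : Jet W) (w : W) : Prop :=
  (X.s * (X.s * X.sb)) • w = (X.s * X.sb) • ((2 : Γ) • F.p + (2 : Γ) • F.q)
    - (X.sb * (2 * X.p + 2 * X.q)) • F.s + (X.s * (-2 * X.q)) • F.sb - (X.sb * (-2 * X.q)) • F.s

/-- The graph of the `F`-calculus. -/
def GraphF (X : Jet Γ) (F : Jet W) (w : W) : Prop :=
  (X.s * (X.s * X.sb)) • w = (X.s * X.sb) • (-4 : Γ) • F.f
    - (X.sb * (-4 * X.f)) • F.s + (X.s * (-2 * X.q)) • (-2 : Γ) • F.q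
    - (-2 * X.q * (-2 * X.q)) • F.s

end Graphs

variable {Γ W : Type*} [CommRing Γ] [AddCommGroup W] [Module Γ W]

variable {e X A G : Jet Γ} {F : Jet W} {v w w₁ w₂ w₃ w₄ w₅ : W}

/-- An equation may be multiplied by an injective scalar. In this form it suffices to compare the
differences of the two sides, which is a linear identity. -/
theorem smul_inj_iff {M : Type*} [AddCommGroup M] [Module Γ M] {c : Γ}
    (hc : Function.Injective fun w : M => c • w) {x y x' y' : M} (h : c • (x' - y') = x - y) :
    x = y ↔ x' = y' := by
  rw [← sub_eq_zero, ← h, ← sub_eq_zero (a := x')]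
  refine ⟨fun h0 => hc (h0.trans (smul_zero c).symm), fun h0 => by rw [h0, smul_zero]⟩

theorem injective_mul {M : Type*} [AddCommGroup M] [Module Γ M] {c d : Γ}
    (hc : Function.Injective fun w : M => c • w) (hd : Function.Injective fun w : M => d • w) :
    Function.Injective fun w : M => (c * d) • w := by
  simpa only [mul_smul] using! hc.comp hd

section Extension

variable (hs : Function.Injective fun w : W => e.s • w)
  (hsb : Function.Injective fun w : W => e.sb • w)

include hs in
-- This and its four analogues show that the graphs do not depend on the regularizer: a further
-- regularizing factor $e$ multiplies the defining equation by an injective product of $e(T)$ and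
-- $e(\overline T)$.
theorem graphS_act : GraphS (e.act X) (e.act F) w ↔ GraphS X F w :=
  smul_inj_iff hs (by simp only [act, smul_eq_mul]; module)

include hsb in
theorem graphSb_act : GraphSb (e.act X) (e.act F) w ↔ GraphSb X F w :=
  smul_inj_iff hsb (by simp only [act, smul_eq_mul]; module)

include hs hsb in
theorem graphQ_act : GraphQ (e.act X) (e.act F) w ↔ GraphQ X F w :=
  smul_inj_iff (injective_mul hs hsb) (by simp only [act, smul_eq_mul]; module)

include hs hsb in
-- The defining formula mixes $(ef)(T)$ with $(ef)(\overline T)$, whose Leibniz rules differ. The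
-- two forms of the `Q` rule, for all three pairs, reconcile them.
theorem graphP_act (hX : e.Rel X) (hF : e.Rel F) (h : X.Rel F) :
    GraphP (e.act X) (e.act F) w ↔ GraphP X F w := by
  refine smul_inj_iff (injective_mul hs (injective_mul hs hsb)) ?_
  have hX' := congrArg (· • F.s) hX
  simp only [act, smul_eq_mul] at hX' ⊢
  unfold Rel at h hF
  linear_combination (norm := module) (2 * e.s * e.s * e.sb * X.s) • h
    - (2 * e.s * X.s * e.sb) • (e.sb • h + X.s • hF - hX')

include hs hsb in
theorem graphF_act (hX : e.Rel X) : GraphF (e.act X) (e.act F) w ↔ GraphF X F w := by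
  refine smul_inj_iff (injective_mul hs (injective_mul hs hsb)) ?_
  have hX' := congrArg (· • (X.s • F.q - X.q • F.s)) hX
  simp only [act, smul_eq_mul] at hX' ⊢
  linear_combination (norm := module) (-4 * e.s * e.sb) • hX'

end Extension

/-- The relation gives $X_q(F_{\bar s}-F_s)=(X_{\bar s}-X_s)F_q$ and so eliminates $F_{\bar s}$.
What is left is the sum of the quotient rules for the kernels $2R^2$ and $2RR_b$, with cleared
denominators. -/
theorem graphP_iff (h : X.Rel F) : GraphP X F w ↔ (X.s * X.s * X.sb) • w =
    (2 * X.sb) • (X.s • F.p - X.p • F.s) + (2 * X.s) • (X.s • F.q - X.q • F.s) := by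
  unfold Rel at h
  unfold GraphP
  rw [← sub_eq_zero, ← sub_eq_zero (a := (X.s * X.s * X.sb) • w)]
  refine Eq.congr_left ?_
  linear_combination (norm := module) (2 * X.s) • h

section Product

/-- The product rule of the `S`-calculus. -/
theorem graphS_mul (h₁ : GraphS A F w₁) (h : GraphS A (G.ev w₁) w) :
    GraphS (A.act A) (G.act F) w := by
  unfold GraphS at *
  simp only [act, ev, smul_eq_mul] at *
  linear_combination (norm := module) A.s • h + G.s • h₁

/-- The first product rule of the `Q`-calculus. -/
theorem graphQ_mul (hAG : A.Rel G) (h₁ : GraphS A F w₁) (h₂ : GraphQ A (G.ev w₁) w₂)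
    (h₃ : GraphQ A F w₃) (h₄ : GraphSb A (G.ev w₃) w₄) :
    GraphQ (A.act A) (G.act F) (w₂ + w₄) := by
  have hX := congrArg (· • F.s) hAG
  unfold GraphS GraphSb GraphQ at *
  simp only [act, ev, smul_eq_mul] at *
  linear_combination (norm := module) (A.s * A.sb) • h₂
    - (2 * A.sb) • (A.s * G.q - A.q * G.s) • h₁
    + (A.s * A.s * A.sb) • h₄ + (A.s * G.sb) • h₃ + (2 * A.s) • hX

/-- The second product rule of the `Q`-calculus. -/
theorem graphQ_mul' (hAG : A.Rel G) (hAF : A.Rel F) (hGF : G.Rel F) (h₁ : GraphSb A F w₁)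
    (h₂ : GraphQ A (G.ev w₁) w₂) (h₃ : GraphQ A F w₃) (h₄ : GraphS A (G.ev w₃) w₄) :
    GraphQ (A.act A) (G.act F) (w₂ + w₄) := by
  have hX := congrArg (· • F.s) hAG
  unfold GraphS GraphSb GraphQ Rel at *
  simp only [act, ev, smul_eq_mul] at *
  linear_combination (norm := module) (A.s * A.sb) • h₂
    - (2 * A.s) • (A.s * G.q - A.q * G.s) • h₁
    + (A.sb * A.s * A.sb) • h₄ + (A.sb * G.s) • h₃ 
    - (2 * A.s * A.s) • hGF + (2 * A.s * G.s) • hAF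

/-- The product rule of the `P`-calculus. -/
theorem graphP_mul (hAG : A.Rel G) (hAF : A.Rel F) (hGF : G.Rel F)
    (h₁ : GraphS A F w₁)
    (h₁' : GraphSb A F w₂) (h₂ : GraphP A (G.ev w₁) w₃) (h₃ : GraphP A F w₄)
    (h₄ : GraphS A (G.ev w₄) w₅) (h₅ : GraphQ A (G.ev (w₁ - w₂)) w) :
    GraphP (A.act A) (G.act F) (w₃ + w₅ + w) := by
  -- The reduced form of the `P` graph is used for all three functions, so the relation has to be
  -- carried over to `G.ev w₁` and to the product.
  have e1 : A.Rel (G.ev w₁) := by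
    have := congrArg (· • w₁) hAG
    unfold Rel at *
    simp only [ev, smul_eq_mul] at *
    linear_combination (norm := module) this
  have e2 : (A.act A).Rel (G.act F) := by
    have hX := congrArg (· • F.s) hAG
    unfold Rel at *
    simp only [act, smul_eq_mul] at *
    linear_combination (norm := module) (A.s + A.sb) • (G.sb • hAF + hX)
  rw [graphP_iff e1] at h₂
  rw [graphP_iff hAF] at h₃
  rw [graphP_iff e2]
  unfold GraphS GraphSb GraphQ Rel at *
  simp only [act, ev, smul_eq_mul] at *
  linear_combination (norm := module) (A.s * A.s * A.sb) • h₂ 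
    + (A.s * A.s * A.s * A.sb * A.sb) • h₄ + (A.s * A.sb * G.s) • h₃
    + (A.s * A.s * A.s * A.sb) • h₅
    + (2 * A.s * A.sb) • (A.sb * (A.s * G.p - A.p * G.s) + A.s * (A.s * G.q - A.q * G.s)) • h₁
    - (2 * A.s * A.s) • (A.s * G.q - A.q * G.s) • (A.sb • h₁ - A.s • h₁')
    + (2 * A.s * A.s * A.s) • (A.s • hGF - G.s • hAF)

/-- The product rule of the `F`-calculus. -/
theorem graphF_mul (hAG : A.Rel G) (h₁ : GraphS A F w₁)
    (h₂ : GraphF A (G.ev w₁) w₂) (h₃ : GraphF A F w₃) (h₄ : GraphS A (G.ev w₃) w₄)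
    (h₅ : GraphQ A F w₅) (h₆ : GraphQ A (G.ev w₅) w) :
    GraphF (A.act A) (G.act F) (w₂ + w₄ - w) := by
  have hX := congrArg (· • F.q) hAG
  unfold GraphS GraphF GraphQ at *
  simp only [act, ev, smul_eq_mul] at *
  linear_combination (norm := module) (A.s * A.s * A.sb) • h₂ 
    + (A.s * A.s * A.s * A.sb * A.sb) • h₄ + (A.s * A.sb * G.s) • h₃
    - (A.s * A.s * A.s * A.sb) • h₆ 
    - (4 * A.s * A.sb) • (A.sb * (A.s * G.f - A.f * G.s) - A.q * (A.s * G.q - A.q * G.s)) • h₁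
    + (2 * A.s * A.s) • (A.s * G.q - A.q * G.s) • h₅
    - (4 * A.s * A.s * (A.s + A.sb)) • hX

end Product

end Jet

end Jets

end QuatHInfty

namespace QuatHInfty

/-! ### Product rules for regularized functions of a resolvent pair. -/

section AbstractProduct

open Complex

variable {A W : Type*} [NormedRing A] [NormedAlgebra ℂ A]

/-- The ring of all elements that commute with everything that commutes with the resolvents. -/
def resolventRing (ω : ℝ) (R Rb : ℂ → A) : Subring A :=
  Subring.centralizer {c | ∀ z ∈ cosector ω, Commute (R z) c ∧ Commute (Rb z) c}

variable {α β ω θ : ℝ} {R Rb : ℂ → A} {e e' : ℂ → ℂ} {h h' : ℂ → A} {φ : ℝ}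

/-- A bicommutant of a commuting family is commutative: the resolvents lie in their own commutant,
hence $b$ commutes with them, so $b$ is in the commutant as well and commutes with $a$. -/
theorem commute_of_mem_resolventRing (hR : ResolventPair ω α β R Rb) {a b : A}
    (ha : a ∈ resolventRing ω R Rb) (hb : b ∈ resolventRing ω R Rb) : a * b = b * a := by
  have hb' := Subring.mem_centralizer_iff.1 hb
  refine (Subring.mem_centralizer_iff.1 ha b fun z hz => ⟨?_, ?_⟩).symm
  · exact hb' _ fun w hw => ⟨hR.comm w hw z hz, (hR.comm'' z hz w hw).symm⟩
  · exact hb' _ fun w hw => ⟨hR.comm'' w hw z hz, hR.comm' w hw z hz⟩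

/-- The ring `resolventRing` is commutative. -/
@[reducible] def resolventRing.commRing (hR : ResolventPair ω α β R Rb) :
    CommRing (resolventRing ω R Rb) :=
  { (resolventRing ω R Rb).toRing with
    mul_comm := fun a b => Subtype.ext (commute_of_mem_resolventRing hR a.2 b.2) }

/-- For a scalar function the integrand is a multiple of a product of resolvents, and commutation
with a fixed operator passes through the integral. -/
theorem cal_mem_resolventRing [CompleteSpace A] (hω : 0 ≤ ω) (hθ : θ < Real.pi)
    (he : ScalarDecaying α β ω θ R Rb e) (hφ : φ ∈ Ioo ω θ) (k : Knl) :
    cal φ (k.fn R Rb) (toOp A e) ∈ resolventRing ω R Rb := by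
  refine Subring.mem_centralizer_iff.2 fun c hc => ?_
  unfold cal rayInt
  have hi := integrable_zder_smul (φ := φ) (he.conv φ hφ k)
  simp only [mul_toOp]
  rw [mul_smul_comm, smul_mul_assoc, ← integral_const_mul_of_integrable hi,
    ← integral_mul_const_of_integrable hi]
  congr 1
  refine integral_congr_ae ?_
  filter_upwards [ae_ne_zero] with t ht
  obtain ⟨h1, h2⟩ := hc _ (zpath_mem_cosector (hω.trans hφ.1.le) hφ.1 (hφ.2.trans hθ) ht)
  simp only [mul_smul_comm, smul_mul_assoc]
  congr 2
  have h3 : Commute (k.fn R Rb (zpath φ t)) c := by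
    cases k
    exacts [h1, h2, h1.mul_left h2, h1.mul_left h1, h1.mul_left (h1.mul_left h2)]
  exact h3.eq.symm

theorem cal_congr {K : ℂ → A} (hω : 0 ≤ ω) (hθ : θ < Real.pi) (hφ : φ ∈ Ioo ω θ)
    (hh : ∀ z ∈ csector θ, h z = h' z) : cal φ K h = cal φ K h' := by
  unfold cal rayInt
  congr 1
  refine integral_congr_ae ?_
  filter_upwards [ae_ne_zero] with t ht
  rw [hh _ (zpath_mem_csector (hω.trans hφ.1.le) hφ.2 hθ.le ht)]

/-- All values of the functional calculi of `h`. -/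
noncomputable def jetCal (φ : ℝ) (R Rb h : ℂ → A) : Jet A where
  s := cal φ (Knl.S.fn R Rb) h
  sb := cal φ (Knl.Sb.fn R Rb) h
  q := cal φ (Knl.Q.fn R Rb) h
  p := cal φ (Knl.P.fn R Rb) h
  f := cal φ (Knl.F.fn R Rb) h

theorem jetCal_congr (hω : 0 ≤ ω) (hθ : θ < Real.pi) (hφ : φ ∈ Ioo ω θ)
    (hh : ∀ z ∈ csector θ, h z = h' z) : jetCal φ R Rb h = jetCal φ R Rb h' := by
  unfold jetCal
  simp only [cal_congr hω hθ hφ hh]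

variable [CompleteSpace A] [AddCommGroup W] [Module A W]

theorem jetCal_eq_jetCal (hR : ResolventPair ω α β R Rb) (hα : 0 ≤ α) (hω : 0 ≤ ω)
    (hθ : θ < Real.pi) (hh : Decaying α β ω θ R Rb h) {φ' : ℝ} (hφ : φ ∈ Ioo ω θ)
    (hφ' : φ' ∈ Ioo ω θ) : jetCal φ R Rb h = jetCal φ' R Rb h := by
  unfold jetCal
  simp only [cal_eq_cal hR hα hω hθ hh _ hφ hφ']

/-- All values of the functional calculi of the scalar function `e`. -/
noncomputable def jetScalar (hω : 0 ≤ ω) (hθ : θ < Real.pi)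
    (he : ScalarDecaying α β ω θ R Rb e) (hφ : φ ∈ Ioo ω θ) : Jet (resolventRing ω R Rb) where
  s := ⟨_, cal_mem_resolventRing hω hθ he hφ .S⟩
  sb := ⟨_, cal_mem_resolventRing hω hθ he hφ .Sb⟩
  q := ⟨_, cal_mem_resolventRing hω hθ he hφ .Q⟩
  p := ⟨_, cal_mem_resolventRing hω hθ he hφ .P⟩
  f := ⟨_, cal_mem_resolventRing hω hθ he hφ .F⟩

section Rules

variable (hR : ResolventPair ω α β R Rb) (hα : 1 / 3 ≤ α) (hβ : β ≤ 1 / 3) (hω : 0 ≤ ω)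
  (hθ : θ < Real.pi) (he : ScalarDecaying α β ω θ R Rb e) (he' : ScalarDecaying α β ω θ R Rb e')
  (hh : Decaying α β ω θ R Rb h) (hφ : φ ∈ Ioo ω θ)
include hR hα hβ

include hh in
-- All five Leibniz rules at once. They are evaluated at a vector because the values of the operator
-- valued $h$ lie outside the commutative ring.
theorem jetCal_smul_ev (v : W) : (jetCal φ R Rb fun z => e z • h z).ev v =
    (jetScalar hω hθ he hφ).act ((jetCal φ R Rb h).ev v) := by
  ext
  · exact (congrArg (· • v) (cal_S_mul hR hα hβ hω hθ he hh hφ)).trans (mul_smul _ _ _)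
  · exact (congrArg (· • v) (cal_Sb_mul hR hα hβ hω hθ he hh hφ)).trans (mul_smul _ _ _)
  · refine (congrArg (· • v) (cal_Q_mul hR hα hβ hω hθ he hh hφ)).trans ?_
    simp only [add_smul, mul_smul]
    rfl
  · refine (congrArg (· • v) (cal_P_mul hR hα hβ hω hθ he hh hφ)).trans ?_
    simp only [add_smul, mul_smul]
    rfl
  · refine (congrArg (· • v) (cal_F_mul hR hα hβ hω hθ he hh hφ)).trans ?_
    simp only [add_smul, mul_smul]
    rfl

include hh in
-- Both Leibniz rules for the kernel `Q` compute the same operator.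
theorem jetScalar_rel (v : W) : (jetScalar hω hθ he hφ).Rel ((jetCal φ R Rb h).ev v) := by
  have h1 := (cal_Q_mul' hR hα hβ hω hθ he hh hφ).symm.trans (cal_Q_mul hR hα hβ hω hθ he hh hφ)
  have h2 := congrArg (· • v) h1
  simp only [add_smul, mul_smul] at h2
  exact h2

theorem jetScalar_mul : jetScalar hω hθ (he.mul hα hβ hω hθ.le he') hφ =
    (jetScalar hω hθ he hφ).act (jetScalar hω hθ he' hφ) := by
  have e1 : (toOp A fun z => e z * e' z) = fun z => e z • toOp A e' z := by
    funext z
    rw [toOp, toOp, smul_smul]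
  have hh := he'.toOp
  ext
  · exact (congrArg (cal φ _) e1).trans (cal_S_mul hR hα hβ hω hθ he hh hφ)
  · exact (congrArg (cal φ _) e1).trans (cal_Sb_mul hR hα hβ hω hθ he hh hφ)
  · exact (congrArg (cal φ _) e1).trans (cal_Q_mul hR hα hβ hω hθ he hh hφ)
  · exact (congrArg (cal φ _) e1).trans (cal_P_mul hR hα hβ hω hθ he hh hφ)
  · exact (congrArg (cal φ _) e1).trans (cal_F_mul hR hα hβ hω hθ he hh hφ)

theorem jetScalar_rel_jetScalar : (jetScalar hω hθ he hφ).Rel (jetScalar hω hθ he' hφ) :=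
  Subtype.ext ((cal_Q_mul' hR hα hβ hω hθ he he'.toOp hφ).symm.trans
    (cal_Q_mul hR hα hβ hω hθ he he'.toOp hφ))

end Rules

open Jet in
-- The five graphs are unchanged when the regularizer $e'$ is replaced by $ee'$: by the Leibniz
-- rules this is the action of the jet of $e$, covered by the `act` lemmas. `X` and `F` are free up
-- to equality so that factors can be regrouped.
theorem graph_smul_iff (hR : ResolventPair ω α β R Rb) (hα : 1 / 3 ≤ α) (hβ : β ≤ 1 / 3)
    (hω : 0 ≤ ω) (hθ : θ < Real.pi) (hφ : φ ∈ Ioo ω θ) (he : ScalarDecaying α β ω θ R Rb e)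
    (he' : ScalarDecaying α β ω θ R Rb e') (hh : Decaying α β ω θ R Rb h)
    (hs : Function.Injective fun w : W => (jetScalar hω hθ he hφ).s • w)
    (hsb : Function.Injective fun w : W => (jetScalar hω hθ he hφ).sb • w)
    {X : Jet (resolventRing ω R Rb)} {F : Jet W} {v : W}
    (hX : X = jetScalar hω hθ (he.mul hα hβ hω hθ.le he') hφ)
    (hF : F = (jetCal φ R Rb fun z => e z • h z).ev v) (w : W) :
    (GraphS (jetCal φ R Rb (toOp A e')) ((jetCal φ R Rb h).ev v) w ↔ GraphS X F w) ∧
    (GraphSb (jetCal φ R Rb (toOp A e')) ((jetCal φ R Rb h).ev v) w ↔ GraphSb X F w) ∧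
    (GraphQ (jetCal φ R Rb (toOp A e')) ((jetCal φ R Rb h).ev v) w ↔ GraphQ X F w) ∧
    (GraphP (jetCal φ R Rb (toOp A e')) ((jetCal φ R Rb h).ev v) w ↔ GraphP X F w) ∧
    (GraphF (jetCal φ R Rb (toOp A e')) ((jetCal φ R Rb h).ev v) w ↔ GraphF X F w) := by
  let _ := resolventRing.commRing hR
  have r1 := jetScalar_rel_jetScalar hR hα hβ hω hθ he he' hφ
  have r2 := jetScalar_rel hR hα hβ hω hθ he hh hφ v
  have r3 := jetScalar_rel hR hα hβ hω hθ he' hh hφ v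
  rw [hX, hF, jetScalar_mul hR hα hβ hω hθ he he' hφ, jetCal_smul_ev hR hα hβ hω hθ he hh hφ]
  have q1 : GraphQ (jetCal φ R Rb (toOp A e')) ((jetCal φ R Rb h).ev v) w ↔
      GraphQ (jetScalar hω hθ he' hφ) ((jetCal φ R Rb h).ev v) w := by
    unfold GraphQ
    simp only [Subring.smul_def]
    push_cast
    rfl
  have q2 : GraphP (jetCal φ R Rb (toOp A e')) ((jetCal φ R Rb h).ev v) w ↔
      GraphP (jetScalar hω hθ he' hφ) ((jetCal φ R Rb h).ev v) w := by
    unfold GraphP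
    simp only [Subring.smul_def]
    push_cast
    rfl
  have q3 : GraphF (jetCal φ R Rb (toOp A e')) ((jetCal φ R Rb h).ev v) w ↔
      GraphF (jetScalar hω hθ he' hφ) ((jetCal φ R Rb h).ev v) w := by
    unfold GraphF
    simp only [Subring.smul_def]
    push_cast
    rfl
  have q4 : GraphS (jetCal φ R Rb (toOp A e')) ((jetCal φ R Rb h).ev v) w ↔
      GraphS (jetScalar hω hθ he' hφ) ((jetCal φ R Rb h).ev v) w := Iff.rfl
  have q5 : GraphSb (jetCal φ R Rb (toOp A e')) ((jetCal φ R Rb h).ev v) w ↔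
      GraphSb (jetScalar hω hθ he' hφ) ((jetCal φ R Rb h).ev v) w := Iff.rfl
  exact ⟨q4.trans (graphS_act hs).symm, q5.trans (graphSb_act hsb).symm, q1.trans (graphQ_act hs hsb).symm,
    q2.trans (graphP_act hs hsb r1 r2 r3).symm, q3.trans (graphF_act hs hsb r1).symm⟩

/-- The data of a function with a regularizer: the regularizer `r` and its product `h` with the
function. -/
structure Regularized (W : Type*) [AddCommGroup W] [Module A W] (α β ω θ φ : ℝ) (R Rb : ℂ → A)
    (r : ℂ → ℂ) (h : ℂ → A) : Prop where
  mem : φ ∈ Ioo ω θ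
  reg : ScalarDecaying α β ω θ R Rb r
  dec : Decaying α β ω θ R Rb h
  inj : Function.Injective fun w : W => (jetCal φ R Rb (toOp A r)).s • w
  inj' : Function.Injective fun w : W => (jetCal φ R Rb (toOp A r)).sb • w

open Jet in
/-- The product rules for regularized functions. -/
theorem graph_mul (hR : ResolventPair ω α β R Rb) (hα : 1 / 3 ≤ α) (hβ : β ≤ 1 / 3) (hω : 0 ≤ ω)
    (hθ : θ < Real.pi) {φ₁ φ₂ φ₃ : ℝ} {r₁ r₂ r₃ g₁ : ℂ → ℂ} {f₂ h₃ : ℂ → A}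
    (hg : ScalarDecaying α β ω θ R Rb g₁)
    (H₁ : Regularized W α β ω θ φ₁ R Rb r₁ (toOp A g₁))
    (H₂ : Regularized W α β ω θ φ₂ R Rb r₂ f₂) (H₃ : Regularized W α β ω θ φ₃ R Rb r₃ h₃)
    (hrel : ∀ z ∈ csector θ, (r₁ z * r₂ z) • h₃ z = (r₃ z * g₁ z) • f₂ z)
    {X₁ X₂ X₃ G F H : Jet A} (hX₁ : X₁ = jetCal φ₁ R Rb (toOp A r₁))
    (hX₂ : X₂ = jetCal φ₂ R Rb (toOp A r₂)) (hX₃ : X₃ = jetCal φ₃ R Rb (toOp A r₃))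
    (hG : G = jetCal φ₁ R Rb (toOp A g₁)) (hF : F = jetCal φ₂ R Rb f₂)
    (hH : H = jetCal φ₃ R Rb h₃) (v : W) :
    (∀ w₁ w, GraphS X₂ (F.ev v) w₁ → GraphS X₁ (G.ev w₁) w → GraphS X₃ (H.ev v) w) ∧
    (∀ w₁ w₂ w₃ w₄, GraphS X₂ (F.ev v) w₁ → GraphQ X₁ (G.ev w₁) w₂ → GraphQ X₂ (F.ev v) w₃ →
      GraphSb X₁ (G.ev w₃) w₄ → GraphQ X₃ (H.ev v) (w₂ + w₄)) ∧
    (∀ w₁ w₂ w₃ w₄, GraphSb X₂ (F.ev v) w₁ → GraphQ X₁ (G.ev w₁) w₂ → GraphQ X₂ (F.ev v) w₃ →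
      GraphS X₁ (G.ev w₃) w₄ → GraphQ X₃ (H.ev v) (w₂ + w₄)) ∧
    (∀ w₁ w₂ w₃ w₄ w₅ w, GraphS X₂ (F.ev v) w₁ → GraphSb X₂ (F.ev v) w₂ →
      GraphP X₁ (G.ev w₁) w₃ → GraphP X₂ (F.ev v) w₄ → GraphS X₁ (G.ev w₄) w₅ →
      GraphQ X₁ (G.ev (w₁ - w₂)) w → GraphP X₃ (H.ev v) (w₃ + w₅ + w)) ∧
    (∀ w₁ w₂ w₃ w₄ w₅ w, GraphS X₂ (F.ev v) w₁ → GraphF X₁ (G.ev w₁) w₂ →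
      GraphF X₂ (F.ev v) w₃ → GraphS X₁ (G.ev w₃) w₄ → GraphQ X₂ (F.ev v) w₅ →
      GraphQ X₁ (G.ev w₅) w → GraphF X₃ (H.ev v) (w₂ + w₄ - w)) := by
  let _ := resolventRing.commRing hR
  have hα0 : 0 ≤ α := by linarith
  have hφ := H₁.mem
  set φ := φ₁
  -- All jets are moved to the angle $\varphi_1$; this makes the result independent of the chosen
  -- paths.
  rw [jetCal_eq_jetCal hR hα0 hω hθ H₂.reg.toOp H₂.mem hφ] at hX₂
  rw [jetCal_eq_jetCal hR hα0 hω hθ H₃.reg.toOp H₃.mem hφ] at hX₃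
  rw [jetCal_eq_jetCal hR hα0 hω hθ H₂.dec H₂.mem hφ] at hF
  rw [jetCal_eq_jetCal hR hα0 hω hθ H₃.dec H₃.mem hφ] at hH
  have i₁ := H₁.inj
  have i₁' := H₁.inj'
  have i₂ := H₂.inj
  have i₂' := H₂.inj'
  have i₃ := H₃.inj
  have i₃' := H₃.inj'
  rw [jetCal_eq_jetCal hR hα0 hω hθ H₂.reg.toOp H₂.mem hφ] at i₂ i₂'
  rw [jetCal_eq_jetCal hR hα0 hω hθ H₃.reg.toOp H₃.mem hφ] at i₃ i₃'
  have s₁₂ := H₁.reg.mul hα hβ hω hθ.le H₂.reg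
  have s₁₃ := H₁.reg.mul hα hβ hω hθ.le H₃.reg
  have s₂₃ := H₂.reg.mul hα hβ hω hθ.le H₃.reg
  have sρ := s₁₂.mul hα hβ hω hθ.le H₃.reg
  have sg := s₂₃.mul hα hβ hω hθ.le hg
  have df := H₂.dec.smul hα hβ hω hθ.le s₁₃
  have congr' : ∀ {e e' : ℂ → ℂ} (he : ScalarDecaying α β ω θ R Rb e)
      (he' : ScalarDecaying α β ω θ R Rb e'), e = e' →
      jetScalar hω hθ he hφ = jetScalar hω hθ he' hφ := by
    rintro e e' he he' rfl
    rfl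
  have injmul : ∀ {e e' : ℂ → ℂ} (he : ScalarDecaying α β ω θ R Rb e)
      (he' : ScalarDecaying α β ω θ R Rb e'),
      (Function.Injective fun w : W => (jetCal φ R Rb (toOp A e)).s • w) →
      (Function.Injective fun w : W => (jetCal φ R Rb (toOp A e)).sb • w) →
      (Function.Injective fun w : W => (jetCal φ R Rb (toOp A e')).s • w) →
      (Function.Injective fun w : W => (jetCal φ R Rb (toOp A e')).sb • w) →
      (Function.Injective fun w : W => (jetCal φ R Rb (toOp A fun z => e z * e' z)).s • w) ∧
      Function.Injective fun w : W => (jetCal φ R Rb (toOp A fun z => e z * e' z)).sb • w := by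
    intro e e' he he' h1 h2 h3 h4
    have h5 := jetScalar_mul hR hα hβ hω hθ he he' hφ
    have h6 := congrArg (fun J => ((J.s : resolventRing ω R Rb) : A)) h5
    have h7 := congrArg (fun J => ((J.sb : resolventRing ω R Rb) : A)) h5
    change (jetCal φ R Rb (toOp A fun z => e z * e' z)).s = (jetCal φ R Rb (toOp A e)).s *
      (jetCal φ R Rb (toOp A e')).s at h6
    change (jetCal φ R Rb (toOp A fun z => e z * e' z)).sb = (jetCal φ R Rb (toOp A e)).sb *
      (jetCal φ R Rb (toOp A e')).sb at h7
    simp only [h6, h7, mul_smul]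
    exact ⟨h1.comp h3, h2.comp h4⟩
  obtain ⟨i₁₂, i₁₂'⟩ := injmul H₁.reg H₂.reg i₁ i₁' i₂ i₂'
  obtain ⟨i₁₃, i₁₃'⟩ := injmul H₁.reg H₃.reg i₁ i₁' i₃ i₃'
  obtain ⟨i₂₃, i₂₃'⟩ := injmul H₂.reg H₃.reg i₂ i₂' i₃ i₃'
  obtain ⟨iρ, iρ'⟩ := injmul s₁₂ H₃.reg i₁₂ i₁₂' i₃ i₃'
  obtain ⟨i₃₃, i₃₃'⟩ := injmul s₁₂ sρ i₁₂ i₁₂' iρ iρ'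
  -- With $\rho=r_1r_2r_3$, the jets `Z`, `G'` and `F'` belong to $\rho$, to $\rho g$ (written
  -- $r_2r_3\cdot r_1g$) and to $\rho f$ (written $r_1r_3\cdot r_2f$, applied to $v$).
  set Z := jetScalar hω hθ sρ hφ with hZ
  set G' := jetScalar hω hθ sg hφ with hG'
  set F' := (jetCal φ R Rb fun z => (r₁ z * r₃ z) • f₂ z).ev v with hF'
  have rZG : Z.Rel G' := jetScalar_rel_jetScalar hR hα hβ hω hθ sρ sg hφ
  have rZF : Z.Rel F' := jetScalar_rel hR hα hβ hω hθ sρ df hφ v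
  have rGF : G'.Rel F' := jetScalar_rel hR hα hβ hω hθ sg df hφ v
  have k₂ := graph_smul_iff hR hα hβ hω hθ hφ s₁₃ H₂.reg H₂.dec i₁₃ i₁₃' (X := Z) (F := F')
    (congr' _ _ (by funext z; ring)) rfl
  have k₁ := fun w₁ => graph_smul_iff hR hα hβ hω hθ hφ s₂₃ H₁.reg hg.toOp i₂₃ i₂₃' (X := Z)
    (F := G'.ev w₁) (v := w₁) (congr' _ _ (by funext z; ring)) (by
      have : (fun z => (r₂ z * r₃ z) • toOp A g₁ z) = toOp A fun z => r₂ z * r₃ z * g₁ z := by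
        funext z
        rw [toOp, toOp, smul_smul]
      rw [this]
      rfl)
  -- The product is regularized by $\rho^2=(r_1r_2\rho)\,r_3$, since $\rho g\cdot\rho f=\rho^2gf$.
  have k₃ := graph_smul_iff hR hα hβ hω hθ hφ (s₁₂.mul hα hβ hω hθ.le sρ) H₃.reg H₃.dec i₃₃ i₃₃'
    (X := Z.act Z) (F := G'.act F') (v := v) (by
      rw [hZ, ← jetScalar_mul hR hα hβ hω hθ sρ sρ hφ]
      exact congr' _ _ (by funext z; ring)) (by
      rw [hF', hG', ← jetCal_smul_ev hR hα hβ hω hθ sg df hφ]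
      refine congrArg (Jet.ev · v) (jetCal_congr hω hθ hφ fun z hz => ?_)
      have h1 := congrArg ((r₁ z * r₂ z * r₃ z) • ·) (hrel z hz)
      simp only [smul_smul] at h1 ⊢
      rw [show r₁ z * r₂ z * (r₁ z * r₂ z * r₃ z) = r₁ z * r₂ z * r₃ z * (r₁ z * r₂ z) by ring, h1]
      congr 1
      ring)
  subst hX₁ hX₂ hX₃ hG hF hH
  refine ⟨fun w₁ w a b => ?_, fun w₁ w₂ w₃ w₄ a b c d => ?_, fun w₁ w₂ w₃ w₄ a b c d => ?_,
    fun w₁ w₂ w₃ w₄ w₅ w a b c d x y => ?_, fun w₁ w₂ w₃ w₄ w₅ w a b c d x y => ?_⟩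
  · exact (k₃ _).1.2 (graphS_mul ((k₂ _).1.1 a) ((k₁ _ _).1.1 b))
  · exact (k₃ _).2.2.1.2 (graphQ_mul rZG ((k₂ _).1.1 a) ((k₁ _ _).2.2.1.1 b) ((k₂ _).2.2.1.1 c)
      ((k₁ _ _).2.1.1 d))
  · exact (k₃ _).2.2.1.2 (graphQ_mul' rZG rZF rGF ((k₂ _).2.1.1 a) ((k₁ _ _).2.2.1.1 b)
      ((k₂ _).2.2.1.1 c) ((k₁ _ _).1.1 d))
  · exact (k₃ _).2.2.2.1.2 (graphP_mul rZG rZF rGF ((k₂ _).1.1 a) ((k₂ _).2.1.1 b)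
      ((k₁ _ _).2.2.2.1.1 c) ((k₂ _).2.2.2.1.1 d) ((k₁ _ _).1.1 x) ((k₁ _ _).2.2.1.1 y))
  · exact (k₃ _).2.2.2.2.2 (graphF_mul rZG ((k₂ _).1.1 a) ((k₁ _ _).2.2.2.2.1 b)
      ((k₂ _).2.2.2.2.1 c) ((k₁ _ _).1.1 d) ((k₂ _).2.2.1.1 x) ((k₁ _ _).2.2.1.1 y))

end AbstractProduct

end QuatHInfty

namespace QuatHInfty

/-! ### Quaternion units. -/

section QuatUnits

theorem quatUnit_zero : quatUnit 0 = 1 := rfl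

theorem re_quatUnit (i : Fin 4) : (quatUnit i).re = ![1, 0, 0, 0] i := by fin_cases i <;> rfl

theorem imI_quatUnit (i : Fin 4) : (quatUnit i).imI = ![0, 1, 0, 0] i := by fin_cases i <;> rfl

theorem imJ_quatUnit (i : Fin 4) : (quatUnit i).imJ = ![0, 0, 1, 0] i := by fin_cases i <;> rfl

theorem imK_quatUnit (i : Fin 4) : (quatUnit i).imK = ![0, 0, 0, 1] i := by fin_cases i <;> rfl

theorem quatUnit_mul (i j : Fin 4) : quatUnit i * quatUnit j =
    ![![quatUnit 0, quatUnit 1, quatUnit 2, quatUnit 3],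
      ![quatUnit 1, -quatUnit 0, quatUnit 3, -quatUnit 2],
      ![quatUnit 2, -quatUnit 3, -quatUnit 0, quatUnit 1],
      ![quatUnit 3, quatUnit 2, -quatUnit 1, -quatUnit 0]] i j := by
  fin_cases i <;> fin_cases j <;> ext <;>
    simp [re_quatUnit, imI_quatUnit, imJ_quatUnit, imK_quatUnit]

theorem star_quatUnit (i : Fin 4) : star (quatUnit i) = if i = 0 then 1 else -quatUnit i := by
  fin_cases i <;> ext <;> simp [re_quatUnit, imI_quatUnit, imJ_quatUnit, imK_quatUnit]

theorem quat_eq_sum (q : ℍ[ℝ]) : q = ∑ i, ![q.re, q.imI, q.imJ, q.imK] i • quatUnit i := by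
  ext <;> simp [re_quatUnit, imI_quatUnit, imJ_quatUnit, imK_quatUnit, Fin.sum_univ_four]

/-- The component formula applied to left multiplication by a unit: it picks out the coefficient of
$e_k$. -/
theorem quatUnit_component (i k : Fin 4) : ((1 / 4 : ℝ) • quatUnit k) *
    (quatUnit k * (quatUnit i * quatUnit k) -
      ∑ j ∈ Finset.univ.erase k, quatUnit j * (quatUnit i * quatUnit j)) = if i = k then 1 else 0 := by
  rw [Finset.sum_erase_eq_sub (Finset.mem_univ k), Fin.sum_univ_four]
  simp only [quatUnit_mul]
  fin_cases i <;> fin_cases k <;> simp [quatUnit_mul, mul_sub, mul_add] <;> 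
    simp [quatUnit_zero] <;> module

end QuatUnits

/-! ### Components and conjugate of a right linear operator. -/

section Operators

variable {V : Type*} [NormedAddCommGroup V] [NormedSpace ℝ V]
  [Module ℍ[ℝ] V] [Module ℍ[ℝ]ᵐᵒᵖ V] [SMulCommClass ℍ[ℝ]ᵐᵒᵖ ℍ[ℝ] V]
  [IsScalarTower ℝ ℍ[ℝ] V] [IsScalarTower ℝ ℍ[ℝ]ᵐᵒᵖ V]
  [NormSMulClass ℍ[ℝ] V] [NormSMulClass ℍ[ℝ]ᵐᵒᵖ V]

/-- Left multiplication by a quaternion unit, as an opaque function. -/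
noncomputable def unitMul (i : Fin 4) (v : V) : V := quatUnit i • v

theorem unitMul_def (i : Fin 4) (v : V) : unitMul i v = quatUnit i • v := rfl

namespace RightOp

variable (T : RightOp V) {v w : V}

theorem app_of_mem (h : v ∈ T.domain) : T.app v = T.toFun ⟨v, h⟩ := dif_pos h

theorem app_add (hv : v ∈ T.domain) (hw : w ∈ T.domain) : T.app (v + w) = T.app v + T.app w := by
  rw [T.app_of_mem hv, T.app_of_mem hw, T.app_of_mem (add_mem hv hw), ← map_add]
  rfl

theorem app_op_smul (q : ℍ[ℝ]ᵐᵒᵖ) (hv : v ∈ T.domain) : T.app (q • v) = q • T.app v := by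
  rw [T.app_of_mem hv, T.app_of_mem (T.domain.smul_mem q hv), ← map_smul]
  rfl

theorem app_neg (hv : v ∈ T.domain) : T.app (-v) = -T.app v := by
  have := T.app_op_smul (-1) hv
  rwa [neg_one_smul, neg_one_smul] at this

theorem app_zero : T.app 0 = 0 := by
  have := T.app_add T.domain.zero_mem T.domain.zero_mem
  rwa [add_zero, left_eq_add] at this

theorem app_sum {ι : Type*} (s : Finset ι) (f : ι → V) (h : ∀ i ∈ s, f i ∈ T.domain) :
    T.app (∑ i ∈ s, f i) = ∑ i ∈ s, T.app (f i) := by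
  classical
  induction s using Finset.induction_on with
  | empty => simpa using T.app_zero
  | insert a s ha ih =>
    rw [Finset.sum_insert ha, Finset.sum_insert ha,
      T.app_add (h a (Finset.mem_insert_self a s))
        (T.domain.sum_mem fun i hi => h i (Finset.mem_insert_of_mem hi)),
      ih fun i hi => h i (Finset.mem_insert_of_mem hi)]

theorem real_smul_mem (r : ℝ) (hv : v ∈ T.domain) : r • v ∈ T.domain := by
  have := T.domain.smul_mem (r • (1 : ℍ[ℝ]ᵐᵒᵖ)) hv
  rwa [smul_assoc, one_smul] at this

theorem app_real_smul (r : ℝ) (hv : v ∈ T.domain) : T.app (r • v) = r • T.app v := by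
  have := T.app_op_smul (r • (1 : ℍ[ℝ]ᵐᵒᵖ)) hv
  rwa [smul_assoc, smul_assoc, one_smul, one_smul] at this

theorem comp_app (i : Fin 4) (hv : v ∈ T.domain) : (T.comp i).app v =
    ((1 / 4 : ℝ) • quatUnit i) • (quatUnit i • T.app (quatUnit i • v) -
      ∑ j ∈ Finset.univ.erase i, quatUnit j • T.app (quatUnit j • v)) := by
  rw [(T.comp i).app_of_mem hv]
  simp only [T.app_of_mem (T.smul_mem _ hv)]
  change (((1 / 4 : ℝ) • quatUnit i : ℍ[ℝ]) • (T.sandwich (quatUnit i) -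
    ∑ j ∈ Finset.univ.erase i, T.sandwich (quatUnit j))) ⟨v, hv⟩ = _
  rw [LinearMap.smul_apply, LinearMap.sub_apply, LinearMap.sum_apply]
  rfl

theorem conj_app (hv : v ∈ T.domain) :
    T.conj.app v = ∑ i, star (quatUnit i) • (T.comp i).app v := by
  rw [T.conj.app_of_mem hv]
  simp only [fun i => (T.comp i).app_of_mem hv]
  simp only [conj]
  rfl

/-- As $e_0^2=1$ and $e_i^2=-1$ otherwise, the terms $e_jTe_j$ with $j\ne0$ cancel in the sum of the
component formulas, and $T$ remains. -/
theorem app_eq_sum (hv : v ∈ T.domain) : T.app v = ∑ i, quatUnit i • (T.comp i).app v := by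
  simp only [T.comp_app _ hv, Finset.sum_erase_eq_sub (Finset.mem_univ _), Fin.sum_univ_four,
    quatUnit_zero, one_smul]
  simp only [smul_smul, smul_add, smul_sub, mul_smul_comm, smul_mul_assoc, quatUnit_mul, quatUnit_zero]
  simp [smul_assoc, quatUnit_mul]
  simp only [← unitMul_def]
  module

/-- Multiplication by $e_j$ permutes the units up to sign, and the signs in the component formula
are such that the four sandwiched terms are permuted accordingly. So the components commute with
left multiplications, although $T$ need not. -/
theorem comp_app_quatUnit_smul (i j : Fin 4) (hv : v ∈ T.domain) :
    (T.comp i).app (quatUnit j • v) = quatUnit j • (T.comp i).app v := by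
  simp only [T.comp_app _ hv, T.comp_app _ (T.smul_mem _ hv),
    Finset.sum_erase_eq_sub (Finset.mem_univ _), Fin.sum_univ_four]
  simp only [smul_smul, smul_add, smul_sub, mul_smul_comm, smul_mul_assoc, quatUnit_mul]
  fin_cases i <;> fin_cases j <;>
    simp [smul_assoc, quatUnit_mul, quatUnit_zero, T.app_neg, hv, T.smul_mem] <;>
    simp only [← unitMul_def] <;> module

theorem comp_app_smul (i : Fin 4) (q : ℍ[ℝ]) (hv : v ∈ T.domain) :
    (T.comp i).app (q • v) = q • (T.comp i).app v := by
  rw [quat_eq_sum q, Finset.sum_smul, Finset.sum_smul]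
  rw [(T.comp i).app_sum _ _ fun j _ => by rw [smul_assoc]; exact T.real_smul_mem _ (T.smul_mem _ hv)]
  refine Finset.sum_congr rfl fun j _ => ?_
  rw [smul_assoc, (T.comp i).app_real_smul _ (T.smul_mem _ hv), T.comp_app_quatUnit_smul i j hv,
    smul_assoc]

theorem conj_comp_app (i : Fin 4) (hv : v ∈ T.domain) :
    (T.conj.comp i).app v = (if i = 0 then (1 : ℝ) else -1) • (T.comp i).app v := by
  have h1 : ∀ j, T.conj.app (quatUnit j • v) =
      ∑ k, (star (quatUnit k) * quatUnit j) • (T.comp k).app v := by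
    intro j
    rw [T.conj_app (T.smul_mem _ hv)]
    refine Finset.sum_congr rfl fun k _ => ?_
    rw [T.comp_app_smul k _ hv, smul_smul]
  have h2 : (T.conj.comp i).app v = ∑ k, (((1 / 4 : ℝ) • quatUnit i) *
      (quatUnit i * (star (quatUnit k) * quatUnit i) -
      ∑ j ∈ Finset.univ.erase i, quatUnit j * (star (quatUnit k) * quatUnit j))) •
        (T.comp k).app v := by
    rw [T.conj.comp_app i hv]
    simp only [h1]
    simp only [Finset.smul_sum, mul_smul, sub_smul, Finset.sum_smul, smul_sub,
      Finset.sum_sub_distrib]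
    rw [Finset.sum_comm (t := Finset.univ)]
  have h3 : ∀ k : Fin 4, ∃ r : ℝ, r = (if k = 0 then (1 : ℝ) else -1) ∧
      star (quatUnit k) = r • quatUnit k := by
    intro k
    refine ⟨_, rfl, ?_⟩
    rw [star_quatUnit]
    split_ifs with h
    · rw [h, one_smul, quatUnit_zero]
    · rw [neg_one_smul]
  rw [h2, Finset.sum_eq_single i]
  · obtain ⟨r, hr, hr'⟩ := h3 i
    rw [← hr, hr']
    simp only [smul_mul_assoc, mul_smul_comm, ← Finset.smul_sum, ← smul_sub]
    have := quatUnit_component i i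
    rw [if_pos rfl, smul_mul_assoc] at this
    rw [this, smul_assoc, one_smul]
  · intro k _ hk
    obtain ⟨r, hr, hr'⟩ := h3 k
    rw [hr']
    simp only [smul_mul_assoc, mul_smul_comm, ← Finset.smul_sum, ← smul_sub]
    have := quatUnit_component k i
    rw [if_neg hk, smul_mul_assoc] at this
    rw [this, smul_zero, zero_smul]
  · simp

theorem conj_conj_app (hv : v ∈ T.domain) : T.conj.conj.app v = T.app v := by
  rw [T.conj.conj_app hv, T.app_eq_sum hv]
  refine Finset.sum_congr rfl fun i _ => ?_
  rw [T.conj_comp_app i hv, star_quatUnit]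
  split_ifs with h
  · rw [h, one_smul, one_smul, quatUnit_zero, one_smul]
  · rw [neg_one_smul, neg_smul, smul_neg, neg_neg]

theorem conj_comp_app_app (i j : Fin 4) (hv : v ∈ T.domain) (h : (T.comp j).app v ∈ T.domain) :
    (T.conj.comp i).app ((T.conj.comp j).app v) = ((if i = 0 then (1 : ℝ) else -1) *
      (if j = 0 then (1 : ℝ) else -1)) • (T.comp i).app ((T.comp j).app v) := by
  rw [T.conj_comp_app j hv, T.conj_comp_app i (T.real_smul_mem _ h),
    (T.comp i).app_real_smul _ h, smul_smul]

theorem conj_normSq (hv : v ∈ T.normSqDomain) : T.conj.normSq v = T.normSq v := by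
  unfold normSq
  refine Finset.sum_congr rfl fun i _ => ?_
  rw [T.conj_comp_app_app i i hv.1 (hv.2 i)]
  split_ifs <;> simp

/-- Conjugation only changes the signs of $T_1,T_2,T_3$, which enter $Q$ through their squares.
Hence $T$ and $\overline T$ share $Q$ and its inverse. -/
theorem conj_Q (s : ℍ[ℝ]) (hv : v ∈ T.normSqDomain) : T.conj.Q s v = T.Q s v := by
  unfold Q
  rw [T.conj_normSq hv, T.conj_comp_app 0 hv.1, if_pos rfl, one_smul]

variable {T} {D : Submodule ℝ V}

end RightOp

end Operators

end QuatHInfty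

/-! ### The complex structure given by right multiplication, and algebra on the domains. -/

namespace QuatHInfty

/-- The complex vector space given by the right multiplication with `x + e₁ y`. -/
def CV (V : Type*) := V

section ComplexStructure

variable {V : Type*} [NormedAddCommGroup V] [NormedSpace ℝ V]
  [Module ℍ[ℝ] V] [Module ℍ[ℝ]ᵐᵒᵖ V] [SMulCommClass ℍ[ℝ]ᵐᵒᵖ ℍ[ℝ] V]
  [IsScalarTower ℝ ℍ[ℝ] V] [IsScalarTower ℝ ℍ[ℝ]ᵐᵒᵖ V]
  [NormSMulClass ℍ[ℝ] V] [NormSMulClass ℍ[ℝ]ᵐᵒᵖ V]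

/-- The complex plane spanned by `1`, `e₁`, in the opposite algebra. -/
noncomputable def opComplex : ℂ →+* ℍ[ℝ]ᵐᵒᵖ :=
  (Quaternion.ofComplex : ℂ →+* ℍ[ℝ]).toOpposite fun x y => by
    rw [Commute, SemiconjBy, ← map_mul, ← map_mul, mul_comm]

theorem opComplex_apply (z : ℂ) : opComplex z = MulOpposite.op (z : ℍ[ℝ]) := rfl

theorem norm_coeComplex (z : ℂ) : ‖(z : ℍ[ℝ])‖ = ‖z‖ := by
  have h1 : ‖(z : ℍ[ℝ])‖ * ‖(z : ℍ[ℝ])‖ = ‖z‖ * ‖z‖ := by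
    rw [← Quaternion.normSq_eq_norm_mul_self, Complex.norm_mul_self_eq_normSq, Quaternion.normSq_def',
      Complex.normSq_apply]
    simp
    ring
  exact (mul_self_inj (norm_nonneg _) (norm_nonneg _)).1 h1

instance CV.instNormedAddCommGroup : NormedAddCommGroup (CV V) :=
  inferInstanceAs (NormedAddCommGroup V)

instance CV.instCompleteSpace [CompleteSpace V] : CompleteSpace (CV V) :=
  inferInstanceAs (CompleteSpace V)

noncomputable instance CV.instModuleLeft : Module ℍ[ℝ] (CV V) :=
  inferInstanceAs (Module ℍ[ℝ] V)

noncomputable instance CV.instModuleRight : Module ℍ[ℝ]ᵐᵒᵖ (CV V) :=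
  inferInstanceAs (Module ℍ[ℝ]ᵐᵒᵖ V)

instance CV.instSMulCommClass : SMulCommClass ℍ[ℝ]ᵐᵒᵖ ℍ[ℝ] (CV V) :=
  inferInstanceAs (SMulCommClass ℍ[ℝ]ᵐᵒᵖ ℍ[ℝ] V)

instance CV.instNormSMulClassLeft : NormSMulClass ℍ[ℝ] (CV V) :=
  inferInstanceAs (NormSMulClass ℍ[ℝ] V)

instance CV.instNormSMulClassRight : NormSMulClass ℍ[ℝ]ᵐᵒᵖ (CV V) :=
  inferInstanceAs (NormSMulClass ℍ[ℝ]ᵐᵒᵖ V)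

noncomputable instance CV.instModule : Module ℂ (CV V) := Module.compHom (CV V) opComplex

theorem CV.smul_def (z : ℂ) (v : CV V) : z • v = opComplex z • v := rfl

noncomputable instance CV.instNormedSpace : NormedSpace ℂ (CV V) where
  norm_smul_le z v := by
    rw [CV.smul_def, norm_smul, opComplex_apply, MulOpposite.norm_op, norm_coeComplex]

/-- A vector as an element of the complex space. -/
def CV.of (v : V) : CV V := v

/-- An element of the complex space as a vector. -/
def CV.out (v : CV V) : V := v

theorem CV.out_real_smul (r : ℝ) (v : CV V) : ((r : ℂ) • v).out = r • v.out := by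
  have h : MulOpposite.op (r : ℍ[ℝ]) = r • (1 : ℍ[ℝ]ᵐᵒᵖ) := by
    rw [← MulOpposite.op_one, ← MulOpposite.op_smul]
    congr 1
    ext <;> simp
  have h2 : (r • (1 : ℍ[ℝ]ᵐᵒᵖ)) • v.out = r • v.out := by rw [smul_assoc, one_smul]
  rw [← h2, ← h, ← Quaternion.coeComplex_coe]
  rfl

variable (V) in
/-- Left multiplication as a complex linear map. -/
noncomputable def lmul : ℍ[ℝ] →+* Module.End ℂ (CV V) where
  toFun q :=
    { toFun := fun v => q • v
      map_add' := fun v w => smul_add q v w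
      map_smul' := fun z v => (smul_comm (opComplex z) q v).symm }
  map_one' := LinearMap.ext fun v => one_smul ℍ[ℝ] v
  map_mul' q r := LinearMap.ext fun v => mul_smul q r v
  map_zero' := LinearMap.ext fun v => zero_smul ℍ[ℝ] v
  map_add' q r := LinearMap.ext fun v => add_smul q r v

theorem lmul_apply (q : ℍ[ℝ]) (v : CV V) : lmul V q v = q • v := rfl

theorem lmul_real (r : ℝ) (v : CV V) : lmul V r v = (r : ℂ) • v := by
  have h : (r : ℍ[ℝ]) = r • (1 : ℍ[ℝ]) := by ext <;> simp
  have h2 : (r • (1 : ℍ[ℝ])) • v.out = r • v.out := by rw [smul_assoc, one_smul]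
  rw [h]
  exact h2.trans (CV.out_real_smul r v).symm

namespace RightOp

variable (T : RightOp V)

/-- The domain as a complex subspace. -/
noncomputable def cdom : Submodule ℂ (CV V) where
  carrier := (T.domain : Set V)
  add_mem' := T.domain.add_mem
  zero_mem' := T.domain.zero_mem
  smul_mem' z _ hv := T.domain.smul_mem (opComplex z) hv

/-- An arbitrary linear extension to the whole space allows computations in the ring of
endomorphisms. Its values off the domain are never used. -/
theorem exists_extension : ∃ t : Module.End ℂ (CV V), ∀ v ∈ T.cdom, t v = T.app v := by
  let f : T.cdom →ₗ[ℂ] CV V :=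
    { toFun := fun v => T.app (v : CV V)
      map_add' := fun v w => T.app_add v.2 w.2
      map_smul' := fun z v => T.app_op_smul (opComplex z) v.2 }
  obtain ⟨t, ht⟩ := f.exists_extend
  exact ⟨t, fun v hv => LinearMap.congr_fun ht ⟨v, hv⟩⟩

/-- Some complex linear extension of `T_i`. -/
noncomputable def ext (i : Fin 4) : Module.End ℂ (CV V) := (T.comp i).exists_extension.choose

variable {T} {D : Submodule ℝ V}

theorem ext_apply (i : Fin 4) {v : CV V} (hv : v ∈ T.cdom) : T.ext i v = (T.comp i).app v :=
  (T.comp i).exists_extension.choose_spec v hv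

theorem lmul_mem (q : ℍ[ℝ]) {v : CV V} (hv : v ∈ T.cdom) : lmul V q v ∈ T.cdom :=
  T.smul_mem q hv

theorem ext_lmul (i : Fin 4) (q : ℍ[ℝ]) {v : CV V} (hv : v ∈ T.cdom) :
    T.ext i (lmul V q v) = lmul V q (T.ext i v) := by
  rw [ext_apply i (lmul_mem q hv), ext_apply i hv]
  exact T.comp_app_smul i q hv

variable (T) in
/-- A complex linear extension of `T`. -/
noncomputable def extT : Module.End ℂ (CV V) := ∑ i, lmul V (quatUnit i) * T.ext i

variable (T) in
/-- A complex linear extension of the conjugate of `T`. -/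
noncomputable def extTb : Module.End ℂ (CV V) := ∑ i, lmul V (star (quatUnit i)) * T.ext i

variable (T) in
/-- A complex linear extension of `|T|²`. -/
noncomputable def extN : Module.End ℂ (CV V) := ∑ i, T.ext i * T.ext i

theorem extT_apply {v : CV V} (hv : v ∈ T.cdom) : T.extT v = T.app v := by
  rw [T.app_eq_sum hv, extT, LinearMap.sum_apply]
  refine Finset.sum_congr rfl fun i _ => ?_
  rw [Module.End.mul_apply, ext_apply i hv]
  rfl

theorem extTb_apply {v : CV V} (hv : v ∈ T.cdom) : T.extTb v = T.conj.app v := by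
  rw [T.conj_app hv, extTb, LinearMap.sum_apply]
  refine Finset.sum_congr rfl fun i _ => ?_
  rw [Module.End.mul_apply, ext_apply i hv]
  rfl

theorem extT_add_extTb : T.extT + T.extTb = (2 : ℂ) • T.ext 0 := by
  simp only [extT, extTb, star_quatUnit, Fin.sum_univ_four, quatUnit_zero]
  simp
  module

/-- The complex version of the domain `D`. -/
noncomputable def IsAdmissible.dom (h : T.IsAdmissible D) : Submodule ℂ (CV V) where
  carrier := (D : Set V)
  add_mem' := D.add_mem
  zero_mem' := D.zero_mem
  smul_mem' z v hv := (h.smul_mem (z : ℍ[ℝ]) v hv).2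

section Admissible

variable (h : T.IsAdmissible D)
include h

theorem IsAdmissible.le_cdom {v : CV V} (hv : v ∈ h.dom) : v ∈ T.cdom := (h.le_domain v hv).1

theorem IsAdmissible.lmul_mem_dom (q : ℍ[ℝ]) {v : CV V} (hv : v ∈ h.dom) : lmul V q v ∈ h.dom :=
  (h.smul_mem q v hv).1

theorem IsAdmissible.ext_mem {v : CV V} (hv : v ∈ h.dom) (i : Fin 4) : T.ext i v ∈ T.cdom := by
  rw [ext_apply i (h.le_cdom hv)]
  exact (h.le_domain v hv).2 i

theorem IsAdmissible.ext_ext {v : CV V} (hv : v ∈ h.dom) (i j : Fin 4) :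
    T.ext i (T.ext j v) = T.ext j (T.ext i v) := by
  rw [ext_apply i (h.ext_mem hv j), ext_apply j (h.ext_mem hv i), ext_apply i (h.le_cdom hv),
    ext_apply j (h.le_cdom hv)]
  exact h.isKC.2 v (h.le_domain v hv) i j

theorem IsAdmissible.extN_apply {v : CV V} (hv : v ∈ h.dom) : T.extN v = T.normSq v := by
  rw [extN, LinearMap.sum_apply]
  refine Finset.sum_congr rfl fun i _ => ?_
  rw [Module.End.mul_apply, ext_apply i (h.ext_mem hv i), ext_apply i (h.le_cdom hv)]

theorem IsAdmissible.extT_mem {v : CV V} (hv : v ∈ h.dom) : T.extT v ∈ T.cdom := by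
  rw [extT, LinearMap.sum_apply]
  exact sum_mem fun i _ => lmul_mem _ (h.ext_mem hv i)

theorem IsAdmissible.extTb_mem {v : CV V} (hv : v ∈ h.dom) : T.extTb v ∈ T.cdom := by
  rw [extTb, LinearMap.sum_apply]
  exact sum_mem fun i _ => lmul_mem _ (h.ext_mem hv i)

/-- The components commute with each other on $D$ and with left multiplications, so the mixed terms
cancel in pairs as in $\bar q q=|q|^2$. -/
theorem IsAdmissible.extTb_extT {v : CV V} (hv : v ∈ h.dom) : T.extTb (T.extT v) = T.extN v := by
  have c := h.ext_ext hv
  have e : T.extTb (T.extT v) =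
      ∑ i, ∑ j, lmul V (star (quatUnit i) * quatUnit j) (T.ext i (T.ext j v)) := by
    simp only [extT, extTb, LinearMap.sum_apply, Module.End.mul_apply, map_sum, map_mul,
      ext_lmul _ _ (h.ext_mem hv _)]
    exact Finset.sum_comm
  rw [e]
  simp only [extN, Fin.sum_univ_four, star_quatUnit,
    c 1 0, c 2 0, c 3 0, c 2 1, c 3 1, c 3 2]
  simp [quatUnit_mul, quatUnit_zero, -map_mul]
  abel

theorem IsAdmissible.extT_extTb {v : CV V} (hv : v ∈ h.dom) : T.extT (T.extTb v) = T.extN v := by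
  have c := h.ext_ext hv
  have e : T.extT (T.extTb v) =
      ∑ i, ∑ j, lmul V (quatUnit i * star (quatUnit j)) (T.ext i (T.ext j v)) := by
    simp only [extT, extTb, LinearMap.sum_apply, Module.End.mul_apply, map_sum, map_mul,
      ext_lmul _ _ (h.ext_mem hv _)]
    exact Finset.sum_comm
  rw [e]
  simp only [extN, Fin.sum_univ_four, star_quatUnit,
    c 1 0, c 2 0, c 3 0, c 2 1, c 3 1, c 3 2]
  simp [quatUnit_mul, quatUnit_zero, -map_mul]
  abel

variable (T) in
/-- The operator `z² - 2 z T_0 + |T|²` with a complex number `z` that multiplies from the right. -/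
noncomputable def extQ (z : ℂ) : Module.End ℂ (CV V) := z ^ 2 • 1 - (2 * z) • T.ext 0 + T.extN

omit h in
theorem extQ_apply (z : ℂ) (v : CV V) :
    T.extQ z v = z ^ 2 • v - (2 * z) • T.ext 0 v + T.extN v := rfl

theorem IsAdmissible.extN_lmul (q : ℍ[ℝ]) {v : CV V} (hv : v ∈ h.dom) :
    T.extN (lmul V q v) = lmul V q (T.extN v) := by
  simp only [extN, LinearMap.sum_apply, Module.End.mul_apply, map_sum, ext_lmul _ _ (h.le_cdom hv),
    ext_lmul _ _ (h.ext_mem hv _)]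

theorem IsAdmissible.extQ_lmul (z : ℂ) (q : ℍ[ℝ]) {v : CV V} (hv : v ∈ h.dom) :
    T.extQ z (lmul V q v) = lmul V q (T.extQ z v) := by
  simp only [extQ_apply, h.extN_lmul q hv, ext_lmul _ _ (h.le_cdom hv), map_add, map_sub, map_smul]

/-- If $Q(z)v$ lies in $\operatorname{dom}(T)$ then so does $|T|^2v$, and the assumption on $D$ puts
$T_iv$ into $D$. This is what makes $T_i$ commute with $Q(z)^{-1}$ on $\operatorname{dom}(T)$. -/
theorem IsAdmissible.extQ_ext {z : ℂ} {v : CV V} (hv : v ∈ h.dom) (hQ : T.extQ z v ∈ T.cdom)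
    (i : Fin 4) : T.ext i v ∈ h.dom ∧ T.extQ z (T.ext i v) = T.ext i (T.extQ z v) := by
  have hN : T.extN v ∈ T.cdom := by
    have : T.extN v = T.extQ z v - z ^ 2 • v + (2 * z) • T.ext 0 v := by
      rw [extQ_apply]
      abel
    rw [this]
    exact add_mem (sub_mem hQ (T.cdom.smul_mem _ (h.le_cdom hv))) (T.cdom.smul_mem _ (h.ext_mem hv 0))
  have hi : ∀ i, T.ext i v ∈ h.dom := by
    intro i
    rw [ext_apply i (h.le_cdom hv)]
    rw [h.extN_apply hv] at hN
    exact h.comp_mem i v hv hN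
  refine ⟨hi i, ?_⟩
  have e : T.extN (T.ext i v) = T.ext i (T.extN v) := by
    simp only [extN, LinearMap.sum_apply, Module.End.mul_apply, map_sum]
    refine Finset.sum_congr rfl fun k _ => ?_
    rw [h.ext_ext hv k i, h.ext_ext (hi k) k i]
  simp only [extQ_apply, map_add, map_sub, map_smul, e, h.ext_ext hv 0 i]

end Admissible

end RightOp

end ComplexStructure

end QuatHInfty

namespace QuatHInfty

/-! ### The complex resolvents of an operator and of its conjugate. -/

section Resolvents

open Complex

variable {V : Type*} [NormedAddCommGroup V] [NormedSpace ℝ V]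
  [Module ℍ[ℝ] V] [Module ℍ[ℝ]ᵐᵒᵖ V] [SMulCommClass ℍ[ℝ]ᵐᵒᵖ ℍ[ℝ] V]
  [IsScalarTower ℝ ℍ[ℝ] V] [IsScalarTower ℝ ℍ[ℝ]ᵐᵒᵖ V]
  [NormSMulClass ℍ[ℝ] V] [NormSMulClass ℍ[ℝ]ᵐᵒᵖ V]

theorem mul_self_of_mem_imagSphere {J : ℍ[ℝ]} (hJ : J ∈ imagSphere) : J * J = -1 := by
  have h := Quaternion.sq_eq_neg_normSq.2 hJ.1
  rw [Quaternion.normSq_eq_norm_mul_self, hJ.2] at h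
  rw [← sq, h]
  simp

theorem neg_mem_imagSphere {J : ℍ[ℝ]} (hJ : J ∈ imagSphere) : -J ∈ imagSphere := by
  refine ⟨?_, ?_⟩
  · simp [hJ.1]
  · rw [norm_neg, hJ.2]

theorem quatUnit_one_mem_imagSphere : quatUnit 1 ∈ imagSphere := by
  refine ⟨by simp [re_quatUnit], ?_⟩
  have h1 : ‖quatUnit 1‖ * ‖quatUnit 1‖ = 1 := by
    rw [← Quaternion.normSq_eq_norm_mul_self, Quaternion.normSq_def']
    simp [re_quatUnit, imI_quatUnit, imJ_quatUnit, imK_quatUnit]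
  nlinarith [norm_nonneg (quatUnit 1)]

theorem slicePt_neg (J : ℍ[ℝ]) (x y : ℝ) : slicePt (-J) x y = slicePt J x (-y) := by
  simp [slicePt]

variable (V) in
/-- The projection onto the subspace of all `v` with `J v = v e₁`. -/
noncomputable def halfP (J : ℍ[ℝ]) : Module.End ℂ (CV V) := (1 / 2 : ℂ) • (1 - I • lmul V J)

theorem halfP_apply (J : ℍ[ℝ]) (v : CV V) :
    halfP V J v = (1 / 2 : ℂ) • (v - I • lmul V J v) := rfl

theorem halfP_add (J : ℍ[ℝ]) (v : CV V) : halfP V J v + halfP V (-J) v = v := by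
  rw [halfP_apply, halfP_apply, map_neg, LinearMap.neg_apply]
  module

/-- Left multiplication by $J$ is complex linear with square $-1$, so $\frac12(1-iJ)$ maps into its
eigenspace for $i$. -/
theorem lmul_halfP {J : ℍ[ℝ]} (hJ : J ∈ imagSphere) (v : CV V) :
    lmul V J (halfP V J v) = I • halfP V J v := by
  have h1 : lmul V J (lmul V J v) = -v := by
    rw [← Module.End.mul_apply, ← map_mul, mul_self_of_mem_imagSphere hJ, map_neg, map_one]
    rfl
  rw [halfP_apply, map_smul, map_sub, map_smul, h1]
  have h2 : I * I = -1 := I_mul_I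
  linear_combination (norm := module) (1 / 2 : ℂ) • congrArg (· • lmul V J v) h2

theorem lmul_slicePt {J : ℍ[ℝ]} {z : ℂ} {v : CV V} (h : lmul V J v = I • v) :
    lmul V (slicePt J z.re z.im) v = z • v := by
  rw [slicePt, map_add, map_mul, LinearMap.add_apply, Module.End.mul_apply, h, lmul_real, lmul_real,
    smul_smul, ← add_smul, re_add_im]

namespace RightOp

variable {T : RightOp V} {D : Submodule ℝ V} (h : T.IsAdmissible D)
include h

theorem IsAdmissible.halfP_mem (J : ℍ[ℝ]) {v : CV V} (hv : v ∈ h.dom) : halfP V J v ∈ h.dom :=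
  h.dom.smul_mem _ (sub_mem hv (h.dom.smul_mem _ (h.lmul_mem_dom J hv)))

theorem IsAdmissible.Q_eq (s : ℍ[ℝ]) {v : CV V} (hv : v ∈ h.dom) :
    T.Q s v = lmul V (s ^ 2) v - lmul V (2 * s) (T.ext 0 v) + T.extN v := by
  rw [h.extN_apply hv, ext_apply 0 (h.le_cdom hv)]
  rfl

/-- On the eigenspace $Jv=iv$, which $T_0$ preserves, left multiplication by $x+Jy$ is the complex
scalar $z$. -/
theorem IsAdmissible.Q_slicePt {J : ℍ[ℝ]} {z : ℂ} {v : CV V} (hv : v ∈ h.dom)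
    (hJ : lmul V J v = I • v) : T.Q (slicePt J z.re z.im) v = T.extQ z v := by
  have h1 : lmul V J (T.ext 0 v) = I • T.ext 0 v := by
    rw [← ext_lmul 0 J (h.le_cdom hv), hJ, map_smul]
  have h2 : ∀ x : CV V, lmul V 2 x = (2 : ℂ) • x := fun x => by
    rw [two_smul, ← one_add_one_eq_two, map_add, map_one]
    rfl
  rw [h.Q_eq _ hv, extQ_apply, sq, map_mul, map_mul, Module.End.mul_apply,
    Module.End.mul_apply, lmul_slicePt hJ, lmul_slicePt h1, map_smul, lmul_slicePt hJ, smul_smul, sq,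
    h2, smul_smul]

variable (T D) in
omit h in
/-- The spheres in the resolvent set. -/
def Regular (z : ℂ) : Prop := ∀ J ∈ imagSphere, slicePt J z.re z.im ∈ T.resolventSet D

omit h in
theorem Regular.conj {z : ℂ} (hz : T.Regular D z) : T.Regular D (starRingEnd ℂ z) := by
  intro J hJ
  have := hz (-J) (neg_mem_imagSphere hJ)
  rwa [slicePt_neg] at this

/-- The space is the sum of the eigenspaces for $J=e_1$ and $J=-e_1$. On each of them the operator
coincides with $Q$ at the quaternion $x+Jy$, which is bijective. -/
theorem IsAdmissible.bijective_extQ {z : ℂ} (hz : T.Regular D z) :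
    Function.Bijective ((T.extQ z).domRestrict h.dom) := by
  have key : ∀ J ∈ imagSphere, ∀ v ∈ h.dom, T.extQ z v = 0 → halfP V J v = 0 := by
    intro J hJ v hv h0
    have hm := h.halfP_mem J hv
    have h1 : T.extQ z (halfP V J v) = 0 := by
      simp only [halfP_apply, map_smul, map_sub, h.extQ_lmul z J hv, h0, map_zero, smul_zero, sub_zero]
    rw [← h.Q_slicePt hm (lmul_halfP hJ v)] at h1
    refine (hz J hJ).injOn hm h.dom.zero_mem (h1.trans ?_)
    rw [h.Q_eq _ h.dom.zero_mem]
    simp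
  refine ⟨?_, fun w => ?_⟩
  · rw [← LinearMap.ker_eq_bot, LinearMap.ker_eq_bot']
    intro v hv
    have hJ := quatUnit_one_mem_imagSphere
    refine Subtype.ext ?_
    rw [← halfP_add (quatUnit 1) (v : CV V), key _ hJ v v.2 hv,
      key _ (neg_mem_imagSphere hJ) v v.2 hv, add_zero]
    rfl
  · have key2 : ∀ J ∈ imagSphere, ∃ u ∈ h.dom, T.extQ z u = halfP V J w := by
      intro J hJ
      obtain ⟨u, hu, hu'⟩ : ∃ u : CV V, u ∈ h.dom ∧
          CV.of (T.Q (slicePt J z.re z.im) u) = halfP V J w :=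
        (hz J hJ).surjOn (mem_univ (halfP V J w))
      refine ⟨u, hu, ?_⟩
      set s := slicePt J z.re z.im with hs
      have hc : s * J = J * s := by
        rw [hs, slicePt, add_mul, mul_add, (Quaternion.coe_commutes z.re J), ← mul_assoc J,
          ← Quaternion.coe_commutes z.im J]
      -- The solution inherits the eigenvalue equation from the right side: $Q_{c,s}(T)$ commutes
      -- with left multiplication by $J$, as $sJ=Js$, and with right multiplications, and it is
      -- injective.
      have e : lmul V J u = I • u := by
        refine (hz J hJ).injOn (h.lmul_mem_dom J hu) (h.dom.smul_mem I hu) ?_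
        have h1 : CV.of (T.Q s (lmul V J u)) = lmul V J (CV.of (T.Q s u)) := by
          rw [CV.of, CV.of, h.Q_eq s (h.lmul_mem_dom J hu), h.Q_eq s hu, ext_lmul 0 J (h.le_cdom hu),
            h.extN_lmul J hu]
          simp only [map_add, map_sub, ← Module.End.mul_apply, ← map_mul]
          have c1 : s ^ 2 * J = J * s ^ 2 := by rw [sq, mul_assoc, hc, ← mul_assoc, hc, mul_assoc]
          have c2 : 2 * s * J = J * (2 * s) := by
            rw [mul_assoc, hc, ← mul_assoc, ← mul_assoc, (Commute.ofNat_left 2 J).eq]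
          rw [c1, ← mul_assoc, ← mul_assoc, ← map_mul, ← map_mul, c2]
        have h2 : CV.of (T.Q s (I • u)) = I • CV.of (T.Q s u) := by
          rw [CV.of, CV.of, h.Q_eq s (h.dom.smul_mem I hu), h.Q_eq s hu]
          simp only [map_smul, smul_add, smul_sub]
        exact h1.trans (by rw [hu', lmul_halfP hJ, ← hu', ← h2]; rfl)
      exact (h.Q_slicePt hu e).symm.trans hu'
    have hJ := quatUnit_one_mem_imagSphere
    obtain ⟨u, hu, hu'⟩ := key2 _ hJ
    obtain ⟨u', hm, hm'⟩ := key2 _ (neg_mem_imagSphere hJ)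
    refine ⟨⟨u + u', add_mem hu hm⟩, ?_⟩
    rw [LinearMap.domRestrict_apply, map_add, hu', hm', halfP_add]

open Classical in
/-- The inverse of `z² - 2 z T_0 + |T|²`. -/
noncomputable def IsAdmissible.QI (z : ℂ) : Module.End ℂ (CV V) :=
  if hz : Function.Bijective ((T.extQ z).domRestrict h.dom) then
    h.dom.subtype ∘ₗ (LinearEquiv.ofBijective _ hz).symm.toLinearMap else 0

section QI

variable {z : ℂ} (hz : T.Regular D z)
include hz

theorem IsAdmissible.QI_mem (w : CV V) : h.QI z w ∈ h.dom := by
  rw [QI, dif_pos (h.bijective_extQ hz)]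
  exact Subtype.prop _

theorem IsAdmissible.extQ_QI (w : CV V) : T.extQ z (h.QI z w) = w := by
  rw [QI, dif_pos (h.bijective_extQ hz)]
  exact (LinearEquiv.ofBijective _ (h.bijective_extQ hz)).apply_symm_apply w

theorem IsAdmissible.QI_eq {u w : CV V} (hu : u ∈ h.dom) (hw : T.extQ z u = w) :
    h.QI z w = u := by
  have := (h.bijective_extQ hz).1 (a₁ := ⟨_, h.QI_mem hz w⟩) (a₂ := ⟨u, hu⟩)
    ((h.extQ_QI hz w).trans hw.symm)
  exact congrArg Subtype.val this

theorem IsAdmissible.QI_lmul (q : ℍ[ℝ]) (w : CV V) : h.QI z (lmul V q w) = lmul V q (h.QI z w) :=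
  h.QI_eq hz (h.lmul_mem_dom q (h.QI_mem hz w)) (by rw [h.extQ_lmul z q (h.QI_mem hz w), h.extQ_QI hz])

theorem IsAdmissible.ext_QI_mem (i : Fin 4) {w : CV V} (hw : w ∈ T.cdom) :
    T.ext i (h.QI z w) ∈ h.dom :=
  (h.extQ_ext (h.QI_mem hz w) (by rwa [h.extQ_QI hz]) i).1

theorem IsAdmissible.QI_ext (i : Fin 4) {w : CV V} (hw : w ∈ T.cdom) :
    h.QI z (T.ext i w) = T.ext i (h.QI z w) :=
  h.QI_eq hz (h.ext_QI_mem hz i hw) (by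
    rw [(h.extQ_ext (h.QI_mem hz w) (by rwa [h.extQ_QI hz]) i).2, h.extQ_QI hz])

theorem IsAdmissible.QI_extT {w : CV V} (hw : w ∈ T.cdom) :
    h.QI z (T.extT w) = T.extT (h.QI z w) := by
  simp only [extT, LinearMap.sum_apply, Module.End.mul_apply, map_sum, h.QI_lmul hz, h.QI_ext hz _ hw]

theorem IsAdmissible.QI_extTb {w : CV V} (hw : w ∈ T.cdom) :
    h.QI z (T.extTb w) = T.extTb (h.QI z w) := by
  simp only [extTb, LinearMap.sum_apply, Module.End.mul_apply, map_sum, h.QI_lmul hz,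
    h.QI_ext hz _ hw]

end QI

/-- The resolvent of `T`. -/
noncomputable def IsAdmissible.RT (z : ℂ) : Module.End ℂ (CV V) := z • h.QI z - T.extTb * h.QI z

/-- The resolvent of the conjugate of `T`. -/
noncomputable def IsAdmissible.RTb (z : ℂ) : Module.End ℂ (CV V) := z • h.QI z - T.extT * h.QI z

theorem IsAdmissible.RT_apply (z : ℂ) (w : CV V) :
    h.RT z w = z • h.QI z w - T.extTb (h.QI z w) := rfl

theorem IsAdmissible.RTb_apply (z : ℂ) (w : CV V) :
    h.RTb z w = z • h.QI z w - T.extT (h.QI z w) := rfl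

/-- Both factorizations $(z-T)(z-\overline T)$ and $(z-\overline T)(z-T)$ follow from $T+\overline
T=2T_0$ and $T\overline T=\overline TT=|T|^2$ on $D$. The first gives the right inverse of $z-T$,
the second the left inverse. -/
theorem IsAdmissible.extQ_eq (z : ℂ) {u : CV V} (hu : u ∈ h.dom) : T.extQ z u =
    z • (z • u - T.extTb u) - T.extT (z • u - T.extTb u) ∧ T.extQ z u =
    z • (z • u - T.extT u) - T.extTb (z • u - T.extT u) := by
  have e := congrArg (· u) (T.extT_add_extTb)
  simp only [LinearMap.add_apply, LinearMap.smul_apply] at e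
  simp only [extQ_apply, map_sub, map_smul, h.extT_extTb hu, h.extTb_extT hu]
  constructor <;> linear_combination (norm := module) z • e

section Inverse

variable {z w : ℂ} (hz : T.Regular D z) (hw : T.Regular D w)
include hz

theorem IsAdmissible.RT_mem (v : CV V) : h.RT z v ∈ T.cdom :=
  sub_mem (T.cdom.smul_mem _ (h.le_cdom (h.QI_mem hz v))) (h.extTb_mem (h.QI_mem hz v))

theorem IsAdmissible.RTb_mem (v : CV V) : h.RTb z v ∈ T.cdom :=
  sub_mem (T.cdom.smul_mem _ (h.le_cdom (h.QI_mem hz v))) (h.extT_mem (h.QI_mem hz v))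

theorem IsAdmissible.sub_RT (v : CV V) : z • h.RT z v - T.extT (h.RT z v) = v := by
  rw [h.RT_apply, ← (h.extQ_eq z (h.QI_mem hz v)).1, h.extQ_QI hz]

theorem IsAdmissible.sub_RTb (v : CV V) : z • h.RTb z v - T.extTb (h.RTb z v) = v := by
  rw [h.RTb_apply, ← (h.extQ_eq z (h.QI_mem hz v)).2, h.extQ_QI hz]

/-- Since $Q(z)^{-1}$ commutes with $T$ on all of $\operatorname{dom}(T)$, the factorization can be
applied to $Q(z)^{-1}v\in D$, although $v$ itself need not be in $D$. -/
theorem IsAdmissible.RT_sub {v : CV V} (hv : v ∈ T.cdom) : h.RT z (z • v - T.extT v) = v := by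
  have e := (h.extQ_eq z (h.QI_mem hz v)).2
  rw [h.extQ_QI hz] at e
  rw [h.RT_apply, map_sub, map_smul, h.QI_extT hz hv, ← e]

theorem IsAdmissible.RTb_sub {v : CV V} (hv : v ∈ T.cdom) : h.RTb z (z • v - T.extTb v) = v := by
  have e := (h.extQ_eq z (h.QI_mem hz v)).1
  rw [h.extQ_QI hz] at e
  rw [h.RTb_apply, map_sub, map_smul, h.QI_extTb hz hv, ← e]

theorem IsAdmissible.RT_mul_RTb : h.RT z * h.RTb z = h.QI z :=
  LinearMap.ext fun v => h.RT_sub hz (h.le_cdom (h.QI_mem hz v))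

theorem IsAdmissible.RTb_extT {v : CV V} (hv : v ∈ T.cdom) :
    h.RTb z (T.extT v) = T.extT (h.RTb z v) := by
  rw [h.RTb_apply, h.RTb_apply, h.QI_extT hz hv, map_sub, map_smul]

include hw

theorem IsAdmissible.RT_resolvent : h.RT z - h.RT w = (w - z) • (h.RT z * h.RT w) := by
  ext v
  have h1 := h.sub_RT hw v
  have h2 := h.RT_sub hz (h.RT_mem hw v)
  have h3 : v = (w - z) • h.RT w v + (z • h.RT w v - T.extT (h.RT w v)) := by
    linear_combination (norm := module) -h1
  have h4 : h.RT z v = (w - z) • h.RT z (h.RT w v) + h.RT w v := by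
    conv_lhs => rw [h3]
    rw [map_add, map_smul, h2]
  rw [LinearMap.sub_apply, h4, add_sub_cancel_right]
  rfl

theorem IsAdmissible.RTb_resolvent : h.RTb z - h.RTb w = (w - z) • (h.RTb z * h.RTb w) := by
  ext v
  have h1 := h.sub_RTb hw v
  have h2 := h.RTb_sub hz (h.RTb_mem hw v)
  have h3 : v = (w - z) • h.RTb w v + (z • h.RTb w v - T.extTb (h.RTb w v)) := by
    linear_combination (norm := module) -h1
  have h4 : h.RTb z v = (w - z) • h.RTb z (h.RTb w v) + h.RTb w v := by
    conv_lhs => rw [h3]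
    rw [map_add, map_smul, h2]
  rw [LinearMap.sub_apply, h4, add_sub_cancel_right]
  rfl

theorem IsAdmissible.RT_comm : h.RT z * h.RT w = h.RT w * h.RT z := by
  by_cases hne : z = w
  · rw [hne]
  have h1 := h.RT_resolvent hz hw
  have h2 := h.RT_resolvent hw hz
  refine smul_right_injective _ (sub_ne_zero.2 (Ne.symm hne)) ?_
  change (w - z) • _ = (w - z) • _
  rw [← h1, ← neg_sub z w, neg_smul, ← h2, neg_sub]

theorem IsAdmissible.RTb_comm : h.RTb z * h.RTb w = h.RTb w * h.RTb z := by
  by_cases hne : z = w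
  · rw [hne]
  have h1 := h.RTb_resolvent hz hw
  have h2 := h.RTb_resolvent hw hz
  refine smul_right_injective _ (sub_ne_zero.2 (Ne.symm hne)) ?_
  change (w - z) • _ = (w - z) • _
  rw [← h1, ← neg_sub z w, neg_smul, ← h2, neg_sub]

/-- Write $v=(z-T)R(z)v$ and use that $R_b(w)$ commutes with $T$ on $\operatorname{dom}(T)$. -/
theorem IsAdmissible.RT_RTb_comm : h.RT z * h.RTb w = h.RTb w * h.RT z := by
  ext v
  rw [Module.End.mul_apply, Module.End.mul_apply]
  conv_lhs => rw [← h.sub_RT hz v]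
  rw [map_sub, map_smul, h.RTb_extT hw (h.RT_mem hz v), h.RT_sub hz (h.RTb_mem hw _)]

end Inverse

/-- The connection of the quaternionic and the complex resolvents. -/
theorem IsAdmissible.Qinv_eq {J : ℍ[ℝ]} (hJ : J ∈ imagSphere) {z : ℂ} (hz : T.Regular D z)
    (v : CV V) : T.Qinv D (slicePt J z.re z.im) v =
      (h.QI z (halfP V J v) + h.QI (starRingEnd ℂ z) (halfP V (-J) v)).out := by
  have key : ∀ J ∈ imagSphere, ∀ z, T.Regular D z →
      T.Q (slicePt J z.re z.im) (h.QI z (halfP V J v)) = halfP V J v := by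
    intro J hJ z hz
    rw [h.Q_slicePt (h.QI_mem hz _), h.extQ_QI hz]
    rw [← h.QI_lmul hz, lmul_halfP hJ, map_smul]
  have h1 := key J hJ z hz
  -- The same quaternion is $x+(-J)(-y)$, so on the eigenspace of $-J$ it acts as $\bar z$.
  have h2 := key (-J) (neg_mem_imagSphere hJ) _ hz.conj
  rw [slicePt_neg, conj_re, conj_im, neg_neg] at h2
  have m1 := h.QI_mem hz (halfP V J v)
  have m2 := h.QI_mem hz.conj (halfP V (-J) v)
  have key2 : ∀ a b : CV V, a ∈ h.dom → b ∈ h.dom → T.Q (slicePt J z.re z.im) (a + b).out =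
      (CV.of (T.Q (slicePt J z.re z.im) a) + CV.of (T.Q (slicePt J z.re z.im) b)).out := by
    intro a b ha hb
    rw [CV.of, CV.of, h.Q_eq _ ha, h.Q_eq _ hb]
    refine (h.Q_eq _ (add_mem ha hb)).trans ?_
    simp only [map_add]
    rw [CV.out]
    abel
  have e := key2 _ _ m1 m2
  rw [h1, h2] at e
  have e2 : (CV.of (halfP V J v) + CV.of (halfP V (-J) v)).out = v.out := halfP_add J v
  have e3 := (hz J hJ).injOn.leftInvOn_invFunOn (add_mem m1 m2)
  exact (congrArg (T.Qinv D (slicePt J z.re z.im)) (e.trans e2)).symm.trans e3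

end RightOp

end Resolvents

end QuatHInfty

namespace QuatHInfty

/-! ### Bounds for the complex resolvents. -/

section BoundedResolvents

open Complex

variable {V : Type*} [NormedAddCommGroup V] [NormedSpace ℝ V]
  [Module ℍ[ℝ] V] [Module ℍ[ℝ]ᵐᵒᵖ V] [SMulCommClass ℍ[ℝ]ᵐᵒᵖ ℍ[ℝ] V]
  [IsScalarTower ℝ ℍ[ℝ] V] [IsScalarTower ℝ ℍ[ℝ]ᵐᵒᵖ V]
  [NormSMulClass ℍ[ℝ] V] [NormSMulClass ℍ[ℝ]ᵐᵒᵖ V]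

theorem re_slicePt {J : ℍ[ℝ]} (hJ : J ∈ imagSphere) (x y : ℝ) : (slicePt J x y).re = x := by
  simp [slicePt, hJ.1]

theorem norm_im_slicePt {J : ℍ[ℝ]} (hJ : J ∈ imagSphere) (x y : ℝ) :
    ‖(slicePt J x y).im‖ = |y| := by
  have h1 : (slicePt J x y).im = (y : ℍ[ℝ]) * J := by
    ext <;> simp [slicePt, hJ.1]
  rw [h1, norm_mul, hJ.2, mul_one, Quaternion.norm_coe, Real.norm_eq_abs]

theorem norm_mk_norm_im (s : ℍ[ℝ]) : ‖(⟨s.re, ‖s.im‖⟩ : ℂ)‖ = ‖s‖ := by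
  have h1 : ‖(⟨s.re, ‖s.im‖⟩ : ℂ)‖ * ‖(⟨s.re, ‖s.im‖⟩ : ℂ)‖ = ‖s‖ * ‖s‖ := by
    rw [← Quaternion.normSq_eq_norm_mul_self, Complex.norm_mul_self_eq_normSq, Quaternion.normSq_def',
      Complex.normSq_apply, ← Quaternion.normSq_eq_norm_mul_self, Quaternion.normSq_def']
    simp
    ring
  exact (mul_self_inj (norm_nonneg _) (norm_nonneg _)).1 h1

theorem norm_slicePt {J : ℍ[ℝ]} (hJ : J ∈ imagSphere) (z : ℂ) : ‖slicePt J z.re z.im‖ = ‖z‖ := by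
  rw [← norm_mk_norm_im, re_slicePt hJ, norm_im_slicePt hJ]
  refine (mul_self_inj (norm_nonneg _) (norm_nonneg _)).1 ?_
  rw [Complex.norm_mul_self_eq_normSq, Complex.norm_mul_self_eq_normSq, Complex.normSq_apply,
    Complex.normSq_apply, abs_mul_abs_self]

theorem absArg_slicePt {J : ℍ[ℝ]} (hJ : J ∈ imagSphere) (z : ℂ) :
    absArg (slicePt J z.re z.im) = |arg z| := by
  have hn := norm_slicePt hJ z
  rw [← norm_mk_norm_im, re_slicePt hJ, norm_im_slicePt hJ] at hn
  rw [absArg, re_slicePt hJ, norm_im_slicePt hJ]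
  rcases eq_or_ne z 0 with rfl | hz
  · have h0 : (⟨(0 : ℂ).re, |(0 : ℂ).im|⟩ : ℂ) = 0 := Complex.ext (by simp) (by simp)
    rw [h0]
    simp
  have h1 := re_eq_norm_mul_cos_abs_arg (⟨z.re, |z.im|⟩ : ℂ)
  have h0 : 0 ≤ arg (⟨z.re, |z.im|⟩ : ℂ) := arg_nonneg_iff.2 (abs_nonneg _)
  rw [hn, abs_of_nonneg h0] at h1
  refine Real.injOn_cos ⟨h0, arg_le_pi _⟩ ⟨abs_nonneg _, abs_arg_le_pi _⟩ ?_
  refine mul_left_cancel₀ (norm_ne_zero_iff.2 hz) ?_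
  rw [← h1, ← re_eq_norm_mul_cos_abs_arg]

theorem slicePt_mem_sector {J : ℍ[ℝ]} (hJ : J ∈ imagSphere) {z : ℂ} {φ : ℝ} :
    slicePt J z.re z.im ∈ sector φ ↔ z ∈ csector φ := by
  refine and_congr ?_ (by rw [absArg_slicePt hJ])
  rw [← norm_ne_zero_iff, norm_slicePt hJ, norm_ne_zero_iff]

/-- The sector lies in the closed cone $|s|\cos\omega\le\operatorname{Re}s$, which such a point
violates strictly. -/
theorem slicePt_notMem_closure {ω : ℝ} (hω : 0 ≤ ω) (hω' : ω ≤ Real.pi) {J : ℍ[ℝ]}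
    (hJ : J ∈ imagSphere) {z : ℂ} (hz : z ∈ cosector ω) :
    slicePt J z.re z.im ∉ closure (sector ω) := by
  have hc : IsClosed {s : ℍ[ℝ] | ‖s‖ * Real.cos ω ≤ s.re} :=
    isClosed_le (by fun_prop) Quaternion.continuous_re
  have hsub : sector ω ⊆ {s : ℍ[ℝ] | ‖s‖ * Real.cos ω ≤ s.re} := by
    intro s hs
    have h1 := re_eq_norm_mul_cos_abs_arg (⟨s.re, ‖s.im‖⟩ : ℂ)
    rw [norm_mk_norm_im] at h1
    have h0 : 0 ≤ arg (⟨s.re, ‖s.im‖⟩ : ℂ) := arg_nonneg_iff.2 (norm_nonneg _)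
    rw [abs_of_nonneg h0] at h1
    change ‖s‖ * Real.cos ω ≤ s.re
    change s.re = _ at h1
    rw [h1]
    exact mul_le_mul_of_nonneg_left (Real.cos_le_cos_of_nonneg_of_le_pi h0 hω' hs.2.le) (norm_nonneg _)
  intro hmem
  have h1 := closure_minimal hsub hc hmem
  change ‖slicePt J z.re z.im‖ * Real.cos ω ≤ (slicePt J z.re z.im).re at h1
  rw [norm_slicePt hJ, re_slicePt hJ, re_eq_norm_mul_cos_abs_arg z] at h1
  have h2 := Real.cos_lt_cos_of_nonneg_of_le_pi hω (abs_arg_le_pi z) hz.2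
  have := norm_pos_iff.2 hz.1
  nlinarith

theorem halfP_of_lmul_eq {J : ℍ[ℝ]} {v : CV V} (h : lmul V J v = I • v) :
    halfP V J v = v ∧ halfP V (-J) v = 0 := by
  have h1 : halfP V J v = v := by
    rw [halfP_apply, h, smul_smul, I_mul_I]
    module
  refine ⟨h1, ?_⟩
  have := halfP_add J v
  rwa [h1, add_eq_left] at this

theorem norm_halfP_le {J : ℍ[ℝ]} (hJ : J ∈ imagSphere) (v : CV V) : ‖halfP V J v‖ ≤ ‖v‖ := by
  have h1 : ‖lmul V J v‖ = ‖v‖ := by rw [lmul_apply, norm_smul, hJ.2, one_mul]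
  rw [halfP_apply, norm_smul]
  have h2 := norm_sub_le v (I • lmul V J v)
  rw [norm_smul, h1, norm_I, one_mul] at h2
  norm_num
  linarith

open Classical in
/-- A bounded linear map as a continuous linear map. -/
noncomputable def toCLM {W : Type*} [NormedAddCommGroup W] [NormedSpace ℂ W] (f : Module.End ℂ W) :
    W →L[ℂ] W :=
  if h : ∃ C, ∀ v, ‖f v‖ ≤ C * ‖v‖ then f.mkContinuousOfExistsBound h else 0

theorem toCLM_apply {W : Type*} [NormedAddCommGroup W] [NormedSpace ℂ W] {f : Module.End ℂ W}
    {C : ℝ} (h : ∀ v, ‖f v‖ ≤ C * ‖v‖) (v : W) : toCLM f v = f v := by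
  rw [toCLM, dif_pos ⟨C, h⟩]
  rfl

theorem norm_toCLM_le {W : Type*} [NormedAddCommGroup W] [NormedSpace ℂ W] {f : Module.End ℂ W}
    {C : ℝ} (hC : 0 ≤ C) (h : ∀ v, ‖f v‖ ≤ C * ‖v‖) : ‖toCLM f‖ ≤ C :=
  ContinuousLinearMap.opNorm_le_bound _ hC fun v => by rw [toCLM_apply h]; exact h v

namespace RightOp

variable {T : RightOp V} {D : Submodule ℝ V} (h : T.IsAdmissible D)
include h

/-- The inverse of $Q$ preserves both eigenspaces of $J$, and there the factor $s$ of $s-\overline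
T$ acts as $z$ and as $\bar z$. -/
theorem IsAdmissible.SL_eq {J : ℍ[ℝ]} (hJ : J ∈ imagSphere) {z : ℂ} (hz : T.Regular D z)
    (v : CV V) : T.SL D (slicePt J z.re z.im) v =
      (h.RT z (halfP V J v) + h.RT (starRingEnd ℂ z) (halfP V (-J) v)).out := by
  set u₁ := h.QI z (halfP V J v) with hu₁
  set u₂ := h.QI (starRingEnd ℂ z) (halfP V (-J) v) with hu₂
  have e : T.Qinv D (slicePt J z.re z.im) v = (u₁ + u₂).out := h.Qinv_eq hJ hz v
  have m₁ : u₁ ∈ T.cdom := h.le_cdom (h.QI_mem hz _)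
  have m₂ : u₂ ∈ T.cdom := h.le_cdom (h.QI_mem hz.conj _)
  have j₁ : lmul V J u₁ = I • u₁ := by rw [hu₁, ← h.QI_lmul hz, lmul_halfP hJ, map_smul]
  have j₂ : lmul V (-J) u₂ = I • u₂ := by
    rw [hu₂, ← h.QI_lmul hz.conj, lmul_halfP (neg_mem_imagSphere hJ), map_smul]
  have s₁ := lmul_slicePt (z := z) j₁
  have s₂ := lmul_slicePt (z := starRingEnd ℂ z) j₂
  rw [slicePt_neg, conj_re, conj_im, neg_neg] at s₂
  have e2 : lmul V (slicePt J z.re z.im) (u₁ + u₂) - T.extTb (u₁ + u₂) =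
      h.RT z (halfP V J v) + h.RT (starRingEnd ℂ z) (halfP V (-J) v) := by
    rw [map_add, map_add, s₁, s₂, h.RT_apply, h.RT_apply]
    abel
  rw [extTb_apply (add_mem m₁ m₂)] at e2
  change slicePt J z.re z.im • T.Qinv D _ v - T.conj.app (T.Qinv D _ v) = _
  rw [e]
  exact e2

theorem IsAdmissible.SL_conj_eq {J : ℍ[ℝ]} (hJ : J ∈ imagSphere) {z : ℂ} (hz : T.Regular D z)
    (v : CV V) : T.conj.SL D (slicePt J z.re z.im) v =
      (h.RTb z (halfP V J v) + h.RTb (starRingEnd ℂ z) (halfP V (-J) v)).out := by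
  set u₁ := h.QI z (halfP V J v) with hu₁
  set u₂ := h.QI (starRingEnd ℂ z) (halfP V (-J) v) with hu₂
  have d₁ := h.QI_mem hz (halfP V J v)
  have d₂ := h.QI_mem hz.conj (halfP V (-J) v)
  have e : T.conj.Qinv D (slicePt J z.re z.im) v = (u₁ + u₂).out := by
    rw [← h.Qinv_eq hJ hz v]
    have eq : EqOn (T.conj.Q (slicePt J z.re z.im)) (T.Q (slicePt J z.re z.im)) D :=
      fun w hw => T.conj_Q _ (h.le_domain w hw)
    have b := hz J hJ
    have b' : BijOn (T.conj.Q (slicePt J z.re z.im)) D univ := b.congr eq.symm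
    refine b'.injOn (b'.surjOn.mapsTo_invFunOn (mem_univ _)) (b.surjOn.mapsTo_invFunOn (mem_univ _)) ?_
    have h1 := Function.invFunOn_eq (b'.surjOn (mem_univ v))
    have h2 := Function.invFunOn_eq (b.surjOn (mem_univ v))
    refine h1.trans (Eq.trans h2.symm ?_)
    exact (eq (b.surjOn.mapsTo_invFunOn (mem_univ _))).symm
  have m₁ : u₁ ∈ T.cdom := h.le_cdom d₁
  have m₂ : u₂ ∈ T.cdom := h.le_cdom d₂
  have j₁ : lmul V J u₁ = I • u₁ := by rw [hu₁, ← h.QI_lmul hz, lmul_halfP hJ, map_smul]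
  have j₂ : lmul V (-J) u₂ = I • u₂ := by
    rw [hu₂, ← h.QI_lmul hz.conj, lmul_halfP (neg_mem_imagSphere hJ), map_smul]
  have s₁ := lmul_slicePt (z := z) j₁
  have s₂ := lmul_slicePt (z := starRingEnd ℂ z) j₂
  rw [slicePt_neg, conj_re, conj_im, neg_neg] at s₂
  have e2 : lmul V (slicePt J z.re z.im) (u₁ + u₂) - T.extT (u₁ + u₂) =
      h.RTb z (halfP V J v) + h.RTb (starRingEnd ℂ z) (halfP V (-J) v) := by
    rw [map_add, map_add, s₁, s₂, h.RTb_apply, h.RTb_apply]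
    abel
  rw [extT_apply (add_mem m₁ m₂)] at e2
  change slicePt J z.re z.im • T.conj.Qinv D _ v - T.conj.conj.app (T.conj.Qinv D _ v) = _
  rw [e]
  refine Eq.trans ?_ e2
  exact congrArg (_ - ·) (T.conj_conj_app (add_mem m₁ m₂))

/-- The sum over the units removes the components $T_1,T_2,T_3$:
$\sum_ie_iR\,\overline{e_i}=4(z-T_0)Q^{-1}=2(R+R_b)$. It transfers the norm bounds, which are
assumed for $T$ only, to the conjugate. -/
theorem IsAdmissible.RTb_eq {z : ℂ} (hz : T.Regular D z) (v : CV V) : h.RTb z v =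
    (1 / 2 : ℂ) • ∑ i, lmul V (quatUnit i) (h.RT z (lmul V (star (quatUnit i)) v)) - h.RT z v := by
  have m := h.le_cdom (h.QI_mem hz v)
  set u := h.QI z v with hu
  have e1 : ∀ i, h.RT z (lmul V (star (quatUnit i)) v) = z • lmul V (star (quatUnit i)) u -
      ∑ k, lmul V (star (quatUnit k) * star (quatUnit i)) (T.ext k u) := by
    intro i
    rw [h.RT_apply, h.QI_lmul hz, ← hu]
    simp only [extTb, LinearMap.sum_apply, Module.End.mul_apply, map_mul, ext_lmul _ _ m]
  simp only [e1]
  have e2 := congrArg (· u) (T.extT_add_extTb)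
  simp only [LinearMap.add_apply, LinearMap.smul_apply] at e2
  have e3 : ∑ i, lmul V (quatUnit i) (z • lmul V (star (quatUnit i)) u -
      ∑ k, lmul V (star (quatUnit k) * star (quatUnit i)) (T.ext k u)) =
      (4 * z) • u - (4 : ℂ) • T.ext 0 u := by
    simp only [map_sub, map_sum, map_smul, ← Module.End.mul_apply, ← map_mul]
    simp only [Fin.sum_univ_four, star_quatUnit]
    simp [quatUnit_mul, quatUnit_zero, -map_mul]
    simp only [← Module.End.mul_apply, ← map_mul, ← mul_assoc, quatUnit_mul]
    simp [quatUnit_zero]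
    module
  rw [e3, h.RT_apply, h.RTb_apply, ← hu]
  linear_combination (norm := module) (-1 : ℂ) • e2

theorem IsAdmissible.injective_RT {z : ℂ} (hz : T.Regular D z) : Function.Injective (h.RT z) := by
  intro v w hvw
  rw [← h.sub_RT hz v, ← h.sub_RT hz w, hvw]

theorem IsAdmissible.injective_RTb {z : ℂ} (hz : T.Regular D z) :
    Function.Injective (h.RTb z) := by
  intro v w hvw
  rw [← h.sub_RTb hz v, ← h.sub_RTb hz w, hvw]

omit h in
theorem eq_zero_of_app_eq_zero (hT : T.IsInjective) {v : V} (hv : v ∈ T.domain)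
    (h0 : T.app v = 0) : v = 0 := by
  rw [T.app_of_mem hv, ← map_zero T.toFun] at h0
  exact congrArg Subtype.val (hT h0)

/-- The operator is $-TR(-1)$, a product of injective operators. -/
theorem IsAdmissible.injective_add_RT (hz : T.Regular D (-1)) (hT : T.IsInjective) :
    Function.Injective fun v => v + h.RT (-1) v := by
  intro v w hvw
  have h1 := h.sub_RT hz (v - w)
  have h2 : (v - w) + h.RT (-1) (v - w) = 0 := by
    rw [map_sub, ← sub_eq_zero.2 hvw]
    simp only
    abel
  have h3 : T.extT (h.RT (-1) (v - w)) = 0 := by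
    linear_combination (norm := module) -h1 - h2
  rw [extT_apply (h.RT_mem hz _)] at h3
  have h4 := eq_zero_of_app_eq_zero hT (h.RT_mem hz _) h3
  have h5 : h.RT (-1) (v - w) = 0 := h4
  rw [h5, add_zero] at h2
  exact sub_eq_zero.1 h2

theorem IsAdmissible.injective_add_RTb (hz : T.Regular D (-1)) (hT : T.conj.IsInjective) :
    Function.Injective fun v => v + h.RTb (-1) v := by
  intro v w hvw
  have h1 := h.sub_RTb hz (v - w)
  have h2 : (v - w) + h.RTb (-1) (v - w) = 0 := by
    rw [map_sub, ← sub_eq_zero.2 hvw]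
    simp only
    abel
  have h3 : T.extTb (h.RTb (-1) (v - w)) = 0 := by
    linear_combination (norm := module) -h1 - h2
  rw [extTb_apply (h.RTb_mem hz _)] at h3
  have h4 := eq_zero_of_app_eq_zero hT (h.RTb_mem hz _) h3
  have h5 : h.RTb (-1) (v - w) = 0 := h4
  rw [h5, add_zero] at h2
  exact sub_eq_zero.1 h2

section OfType

variable {α β ω : ℝ}

omit h in
theorem IsOfType.regular (hT : T.IsOfType D α β ω) (hω : 0 ≤ ω) (hω' : ω ≤ Real.pi) {z : ℂ}
    (hz : z ∈ cosector ω) : T.Regular D z := by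
  intro J hJ
  by_contra hn
  exact slicePt_notMem_closure hω hω' hJ hz (hT.spectrum_subset hn)

/-- On the range of $P_J$ the resolvent equals the $S$-resolvent at $x+Jy$. The factor 2 counts the
two projections for $J=\pm e_1$. -/
theorem IsAdmissible.norm_RT_apply_le {z : ℂ} (hz : T.Regular D z) {c : ℝ}
    (hc : ∀ J ∈ imagSphere, ∀ v, ‖T.SL D (slicePt J z.re z.im) v‖ ≤ c * ‖v‖) (hc0 : 0 ≤ c)
    (v : CV V) : ‖h.RT z v‖ ≤ 2 * c * ‖v‖ := by
  have key : ∀ J ∈ imagSphere, ‖h.RT z (halfP V J v)‖ ≤ c * ‖v‖ := by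
    intro J hJ
    obtain ⟨h1, h2⟩ := halfP_of_lmul_eq (lmul_halfP hJ v)
    have h3 := h.SL_eq hJ hz (halfP V J v)
    rw [h1, h2, map_zero, add_zero] at h3
    have h4 := hc J hJ (halfP V J v)
    rw [h3] at h4
    exact h4.trans (mul_le_mul_of_nonneg_left (norm_halfP_le hJ v) hc0)
  have hJ := quatUnit_one_mem_imagSphere
  have h1 := key _ hJ
  have h2 := key _ (neg_mem_imagSphere hJ)
  rw [← halfP_add (quatUnit 1) v, map_add, halfP_add]
  have := norm_add_le (h.RT z (halfP V (quatUnit 1) v)) (h.RT z (halfP V (-quatUnit 1) v))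
  linarith

omit h in
theorem norm_quatUnit (i : Fin 4) : ‖quatUnit i‖ = 1 := by
  have h1 : ‖quatUnit i‖ * ‖quatUnit i‖ = 1 := by
    rw [← Quaternion.normSq_eq_norm_mul_self, Quaternion.normSq_def']
    fin_cases i <;> simp [re_quatUnit, imI_quatUnit, imJ_quatUnit, imK_quatUnit]
  nlinarith [norm_nonneg (quatUnit i)]

theorem IsAdmissible.norm_RTb_apply_le {z : ℂ} (hz : T.Regular D z) {c : ℝ}
    (hc : ∀ v, ‖h.RT z v‖ ≤ c * ‖v‖) (v : CV V) : ‖h.RTb z v‖ ≤ 3 * c * ‖v‖ := by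
  have key : ∀ i, ‖lmul V (quatUnit i) (h.RT z (lmul V (star (quatUnit i)) v))‖ ≤ c * ‖v‖ := by
    intro i
    rw [lmul_apply, norm_smul, norm_quatUnit, one_mul]
    refine (hc _).trans (le_of_eq ?_)
    rw [lmul_apply, norm_smul, norm_star, norm_quatUnit, one_mul]
  rw [h.RTb_eq hz]
  refine (norm_sub_le _ _).trans ?_
  rw [norm_smul]
  have h1 := norm_sum_le Finset.univ fun i =>
    lmul V (quatUnit i) (h.RT z (lmul V (star (quatUnit i)) v))
  have h2 := Finset.sum_le_sum fun i (_ : i ∈ Finset.univ) => key i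
  rw [Finset.sum_const, Finset.card_univ, Fintype.card_fin] at h2
  have h3 := hc v
  norm_num at h2 ⊢
  linarith

/-- The bounded resolvents of `T`. -/
noncomputable def IsAdmissible.R (z : ℂ) : CV V →L[ℂ] CV V := toCLM (h.RT z)

/-- The bounded resolvents of the conjugate of `T`. -/
noncomputable def IsAdmissible.Rb (z : ℂ) : CV V →L[ℂ] CV V := toCLM (h.RTb z)

variable (hT : T.IsOfType D α β ω) (hω : 0 ≤ ω) (hω' : ω < Real.pi)
include hT hω hω'

theorem IsOfType.exists_bound : ∀ φ ∈ Ioo ω Real.pi, ∃ C, 0 ≤ C ∧ ∀ z : ℂ, z ≠ 0 → φ ≤ |arg z| →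
    (‖z‖ ≤ 1 → ∀ v, ‖h.RT z v‖ ≤ C * ‖z‖ ^ (-α) * ‖v‖) ∧
    (1 ≤ ‖z‖ → ∀ v, ‖h.RT z v‖ ≤ C * ‖z‖ ^ (-β) * ‖v‖) := by
  intro φ hφ
  obtain ⟨C, hC, hb⟩ := hT.resolvent_bound φ hφ
  refine ⟨2 * C, by positivity, fun z hz hz' => ?_⟩
  have hr := hT.regular hω hω'.le (z := z) ⟨hz, hφ.1.trans_le hz'⟩
  have hb' : ∀ J ∈ imagSphere, _ := fun J hJ => hb (slicePt J z.re z.im)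
    (fun hmem => (((slicePt_mem_sector hJ).1 hmem).2.trans_le hz').false)
    (by rwa [← norm_ne_zero_iff, norm_slicePt hJ, norm_ne_zero_iff])
  refine ⟨fun h1 v => ?_, fun h1 v => ?_⟩
  · rw [mul_assoc 2]
    refine h.norm_RT_apply_le hr (fun J hJ v => ?_) (by positivity) v
    have := (hb' J hJ v).1
    rw [norm_slicePt hJ] at this
    exact this h1
  · rw [mul_assoc 2]
    refine h.norm_RT_apply_le hr (fun J hJ v => ?_) (by positivity) v
    have := (hb' J hJ v).2
    rw [norm_slicePt hJ] at this
    exact this h1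

theorem IsOfType.exists_bound_apply {z : ℂ} (hz : z ∈ cosector ω) :
    ∃ C, ∀ v, ‖h.RT z v‖ ≤ C * ‖v‖ := by
  obtain ⟨φ, h1, h2⟩ := exists_between hz.2
  obtain ⟨C, hC, hb⟩ := hT.exists_bound h hω hω' φ ⟨h1, h2.trans_le (abs_arg_le_pi z)⟩
  obtain ⟨h3, h4⟩ := hb z hz.1 h2.le
  rcases le_total ‖z‖ 1 with h5 | h5
  exacts [⟨_, h3 h5⟩, ⟨_, h4 h5⟩]

theorem IsOfType.R_apply {z : ℂ} (hz : z ∈ cosector ω) (v : CV V) : h.R z v = h.RT z v := by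
  obtain ⟨C, hC⟩ := hT.exists_bound_apply h hω hω' hz
  exact toCLM_apply hC v

theorem IsOfType.Rb_apply {z : ℂ} (hz : z ∈ cosector ω) (v : CV V) : h.Rb z v = h.RTb z v := by
  obtain ⟨C, hC⟩ := hT.exists_bound_apply h hω hω' hz
  exact toCLM_apply (h.norm_RTb_apply_le (hT.regular hω hω'.le hz) hC) v

theorem IsOfType.resolventPair : ResolventPair ω α β h.R h.Rb where
  res z hz w hw := by
    ext v
    have := LinearMap.congr_fun
      (h.RT_resolvent (hT.regular hω hω'.le hz) (hT.regular hω hω'.le hw)) v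
    simpa [hT.R_apply h hω hω' hz, hT.R_apply h hω hω' hw] using this
  res' z hz w hw := by
    ext v
    have := LinearMap.congr_fun
      (h.RTb_resolvent (hT.regular hω hω'.le hz) (hT.regular hω hω'.le hw)) v
    simpa [hT.Rb_apply h hω hω' hz, hT.Rb_apply h hω hω' hw] using this
  comm z hz w hw := by
    ext v
    have := LinearMap.congr_fun
      (h.RT_comm (hT.regular hω hω'.le hz) (hT.regular hω hω'.le hw)) v
    simpa [hT.R_apply h hω hω' hz, hT.R_apply h hω hω' hw] using this
  comm' z hz w hw := by
    ext v
    have := LinearMap.congr_fun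
      (h.RTb_comm (hT.regular hω hω'.le hz) (hT.regular hω hω'.le hw)) v
    simpa [hT.Rb_apply h hω hω' hz, hT.Rb_apply h hω hω' hw] using this
  comm'' z hz w hw := by
    ext v
    have := LinearMap.congr_fun
      (h.RT_RTb_comm (hT.regular hω hω'.le hz) (hT.regular hω hω'.le hw)) v
    simpa [hT.R_apply h hω hω' hz, hT.Rb_apply h hω hω' hw] using this
  bound φ hφ := by
    obtain ⟨C, hC, hb⟩ := hT.exists_bound h hω hω' φ hφ
    refine ⟨C, fun z hz => ⟨fun h1 => ?_, fun h1 => ?_⟩⟩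
    · exact norm_toCLM_le (by positivity) ((hb z hz.1 hz.2).1 h1)
    · exact norm_toCLM_le (by positivity) ((hb z hz.1 hz.2).2 h1)
  bound' φ hφ := by
    obtain ⟨C, hC, hb⟩ := hT.exists_bound h hω hω' φ hφ
    refine ⟨3 * C, fun z hz => ⟨fun h1 => ?_, fun h1 => ?_⟩⟩ <;> rw [mul_assoc]
    · have hr := hT.regular hω hω'.le (z := z) ⟨hz.1, hφ.1.trans_le hz.2⟩
      have := h.norm_RTb_apply_le hr ((hb z hz.1 hz.2).1 h1)
      exact norm_toCLM_le (by positivity) this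
    · have hr := hT.regular hω hω'.le (z := z) ⟨hz.1, hφ.1.trans_le hz.2⟩
      have := h.norm_RTb_apply_le hr ((hb z hz.1 hz.2).2 h1)
      exact norm_toCLM_le (by positivity) this

end OfType

end RightOp

end BoundedResolvents

end QuatHInfty

namespace QuatHInfty

/-! ### Slice functions as holomorphic functions on a complex sector. -/

section SliceFunctions

open Complex

/-- The even part `a` of a slice function `a + J b`. -/
noncomputable def evenPart (f : ℍ[ℝ] → ℍ[ℝ]) (z : ℂ) : ℍ[ℝ] :=
  (1 / 2 : ℝ) • (f (slicePt (quatUnit 1) z.re z.im) + f (slicePt (-quatUnit 1) z.re z.im))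

/-- The odd part `b` of a slice function `a + J b`. -/
noncomputable def oddPart (f : ℍ[ℝ] → ℍ[ℝ]) (z : ℂ) : ℍ[ℝ] :=
  (-1 / 2 : ℝ) • (quatUnit 1 *
    (f (slicePt (quatUnit 1) z.re z.im) - f (slicePt (-quatUnit 1) z.re z.im)))

theorem mem_reducedSet_sector {θ : ℝ} {p : ℝ × ℝ} :
    p ∈ reducedSet (sector θ) ↔ (⟨p.1, p.2⟩ : ℂ) ∈ csector θ := by
  refine ⟨fun h => ?_, fun h J hJ => ?_⟩
  · exact (slicePt_mem_sector quatUnit_one_mem_imagSphere (z := ⟨p.1, p.2⟩)).1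
      (h _ quatUnit_one_mem_imagSphere)
  · exact (slicePt_mem_sector hJ (z := ⟨p.1, p.2⟩)).2 h

theorem isOpen_reducedSet_sector {θ : ℝ} (h0 : 0 ≤ θ) (hθ : θ ≤ Real.pi) :
    IsOpen (reducedSet (sector θ)) := by
  have : reducedSet (sector θ) = equivRealProdCLM.symm ⁻¹' csector θ := by
    ext p
    rw [mem_reducedSet_sector, mem_preimage]
    rfl
  rw [this]
  exact (isOpen_csector h0 hθ).preimage equivRealProdCLM.symm.continuous

section Decomposition

variable {θ : ℝ} {f : ℍ[ℝ] → ℍ[ℝ]} {a b : ℝ × ℝ → ℍ[ℝ]}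
  (hab : SliceDecomposition (sector θ) f a b) {z : ℂ} (hz : z ∈ csector θ)
include hab hz

theorem SliceDecomposition.apply_slicePt {J : ℍ[ℝ]} (hJ : J ∈ imagSphere) :
    f (slicePt J z.re z.im) = a (z.re, z.im) + J * b (z.re, z.im) :=
  hab.repr (z.re, z.im) (mem_reducedSet_sector.2 hz) J hJ

theorem SliceDecomposition.evenPart_eq : evenPart f z = a (z.re, z.im) := by
  have hJ := quatUnit_one_mem_imagSphere
  rw [evenPart, hab.apply_slicePt hz hJ, hab.apply_slicePt hz (neg_mem_imagSphere hJ), neg_mul]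
  module

theorem SliceDecomposition.oddPart_eq : oddPart f z = b (z.re, z.im) := by
  have hJ := quatUnit_one_mem_imagSphere
  rw [oddPart, hab.apply_slicePt hz hJ, hab.apply_slicePt hz (neg_mem_imagSphere hJ), neg_mul]
  have e : a (z.re, z.im) + quatUnit 1 * b (z.re, z.im) -
      (a (z.re, z.im) + -(quatUnit 1 * b (z.re, z.im))) = (2 : ℝ) • (quatUnit 1 * b (z.re, z.im)) := by
    module
  rw [e, mul_smul_comm, ← mul_assoc, mul_self_of_mem_imagSphere hJ, smul_smul, neg_one_mul]
  module

end Decomposition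

variable {θ : ℝ} {f g : ℍ[ℝ] → ℍ[ℝ]}

theorem LeftSlice.apply_slicePt (hf : LeftSlice (sector θ) f) {z : ℂ} (hz : z ∈ csector θ)
    {J : ℍ[ℝ]} (hJ : J ∈ imagSphere) :
    f (slicePt J z.re z.im) = evenPart f z + J * oddPart f z := by
  obtain ⟨a, b, hab⟩ := hf
  rw [hab.evenPart_eq hz, hab.oddPart_eq hz, hab.apply_slicePt hz hJ]

theorem Intrinsic.leftSlice {U : Set ℍ[ℝ]} (hg : Intrinsic U g) : LeftSlice U g := by
  obtain ⟨a, b, h, -⟩ := hg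
  exact ⟨a, b, h⟩

theorem Intrinsic.im_eq_zero (hg : Intrinsic (sector θ) g) {z : ℂ} (hz : z ∈ csector θ) :
    (evenPart g z).im = 0 ∧ (oddPart g z).im = 0 := by
  obtain ⟨a, b, hab, h⟩ := hg
  rw [hab.evenPart_eq hz, hab.oddPart_eq hz]
  exact h _ (mem_reducedSet_sector.2 hz)

theorem eq_coe_re_of_im_eq_zero {q : ℍ[ℝ]} (h : q.im = 0) : q = (q.re : ℍ[ℝ]) := by
  rw [← sub_eq_zero, Quaternion.sub_re_self, h]

/-- The product of an intrinsic and a left slice hyperholomorphic function. -/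
theorem Intrinsic.mul_leftSlice (h0 : 0 ≤ θ) (hθ : θ ≤ Real.pi) (hg : Intrinsic (sector θ) g)
    (hf : LeftSlice (sector θ) f) : LeftSlice (sector θ) fun s => g s * f s := by
  obtain ⟨a, b, hab⟩ := hf
  obtain ⟨c, d, hcd, him⟩ := hg
  have ho := isOpen_reducedSet_sector h0 hθ
  have dif : ∀ {u : ℝ × ℝ → ℍ[ℝ]}, ContDiffOn ℝ 1 u (reducedSet (sector θ)) →
      ∀ p ∈ reducedSet (sector θ), DifferentiableAt ℝ u p := fun hu p hp =>
    (hu.contDiffAt (ho.mem_nhds hp)).differentiableAt one_ne_zero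
  refine ⟨fun p => c p * a p - d p * b p, fun p => d p * a p + c p * b p,
    (hcd.contDiff_a.mul hab.contDiff_a).sub (hcd.contDiff_b.mul hab.contDiff_b),
    (hcd.contDiff_b.mul hab.contDiff_a).add (hcd.contDiff_a.mul hab.contDiff_b), ?_, ?_, ?_, ?_, ?_⟩
  · intro p hp J hJ
    rw [hab.repr p hp J hJ, hcd.repr p hp J hJ, eq_coe_re_of_im_eq_zero (him p hp).1,
      eq_coe_re_of_im_eq_zero (him p hp).2]
    simp only [mul_add, add_mul, Quaternion.coe_mul_eq_smul, ← Quaternion.coe_commutes, smul_mul_assoc,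
      mul_smul_comm, ← mul_assoc, mul_self_of_mem_imagSphere hJ]
    rw [neg_one_mul]
    module
  · intro p hp
    simp only [hab.even_a p hp, hab.odd_b p hp, hcd.even_a p hp, hcd.odd_b p hp, neg_mul_neg]
  · intro p hp
    simp only [hab.even_a p hp, hab.odd_b p hp, hcd.even_a p hp, hcd.odd_b p hp, neg_mul, mul_neg]
    abel
  all_goals
    intro p hp
    have da := dif hab.contDiff_a p hp
    have db := dif hab.contDiff_b p hp
    have dc := dif hcd.contDiff_a p hp
    have dd := dif hcd.contDiff_b p hp
    have x1 := hab.cauchyRiemann_x p hp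
    have y1 := hab.cauchyRiemann_y p hp
    have x2 := hcd.cauchyRiemann_x p hp
    have y2 := hcd.cauchyRiemann_y p hp
    have e1 := ((dc.hasFDerivAt.mul' da.hasFDerivAt).sub (dd.hasFDerivAt.mul' db.hasFDerivAt)).fderiv
    have e2 := ((dd.hasFDerivAt.mul' da.hasFDerivAt).add (dc.hasFDerivAt.mul' db.hasFDerivAt)).fderiv
    first
    | change (fderiv ℝ (c * a - d * b) p) (1, 0) = (fderiv ℝ (d * a + c * b) p) (0, 1)
    | change (fderiv ℝ (c * a - d * b) p) (0, 1) = -(fderiv ℝ (d * a + c * b) p) (1, 0)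
    rw [e1, e2]
    simp only [sub_apply, add_apply,
      smul_apply, smul_eq_mul, MulOpposite.smul_eq_mul_unop,
      MulOpposite.unop_op, x1, y1, x2, y2]
    noncomm_ring

section Hat

variable {E : Type*} [NormedAddCommGroup E] [NormedSpace ℂ E] (L : ℍ[ℝ] →L[ℝ] E)

/-- The function `L(a) + i L(b)` of a slice function `a + J b`. -/
noncomputable def hatWith (f : ℍ[ℝ] → ℍ[ℝ]) (z : ℂ) : E := L (evenPart f z) + I • L (oddPart f z)

/-- The Cauchy-Riemann system for $(a,b)$ implies complex differentiability of $L(a)+iL(b)$, for any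
real linear `L` into a complex space. It is used with the real part for intrinsic functions and with
left multiplication in general. -/
theorem differentiableAt_hatWith (h0 : 0 ≤ θ) (hθ : θ ≤ Real.pi) (hf : LeftSlice (sector θ) f)
    {z : ℂ} (hz : z ∈ csector θ) : DifferentiableAt ℂ (hatWith L f) z := by
  obtain ⟨a, b, hab⟩ := hf
  have ho := isOpen_reducedSet_sector h0 hθ
  have hp : (z.re, z.im) ∈ reducedSet (sector θ) := mem_reducedSet_sector.2 hz
  have da := ((hab.contDiff_a.contDiffAt (ho.mem_nhds hp)).differentiableAt one_ne_zero).hasFDerivAt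
  have db := ((hab.contDiff_b.contDiffAt (ho.mem_nhds hp)).differentiableAt one_ne_zero).hasFDerivAt
  have hi : HasFDerivAt (fun z : ℂ => (z.re, z.im)) (equivRealProdCLM : ℂ →L[ℝ] ℝ × ℝ) z :=
    equivRealProdCLM.hasFDerivAt
  have hF := (L.hasFDerivAt.comp z (da.comp z hi)).add
    ((L.hasFDerivAt.comp z (db.comp z hi)).const_smul I)
  have heq : hatWith L f =ᶠ[nhds z] fun z => L (a (z.re, z.im)) + I • L (b (z.re, z.im)) := by
    filter_upwards [(isOpen_csector h0 hθ).mem_nhds hz] with w hw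
    rw [hatWith, hab.evenPart_eq hw, hab.oddPart_eq hw]
  refine DifferentiableAt.congr_of_eventuallyEq ?_ heq
  refine differentiableAt_complex_iff_differentiableAt_real.2 ⟨hF.differentiableAt, ?_⟩
  have x1 := hab.cauchyRiemann_x _ hp
  have y1 := hab.cauchyRiemann_y _ hp
  have e := hF.fderiv
  have e1 : equivRealProdCLM (1 : ℂ) = (1, 0) := Prod.ext (by simp) (by simp)
  have e2 : equivRealProdCLM I = (0, 1) := Prod.ext (by simp) (by simp)
  change (fderiv ℝ ((⇑L ∘ a ∘ fun z : ℂ => (z.re, z.im)) + I • ⇑L ∘ b ∘ fun z : ℂ => (z.re, z.im)) z) I =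
    I • (fderiv ℝ ((⇑L ∘ a ∘ fun z : ℂ => (z.re, z.im)) + I • ⇑L ∘ b ∘ fun z : ℂ => (z.re, z.im)) z) 1
  rw [e]
  simp only [add_apply, smul_apply,
    ContinuousLinearMap.comp_apply, ContinuousLinearEquiv.coe_coe, e1, e2, x1, y1, smul_add,
    smul_smul, I_mul_I, map_neg]
  module

theorem norm_evenPart_le {f : ℍ[ℝ] → ℍ[ℝ]} {z : ℂ} {c : ℝ}
    (h : ∀ J ∈ imagSphere, ‖f (slicePt J z.re z.im)‖ ≤ c) : ‖evenPart f z‖ ≤ c := by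
  have hJ := quatUnit_one_mem_imagSphere
  rw [evenPart, norm_smul]
  have h1 := norm_add_le (f (slicePt (quatUnit 1) z.re z.im)) (f (slicePt (-quatUnit 1) z.re z.im))
  have h2 := h _ hJ
  have h3 := h _ (neg_mem_imagSphere hJ)
  norm_num
  linarith

theorem norm_oddPart_le {f : ℍ[ℝ] → ℍ[ℝ]} {z : ℂ} {c : ℝ}
    (h : ∀ J ∈ imagSphere, ‖f (slicePt J z.re z.im)‖ ≤ c) : ‖oddPart f z‖ ≤ c := by
  have hJ := quatUnit_one_mem_imagSphere
  rw [oddPart, norm_smul, norm_mul, hJ.2, one_mul]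
  have h1 := norm_sub_le (f (slicePt (quatUnit 1) z.re z.im)) (f (slicePt (-quatUnit 1) z.re z.im))
  have h2 := h _ hJ
  have h3 := h _ (neg_mem_imagSphere hJ)
  norm_num
  linarith

theorem norm_hatWith_le {f : ℍ[ℝ] → ℍ[ℝ]} {z : ℂ} :
    ‖hatWith L f z‖ ≤ ‖L‖ * (‖evenPart f z‖ + ‖oddPart f z‖) := by
  rw [hatWith, mul_add]
  refine (norm_add_le _ _).trans (add_le_add (L.le_opNorm _) ?_)
  rw [norm_smul, norm_I, one_mul]
  exact L.le_opNorm _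

theorem exists_powBound_hatWith {p q : ℝ} (h : Decays p q θ f) :
    ∃ δ > 0, ∃ C, PowBound (csector θ) C (p - 1 + δ) (q - 1 - δ) (hatWith L f) := by
  obtain ⟨δ, hδ, C, hC, hb⟩ := h
  refine ⟨δ, hδ, ‖L‖ * (C + C), fun z hz => ?_⟩
  have key : ∀ c, (∀ J ∈ imagSphere, ‖f (slicePt J z.re z.im)‖ ≤ C * c) →
      ‖hatWith L f z‖ ≤ ‖L‖ * (C + C) * c := by
    intro c hc
    refine (norm_hatWith_le L).trans ?_
    rw [mul_assoc]
    refine mul_le_mul_of_nonneg_left ?_ (norm_nonneg L)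
    rw [add_mul]
    exact add_le_add (norm_evenPart_le hc) (norm_oddPart_le hc)
  refine ⟨fun h1 => key _ fun J hJ => ?_, fun h1 => key _ fun J hJ => ?_⟩
  all_goals
    have := hb _ ((slicePt_mem_sector hJ).2 hz)
    rw [norm_slicePt hJ] at this
  exacts [this.1 h1, this.2 h1]

end Hat

/-- The real part of a quaternion as a complex number. -/
noncomputable def reComplex : ℍ[ℝ] →L[ℝ] ℂ :=
  LinearMap.toContinuousLinearMap (ofRealLI.toLinearMap ∘ₗ QuaternionAlgebra.reₗ (-1 : ℝ) 0 (-1))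

@[simp]
theorem reComplex_apply (q : ℍ[ℝ]) : reComplex q = q.re := rfl

/-- The complex holomorphic function of an intrinsic function. -/
noncomputable def scalarHat (g : ℍ[ℝ] → ℍ[ℝ]) : ℂ → ℂ := hatWith reComplex g

theorem scalarHat_eq (g : ℍ[ℝ] → ℍ[ℝ]) (z : ℂ) :
    scalarHat g z = (evenPart g z).re + (oddPart g z).re * I := by
  rw [scalarHat, hatWith, reComplex_apply, reComplex_apply, smul_eq_mul, mul_comm I]

end SliceFunctions

end QuatHInfty

namespace QuatHInfty

/-! ### Quaternionic kernels in terms of the complex resolvents. -/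

section Representation

open Complex

variable {V : Type*} [NormedAddCommGroup V] [NormedSpace ℝ V]
  [Module ℍ[ℝ] V] [Module ℍ[ℝ]ᵐᵒᵖ V] [SMulCommClass ℍ[ℝ]ᵐᵒᵖ ℍ[ℝ] V]
  [IsScalarTower ℝ ℍ[ℝ] V] [IsScalarTower ℝ ℍ[ℝ]ᵐᵒᵖ V]
  [NormSMulClass ℍ[ℝ] V] [NormSMulClass ℍ[ℝ]ᵐᵒᵖ V]

variable (V) in
/-- Left multiplication as a bounded complex linear operator. -/
noncomputable def lmC : ℍ[ℝ] →L[ℝ] (CV V →L[ℂ] CV V) :=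
  LinearMap.mkContinuous
    { toFun := fun q => (lmul V q).mkContinuous ‖q‖ fun v => (norm_smul q v.out).le
      map_add' := fun q q' => ContinuousLinearMap.ext fun v => add_smul q q' v
      map_smul' := fun r q => ContinuousLinearMap.ext fun v => by
        have h : r • q = (r : ℍ[ℝ]) * q := (Quaternion.coe_mul_eq_smul r q).symm
        rw [h]
        change lmul V ((r : ℍ[ℝ]) * q) v = (r : ℂ) • lmul V q v
        rw [map_mul, Module.End.mul_apply, lmul_real] } 1
    fun q => by
      rw [one_mul]
      exact LinearMap.mkContinuous_norm_le _ (norm_nonneg q) fun v => (norm_smul q v.out).le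

theorem lmC_mul (p q : ℍ[ℝ]) : lmC V (p * q) = lmC V p * lmC V q :=
  ContinuousLinearMap.ext fun v => mul_smul p q v

theorem lmC_one : lmC V 1 = 1 := ContinuousLinearMap.ext fun v => one_smul _ v

theorem lmC_coe (r : ℝ) : lmC V r = (r : ℂ) • 1 :=
  ContinuousLinearMap.ext fun v => lmul_real r v

variable (V) in
/-- The projection onto the subspace of all `v` with `J v = v e₁`, as a bounded operator. -/
noncomputable def halfC (J : ℍ[ℝ]) : CV V →L[ℂ] CV V := (1 / 2 : ℂ) • (1 - I • lmC V J)

theorem halfC_add (J : ℍ[ℝ]) : halfC V J + halfC V (-J) = 1 :=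
  ContinuousLinearMap.ext fun v => halfP_add J v

theorem halfC_mul_lmC {J : ℍ[ℝ]} (hJ : J ∈ imagSphere) :
    halfC V J * lmC V J = I • halfC V J := by
  have h : lmC V J * lmC V J = -1 := by
    rw [← lmC_mul, mul_self_of_mem_imagSphere hJ, map_neg, lmC_one]
  nth_rw 1 [halfC]
  rw [smul_mul_assoc, sub_mul, smul_mul_assoc, h, one_mul]
  rw [halfC, smul_comm I, smul_sub, smul_sub, smul_smul I I, I_mul_I]
  module

theorem halfC_mul_self {J : ℍ[ℝ]} (hJ : J ∈ imagSphere) :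
    halfC V J * halfC V J = halfC V J := by
  nth_rw 2 [halfC]
  rw [mul_smul_comm, mul_sub, mul_smul_comm, halfC_mul_lmC hJ, smul_smul, I_mul_I, mul_one]
  module

theorem halfC_mul_neg {J : ℍ[ℝ]} (hJ : J ∈ imagSphere) :
    halfC V J * halfC V (-J) = 0 := by
  have h : halfC V (-J) = 1 - halfC V J := eq_sub_of_add_eq' (halfC_add J)
  rw [h, mul_sub, mul_one, halfC_mul_self hJ, sub_self]

theorem halfC_neg_mul {J : ℍ[ℝ]} (hJ : J ∈ imagSphere) :
    halfC V (-J) * halfC V J = 0 := by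
  have := halfC_mul_neg (V := V) (neg_mem_imagSphere hJ)
  rwa [neg_neg] at this

variable (V) in
/-- A bounded complex linear operator as a bounded real linear operator. -/
noncomputable def toReal : (CV V →L[ℂ] CV V) →ₗᵢ[ℝ] (V →L[ℝ] V) where
  toFun x :=
    { toFun := fun v => x v
      map_add' := fun v w => map_add x (v : CV V) w
      map_smul' := fun r v => by
        have h := x.map_smul (r : ℂ) (CV.of v)
        have h1 : ((r : ℂ) • CV.of v) = CV.of (r • v) := CV.out_real_smul (V := V) r _
        rw [h1] at h
        exact h.trans (CV.out_real_smul (V := V) r _)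
      cont := x.continuous }
  map_add' x y := rfl
  map_smul' r x := ContinuousLinearMap.ext fun v => CV.out_real_smul (V := V) r (x v)
  norm_map' x := rfl

theorem toReal_mul (x y : CV V →L[ℂ] CV V) : toReal V (x * y) = toReal V x ∘L toReal V y := rfl

theorem toReal_lmC (q : ℍ[ℝ]) : toReal V (lmC V q) = leftMul q := rfl

theorem asBounded_eq {F : V → V} {B : V →L[ℝ] V} (h : ∀ v, B v = F v) : asBounded F = B := by
  have he : ∃ B : V →L[ℝ] V, ∀ v, B v = F v := ⟨B, h⟩
  rw [asBounded, dif_pos he]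
  ext v
  rw [he.choose_spec v, h]

theorem conj_mem_cosector {ω : ℝ} {z : ℂ} (hz : z ∈ cosector ω) : starRingEnd ℂ z ∈ cosector ω := by
  refine ⟨(map_ne_zero _).2 hz.1, ?_⟩
  rw [arg_conj]
  split_ifs with h
  · rw [← h]
    exact hz.2
  · rw [abs_neg]
    exact hz.2

/-- The kernel `κ` with quaternionic parameter comes from the kernel `K` with complex parameter. -/
def Represents (ω : ℝ) (κ : ℍ[ℝ] → V →L[ℝ] V) (K : ℂ → CV V →L[ℂ] CV V) : Prop :=
  ∀ J ∈ imagSphere, ∀ z ∈ cosector ω, κ (slicePt J z.re z.im) =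
    toReal V (K z * halfC V J + K (starRingEnd ℂ z) * halfC V (-J))

section

variable {ω : ℝ} {κ κ' : ℍ[ℝ] → V →L[ℝ] V} {K K' : ℂ → CV V →L[ℂ] CV V}

theorem Represents.add (h : Represents ω κ K) (h' : Represents ω κ' K') :
    Represents ω (fun s => κ s + κ' s) (fun z => K z + K' z) := by
  intro J hJ z hz
  beta_reduce
  rw [h J hJ z hz, h' J hJ z hz, ← map_add]
  congr 1
  noncomm_ring

theorem Represents.smul (r : ℝ) (h : Represents ω κ K) :
    Represents ω (fun s => r • κ s) (fun z => (r : ℂ) • K z) := by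
  intro J hJ z hz
  beta_reduce
  rw [h J hJ z hz, ← map_smul]
  congr 1
  rw [smul_add, smul_mul_assoc, smul_mul_assoc]
  rfl

/-- If the right factor commutes with left multiplications it commutes with $P_{\pm J}$, and the
mixed terms vanish because $P_JP_{-J}=0$. -/
theorem Represents.comp (h : Represents ω κ K) (h' : Represents ω κ' K')
    (hc : ∀ z ∈ cosector ω, ∀ q, lmC V q * K' z = K' z * lmC V q) :
    Represents ω (fun s => κ s ∘L κ' s) (fun z => K z * K' z) := by
  have hc' : ∀ z ∈ cosector ω, ∀ J, halfC V J * K' z = K' z * halfC V J := by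
    intro z hz J
    simp only [halfC, mul_smul_comm, smul_mul_assoc, mul_sub, sub_mul, mul_one, one_mul, hc z hz]
  intro J hJ z hz
  beta_reduce
  rw [h J hJ z hz, h' J hJ z hz, ← toReal_mul]
  congr 1
  have e1 := hc' z hz J
  have e2 := hc' z hz (-J)
  have e3 := hc' _ (conj_mem_cosector hz) J
  have e4 := hc' _ (conj_mem_cosector hz) (-J)
  have a1 := halfC_mul_self (V := V) hJ
  have a2 := halfC_mul_self (V := V) (neg_mem_imagSphere hJ)
  have a3 := halfC_mul_neg (V := V) hJ
  have a4 := halfC_neg_mul (V := V) hJ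
  simp only [mul_add, add_mul, mul_assoc]
  rw [← mul_assoc (halfC V J), ← mul_assoc (halfC V J), ← mul_assoc (halfC V (-J)),
    ← mul_assoc (halfC V (-J)), e1, e2, e3, e4]
  simp only [mul_assoc, a1, a2, a3, a4, mul_zero, add_zero, zero_add]

end

namespace RightOp

variable {T : RightOp V} {D : Submodule ℝ V} {α β ω : ℝ} (h : T.IsAdmissible D)
  (hT : T.IsOfType D α β ω) (hω : 0 ≤ ω) (hω' : ω < Real.pi)
include h hT hω hω'

theorem IsOfType.represents_kerS : Represents ω (kerS T D) h.R := by
  intro J hJ z hz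
  refine asBounded_eq fun v => ?_
  refine Eq.trans ?_ (h.SL_eq hJ (hT.regular hω hω'.le hz) (CV.of v)).symm
  rw [← hT.R_apply h hω hω' hz,
    ← hT.R_apply h hω hω' (conj_mem_cosector hz)]
  rfl

theorem IsOfType.represents_kerS_conj : Represents ω (kerS T.conj D) h.Rb := by
  intro J hJ z hz
  refine asBounded_eq fun v => ?_
  refine Eq.trans ?_ (h.SL_conj_eq hJ (hT.regular hω hω'.le hz) (CV.of v)).symm
  rw [← hT.Rb_apply h hω hω' hz,
    ← hT.Rb_apply h hω hω' (conj_mem_cosector hz)]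
  rfl

theorem IsOfType.R_mul_Rb_apply {z : ℂ} (hz : z ∈ cosector ω) (v : CV V) :
    (h.R z * h.Rb z) v = h.QI z v := by
  rw [← h.RT_mul_RTb (hT.regular hω hω'.le hz), Module.End.mul_apply, ← hT.Rb_apply h hω hω' hz,
    ← hT.R_apply h hω hω' hz]
  rfl

theorem IsOfType.represents_kerQ : Represents ω (kerQ T D) fun z => h.R z * h.Rb z := by
  intro J hJ z hz
  beta_reduce
  refine asBounded_eq fun v => ?_
  refine Eq.trans ?_ (h.Qinv_eq hJ (hT.regular hω hω'.le hz) (CV.of v)).symm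
  rw [← hT.R_mul_Rb_apply h hω hω' hz,
    ← hT.R_mul_Rb_apply h hω hω' (conj_mem_cosector hz)]
  rfl

theorem IsOfType.lmC_mul_R_mul_Rb {z : ℂ} (hz : z ∈ cosector ω) (q : ℍ[ℝ]) :
    lmC V q * (h.R z * h.Rb z) = h.R z * h.Rb z * lmC V q := by
  ext v
  change lmul V q ((h.R z * h.Rb z) v) = (h.R z * h.Rb z) (lmul V q v)
  rw [hT.R_mul_Rb_apply h hω hω' hz, hT.R_mul_Rb_apply h hω hω' hz,
    h.QI_lmul (hT.regular hω hω'.le hz)]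

/-- The sum is $2(z-T_0)Q^{-1}$, which involves only operators that commute with left
multiplications. So $S_L^{-1}(s,T)+S_L^{-1}(s,\overline T)$ is an admissible right factor in the
kernel $P_2^L$. -/
theorem IsOfType.lmC_mul_R_add_Rb {z : ℂ} (hz : z ∈ cosector ω) (q : ℍ[ℝ]) :
    lmC V q * (h.R z + h.Rb z) = (h.R z + h.Rb z) * lmC V q := by
  have hr := hT.regular hω hω'.le hz
  have key : ∀ v, (h.R z + h.Rb z) v = (2 * z) • h.QI z v - (2 : ℂ) • T.ext 0 (h.QI z v) := by
    intro v
    have e := congrArg (· (h.QI z v)) (T.extT_add_extTb)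
    simp only [LinearMap.add_apply, LinearMap.smul_apply] at e
    rw [add_apply, hT.R_apply h hω hω' hz, hT.Rb_apply h hω hω' hz, h.RT_apply, h.RTb_apply, ← e]
    module
  ext v
  change lmul V q ((h.R z + h.Rb z) v) = (h.R z + h.Rb z) (lmul V q v)
  rw [key, key, h.QI_lmul hr, ext_lmul _ _ (h.le_cdom (h.QI_mem hr v)), map_sub, map_smul, map_smul]

theorem IsOfType.represents_kerP :
    Represents ω (kerP T D) fun z => (2 : ℂ) • (h.R z * (h.R z + h.Rb z)) := by
  have h1 := hT.represents_kerS h hω hω'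
  have h2 := (h1.comp (h1.add (hT.represents_kerS_conj h hω hω'))
    fun z hz q => hT.lmC_mul_R_add_Rb h hω hω' hz q).smul 2
  rw [ofReal_ofNat] at h2
  exact h2

theorem IsOfType.represents_kerF :
    Represents ω (kerF T D) fun z => (-4 : ℂ) • (h.R z * (h.R z * h.Rb z)) := by
  have h2 := ((hT.represents_kerS h hω hω').comp (hT.represents_kerQ h hω hω')
    fun z hz q => hT.lmC_mul_R_mul_Rb h hω hω' hz q).smul (-4)
  rw [ofReal_neg, ofReal_ofNat] at h2
  exact h2

end RightOp

end Representation

end QuatHInfty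

namespace QuatHInfty

/-! ### Quaternionic path integrals as complex contour integrals. -/

section ContourIntegrals

open Complex

variable {V : Type*} [NormedAddCommGroup V] [NormedSpace ℝ V]
  [Module ℍ[ℝ] V] [Module ℍ[ℝ]ᵐᵒᵖ V] [SMulCommClass ℍ[ℝ]ᵐᵒᵖ ℍ[ℝ] V]
  [IsScalarTower ℝ ℍ[ℝ] V] [IsScalarTower ℝ ℍ[ℝ]ᵐᵒᵖ V]
  [NormSMulClass ℍ[ℝ] V] [NormSMulClass ℍ[ℝ]ᵐᵒᵖ V]

theorem expJ_eq (J : ℍ[ℝ]) (φ : ℝ) :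
    expJ J φ = slicePt J (exp (φ * I)).re (exp (φ * I)).im := by
  rw [exp_ofReal_mul_I_re, exp_ofReal_mul_I_im, expJ]

theorem smul_slicePt (r : ℝ) (J : ℍ[ℝ]) (z : ℂ) :
    r • slicePt J z.re z.im = slicePt J ((r : ℂ) * z).re ((r : ℂ) * z).im := by
  rw [re_ofReal_mul, im_ofReal_mul, slicePt, slicePt, smul_add, ← smul_mul_assoc,
    ← Quaternion.coe_mul_eq_smul, ← Quaternion.coe_mul_eq_smul, ← Quaternion.coe_mul,
    ← Quaternion.coe_mul]

theorem sectorPath_eq (J : ℍ[ℝ]) (φ t : ℝ) :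
    sectorPath J φ t = slicePt J (zpath φ t).re (zpath φ t).im := by
  unfold sectorPath zpath
  split_ifs <;> rw [expJ_eq, smul_slicePt]

theorem sectorPathDeriv_eq (J : ℍ[ℝ]) (φ t : ℝ) :
    sectorPathDeriv J φ t = slicePt J (zder φ t).re (zder φ t).im := by
  unfold sectorPathDeriv zder
  split_ifs <;> rw [expJ_eq]
  rw [← neg_one_smul ℝ, smul_slicePt]
  simp

theorem zpath_neg {φ t : ℝ} (ht : t ≠ 0) : zpath φ (-t) = starRingEnd ℂ (zpath φ t) := by
  have hc : ∀ x : ℝ, starRingEnd ℂ (exp (x * I)) = exp ((-x : ℝ) * I) := fun x => by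
    rw [← exp_conj, map_mul, conj_ofReal, conj_I, ofReal_neg, mul_neg, neg_mul]
  unfold zpath
  rcases lt_or_gt_of_ne ht with h | h
  · rw [if_pos h, if_neg (by linarith), map_mul, conj_ofReal, hc]
  · rw [if_pos (neg_lt_zero.2 h), if_neg h.not_gt, map_mul, conj_ofReal, hc, neg_neg, neg_neg]

theorem zder_neg {φ t : ℝ} (ht : t ≠ 0) : zder φ (-t) = -starRingEnd ℂ (zder φ t) := by
  have hc : ∀ x : ℝ, starRingEnd ℂ (exp (x * I)) = exp ((-x : ℝ) * I) := fun x => by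
    rw [← exp_conj, map_mul, conj_ofReal, conj_I, ofReal_neg, mul_neg, neg_mul]
  unfold zder
  rcases lt_or_gt_of_ne ht with h | h
  · rw [if_pos h, if_neg (by linarith), map_neg, hc, neg_neg]
  · rw [if_pos (neg_lt_zero.2 h), if_neg h.not_gt, hc, neg_neg]

/-- Left multiplication by $q\neq0$ is invertible with inverse of norm at most $|q|^{-1}$. The
equality allows norms of kernel and function to be read off from the integrand. -/
theorem norm_comp_leftMul (B : V →L[ℝ] V) (q : ℍ[ℝ]) : ‖B ∘L leftMul q‖ = ‖B‖ * ‖q‖ := by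
  have hl : ∀ q : ℍ[ℝ], ‖(leftMul q : V →L[ℝ] V)‖ ≤ ‖q‖ := fun q =>
    LinearMap.mkContinuous_norm_le _ (norm_nonneg q) _
  refine le_antisymm ((ContinuousLinearMap.opNorm_comp_le _ _).trans
    (mul_le_mul_of_nonneg_left (hl q) (norm_nonneg B))) ?_
  rcases eq_or_ne q 0 with rfl | hq
  · rw [norm_zero, mul_zero]
    exact norm_nonneg _
  have e : B = (B ∘L leftMul q) ∘L leftMul q⁻¹ := by
    ext v
    change B v = B (q • q⁻¹ • v)
    rw [smul_smul, mul_inv_cancel₀ hq, one_smul]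
  have h1 := (ContinuousLinearMap.opNorm_comp_le (B ∘L leftMul q) (leftMul q⁻¹)).trans
    (mul_le_mul_of_nonneg_left (hl q⁻¹) (norm_nonneg _))
  rw [← e, norm_inv] at h1
  have := mul_le_mul_of_nonneg_right h1 (norm_nonneg q)
  rwa [mul_assoc, inv_mul_cancel₀ (norm_ne_zero_iff.2 hq), mul_one] at this

theorem norm_integrand (κ : ℍ[ℝ] → V →L[ℝ] V) (f : ℍ[ℝ] → ℍ[ℝ]) {J : ℍ[ℝ]} (hJ : J ∈ imagSphere)
    (φ t : ℝ) : ‖integrand κ f J φ t‖ = ‖κ (sectorPath J φ t)‖ * ‖f (sectorPath J φ t)‖ := by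
  rw [integrand, norm_comp_leftMul, norm_mul, norm_mul, norm_inv, hJ.2, sectorPathDeriv_eq,
    norm_slicePt hJ, norm_zder, inv_one, one_mul, one_mul]

variable (V) in
/-- The operator valued holomorphic function of a left slice hyperholomorphic function. -/
noncomputable def hat (f : ℍ[ℝ] → ℍ[ℝ]) : ℂ → CV V →L[ℂ] CV V := hatWith (lmC V) f

theorem halfC_mul_lmC_slicePt {J : ℍ[ℝ]} (hJ : J ∈ imagSphere) (z : ℂ) :
    halfC V J * lmC V (slicePt J z.re z.im) = z • halfC V J := by
  rw [slicePt, map_add, lmC_mul, lmC_coe, lmC_coe, smul_mul_assoc, one_mul, mul_add, mul_smul_comm,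
    mul_smul_comm, halfC_mul_lmC hJ, mul_one, smul_smul, ← add_smul, re_add_im]

theorem inv_of_mem_imagSphere {J : ℍ[ℝ]} (hJ : J ∈ imagSphere) : J⁻¹ = -J := by
  refine (eq_inv_of_mul_eq_one_left ?_).symm
  rw [neg_mul, mul_self_of_mem_imagSphere hJ, neg_neg]

section

variable {ω θ φ : ℝ} {f : ℍ[ℝ] → ℍ[ℝ]}

/-- Since $P_JJ=iP_J$, the value $a+Jb$ may be replaced by $a+ib$ behind the projection. -/
theorem halfC_mul_lmC_apply_slicePt (hf : LeftSlice (sector θ) f) {z : ℂ} (hz : z ∈ csector θ)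
    {J : ℍ[ℝ]} (hJ : J ∈ imagSphere) :
    halfC V J * lmC V (f (slicePt J z.re z.im)) = halfC V J * hat V f z := by
  rw [hf.apply_slicePt hz hJ, map_add, lmC_mul, mul_add, ← mul_assoc, halfC_mul_lmC hJ, hat, hatWith,
    mul_add, smul_mul_assoc, mul_smul_comm]

theorem halfC_mul_lmC_integrand (hf : LeftSlice (sector θ) f) {z w : ℂ} (hz : z ∈ csector θ)
    {J : ℍ[ℝ]} (hJ : J ∈ imagSphere) :
    halfC V J * lmC V (slicePt J w.re w.im * J⁻¹ * f (slicePt J z.re z.im)) =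
      (-I * w) • (halfC V J * hat V f z) := by
  rw [lmC_mul, lmC_mul, ← mul_assoc, ← mul_assoc, halfC_mul_lmC_slicePt hJ, inv_of_mem_imagSphere hJ,
    map_neg, mul_neg, smul_mul_assoc, halfC_mul_lmC hJ, neg_mul, smul_mul_assoc, smul_mul_assoc,
    halfC_mul_lmC_apply_slicePt hf hz hJ]
  module

theorem conj_mem_csector {z : ℂ} (hz : z ∈ csector θ) :
    starRingEnd ℂ z ∈ csector θ := by
  refine ⟨(map_ne_zero _).2 hz.1, ?_⟩
  rw [arg_conj]
  split_ifs with h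
  · have := hz.2
    rw [h] at this
    exact this
  · rw [abs_neg]
    exact hz.2

variable {κ : ℍ[ℝ] → V →L[ℝ] V} {K : ℂ → CV V →L[ℂ] CV V} (hκ : Represents ω κ K)
  (hf : LeftSlice (sector θ) f) (hω : 0 ≤ ω) (hθ : θ < Real.pi) (hφ : φ ∈ Ioo ω θ)
include hκ hf hω hθ hφ

/-- The summand with $\bar z$ is the first summand for $-J$ at the parameter $-t$: the path is
symmetric under conjugation, and $s$ and $\gamma'(t)/J$ do not change when $(J,t)$ is replaced by
$(-J,-t)$. -/
theorem integrand_eq {t : ℝ} (ht : t ≠ 0) {J : ℍ[ℝ]} (hJ : J ∈ imagSphere) :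
    integrand κ f J φ t = toReal V
      ((-I * zder φ t) • (K (zpath φ t) * (halfC V J * hat V f (zpath φ t))) +
      (-I * zder φ (-t)) • (K (zpath φ (-t)) * (halfC V (-J) * hat V f (zpath φ (-t))))) := by
  have h0 : 0 ≤ φ := hω.trans hφ.1.le
  have m1 := zpath_mem_csector h0 hφ.2 hθ.le ht
  have m2 := zpath_mem_cosector h0 hφ.1 (hφ.2.trans hθ) ht
  have m3 := conj_mem_csector m1
  have e2 : slicePt J (zder φ t).re (zder φ t).im * J⁻¹ =
      slicePt (-J) (zder φ (-t)).re (zder φ (-t)).im * (-J)⁻¹ := by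
    rw [zder_neg ht, slicePt_neg, inv_neg, mul_neg, neg_re, neg_im, conj_re, conj_im, neg_neg,
      ← neg_mul]
    congr 1
    simp only [slicePt, Quaternion.coe_neg, neg_mul]
    abel
  rw [integrand, sectorPath_eq, sectorPathDeriv_eq, hκ J hJ _ m2, ← toReal_lmC, ← toReal_mul, add_mul,
    mul_assoc, halfC_mul_lmC_integrand hf m1 hJ, mul_assoc, e2]
  have e3 : slicePt J (zpath φ t).re (zpath φ t).im =
      slicePt (-J) (zpath φ (-t)).re (zpath φ (-t)).im := by
    rw [zpath_neg ht, slicePt_neg, conj_re, conj_im, neg_neg]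
  rw [← zpath_neg ht] at m3 ⊢
  rw [e3, halfC_mul_lmC_integrand hf m3 (neg_mem_imagSphere hJ), mul_smul_comm, mul_smul_comm]

/-- Adding the integrands at $t$ and $-t$ brings $P_J$ and $P_{-J}$ together at the same point of
the path, and they sum to the identity. Integration doubles both sides. -/
theorem contourInt_eq [CompleteSpace V] {J : ℍ[ℝ]} (hJ : J ∈ imagSphere) (hF : Integrable (integrand κ f J φ))
    (hG : Integrable fun t => K (zpath φ t) * hat V f (zpath φ t)) :
    contourInt κ f J φ = toReal V ((-I) • rayInt φ fun z => K z * hat V f z) := by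
  set G : ℝ → CV V →L[ℂ] CV V := fun t => (-I) • (zder φ t • (K (zpath φ t) * hat V f (zpath φ t)))
    with hGdef
  have hGi : Integrable G := (integrable_zder_smul hG).smul (-I)
  have e : ∀ᵐ t : ℝ, integrand κ f J φ t + integrand κ f J φ (-t) =
      toReal V (G t) + toReal V (G (-t)) := by
    filter_upwards [ae_ne_zero] with t ht
    rw [integrand_eq hκ hf hω hθ hφ ht hJ, integrand_eq hκ hf hω hθ hφ (neg_ne_zero.2 ht) hJ,
      ← map_add, ← map_add, neg_neg]
    congr 1
    have h1 : ∀ s, G s = (-I * zder φ s) • (K (zpath φ s) * (halfC V J * hat V f (zpath φ s))) +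
        (-I * zder φ s) • (K (zpath φ s) * (halfC V (-J) * hat V f (zpath φ s))) := by
      intro s
      rw [← smul_add, ← mul_add, ← add_mul, halfC_add, one_mul, mul_smul]
    rw [h1, h1]
    abel
  have hPhi : Integrable fun t => toReal V (G t) := (toReal V).toContinuousLinearMap.integrable_comp hGi
  have h1 := integral_congr_ae e
  rw [integral_add hF hF.comp_neg, integral_add hPhi hPhi.comp_neg, integral_neg_eq_self,
    integral_neg_eq_self (fun t => toReal V (G t)), ← two_smul ℝ, ← two_smul ℝ] at h1
  have h2 := smul_right_injective _ (two_ne_zero (α := ℝ)) h1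
  refine h2.trans (((toReal V).integral_comp_comm G).trans ?_)
  exact congrArg _ (integral_smul _ _)

theorem integrable_integrand {J : ℍ[ℝ]} (hJ : J ∈ imagSphere)
    (hG : ∀ J ∈ imagSphere,
      Integrable fun t => K (zpath φ t) * (halfC V J * hat V f (zpath φ t))) :
    Integrable (integrand κ f J φ) := by
  have h1 : ∀ J ∈ imagSphere, Integrable fun t => (-I * zder φ t) •
      (K (zpath φ t) * (halfC V J * hat V f (zpath φ t))) := by
    intro J hJ
    simp only [mul_smul]
    exact (integrable_zder_smul (hG J hJ) (φ := φ)).smul (-I)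
  have h2 := (toReal V).toContinuousLinearMap.integrable_comp
    ((h1 J hJ).add (h1 (-J) (neg_mem_imagSphere hJ)).comp_neg)
  refine h2.congr ?_
  filter_upwards [ae_ne_zero] with t ht
  rw [integrand_eq hκ hf hω hθ hφ ht hJ]
  rfl

end

section Bounds

variable {ω : ℝ} {κ : ℍ[ℝ] → V →L[ℝ] V} {K : ℂ → CV V →L[ℂ] CV V}

theorem Represents.apply_of_lmul_eq (hκ : Represents ω κ K) {J : ℍ[ℝ]} (hJ : J ∈ imagSphere) {z : ℂ}
    (hz : z ∈ cosector ω) {v : CV V} (hv : lmul V J v = I • v) :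
    K z v = κ (slicePt J z.re z.im) v.out := by
  rw [hκ J hJ z hz]
  change K z v = K z (halfP V J v) + K _ (halfP V (-J) v)
  rw [(halfP_of_lmul_eq hv).1, (halfP_of_lmul_eq hv).2, map_zero, add_zero]

/-- For anticommuting $J_1,J_2$ their eigenspaces for $i$ span the whole space. Hence $K(z)$ is
controlled without using the opposite points $-J_1,-J_2$, where $f$ may be small. -/
theorem Represents.norm_le (hκ : Represents ω κ K) {J₁ J₂ : ℍ[ℝ]} (h₁ : J₁ ∈ imagSphere)
    (h₂ : J₂ ∈ imagSphere) (h : J₁ * J₂ = -(J₂ * J₁)) {z : ℂ} (hz : z ∈ cosector ω) :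
    ‖K z‖ ≤ 3 * (‖κ (slicePt J₁ z.re z.im)‖ + ‖κ (slicePt J₂ z.re z.im)‖) := by
  refine ContinuousLinearMap.opNorm_le_bound _ (by positivity) fun v => ?_
  have c₁ : ∀ v, lmul V J₁ (lmul V J₁ v) = -v := fun v => by
    rw [← Module.End.mul_apply, ← map_mul, mul_self_of_mem_imagSphere h₁, map_neg, map_one]
    rfl
  have c₂ : ∀ v, lmul V J₂ (lmul V J₂ v) = -v := fun v => by
    rw [← Module.End.mul_apply, ← map_mul, mul_self_of_mem_imagSphere h₂, map_neg, map_one]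
    rfl
  have c₃ : ∀ v, lmul V J₁ (lmul V J₂ v) = -lmul V J₂ (lmul V J₁ v) := fun v => by
    rw [← Module.End.mul_apply, ← map_mul, h, map_neg, map_mul]
    rfl
  have n₁ : ∀ v : CV V, ‖lmul V J₁ v‖ = ‖v‖ := fun v => by
    rw [lmul_apply, norm_smul, h₁.2, one_mul]
  have n₂ : ∀ v : CV V, ‖lmul V J₂ v‖ = ‖v‖ := fun v => by
    rw [lmul_apply, norm_smul, h₂.2, one_mul]
  have hI : ∀ v : CV V, I • I • v = -v := fun v => by rw [smul_smul, I_mul_I, neg_one_smul]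
  set u := I • v - lmul V J₂ v with hu
  -- The conditions $J_1v_1=iv_1$ and $J_2(v-v_1)=i(v-v_1)$ force $(J_1-J_2)v_1=(i-J_2)v=u$, and
  -- $(J_1-J_2)^2=-2$.
  set v₁ := (-1 / 2 : ℂ) • (lmul V J₁ u - lmul V J₂ u) with hv₁
  have e₁ : lmul V J₁ v₁ = I • v₁ := by
    simp only [hv₁, hu, map_sub, map_smul, smul_sub, c₁, c₂, c₃, smul_comm I (-1 / 2 : ℂ), hI]
    simp only [map_neg, c₁, c₃]
    module
  have e₂ : lmul V J₂ (v - v₁) = I • (v - v₁) := by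
    simp only [hv₁, hu, map_sub, map_smul, smul_sub, c₂, c₃, smul_comm I (-1 / 2 : ℂ), hI]
    simp only [map_neg, c₂]
    module
  have b₀ : ‖u‖ ≤ 2 * ‖v‖ := by
    refine (norm_sub_le _ _).trans ?_
    rw [norm_smul, norm_I, n₂]
    linarith
  have b₁ : ‖v₁‖ ≤ 2 * ‖v‖ := by
    rw [hv₁, norm_smul]
    have := norm_sub_le (lmul V J₁ u) (lmul V J₂ u)
    rw [n₁, n₂] at this
    norm_num
    linarith
  have b₂ : ‖v - v₁‖ ≤ 3 * ‖v‖ := (norm_sub_le _ _).trans (by linarith)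
  have k₁ := (κ (slicePt J₁ z.re z.im)).le_opNorm v₁.out
  have k₂ := (κ (slicePt J₂ z.re z.im)).le_opNorm (v - v₁).out
  have hK : K z v = K z v₁ + K z (v - v₁) := by rw [← map_add, add_sub_cancel]
  rw [hK, hκ.apply_of_lmul_eq h₁ hz e₁, hκ.apply_of_lmul_eq h₂ hz e₂]
  refine (norm_add_le _ _).trans ?_
  have k₃ := k₁.trans (mul_le_mul_of_nonneg_left b₁ (norm_nonneg _))
  have k₄ := k₂.trans (mul_le_mul_of_nonneg_left b₂ (norm_nonneg _))
  have k₅ := mul_nonneg (norm_nonneg (κ (slicePt J₁ z.re z.im))) (norm_nonneg v)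
  refine (add_le_add k₃ k₄).trans ?_
  linarith

/-- From $2a=f(x+Jy)+f(x-Jy)$ and $2Jb=f(x+Jy)-f(x-Jy)$, the larger of the two values bounds both
parts. -/
theorem exists_norm_le_norm_apply {θ : ℝ} {f : ℍ[ℝ] → ℍ[ℝ]} (hf : LeftSlice (sector θ) f) {z : ℂ}
    (hz : z ∈ csector θ) {J : ℍ[ℝ]} (hJ : J ∈ imagSphere) : ∃ J' ∈ ({J, -J} : Set ℍ[ℝ]),
    ‖evenPart f z‖ ≤ ‖f (slicePt J' z.re z.im)‖ ∧ ‖oddPart f z‖ ≤ ‖f (slicePt J' z.re z.im)‖ := by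
  have h1 := hf.apply_slicePt hz hJ
  have h2 := hf.apply_slicePt hz (neg_mem_imagSphere hJ)
  set x := f (slicePt J z.re z.im)
  set y := f (slicePt (-J) z.re z.im)
  have e1 : (2 : ℝ) • evenPart f z = x + y := by
    rw [h1, h2, neg_mul]
    module
  have e2 : (2 : ℝ) • (J * oddPart f z) = x - y := by
    rw [h1, h2, neg_mul]
    module
  have n1 := norm_add_le x y
  have n2 := norm_sub_le x y
  rw [← e1, norm_smul] at n1
  rw [← e2, norm_smul, norm_mul, hJ.2, one_mul] at n2
  norm_num at n1 n2
  rcases le_total ‖x‖ ‖y‖ with h | h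
  · exact ⟨-J, by simp, by change _ ≤ ‖y‖; linarith, by change _ ≤ ‖y‖; linarith⟩
  · exact ⟨J, by simp, by change _ ≤ ‖x‖; linarith, by change _ ≤ ‖x‖; linarith⟩

end Bounds

end ContourIntegrals

end QuatHInfty

namespace QuatHInfty

/-! ### Transfer of convergence and of the decaying calculi. -/

section Transfer

open Complex

variable {V : Type*} [NormedAddCommGroup V] [NormedSpace ℝ V] [CompleteSpace V]
  [Module ℍ[ℝ] V] [Module ℍ[ℝ]ᵐᵒᵖ V] [SMulCommClass ℍ[ℝ]ᵐᵒᵖ ℍ[ℝ] V]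
  [IsScalarTower ℝ ℍ[ℝ] V] [IsScalarTower ℝ ℍ[ℝ]ᵐᵒᵖ V]
  [NormSMulClass ℍ[ℝ] V] [NormSMulClass ℍ[ℝ]ᵐᵒᵖ V]

theorem quatUnit_two_mem_imagSphere : quatUnit 2 ∈ imagSphere :=
  ⟨by simp [re_quatUnit], RightOp.norm_quatUnit 2⟩

/-- At each point choose the signs of $\pm e_1$ and $\pm e_2$ for which $|f|$ is larger. These units
anticommute, so `Represents.norm_le` bounds $\|K(z)\|(|a|+|b|)$ by the quaternionic integrands; four
imaginary units suffice. -/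
theorem Represents.integrable_mul_hat {ω θ φ : ℝ} {f : ℍ[ℝ] → ℍ[ℝ]} {κ : ℍ[ℝ] → V →L[ℝ] V}
    {K : ℂ → CV V →L[ℂ] CV V} (hκ : Represents ω κ K) (hf : LeftSlice (sector θ) f) (hω : 0 ≤ ω)
    (hθ : θ < Real.pi) (hφ : φ ∈ Ioo ω θ) (hK : ∀ z ∈ cosector ω, DifferentiableAt ℂ K z)
    (hF : ∀ J ∈ imagSphere, Integrable (integrand κ f J φ)) :
    Integrable fun t => K (zpath φ t) * hat V f (zpath φ t) := by
  have h0 : 0 ≤ φ := hω.trans hφ.1.le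
  have hθ0 : 0 ≤ θ := h0.trans hφ.2.le
  set J₁ := quatUnit 1
  set J₂ := quatUnit 2
  have m₁ : J₁ ∈ imagSphere := quatUnit_one_mem_imagSphere
  have m₂ : J₂ ∈ imagSphere := quatUnit_two_mem_imagSphere
  have m₃ := neg_mem_imagSphere m₁
  have m₄ := neg_mem_imagSphere m₂
  have hac : J₁ * J₂ = -(J₂ * J₁) := by
    simp [J₁, J₂, quatUnit_mul]
  have hint := ((((hF _ m₁).norm.add (hF _ m₃).norm).add (hF _ m₂).norm).add
    (hF _ m₄).norm).const_mul (‖lmC V‖ * 6)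
  refine hint.mono' (aestronglyMeasurable_of_continuousAt fun t ht => ?_) ?_
  · have c := continuousAt_zpath (φ := φ) ht
    exact (ContinuousAt.comp (hK _ (zpath_mem_cosector h0 hφ.1 (hφ.2.trans hθ) ht)).continuousAt c).mul
      (ContinuousAt.comp (differentiableAt_hatWith (lmC V) hθ0 hθ.le hf
        (zpath_mem_csector h0 hφ.2 hθ.le ht)).continuousAt c)
  filter_upwards [ae_ne_zero] with t ht
  have hz := zpath_mem_cosector h0 hφ.1 (hφ.2.trans hθ) ht
  have hz' := zpath_mem_csector h0 hφ.2 hθ.le ht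
  set z := zpath φ t with hzdef
  have hn : ∀ J ∈ imagSphere, ‖integrand κ f J φ t‖ =
      ‖κ (slicePt J z.re z.im)‖ * ‖f (slicePt J z.re z.im)‖ := fun J hJ => by
    rw [norm_integrand κ f hJ, sectorPath_eq]
  simp only [Pi.add_apply]
  obtain ⟨J, hJ, a₁, b₁⟩ := exists_norm_le_norm_apply hf hz' m₁
  obtain ⟨J', hJ', a₂, b₂⟩ := exists_norm_le_norm_apply hf hz' m₂
  have key : ‖K z‖ * (‖evenPart f z‖ + ‖oddPart f z‖) ≤
      6 * (‖integrand κ f J φ t‖ + ‖integrand κ f J' φ t‖) := by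
    have hJm : J ∈ imagSphere := by rcases hJ with rfl | rfl; exacts [m₁, m₃]
    have hJm' : J' ∈ imagSphere := by rcases hJ' with rfl | rfl; exacts [m₂, m₄]
    have hac' : J * J' = -(J' * J) := by
      rcases hJ with rfl | rfl <;> rcases hJ' with rfl | rfl <;>
        simp only [neg_mul, mul_neg, hac, neg_neg]
    rw [hn J hJm, hn J' hJm']
    have h1 := hκ.norm_le hJm hJm' hac' hz
    have h2 := mul_le_mul_of_nonneg_right h1
      (add_nonneg (norm_nonneg (evenPart f z)) (norm_nonneg (oddPart f z)))
    have h3 := mul_le_mul_of_nonneg_left (add_le_add a₁ b₁) (norm_nonneg (κ (slicePt J z.re z.im)))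
    have h4 := mul_le_mul_of_nonneg_left (add_le_add a₂ b₂) (norm_nonneg (κ (slicePt J' z.re z.im)))
    linarith
  have hsum : ‖integrand κ f J φ t‖ + ‖integrand κ f J' φ t‖ ≤ ‖integrand κ f J₁ φ t‖ +
      ‖integrand κ f (-J₁) φ t‖ + ‖integrand κ f J₂ φ t‖ + ‖integrand κ f (-J₂) φ t‖ := by
    have p₁ := norm_nonneg (integrand κ f J₁ φ t)
    have p₂ := norm_nonneg (integrand κ f (-J₁) φ t)
    have p₃ := norm_nonneg (integrand κ f J₂ φ t)
    have p₄ := norm_nonneg (integrand κ f (-J₂) φ t)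
    rcases hJ with rfl | rfl <;> rcases hJ' with rfl | rfl <;> linarith
  calc ‖K z * hat V f z‖ ≤ ‖K z‖ * (‖lmC V‖ * (‖evenPart f z‖ + ‖oddPart f z‖)) :=
        (norm_mul_le _ _).trans (mul_le_mul_of_nonneg_left (norm_hatWith_le _) (norm_nonneg _))
    _ = ‖lmC V‖ * (‖K z‖ * (‖evenPart f z‖ + ‖oddPart f z‖)) := by ring
    _ ≤ ‖lmC V‖ * (6 * (‖integrand κ f J₁ φ t‖ + ‖integrand κ f (-J₁) φ t‖ +
        ‖integrand κ f J₂ φ t‖ + ‖integrand κ f (-J₂) φ t‖)) :=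
      mul_le_mul_of_nonneg_left (key.trans (mul_le_mul_of_nonneg_left hsum (by norm_num)))
        (norm_nonneg (lmC V))
    _ = _ := by ring

section Intrinsic

variable {θ : ℝ} {f g : ℍ[ℝ] → ℍ[ℝ]} (hg : Intrinsic (sector θ) g) {z : ℂ} (hz : z ∈ csector θ)
include hg hz

theorem Intrinsic.hat_eq : hat V g z = scalarHat g z • 1 := by
  obtain ⟨h1, h2⟩ := hg.im_eq_zero hz
  rw [scalarHat_eq, hat, hatWith]
  conv_lhs => rw [eq_coe_re_of_im_eq_zero h1, eq_coe_re_of_im_eq_zero h2]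
  rw [lmC_coe, lmC_coe]
  module

theorem Intrinsic.parts_mul (hf : LeftSlice (sector θ) f) :
    evenPart (fun s => g s * f s) z =
      (evenPart g z).re • evenPart f z - (oddPart g z).re • oddPart f z ∧
    oddPart (fun s => g s * f s) z =
      (oddPart g z).re • evenPart f z + (evenPart g z).re • oddPart f z := by
  have hJ := quatUnit_one_mem_imagSphere
  have hJ2 := mul_self_of_mem_imagSphere hJ
  obtain ⟨h1, h2⟩ := hg.im_eq_zero hz
  have e : ∀ J ∈ imagSphere, g (slicePt J z.re z.im) * f (slicePt J z.re z.im) =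
      ((evenPart g z).re • evenPart f z - (oddPart g z).re • oddPart f z) +
      J * ((oddPart g z).re • evenPart f z + (evenPart g z).re • oddPart f z) := by
    intro J hJ
    have hJ2 := mul_self_of_mem_imagSphere hJ
    rw [hg.leftSlice.apply_slicePt hz hJ, hf.apply_slicePt hz hJ]
    conv_lhs => rw [eq_coe_re_of_im_eq_zero h1, eq_coe_re_of_im_eq_zero h2]
    simp only [mul_add, add_mul, Quaternion.coe_mul_eq_smul, ← Quaternion.coe_commutes,
      smul_mul_assoc, mul_smul_comm, ← mul_assoc, hJ2]
    rw [neg_one_mul]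
    module
  constructor
  · rw [evenPart, e _ hJ, e _ (neg_mem_imagSphere hJ), neg_mul]
    module
  · rw [oddPart, e _ hJ, e _ (neg_mem_imagSphere hJ), neg_mul]
    simp only [mul_sub, mul_add, mul_neg, mul_smul_comm, ← mul_assoc, hJ2]
    simp only [neg_one_mul]
    module

/-- The real parts of $g$ commute with everything, so $a+Jb$ multiplies like $a+ib$. -/
theorem Intrinsic.hat_mul (hf : LeftSlice (sector θ) f) :
    hat V (fun s => g s * f s) z = scalarHat g z • hat V f z := by
  obtain ⟨e1, e2⟩ := hg.parts_mul hz hf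
  simp only [hat, hatWith, scalarHat_eq, e1, e2, map_sub, map_add, map_smul]
  simp only [← coe_smul]
  linear_combination (norm := module)
    (-(oddPart g z).re : ℂ) • congrArg (· • lmC V (oddPart f z)) I_mul_I

theorem Intrinsic.scalarHat_mul (hf : LeftSlice (sector θ) f) :
    scalarHat (fun s => g s * f s) z = scalarHat g z * scalarHat f z := by
  obtain ⟨e1, e2⟩ := hg.parts_mul hz hf
  rw [scalarHat_eq, scalarHat_eq, scalarHat_eq, e1, e2]
  simp only [Quaternion.re_sub, Quaternion.re_add, Quaternion.re_smul, smul_eq_mul, ofReal_add,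
    ofReal_sub, ofReal_mul]
  linear_combination (-(oddPart g z).re * (oddPart f z).re : ℂ) * I_mul_I

end Intrinsic

theorem Intrinsic.mul {θ : ℝ} {f g : ℍ[ℝ] → ℍ[ℝ]} (h0 : 0 ≤ θ) (hθ : θ ≤ Real.pi)
    (hg : Intrinsic (sector θ) g) (hf : Intrinsic (sector θ) f) :
    Intrinsic (sector θ) fun s => g s * f s := by
  obtain ⟨a, b, hab⟩ := hg.mul_leftSlice h0 hθ hf.leftSlice
  refine ⟨a, b, hab, fun p hp => ?_⟩
  have hz : (⟨p.1, p.2⟩ : ℂ) ∈ csector θ := mem_reducedSet_sector.1 hp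
  obtain ⟨e1, e2⟩ := hg.parts_mul hz hf.leftSlice
  obtain ⟨h1, h2⟩ := hf.im_eq_zero hz
  have e3 := hab.evenPart_eq hz
  have e4 := hab.oddPart_eq hz
  change _ = a p at e3
  change _ = b p at e4
  rw [← e3, ← e4, e1, e2]
  simp [h1, h2]

theorem smul_toReal_neg_I_smul (r : ℝ) (x : CV V →L[ℂ] CV V) :
    r • toReal V ((-I) • x) = toReal V ((-I * r) • x) := by
  rw [← map_smul, ← coe_smul, smul_smul, mul_comm]

namespace RightOp

variable {T : RightOp V} {D : Submodule ℝ V} {α β ω θ : ℝ} (h : T.IsAdmissible D)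
  (hT : T.IsOfType D α β ω) (hω : 0 ≤ ω) (hωθ : ω < θ) (hθ : θ < Real.pi) {f r : ℍ[ℝ] → ℍ[ℝ]}
include h hT hω hωθ hθ

theorem IsOfType.decaying (hf : PsiL (3 * α) (3 * β) θ f) (hc : Converges T D ω θ f) :
    Decaying α β ω θ h.R h.Rb (hat V f) where
  diff z hz := differentiableAt_hatWith _ (hω.trans hωθ.le) hθ.le hf.1 hz
  decay := exists_powBound_hatWith _ hf.2
  conv := by
    intro φ hφ
    have hω' := hωθ.trans hθ
    have hd := (hT.resolventPair h hω hω').diff hω hω'.le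
    have key : ∀ κ ∈ ({kerS T D, kerS T.conj D, kerQ T D, kerP T D, kerF T D} :
        Set (ℍ[ℝ] → V →L[ℝ] V)), ∀ K, Represents ω κ K →
        (∀ z ∈ cosector ω, DifferentiableAt ℂ K z) →
        Integrable fun t => K (zpath φ t) * hat V f (zpath φ t) := by
      intro κ hκ K hR hK
      exact hR.integrable_mul_hat hf.1 hω hθ hφ hK fun J hJ => hc ⟨J, hJ, φ, hφ⟩ κ hκ
    have iS := key _ (by simp) _ (hT.represents_kerS h hω hω') (hd .S)
    have iSb := key _ (by simp) _ (hT.represents_kerS_conj h hω hω') (hd .Sb)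
    have iQ := key _ (by simp) _ (hT.represents_kerQ h hω hω') (hd .Q)
    have iP := key _ (by simp) _ (hT.represents_kerP h hω hω') fun z hz =>
      ((hd .S z hz).mul ((hd .S z hz).add (hd .Sb z hz))).const_smul (2 : ℂ)
    have iF := key _ (by simp) _ (hT.represents_kerF h hω hω') fun z hz =>
      (hd .F z hz).const_smul (-4 : ℂ)
    intro k
    cases k
    · exact iS
    · exact iSb
    · exact iQ
    -- The quaternionic kernel corresponds to $2R^2+2RR_b$, so convergence for $R^2$ follows by
    -- subtracting that for $RR_b$.
    · refine ((iP.smul (1 / 2 : ℂ)).sub iQ).congr (ae_of_all _ fun t => ?_)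
      simp only [Pi.sub_apply, Pi.smul_apply, Knl.fn, smul_mul_assoc, smul_smul, mul_add, add_mul]
      norm_num
    · refine (iF.smul (-1 / 4 : ℂ)).congr (ae_of_all _ fun t => ?_)
      simp only [Pi.smul_apply, Knl.fn, smul_mul_assoc, smul_smul]
      norm_num

theorem IsOfType.scalarDecaying (hr : Psi (3 * α) (3 * β) θ r) (hc : Converges T D ω θ r) :
    ScalarDecaying α β ω θ h.R h.Rb (scalarHat r) where
  diff z hz := differentiableAt_hatWith _ (hω.trans hωθ.le) hθ.le hr.1.leftSlice hz
  decay := exists_powBound_hatWith _ hr.2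
  conv := by
    intro φ hφ k
    have hd := hT.decaying h hω hωθ hθ ⟨hr.1.leftSlice, hr.2⟩ hc
    refine (hd.conv φ hφ k).congr ?_
    filter_upwards [ae_ne_zero] with t ht
    rw [hr.1.hat_eq (zpath_mem_csector (hω.trans hφ.1.le) hφ.2 hθ.le ht), mul_smul_comm, mul_one]

section Jets

variable (hf : PsiL (3 * α) (3 * β) θ f) (hc : Converges T D ω θ f) (c : Contour ω θ)
include hf hc

theorem IsOfType.contourInt_eq {κ : ℍ[ℝ] → V →L[ℝ] V} {K : ℂ → CV V →L[ℂ] CV V}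
    (hκ : κ ∈ ({kerS T D, kerS T.conj D, kerQ T D, kerP T D, kerF T D} :
        Set (ℍ[ℝ] → V →L[ℝ] V))) (hR : Represents ω κ K)
    (hK : ∀ z ∈ cosector ω, DifferentiableAt ℂ K z) :
    contourInt κ f c.J c.φ = toReal V ((-I) • rayInt c.φ fun z => K z * hat V f z) :=
  QuatHInfty.contourInt_eq hR hf.1 hω hθ c.φ_mem c.J_mem (hc c κ hκ)
    (hR.integrable_mul_hat hf.1 hω hθ c.φ_mem hK fun J hJ => hc ⟨J, hJ, c.φ, c.φ_mem⟩ κ hκ)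

/-- The factor $-i$ from the change to the complex integral turns $1/(2\pi)$ into $1/(2\pi i)$. In
the other calculi it leaves the constants $-2$, $2$ and $-4$. -/
theorem IsOfType.decS_eq : decS T D c f = toReal V (jetCal c.φ h.R h.Rb (hat V f)).s := by
  have hω' := hωθ.trans hθ
  have hd := (hT.resolventPair h hω hω').diff hω hω'.le
  rw [decS, hT.contourInt_eq h hω hωθ hθ hf hc c (by simp) (hT.represents_kerS h hω hω') (hd .S),
    smul_toReal_neg_I_smul]
  refine congrArg _ (congrArg (· • _) ?_)
  push_cast
  field_simp
  simp

theorem IsOfType.decS_conj_eq :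
    decS T.conj D c f = toReal V (jetCal c.φ h.R h.Rb (hat V f)).sb := by
  have hω' := hωθ.trans hθ
  have hd := (hT.resolventPair h hω hω').diff hω hω'.le
  rw [decS, hT.contourInt_eq h hω hωθ hθ hf hc c (by simp) (hT.represents_kerS_conj h hω hω')
    (hd .Sb), smul_toReal_neg_I_smul]
  refine congrArg _ (congrArg (· • _) ?_)
  push_cast
  field_simp
  simp

theorem IsOfType.decQ_eq :
    decQ T D c f = toReal V ((-2 : ℂ) • (jetCal c.φ h.R h.Rb (hat V f)).q) := by
  have hω' := hωθ.trans hθ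
  have hd := (hT.resolventPair h hω hω').diff hω hω'.le
  rw [decQ, hT.contourInt_eq h hω hωθ hθ hf hc c (by simp) (hT.represents_kerQ h hω hω') (hd .Q),
    smul_toReal_neg_I_smul]
  simp only [jetCal, cal, smul_smul]
  refine congrArg _ (congrArg (· • _) ?_)
  push_cast
  field_simp
  simp

theorem IsOfType.decP_eq : decP T D c f = toReal V
    ((2 : ℂ) • (jetCal c.φ h.R h.Rb (hat V f)).p + (2 : ℂ) • (jetCal c.φ h.R h.Rb (hat V f)).q) := by
  have hω' := hωθ.trans hθ
  have hd := (hT.resolventPair h hω hω').diff hω hω'.le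
  have hdec := hT.decaying h hω hωθ hθ hf hc
  have e : (rayInt c.φ fun z => (2 : ℂ) • (h.R z * (h.R z + h.Rb z)) * hat V f z) =
      (2 : ℂ) • ((rayInt c.φ fun z => Knl.P.fn h.R h.Rb z * hat V f z) +
        rayInt c.φ fun z => Knl.Q.fn h.R h.Rb z * hat V f z) := by
    unfold rayInt
    rw [← integral_add (integrable_zder_smul (hdec.conv c.φ c.φ_mem .P))
      (integrable_zder_smul (hdec.conv c.φ c.φ_mem .Q)), ← integral_smul]
    refine integral_congr_ae (ae_of_all _ fun t => ?_)
    simp only [Knl.fn, mul_add, add_mul, smul_add, smul_mul_assoc, smul_comm (2 : ℂ)]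
  rw [decP, hT.contourInt_eq h hω hωθ hθ hf hc c (by simp) (hT.represents_kerP h hω hω') fun z hz =>
      ((hd .S z hz).mul ((hd .S z hz).add (hd .Sb z hz))).const_smul (2 : ℂ), e,
    smul_toReal_neg_I_smul]
  simp only [jetCal, cal, ← smul_add, smul_smul]
  refine congrArg _ (congrArg (· • _) ?_)
  push_cast
  field_simp
  simp

theorem IsOfType.decF_eq :
    decF T D c f = toReal V ((-4 : ℂ) • (jetCal c.φ h.R h.Rb (hat V f)).f) := by
  have hω' := hωθ.trans hθ
  have hd := (hT.resolventPair h hω hω').diff hω hω'.le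
  have e : (rayInt c.φ fun z => (-4 : ℂ) • (h.R z * (h.R z * h.Rb z)) * hat V f z) =
      (-4 : ℂ) • rayInt c.φ fun z => Knl.F.fn h.R h.Rb z * hat V f z := by
    unfold rayInt
    rw [← integral_smul]
    refine integral_congr_ae (ae_of_all _ fun t => ?_)
    simp only [Knl.fn, smul_mul_assoc, smul_comm (-4 : ℂ)]
  rw [decF, hT.contourInt_eq h hω hωθ hθ hf hc c (by simp) (hT.represents_kerF h hω hω') fun z hz =>
      (hd .F z hz).const_smul (-4 : ℂ), e, smul_toReal_neg_I_smul]
  simp only [jetCal, cal, smul_smul]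
  refine congrArg _ (congrArg (· • _) ?_)
  push_cast
  field_simp
  simp

end Jets

end RightOp

end Transfer

end QuatHInfty

namespace QuatHInfty

/-! ### Graphs of unbounded operators. -/

section UnboundedOperators

variable {V : Type*} [NormedAddCommGroup V] [NormedSpace ℝ V] {A B : V →ₗ.[ℝ] V} {v w u : V}

theorem mem_graph_iff_exists_mem {A : V →ₗ.[ℝ] V} :
    (v, w) ∈ A.graph ↔ ∃ h : v ∈ A.domain, A ⟨v, h⟩ = w := by
  rw [LinearPMap.mem_graph_iff]
  constructor
  · rintro ⟨⟨y, hy⟩, rfl, rfl⟩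
    exact ⟨hy, rfl⟩
  · rintro ⟨h, rfl⟩
    exact ⟨⟨v, h⟩, rfl, rfl⟩

theorem mem_graph_mulP : (v, w) ∈ (mulP A B).graph ↔ ∃ u, (v, u) ∈ B.graph ∧ (u, w) ∈ A.graph := by
  constructor
  · rw [mem_graph_iff_exists_mem]
    rintro ⟨⟨hv1, hv2⟩, rfl⟩
    refine ⟨B ⟨v, hv2⟩, LinearPMap.mem_graph B ⟨v, hv2⟩, ?_⟩
    have hm : B ⟨v, hv2⟩ ∈ A.domain := by
      obtain ⟨⟨v', hv'⟩, h', rfl⟩ := Submodule.mem_map.1 hv1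
      exact h'
    rw [mem_graph_iff_exists_mem]
    refine ⟨hm, ?_⟩
    rfl
  · rintro ⟨u, hu, hw⟩
    obtain ⟨hv, rfl⟩ := mem_graph_iff_exists_mem.1 hu
    obtain ⟨hm, rfl⟩ := mem_graph_iff_exists_mem.1 hw
    exact mem_graph_iff_exists_mem.2 ⟨⟨Submodule.mem_map.2 ⟨⟨v, hv⟩, hm, rfl⟩, hv⟩, rfl⟩

theorem mem_graph_invMul {A B : V →L[ℝ] V} (hA : Function.Injective A) :
    (v, w) ∈ (invMul A B).graph ↔ A w = B v := by
  have hk : ((A : V →ₗ[ℝ] V).toPMap ⊤).toFun.ker = ⊥ := by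
    rw [LinearMap.ker_eq_bot]
    intro x y hxy
    exact Subtype.ext (hA hxy)
  rw [invMul, mem_graph_mulP, LinearPMap.inverse_graph hk]
  constructor
  · rintro ⟨u, hu, hw⟩
    obtain ⟨hv, rfl⟩ := mem_graph_iff_exists_mem.1 hu
    obtain ⟨⟨x, y⟩, hxy, he⟩ := Submodule.mem_map.1 hw
    obtain ⟨hx, rfl⟩ := mem_graph_iff_exists_mem.1 hxy
    have h1 := congrArg Prod.fst he
    have h2 := congrArg Prod.snd he
    change x = w at h2
    subst h2
    exact h1
  · intro h
    refine ⟨B v, mem_graph_iff_exists_mem.2 ⟨trivial, rfl⟩, Submodule.mem_map.2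
      ⟨(w, B v), mem_graph_iff_exists_mem.2 ⟨trivial, h⟩, rfl⟩⟩

theorem exists_of_mem_graph_add (h : (v, w) ∈ (A + B).graph) :
    ∃ a b, (v, a) ∈ A.graph ∧ (v, b) ∈ B.graph ∧ w = a + b := by
  obtain ⟨⟨hA, hB⟩, rfl⟩ := mem_graph_iff_exists_mem.1 h
  exact ⟨A ⟨v, hA⟩, B ⟨v, hB⟩, LinearPMap.mem_graph A ⟨v, hA⟩, LinearPMap.mem_graph B ⟨v, hB⟩, rfl⟩

theorem exists_of_mem_graph_sub (h : (v, w) ∈ (A - B).graph) :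
    ∃ a b, (v, a) ∈ A.graph ∧ (v, b) ∈ B.graph ∧ w = a - b := by
  obtain ⟨⟨hA, hB⟩, rfl⟩ := mem_graph_iff_exists_mem.1 h
  exact ⟨A ⟨v, hA⟩, B ⟨v, hB⟩, LinearPMap.mem_graph A ⟨v, hA⟩, LinearPMap.mem_graph B ⟨v, hB⟩, rfl⟩

theorem le_of_forall_mem_graph (h : ∀ v w, (v, w) ∈ A.graph → (v, w) ∈ B.graph) : A ≤ B :=
  LinearPMap.le_of_le_graph fun x hx => h x.1 x.2 hx

end UnboundedOperators

/-! ### Graphs of the $H^\infty$ calculi, and the product rules. -/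

section Regularization

open Complex

variable {V : Type*} [NormedAddCommGroup V] [NormedSpace ℝ V] [CompleteSpace V]
  [Module ℍ[ℝ] V] [Module ℍ[ℝ]ᵐᵒᵖ V] [SMulCommClass ℍ[ℝ]ᵐᵒᵖ ℍ[ℝ] V]
  [IsScalarTower ℝ ℍ[ℝ] V] [IsScalarTower ℝ ℍ[ℝ]ᵐᵒᵖ V]
  [NormSMulClass ℍ[ℝ] V] [NormSMulClass ℍ[ℝ]ᵐᵒᵖ V]

namespace RightOp

variable {T : RightOp V} {D : Submodule ℝ V} {α β ω θ : ℝ} (h : T.IsAdmissible D)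
  (hT : T.IsOfType D α β ω) (hω : 0 ≤ ω) (hωθ : ω < θ) (hθ : θ < Real.pi) {f r : ℍ[ℝ] → ℍ[ℝ]}
  {c : Contour ω θ} (hr : IsRegularizer T D α β c r f)
include hT hω hωθ hθ hr

/-- Injectivity of the regularizing operator turns $A^{-1}B$ into the equation $Aw=Bv$, which is the
abstract graph condition. The other calculi are treated in the same way. -/
theorem IsOfType.mem_graph_hInfS {v w : V} : (v, w) ∈ (hInfS T D c r f).graph ↔
    Jet.GraphS (jetCal c.φ h.R h.Rb (hat V r))
      ((jetCal c.φ h.R h.Rb (hat V fun s => r s * f s)).ev (CV.of v)) (CV.of w) := by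
  have p : PsiL (3 * α) (3 * β) θ r := ⟨hr.psi.1.leftSlice, hr.psi.2⟩
  rw [hInfS, mem_graph_invMul hr.injective, hT.decS_eq h hω hωθ hθ p hr.converges,
    hT.decS_eq h hω hωθ hθ hr.psi_mul hr.converges_mul]
  rfl

theorem IsOfType.mem_graph_hInfS_conj {v w : V} : (v, w) ∈ (hInfS T.conj D c r f).graph ↔
    Jet.GraphSb (jetCal c.φ h.R h.Rb (hat V r))
      ((jetCal c.φ h.R h.Rb (hat V fun s => r s * f s)).ev (CV.of v)) (CV.of w) := by
  have p : PsiL (3 * α) (3 * β) θ r := ⟨hr.psi.1.leftSlice, hr.psi.2⟩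
  rw [hInfS, mem_graph_invMul hr.injective_conj, hT.decS_conj_eq h hω hωθ hθ p hr.converges,
    hT.decS_conj_eq h hω hωθ hθ hr.psi_mul hr.converges_mul]
  rfl

omit hT hω hωθ hθ hr in
theorem ofNat_smul (x : CV V →L[ℂ] CV V) :
    (2 : ℂ) • x = 2 * x ∧ (-2 : ℂ) • x = -2 * x ∧ (-4 : ℂ) • x = -4 * x := by
  simp only [Algebra.smul_def, map_neg, map_ofNat, and_self]

theorem IsOfType.mem_graph_hInfQ {v w : V} : (v, w) ∈ (hInfQ T D c r f).graph ↔
    Jet.GraphQ (jetCal c.φ h.R h.Rb (hat V r))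
      ((jetCal c.φ h.R h.Rb (hat V fun s => r s * f s)).ev (CV.of v)) (CV.of w) := by
  have p : PsiL (3 * α) (3 * β) θ r := ⟨hr.psi.1.leftSlice, hr.psi.2⟩
  have hi : Function.Injective (decS T D c r ∘L decS T.conj D c r) :=
    hr.injective.comp hr.injective_conj
  rw [hInfQ, mem_graph_invMul hi, hT.decS_eq h hω hωθ hθ p hr.converges,
    hT.decS_eq h hω hωθ hθ hr.psi_mul hr.converges_mul,
    hT.decS_conj_eq h hω hωθ hθ p hr.converges, hT.decQ_eq h hω hωθ hθ p hr.converges,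
    hT.decQ_eq h hω hωθ hθ hr.psi_mul hr.converges_mul, (ofNat_smul _).2.1, (ofNat_smul _).2.1]
  rfl

theorem IsOfType.mem_graph_hInfP {v w : V} : (v, w) ∈ (hInfP T D c r f).graph ↔
    Jet.GraphP (jetCal c.φ h.R h.Rb (hat V r))
      ((jetCal c.φ h.R h.Rb (hat V fun s => r s * f s)).ev (CV.of v)) (CV.of w) := by
  have p : PsiL (3 * α) (3 * β) θ r := ⟨hr.psi.1.leftSlice, hr.psi.2⟩
  have hi : Function.Injective (decS T D c r ∘L decS T D c r ∘L decS T.conj D c r) :=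
    hr.injective.comp (hr.injective.comp hr.injective_conj)
  rw [hInfP, mem_graph_invMul hi, hT.decS_eq h hω hωθ hθ p hr.converges,
    hT.decS_eq h hω hωθ hθ hr.psi_mul hr.converges_mul,
    hT.decS_conj_eq h hω hωθ hθ p hr.converges,
    hT.decS_conj_eq h hω hωθ hθ hr.psi_mul hr.converges_mul,
    hT.decQ_eq h hω hωθ hθ p hr.converges, hT.decP_eq h hω hωθ hθ p hr.converges,
    hT.decP_eq h hω hωθ hθ hr.psi_mul hr.converges_mul, (ofNat_smul _).1, (ofNat_smul _).1,
    (ofNat_smul _).1, (ofNat_smul _).1, (ofNat_smul _).2.1]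
  rfl

theorem IsOfType.mem_graph_hInfF {v w : V} : (v, w) ∈ (hInfF T D c r f).graph ↔
    Jet.GraphF (jetCal c.φ h.R h.Rb (hat V r))
      ((jetCal c.φ h.R h.Rb (hat V fun s => r s * f s)).ev (CV.of v)) (CV.of w) := by
  have p : PsiL (3 * α) (3 * β) θ r := ⟨hr.psi.1.leftSlice, hr.psi.2⟩
  have hi : Function.Injective (decS T D c r ∘L decS T D c r ∘L decS T.conj D c r) :=
    hr.injective.comp (hr.injective.comp hr.injective_conj)
  rw [hInfF, mem_graph_invMul hi, hT.decS_eq h hω hωθ hθ p hr.converges,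
    hT.decS_eq h hω hωθ hθ hr.psi_mul hr.converges_mul,
    hT.decS_conj_eq h hω hωθ hθ p hr.converges,
    hT.decQ_eq h hω hωθ hθ p hr.converges,
    hT.decQ_eq h hω hωθ hθ hr.psi_mul hr.converges_mul, hT.decF_eq h hω hωθ hθ p hr.converges,
    hT.decF_eq h hω hωθ hθ hr.psi_mul hr.converges_mul, (ofNat_smul _).2.1, (ofNat_smul _).2.1,
    (ofNat_smul _).2.2, (ofNat_smul _).2.2]
  rfl

theorem IsOfType.regularized {k : ℂ → CV V →L[ℂ] CV V} (hk : Decaying α β ω θ h.R h.Rb k) :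
    Regularized (CV V) α β ω θ c.φ h.R h.Rb (scalarHat r) k where
  mem := c.φ_mem
  reg := hT.scalarDecaying h hω hωθ hθ hr.psi hr.converges
  dec := hk
  inj := by
    have p : PsiL (3 * α) (3 * β) θ r := ⟨hr.psi.1.leftSlice, hr.psi.2⟩
    have hi := hr.injective
    rw [hT.decS_eq h hω hωθ hθ p hr.converges,
      jetCal_congr hω hθ c.φ_mem fun z hz => hr.psi.1.hat_eq (V := V) hz] at hi
    exact hi
  inj' := by
    have p : PsiL (3 * α) (3 * β) θ r := ⟨hr.psi.1.leftSlice, hr.psi.2⟩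
    have hi := hr.injective_conj
    rw [hT.decS_conj_eq h hω hωθ hθ p hr.converges,
      jetCal_congr hω hθ c.φ_mem fun z hz => hr.psi.1.hat_eq (V := V) hz] at hi
    exact hi

end RightOp

/-- The product rules for arbitrary regularizers. -/
theorem RightOp.IsOfType.product_rules {T : RightOp V} {D : Submodule ℝ V} {α β ω θ : ℝ}
    (hT : T.IsOfType D α β ω) (hα : 1 / 3 ≤ α) (hβ : β ≤ 1 / 3) (hω : 0 ≤ ω) (hωθ : ω < θ)
    (hθ : θ < Real.pi) {g f : ℍ[ℝ] → ℍ[ℝ]} (hg : Intrinsic (sector θ) g)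
    (hf : LeftSlice (sector θ) f) {c₁ c₂ c₃ : Contour ω θ} {r₁ r₂ r₃ : ℍ[ℝ] → ℍ[ℝ]}
    (h₁ : IsRegularizer T D α β c₁ r₁ g) (h₂ : IsRegularizer T D α β c₂ r₂ f)
    (h₃ : IsRegularizer T D α β c₃ r₃ (fun s => g s * f s)) :
    mulP (hInfS T D c₁ r₁ g) (hInfS T D c₂ r₂ f) ≤
      hInfS T D c₃ r₃ (fun s => g s * f s) ∧
    mulP (hInfQ T D c₁ r₁ g) (hInfS T D c₂ r₂ f) +
        mulP (hInfS T.conj D c₁ r₁ g) (hInfQ T D c₂ r₂ f) ≤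
      hInfQ T D c₃ r₃ (fun s => g s * f s) ∧
    mulP (hInfQ T D c₁ r₁ g) (hInfS T.conj D c₂ r₂ f) +
        mulP (hInfS T D c₁ r₁ g) (hInfQ T D c₂ r₂ f) ≤
      hInfQ T D c₃ r₃ (fun s => g s * f s) ∧
    mulP (hInfP T D c₁ r₁ g) (hInfS T D c₂ r₂ f) +
        mulP (hInfS T D c₁ r₁ g) (hInfP T D c₂ r₂ f) +
        mulP (hInfQ T D c₁ r₁ g) (hInfS T D c₂ r₂ f - hInfS T.conj D c₂ r₂ f) ≤
      hInfP T D c₃ r₃ (fun s => g s * f s) ∧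
    mulP (hInfF T D c₁ r₁ g) (hInfS T D c₂ r₂ f) +
        mulP (hInfS T D c₁ r₁ g) (hInfF T D c₂ r₂ f) -
        mulP (hInfQ T D c₁ r₁ g) (hInfQ T D c₂ r₂ f) ≤
      hInfF T D c₃ r₃ (fun s => g s * f s) := by
  have h := hT.admissible
  have hθ0 := hω.trans hωθ.le
  have hrg : Intrinsic (sector θ) fun s => r₁ s * g s := h₁.psi.1.mul hθ0 hθ.le hg
  have hgd := hT.scalarDecaying h hω hωθ hθ (r := fun s => r₁ s * g s) ⟨hrg, h₁.psi_mul.2⟩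
    h₁.converges_mul
  have key := graph_mul (hT.resolventPair h hω (hωθ.trans hθ)) hα hβ hω hθ hgd
    (hT.regularized h hω hωθ hθ h₁ hgd.toOp)
    (hT.regularized h hω hωθ hθ h₂ (hT.decaying h hω hωθ hθ h₂.psi_mul h₂.converges_mul))
    (hT.regularized h hω hωθ hθ h₃ (hT.decaying h hω hωθ hθ h₃.psi_mul h₃.converges_mul))
    (by
      intro z hz
      rw [h₃.psi.1.hat_mul hz (hg.mul_leftSlice hθ0 hθ.le hf), hg.hat_mul hz hf,
        h₂.psi.1.hat_mul hz hf, h₁.psi.1.scalarHat_mul hz hg.leftSlice]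
      simp only [smul_smul]
      congr 1
      ring)
    (jetCal_congr hω hθ c₁.φ_mem fun z hz => h₁.psi.1.hat_eq hz)
    (jetCal_congr hω hθ c₂.φ_mem fun z hz => h₂.psi.1.hat_eq hz)
    (jetCal_congr hω hθ c₃.φ_mem fun z hz => h₃.psi.1.hat_eq hz)
    (jetCal_congr hω hθ c₁.φ_mem fun z hz => hrg.hat_eq hz) rfl rfl
  have S₁ := fun v w => hT.mem_graph_hInfS h hω hωθ hθ h₁ (v := v) (w := w)
  have S₂ := fun v w => hT.mem_graph_hInfS h hω hωθ hθ h₂ (v := v) (w := w)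
  have Sb₁ := fun v w => hT.mem_graph_hInfS_conj h hω hωθ hθ h₁ (v := v) (w := w)
  have Sb₂ := fun v w => hT.mem_graph_hInfS_conj h hω hωθ hθ h₂ (v := v) (w := w)
  have Q₁ := fun v w => hT.mem_graph_hInfQ h hω hωθ hθ h₁ (v := v) (w := w)
  have Q₂ := fun v w => hT.mem_graph_hInfQ h hω hωθ hθ h₂ (v := v) (w := w)
  have Q₃ := fun v w => hT.mem_graph_hInfQ h hω hωθ hθ h₃ (v := v) (w := w)
  have P₁ := fun v w => hT.mem_graph_hInfP h hω hωθ hθ h₁ (v := v) (w := w)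
  have P₂ := fun v w => hT.mem_graph_hInfP h hω hωθ hθ h₂ (v := v) (w := w)
  have F₁ := fun v w => hT.mem_graph_hInfF h hω hωθ hθ h₁ (v := v) (w := w)
  have F₂ := fun v w => hT.mem_graph_hInfF h hω hωθ hθ h₂ (v := v) (w := w)
  refine ⟨le_of_forall_mem_graph fun v w hw => ?_, le_of_forall_mem_graph fun v w hw => ?_,
    le_of_forall_mem_graph fun v w hw => ?_, le_of_forall_mem_graph fun v w hw => ?_,
    le_of_forall_mem_graph fun v w hw => ?_⟩
  · obtain ⟨u, a, b⟩ := mem_graph_mulP.1 hw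
    exact (hT.mem_graph_hInfS h hω hωθ hθ h₃).2
      ((key (CV.of v)).1 _ _ ((S₂ _ _).1 a) ((S₁ _ _).1 b))
  · obtain ⟨x, y, hx, hy, rfl⟩ := exists_of_mem_graph_add hw
    obtain ⟨w₁, a, b⟩ := mem_graph_mulP.1 hx
    obtain ⟨w₃, a', b'⟩ := mem_graph_mulP.1 hy
    exact (Q₃ _ _).2 ((key (CV.of v)).2.1 _ _ _ _ ((S₂ _ _).1 a) ((Q₁ _ _).1 b) ((Q₂ _ _).1 a')
      ((Sb₁ _ _).1 b'))
  · obtain ⟨x, y, hx, hy, rfl⟩ := exists_of_mem_graph_add hw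
    obtain ⟨w₁, a, b⟩ := mem_graph_mulP.1 hx
    obtain ⟨w₃, a', b'⟩ := mem_graph_mulP.1 hy
    exact (Q₃ _ _).2 ((key (CV.of v)).2.2.1 _ _ _ _ ((Sb₂ _ _).1 a) ((Q₁ _ _).1 b)
      ((Q₂ _ _).1 a') ((S₁ _ _).1 b'))
  · obtain ⟨x', z, hx', hz, rfl⟩ := exists_of_mem_graph_add hw
    obtain ⟨x, y, hx, hy, rfl⟩ := exists_of_mem_graph_add hx'
    obtain ⟨w₁, a, b⟩ := mem_graph_mulP.1 hx
    obtain ⟨w₃, a', b'⟩ := mem_graph_mulP.1 hy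
    obtain ⟨u, hu, d⟩ := mem_graph_mulP.1 hz
    obtain ⟨u₁, u₂, e₁, e₂, rfl⟩ := exists_of_mem_graph_sub hu
    -- The value $f(T)v$ arises twice, in $\overline{\mathcal D}g(T)f(T)$ and in $f(T)-f(\overline
    -- T)$; operators are single valued.
    have eq : w₁ = u₁ := by
      obtain ⟨m, rfl⟩ := mem_graph_iff_exists_mem.1 a
      obtain ⟨m', rfl⟩ := mem_graph_iff_exists_mem.1 e₁
      rfl
    subst eq
    exact (hT.mem_graph_hInfP h hω hωθ hθ h₃).2 ((key (CV.of v)).2.2.2.1 _ _ _ _ _ _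
      ((S₂ _ _).1 a) ((Sb₂ _ _).1 e₂) ((P₁ _ _).1 b) ((P₂ _ _).1 a') ((S₁ _ _).1 b')
      ((Q₁ _ _).1 d))
  · obtain ⟨x', z, hx', hz, rfl⟩ := exists_of_mem_graph_sub hw
    obtain ⟨x, y, hx, hy, rfl⟩ := exists_of_mem_graph_add hx'
    obtain ⟨w₁, a, b⟩ := mem_graph_mulP.1 hx
    obtain ⟨w₃, a', b'⟩ := mem_graph_mulP.1 hy
    obtain ⟨u, hu, d⟩ := mem_graph_mulP.1 hz
    exact (hT.mem_graph_hInfF h hω hωθ hθ h₃).2 ((key (CV.of v)).2.2.2.2 _ _ _ _ _ _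
      ((S₂ _ _).1 a) ((F₁ _ _).1 b) ((F₂ _ _).1 a') ((S₁ _ _).1 b') ((Q₂ _ _).1 hu)
      ((Q₁ _ _).1 d))

end Regularization

end QuatHInfty

namespace QuatHInfty

/-! ### Intrinsic functions from holomorphic functions. -/

section IntrinsicExtension

open Complex

/-- The slice function with the values `Re u(z) + J Im u(z)`. -/
noncomputable def sliceExt (u : ℂ → ℂ) (s : ℍ[ℝ]) : ℍ[ℝ] :=
  slicePt (‖s.im‖⁻¹ • s.im) (u ⟨s.re, ‖s.im‖⟩).re (u ⟨s.re, ‖s.im‖⟩).im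

variable {u : ℂ → ℂ} {θ : ℝ}

/-- The symmetry $u(\bar z)=\overline{u(z)}$ makes the value independent of the choice between
$(J,y)$ and $(-J,-y)$. -/
theorem sliceExt_slicePt {J : ℍ[ℝ]} (hJ : J ∈ imagSphere) {z : ℂ}
    (hu : u (starRingEnd ℂ z) = starRingEnd ℂ (u z)) :
    sliceExt u (slicePt J z.re z.im) = slicePt J (u z).re (u z).im := by
  have h1 : (slicePt J z.re z.im).im = z.im • J := by
    ext <;> simp [slicePt, hJ.1]
  have h2 : ‖z.im • J‖ = |z.im| := by rw [norm_smul, hJ.2, mul_one, Real.norm_eq_abs]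
  rw [sliceExt, re_slicePt hJ, h1, h2, smul_smul]
  rcases lt_trichotomy z.im 0 with h | h | h
  · have e : (⟨z.re, |z.im|⟩ : ℂ) = starRingEnd ℂ z := Complex.ext rfl (abs_of_neg h)
    rw [e, hu, abs_of_neg h, inv_neg, neg_mul, inv_mul_cancel₀ h.ne, neg_one_smul, slicePt_neg, conj_re,
      conj_im, neg_neg]
  -- At real points the normalized imaginary part has the default value $0$ instead of a unit. This
  -- is harmless, because $u$ is real there.
  · have e : (⟨z.re, |z.im|⟩ : ℂ) = z := Complex.ext rfl (by simp [h])
    have hr : (u z).im = 0 := by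
      rw [conj_eq_iff_im.2 h] at hu
      exact conj_eq_iff_im.1 hu.symm
    rw [e, hr]
    simp [slicePt]
  · have e : (⟨z.re, |z.im|⟩ : ℂ) = z := Complex.ext rfl (abs_of_pos h)
    rw [e, abs_of_pos h, inv_mul_cancel₀ h.ne', one_smul]

theorem sliceExt_decomposition (h0 : 0 ≤ θ) (hθ : θ ≤ Real.pi)
    (hu : ∀ z ∈ csector θ, u (starRingEnd ℂ z) = starRingEnd ℂ (u z))
    (hd : ∀ z ∈ csector θ, DifferentiableAt ℂ u z) :
    SliceDecomposition (sector θ) (sliceExt u) (fun p => (u ⟨p.1, p.2⟩).re • (1 : ℍ[ℝ]))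
      (fun p => (u ⟨p.1, p.2⟩).im • (1 : ℍ[ℝ])) := by
  have ho := isOpen_csector h0 hθ
  have hu' : ContDiffOn ℝ 1 u (csector θ) :=
    (DifferentiableOn.contDiffOn (fun z hz => (hd z hz).differentiableWithinAt) ho).restrict_scalars ℝ
  have hp : ContDiffOn ℝ 1 (fun p : ℝ × ℝ => u ⟨p.1, p.2⟩) (reducedSet (sector θ)) :=
    hu'.comp equivRealProdCLM.symm.contDiff.contDiffOn fun p hp => mem_reducedSet_sector.1 hp
  -- The derivative of $u$ in direction $q$ is $q\,u'$; its real and imaginary parts for $q=1,i$ are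
  -- the Cauchy-Riemann equations.
  have hder : ∀ p ∈ reducedSet (sector θ), ∀ L : ℂ →L[ℝ] ℝ, ∀ q : ℝ × ℝ,
      fderiv ℝ (fun p : ℝ × ℝ => L (u ⟨p.1, p.2⟩) • (1 : ℍ[ℝ])) p q =
        L (⟨q.1, q.2⟩ * deriv u ⟨p.1, p.2⟩) • 1 := by
    intro p hp L q
    have h1 := (hd _ (mem_reducedSet_sector.1 hp)).hasDerivAt.hasFDerivAt.restrictScalars ℝ
    have h2 : HasFDerivAt (fun p : ℝ × ℝ => (⟨p.1, p.2⟩ : ℂ))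
        (equivRealProdCLM.symm : ℝ × ℝ →L[ℝ] ℂ) p := equivRealProdCLM.symm.hasFDerivAt
    have h3 := (L.hasFDerivAt.comp p (h1.comp p h2)).smul_const (1 : ℍ[ℝ])
    have h4 := congrArg (fun F => F q) h3.fderiv
    exact h4
  refine ⟨?_, ?_, ?_, ?_, ?_, ?_, ?_⟩
  · exact (reCLM.contDiff.comp_contDiffOn hp).smul contDiffOn_const
  · exact (imCLM.contDiff.comp_contDiffOn hp).smul contDiffOn_const
  · intro p hp J hJ
    have hz := mem_reducedSet_sector.1 hp
    refine (sliceExt_slicePt hJ (hu _ hz)).trans ?_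
    have e : ∀ x : ℝ, (x : ℍ[ℝ]) = x • (1 : ℍ[ℝ]) := fun x => by
      rw [← Quaternion.coe_mul_eq_smul, mul_one]
    rw [slicePt, ← e, mul_smul_comm, mul_one, Quaternion.coe_mul_eq_smul]
  · intro p hp
    have := hu _ (mem_reducedSet_sector.1 hp)
    exact congrArg (· • (1 : ℍ[ℝ])) ((congrArg re this).trans (conj_re _))
  · intro p hp
    have := hu _ (mem_reducedSet_sector.1 hp)
    refine (congrArg (· • (1 : ℍ[ℝ])) (congrArg im this)).trans ?_
    rw [conj_im, neg_smul]
  · intro p hp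
    refine (hder p hp reCLM (1, 0)).trans (Eq.trans ?_ (hder p hp imCLM (0, 1)).symm)
    simp
  · intro p hp
    refine (hder p hp reCLM (0, 1)).trans
      (Eq.trans ?_ (congrArg Neg.neg (hder p hp imCLM (1, 0)).symm))
    simp

theorem intrinsic_sliceExt (h0 : 0 ≤ θ) (hθ : θ ≤ Real.pi)
    (hu : ∀ z ∈ csector θ, u (starRingEnd ℂ z) = starRingEnd ℂ (u z))
    (hd : ∀ z ∈ csector θ, DifferentiableAt ℂ u z) : Intrinsic (sector θ) (sliceExt u) :=
  ⟨_, _, sliceExt_decomposition h0 hθ hu hd, fun p _ => by simp⟩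

theorem scalarHat_sliceExt (h0 : 0 ≤ θ) (hθ : θ ≤ Real.pi)
    (hu : ∀ z ∈ csector θ, u (starRingEnd ℂ z) = starRingEnd ℂ (u z))
    (hd : ∀ z ∈ csector θ, DifferentiableAt ℂ u z) {z : ℂ} (hz : z ∈ csector θ) :
    scalarHat (sliceExt u) z = u z := by
  have h := sliceExt_decomposition h0 hθ hu hd
  rw [scalarHat_eq, h.evenPart_eq hz, h.oddPart_eq hz]
  simp

theorem exists_eq_slicePt (s : ℍ[ℝ]) : ∃ J ∈ imagSphere, ∃ z : ℂ, s = slicePt J z.re z.im := by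
  by_cases h : s.im = 0
  · refine ⟨_, quatUnit_one_mem_imagSphere, (s.re : ℂ), ?_⟩
    rw [ofReal_re, ofReal_im, slicePt, Quaternion.coe_zero, zero_mul, add_zero]
    exact eq_coe_re_of_im_eq_zero h
  · have hn := norm_ne_zero_iff.2 h
    refine ⟨‖s.im‖⁻¹ • s.im, ⟨by simp, ?_⟩, ⟨s.re, ‖s.im‖⟩, ?_⟩
    · rw [norm_smul, norm_inv, norm_norm, inv_mul_cancel₀ hn]
    · rw [slicePt, Quaternion.coe_mul_eq_smul, smul_smul, mul_inv_cancel₀ hn, one_smul,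
        Quaternion.re_add_im]

end IntrinsicExtension

/-! ### Functions of polynomial growth. -/

section Growth

variable {θ : ℝ} {f g : ℍ[ℝ] → ℍ[ℝ]}

theorem PolyGrowth.exists_bounds (h : PolyGrowth θ f) : ∃ k : ℝ, 0 < k ∧ ∃ C ≥ 0, ∀ s ∈ sector θ,
    (‖s‖ ≤ 1 → ‖f s‖ ≤ C * ‖s‖ ^ (-k)) ∧ (1 ≤ ‖s‖ → ‖f s‖ ≤ C * ‖s‖ ^ k) := by
  obtain ⟨k, hk, C, hC, hb⟩ := h
  refine ⟨k, hk, 2 * C, by positivity, fun s hs => ?_⟩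
  have h0 : 0 < ‖s‖ := norm_pos_iff.2 hs.1
  have h1 := hb s hs
  rw [one_div, ← Real.rpow_neg h0.le] at h1
  refine ⟨fun h2 => h1.trans ?_, fun h2 => h1.trans ?_⟩
  · have := Real.rpow_le_rpow_of_exponent_ge h0 h2 (by linarith : -k ≤ k)
    nlinarith
  · have := Real.rpow_le_rpow_of_exponent_le h2 (by linarith : -k ≤ k)
    nlinarith

theorem PolyGrowth.mul (hg : PolyGrowth θ g) (hf : PolyGrowth θ f) :
    PolyGrowth θ fun s => g s * f s := by
  obtain ⟨k, hk, C, hC, hb⟩ := hg.exists_bounds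
  obtain ⟨k', hk', C', hC', hb'⟩ := hf.exists_bounds
  refine ⟨k + k', by positivity, C * C', by positivity, fun s hs => ?_⟩
  have h0 : 0 < ‖s‖ := norm_pos_iff.2 hs.1
  rw [one_div, ← Real.rpow_neg h0.le, norm_mul]
  have p1 : 0 ≤ C * C' * ‖s‖ ^ (k + k') := by positivity
  have p2 : 0 ≤ C * C' * ‖s‖ ^ (-(k + k')) := by positivity
  rcases le_total ‖s‖ 1 with h | h
  · have := mul_le_mul ((hb s hs).1 h) ((hb' s hs).1 h) (norm_nonneg _) (by positivity)
    rw [mul_mul_mul_comm, ← Real.rpow_add h0, ← neg_add] at this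
    linarith
  · have := mul_le_mul ((hb s hs).2 h) ((hb' s hs).2 h) (norm_nonneg _) (by positivity)
    rw [mul_mul_mul_comm, ← Real.rpow_add h0] at this
    linarith

/-- With the constant function $1$, the decay of products $rf$ includes the decay of the regularizer
$r$ itself. -/
theorem growthL_one : GrowthL θ fun _ => 1 := by
  refine ⟨⟨fun _ => 1, fun _ => 0, contDiffOn_const, contDiffOn_const, ?_, ?_, ?_, ?_, ?_⟩,
    1, one_pos, 1, zero_le_one, fun s hs => ?_⟩
  · intro p _ J _
    simp
  · intro p _
    rfl
  · intro p _
    simp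
  · intro p _
    simp
  · intro p _
    simp
  · have h0 : 0 < ‖s‖ := norm_pos_iff.2 hs.1
    rw [norm_one, one_mul, Real.rpow_one]
    rcases le_total ‖s‖ 1 with h | h
    · have := one_le_one_div h0 h
      linarith
    · have : 0 ≤ 1 / ‖s‖ := by positivity
      linarith

end Growth

/-! ### Rational intrinsic functions. -/

section Regularizers

open Complex

theorem ratFun_conj (m l : ℕ) (z : ℂ) :
    ratFun m l (starRingEnd ℂ z) = starRingEnd ℂ (ratFun m l z) := by
  simp [ratFun]

theorem differentiableAt_ratFun_csector {θ : ℝ} (h0 : 0 ≤ θ) (hθ : θ < Real.pi) (m l : ℕ) :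
    ∀ z ∈ csector θ, DifferentiableAt ℂ (ratFun m l) z := by
  obtain ⟨κ, _, h⟩ := exists_norm_inv_one_add_le h0 hθ
  exact fun z hz => differentiableAt_ratFun m l (h z hz.1 hz.2.le).1

/-- The intrinsic rational functions `s^m (1 + s)^(-m - l)`. -/
noncomputable def ratSlice (m l : ℕ) : ℍ[ℝ] → ℍ[ℝ] := sliceExt (ratFun m l)

variable {θ : ℝ} (h0 : 0 ≤ θ) (hθ : θ < Real.pi)
include h0 hθ

theorem intrinsic_ratSlice (m l : ℕ) : Intrinsic (sector θ) (ratSlice m l) :=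
  intrinsic_sliceExt h0 hθ.le (fun z _ => ratFun_conj m l z)
    (differentiableAt_ratFun_csector h0 hθ m l)

theorem scalarHat_ratSlice (m l : ℕ) {z : ℂ} (hz : z ∈ csector θ) :
    scalarHat (ratSlice m l) z = ratFun m l z :=
  scalarHat_sliceExt h0 hθ.le (fun z _ => ratFun_conj m l z)
    (differentiableAt_ratFun_csector h0 hθ m l) hz

theorem decays_ratSlice_mul (a : ℝ) {f : ℍ[ℝ] → ℍ[ℝ]} (hf : PolyGrowth θ f) :
    ∃ N : ℕ, ∀ m ≥ N, ∀ l ≥ N, Decays a 0 θ fun s => ratSlice m l s * f s := by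
  obtain ⟨k, hk, C, hC, hb⟩ := hf.exists_bounds
  -- With $\delta=1$ the requirements are $m-k\ge a$ at $0$ and $k-l\le-2$ at infinity.
  obtain ⟨N, hN⟩ := exists_nat_ge (k + |a| + 2)
  refine ⟨N, fun m hm l hl => ?_⟩
  obtain ⟨C', hC', hr⟩ := exists_norm_ratFun_le h0 hθ m l
  refine ⟨1, one_pos, C' * C, by positivity, fun s hs => ?_⟩
  have hm' : (N : ℝ) ≤ m := Nat.cast_le.2 hm
  have hl' : (N : ℝ) ≤ l := Nat.cast_le.2 hl
  have ha := abs_nonneg a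
  have ha' := le_abs_self a
  have hs0 : 0 < ‖s‖ := norm_pos_iff.2 hs.1
  obtain ⟨b1, b2⟩ := hb s hs
  obtain ⟨J, hJ, z, hz⟩ := exists_eq_slicePt s
  have hz' : z ∈ csector θ := by rwa [hz, slicePt_mem_sector hJ] at hs
  have hn : ‖ratSlice m l s‖ = ‖ratFun m l z‖ := by
    rw [hz, ratSlice, sliceExt_slicePt hJ (ratFun_conj m l z), norm_slicePt hJ]
  obtain ⟨r1, r2⟩ := hr z hz'.1 hz'.2.le
  rw [← norm_slicePt hJ z, ← hz, ← hn] at r1 r2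
  rw [norm_mul]
  refine ⟨fun h => ?_, fun h => ?_⟩
  · have := mul_le_mul (r1 h) (b1 h) (norm_nonneg _) (by positivity)
    rw [mul_mul_mul_comm, ← Real.rpow_natCast, ← Real.rpow_add hs0] at this
    refine this.trans (mul_le_mul_of_nonneg_left ?_ (by positivity))
    exact Real.rpow_le_rpow_of_exponent_ge hs0 h (by linarith)
  · have := mul_le_mul (r2 h) (b2 h) (norm_nonneg _) (by positivity)
    rw [mul_mul_mul_comm, inv_pow, ← Real.rpow_natCast, ← Real.rpow_neg hs0.le,
      ← Real.rpow_add hs0] at this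
    refine this.trans (mul_le_mul_of_nonneg_left ?_ (by positivity))
    exact Real.rpow_le_rpow_of_exponent_le h (by linarith)

omit h0 hθ in
theorem Decays.mono {a b : ℝ} {f : ℍ[ℝ] → ℍ[ℝ]} (hb : 0 ≤ b) (h : Decays a 0 θ f) :
    Decays a b θ f := by
  obtain ⟨δ, hδ, C, hC, h⟩ := h
  refine ⟨δ, hδ, C, hC, fun s hs => ⟨(h s hs).1, fun h1 => ((h s hs).2 h1).trans ?_⟩⟩
  exact mul_le_mul_of_nonneg_left (Real.rpow_le_rpow_of_exponent_le h1 (by linarith)) hC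

end Regularizers

/-! ### Existence of regularizers. -/

section Existence

open Complex

variable {V : Type*} [NormedAddCommGroup V] [NormedSpace ℝ V] [CompleteSpace V]
  [Module ℍ[ℝ] V] [Module ℍ[ℝ]ᵐᵒᵖ V] [SMulCommClass ℍ[ℝ]ᵐᵒᵖ ℍ[ℝ] V]
  [IsScalarTower ℝ ℍ[ℝ] V] [IsScalarTower ℝ ℍ[ℝ]ᵐᵒᵖ V]
  [NormSMulClass ℍ[ℝ] V] [NormSMulClass ℍ[ℝ]ᵐᵒᵖ V]

namespace RightOp

variable {T : RightOp V} {D : Submodule ℝ V} {α β ω θ : ℝ} (hT : T.IsOfType D α β ω) (hα : 0 ≤ α)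
  (hβ : 0 < β) (hω : 0 ≤ ω) (hωθ : ω < θ) (hθ : θ < Real.pi) {f : ℍ[ℝ] → ℍ[ℝ]}
include hT hα hβ hω hωθ hθ

/-- Near $0$ the kernels are at worst $|z|^{-3\alpha}$ against $|z|^{3\alpha-1+\delta}$. At infinity
they are bounded because $\beta>0$, and the decay $|z|^{-1-\delta}$ of $f$ suffices, hence the
exponent $0$ instead of $3\beta$. -/
theorem IsOfType.converges (hf : PsiL (3 * α) 0 θ f) : Converges T D ω θ f := by
  have h := hT.admissible
  have hω' := hωθ.trans hθ
  have hR := hT.resolventPair h hω hω'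
  obtain ⟨δ, hδ, C, hC⟩ := exists_powBound_hatWith (lmC V) hf.2
  intro c κ hκ
  have hφ0 : 0 ≤ c.φ := hω.trans c.φ_mem.1.le
  have hφπ : c.φ < Real.pi := c.φ_mem.2.trans hθ
  have hb : ∀ k : Knl, ∃ C p q, -(3 * α) ≤ p ∧ q ≤ 0 ∧
      PowBound {z : ℂ | z ≠ 0 ∧ c.φ ≤ |arg z|} C p q (k.fn h.R h.Rb) := by
    intro k
    obtain ⟨C, hC⟩ := hR.bound c.φ ⟨c.φ_mem.1, hφπ⟩
    obtain ⟨C', hC'⟩ := hR.bound' c.φ ⟨c.φ_mem.1, hφπ⟩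
    have hs : ∀ z ∈ {z : ℂ | z ≠ 0 ∧ c.φ ≤ |arg z|}, z ≠ 0 := fun z hz => hz.1
    cases k
    · exact ⟨_, _, _, by linarith, by linarith, hC⟩
    · exact ⟨_, _, _, by linarith, by linarith, hC'⟩
    · exact ⟨_, _, _, by linarith, by linarith, hC.mul hC' hs⟩
    · exact ⟨_, _, _, by linarith, by linarith, hC.mul hC hs⟩
    · exact ⟨_, _, _, by linarith, by linarith, hC.mul (hC.mul hC' hs) hs⟩
  have key : ∀ J ∈ imagSphere, ∀ k : Knl, Integrable fun t =>
      k.fn h.R h.Rb (zpath c.φ t) * (halfC V J * hat V f (zpath c.φ t)) := by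
    intro J hJ k
    obtain ⟨C', p, q, hp, hq, hk⟩ := hb k
    have hs : ∀ z ∈ {z : ℂ | z ≠ 0 ∧ |arg z| = c.φ}, z ≠ 0 := fun z hz => hz.1
    have hsub : {z : ℂ | z ≠ 0 ∧ |arg z| = c.φ} ⊆ csector θ := fun z hz =>
      ⟨hz.1, hz.2.trans_lt c.φ_mem.2⟩
    have hH : PowBound {z : ℂ | z ≠ 0 ∧ |arg z| = c.φ} ‖halfC V J‖ 0 0 fun _ => halfC V J :=
      fun z _ => by simp
    have hu := (hk.mono (fun z hz => ⟨hz.1, hz.2.ge⟩) hs le_rfl le_rfl).mul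
      (hH.mul (hC.mono hsub hs le_rfl le_rfl) hs) hs
    refine integrable_ray_of_powBound
      (u := fun z => k.fn h.R h.Rb z * (halfC V J * hat V f z))
      (s := {z : ℂ | z ≠ 0 ∧ |arg z| = c.φ}) hφ0 hφπ (fun z hz hz' => ⟨hz, hz'⟩) (fun z hz hz' => ?_) hu
      (by linarith) (by linarith)
    refine ContinuousAt.mul (hR.diff hω hω'.le k z ⟨hz, c.φ_mem.1.trans_eq hz'.symm⟩).continuousAt ?_
    exact continuousAt_const.mul (differentiableAt_hatWith _ (hω.trans hωθ.le) hθ.le hf.1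
      (hsub ⟨hz, hz'⟩)).continuousAt
  have fin : ∀ K, Represents ω κ K → (∀ J ∈ imagSphere, Integrable fun t =>
      K (zpath c.φ t) * (halfC V J * hat V f (zpath c.φ t))) →
      Integrable (integrand κ f c.J c.φ) := fun K hK hG =>
    integrable_integrand hK hf.1 hω hθ c.φ_mem c.J_mem hG
  rcases hκ with rfl | rfl | rfl | rfl | rfl
  · exact fin _ (hT.represents_kerS h hω hω') fun J hJ => key J hJ .S
  · exact fin _ (hT.represents_kerS_conj h hω hω') fun J hJ => key J hJ .Sb
  · exact fin _ (hT.represents_kerQ h hω hω') fun J hJ => key J hJ .Q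
  · refine fin _ (hT.represents_kerP h hω hω') fun J hJ => ?_
    refine (((key J hJ .P).add (key J hJ .Q)).smul (2 : ℂ)).congr (ae_of_all _ fun t => ?_)
    simp only [Pi.smul_apply, Pi.add_apply, Knl.fn, smul_mul_assoc, mul_add, add_mul]
  · refine fin _ (hT.represents_kerF h hω hω') fun J hJ => ?_
    refine ((key J hJ .F).smul (-4 : ℂ)).congr (ae_of_all _ fun t => ?_)
    simp only [Pi.smul_apply, Knl.fn, smul_mul_assoc]

omit hT hα hβ hω hωθ hθ [CompleteSpace V] in
theorem injective_pow_mul_pow {x y : CV V →L[ℂ] CV V} (hx : Function.Injective x)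
    (hy : Function.Injective y) (m l : ℕ) : Function.Injective (x ^ l * y ^ m : CV V →L[ℂ] CV V) := by
  have hp : ∀ {x : CV V →L[ℂ] CV V}, Function.Injective x → ∀ n : ℕ, Function.Injective (x ^ n) := by
    intro x hx n
    rw [FunLike.coe_pow_eq_iterate]
    exact hx.iterate n
  exact (hp hx l).comp (hp hy m)

/-- Every function of polynomial growth has a regularizer. -/
theorem IsOfType.exists_isRegularizer (hinj : T.IsInjective) (hinj' : T.conj.IsInjective)
    (hf : GrowthL θ f) (c : Contour ω θ) : ∃ r, IsRegularizer T D α β c r f := by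
  have h := hT.admissible
  have hω' := hωθ.trans hθ
  have hθ0 := hω.trans hωθ.le
  have hR := hT.resolventPair h hω hω'
  have hm1 := neg_one_mem_cosector hω'
  have hreg := hT.regular hω hω'.le hm1
  obtain ⟨N₁, h₁⟩ := decays_ratSlice_mul hθ0 hθ (3 * α) hf.2
  obtain ⟨N₂, h₂⟩ := decays_ratSlice_mul hθ0 hθ (3 * α) (growthL_one (θ := θ)).2
  obtain ⟨N₃, h₃⟩ := exists_nat_ge α
  -- The exponent has to make $rf$ and $r$ decay and to satisfy $m\ge\alpha$, which the rational
  -- calculus needs at the origin.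
  set m := max N₁ (max N₂ N₃)
  have hmα : α ≤ m := h₃.trans (Nat.cast_le.2 ((le_max_right _ _).trans (le_max_right _ _)))
  have hm1 : N₁ ≤ m := le_max_left _ _
  have hm2 : N₂ ≤ m := (le_max_left _ _).trans (le_max_right _ _)
  set r := ratSlice m (m + 1) with hrdef
  have hri : Intrinsic (sector θ) r := intrinsic_ratSlice hθ0 hθ _ _
  have d₁ : Decays (3 * α) 0 θ fun s => r s * f s := h₁ m hm1 (m + 1) (hm1.trans (Nat.le_succ m))
  have d₂ : Decays (3 * α) 0 θ r := by
    have := h₂ m hm2 (m + 1) (hm2.trans (Nat.le_succ m))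
    simpa only [mul_one] using this
  have c₂ := hT.converges hα hβ hω hωθ hθ ⟨hri.leftSlice, d₂⟩
  have p : PsiL (3 * α) (3 * β) θ r := ⟨hri.leftSlice, d₂.mono (by positivity)⟩
  have hcal : ∀ K : ℂ → CV V →L[ℂ] CV V, cal c.φ K (hat V r) =
      (2 * Real.pi * I : ℂ)⁻¹ • rayInt c.φ fun z => ratFun m (m + 1) z • K z := by
    intro K
    have e : ∀ z ∈ csector θ, hat V r z = toOp (CV V →L[ℂ] CV V) (ratFun m (m + 1)) z := fun z hz => by
      rw [hri.hat_eq hz, hrdef, scalarHat_ratSlice hθ0 hθ _ _ hz]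
      rfl
    rw [cal_congr hω hθ c.φ_mem e, cal]
    simp only [mul_toOp]
  have h2π : (2 * Real.pi * I : ℂ) ≠ 0 := two_pi_I_ne_zero
  refine ⟨r, ⟨hri, p.2⟩, ⟨hri.mul_leftSlice hθ0 hθ.le hf.1, d₁.mono (by positivity)⟩, c₂,
    hT.converges hα hβ hω hωθ hθ ⟨hri.mul_leftSlice hθ0 hθ.le hf.1, d₁⟩, ?_, ?_⟩
  · rw [hT.decS_eq h hω hωθ hθ p c₂]
    -- Formally $r(T)=T^m(1+T)^{-2m-1}$. It is injective since the resolvent and $1+R(-1)$ are, the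
    -- latter because $T$ is.
    have e : (jetCal c.φ h.R h.Rb (hat V r)).s = (-h.R (-1)) ^ (m + 1) * (1 + h.R (-1)) ^ m := by
      change cal c.φ h.R (hat V r) = _
      rw [hcal, rayInt_ratFun_resolvent hω hω' hR.res hα hβ c.φ_mem.1 (c.φ_mem.2.trans hθ) hR.bound
        hmα, smul_smul, inv_mul_cancel₀ h2π, one_smul]
    rw [e]
    refine injective_pow_mul_pow (fun v w hvw => ?_) (fun v w hvw => ?_) m (m + 1)
    · exact h.injective_RT hreg (by
        simpa only [neg_apply, neg_inj, hT.R_apply h hω hω' (neg_one_mem_cosector hω')] using hvw)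
    · refine h.injective_add_RT hreg hinj ?_
      simpa only [add_apply, one_apply_eq_self, hT.R_apply h hω hω' (neg_one_mem_cosector hω')] using hvw
  · rw [hT.decS_conj_eq h hω hωθ hθ p c₂]
    have e : (jetCal c.φ h.R h.Rb (hat V r)).sb = (-h.Rb (-1)) ^ (m + 1) * (1 + h.Rb (-1)) ^ m := by
      change cal c.φ h.Rb (hat V r) = _
      rw [hcal, rayInt_ratFun_resolvent hω hω' hR.res' hα hβ c.φ_mem.1 (c.φ_mem.2.trans hθ) hR.bound'
        hmα, smul_smul, inv_mul_cancel₀ h2π, one_smul]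
    rw [e]
    refine injective_pow_mul_pow (fun v w hvw => ?_) (fun v w hvw => ?_) m (m + 1)
    · exact h.injective_RTb hreg (by
        simpa only [neg_apply, neg_inj, hT.Rb_apply h hω hω' (neg_one_mem_cosector hω')] using hvw)
    · refine h.injective_add_RTb hreg hinj' ?_
      simpa only [add_apply, one_apply_eq_self, hT.Rb_apply h hω hω' (neg_one_mem_cosector hω')] using hvw

end RightOp

end Existence

end QuatHInfty

theorem mainTheorem2 {V : Type*} [NormedAddCommGroup V] [NormedSpace ℝ V] [CompleteSpace V]
    [Module ℍ[ℝ] V] [Module ℍ[ℝ]ᵐᵒᵖ V] [SMulCommClass ℍ[ℝ]ᵐᵒᵖ ℍ[ℝ] V]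
    [IsScalarTower ℝ ℍ[ℝ] V] [IsScalarTower ℝ ℍ[ℝ]ᵐᵒᵖ V]
    [NormSMulClass ℍ[ℝ] V] [NormSMulClass ℍ[ℝ]ᵐᵒᵖ V]
    {α β ω θ : ℝ} (hα : 1 / 3 ≤ α) (hβ : β ∈ Set.Ioc (0 : ℝ) (1 / 3))
    (hω : ω ∈ Set.Ioo 0 Real.pi) (hθ : θ ∈ Set.Ioo ω Real.pi)
    (T : RightOp V) (D : Submodule ℝ V) (hT : T.IsOfType D α β ω)
    (hinj : T.IsInjective) (hinj' : T.conj.IsInjective)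
    (g f : ℍ[ℝ] → ℍ[ℝ]) (hg : Growth θ g) (hf : GrowthL θ f) :
    (∀ c : Contour ω θ,
      (∃ r, IsRegularizer T D α β c r g) ∧
      (∃ r, IsRegularizer T D α β c r f) ∧
      (∃ r, IsRegularizer T D α β c r (fun s => g s * f s))) ∧
    ∀ (c₁ c₂ c₃ : Contour ω θ) (r₁ r₂ r₃ : ℍ[ℝ] → ℍ[ℝ]),
      IsRegularizer T D α β c₁ r₁ g →
      IsRegularizer T D α β c₂ r₂ f →
      IsRegularizer T D α β c₃ r₃ (fun s => g s * f s) →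
      mulP (hInfS T D c₁ r₁ g) (hInfS T D c₂ r₂ f) ≤
        hInfS T D c₃ r₃ (fun s => g s * f s) ∧
      mulP (hInfQ T D c₁ r₁ g) (hInfS T D c₂ r₂ f) +
          mulP (hInfS T.conj D c₁ r₁ g) (hInfQ T D c₂ r₂ f) ≤
        hInfQ T D c₃ r₃ (fun s => g s * f s) ∧
      mulP (hInfQ T D c₁ r₁ g) (hInfS T.conj D c₂ r₂ f) +
          mulP (hInfS T D c₁ r₁ g) (hInfQ T D c₂ r₂ f) ≤
        hInfQ T D c₃ r₃ (fun s => g s * f s) ∧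
      mulP (hInfP T D c₁ r₁ g) (hInfS T D c₂ r₂ f) +
          mulP (hInfS T D c₁ r₁ g) (hInfP T D c₂ r₂ f) +
          mulP (hInfQ T D c₁ r₁ g) (hInfS T D c₂ r₂ f - hInfS T.conj D c₂ r₂ f) ≤
        hInfP T D c₃ r₃ (fun s => g s * f s) ∧
      mulP (hInfF T D c₁ r₁ g) (hInfS T D c₂ r₂ f) +
          mulP (hInfS T D c₁ r₁ g) (hInfF T D c₂ r₂ f) -
          mulP (hInfQ T D c₁ r₁ g) (hInfQ T D c₂ r₂ f) ≤
        hInfF T D c₃ r₃ (fun s => g s * f s) := by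
  have hω0 := hω.1.le
  have hθ0 := hω0.trans hθ.1.le
  have hα0 : 0 ≤ α := by linarith
  have ex := fun {k} (hk : GrowthL θ k) (c : Contour ω θ) =>
    hT.exists_isRegularizer hα0 hβ.1 hω0 hθ.1 hθ.2 hinj hinj' hk c
  exact ⟨fun c => ⟨ex ⟨hg.1.leftSlice, hg.2⟩ c, ex hf c,
      ex ⟨hg.1.mul_leftSlice hθ0 hθ.2.le hf.1, hg.2.mul hf.2⟩ c⟩,
    fun c₁ c₂ c₃ r₁ r₂ r₃ h₁ h₂ h₃ =>
      hT.product_rules hα hβ.2 hω0 hθ.1 hθ.2 hg.1 hf.1 h₁ h₂ h₃⟩
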